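/- Let $H=-\tfrac12\Delta+V$ and $H_t=H+W_t$ on $L^2(\mathbb R^d)$. Here $V:\mathbb R^d\to\mathbb R$ is measurable and satisfies, for some $0\le a_1<1$ and $a_2>0$, $$\|Vu\|\le \tfrac{a_1}{2}\|\Delta u\|+a_2\|u\|\qquad\text{for all }u\in D(\Delta)=H^2(\mathbb R^d),$$ so that $H$ is self-adjoint on $H^2(\mathbb R^d)$. The function $W:(t,x)\mapsto W_t(x)\in\mathbb R$ is a measurable, time-dependent potential such that $\int_0^T\|W_t\|_{L^\infty}\,dt<\infty$ for all $T>0$ (for example, $W$ bounded). For $t\ge0$ set (with weak derivatives, the norms being $+\infty$ if these do not exist as bounded functions) $$w_t:=\int_t^\infty\|W_r\|_{W^{1,\infty}}\,dr,\qquad w_t':=\max_{1\le|\alpha|\le2}\int_t^\infty\|\partial_x^\alpha W_r\|_{L^\infty}\,dr .$$ Let $w^\sharp$ be either $w$ or $w'$, and assume that $\int_0^\infty w^\sharp_t\,dt<\infty$. Let $I\subset\mathbb R$ be a bounded open interval, let $g\in C_0^\infty(I;\mathbb R)$, and put $k_I:=\||\nabla|\chi_I(H)\|$. Let $U_t=U(t,0)$,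 $t\ge0$, be the evolution generated by $H_t$, that is the strongly continuous family of unitary operators with $U_0=1$ such that $\langle\varphi,U_tu\rangle=\langle\varphi,u\rangle-i\int_0^t\langle H_r\varphi,U_ru\rangle\,dr$ for all $u\in L^2(\mathbb R^d)$, $\varphi\in H^2(\mathbb R^d)$ and $t\ge0$. Then the limit $g_+(H):=\lim_{\tau\to\infty}U_\tau^{-1}g(H)U_\tau$ exists in operator norm, and for all real $c>k_I$, all real $a>b$ and all $0<\beta<1$ there is a constant $C$ such that for all $t\ge1$ $$\big\|\chi_{\{|x|\ge ct+a\}}\,U_t\,g_+(H)\,\chi_{\{|x|\le b\}}\big\|\le C\Big(t^{-\min(\frac12,\,1-\beta)}+w^\sharp_{t^\beta}\Big).$$ -/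

import Mathlib

open MeasureTheory Set Filter Topology FourierTransform
open scoped ENNReal NNReal ContDiff

namespace MaxSpeed

noncomputable section

/-- The physical space `ℝᵈ` with its Euclidean norm. -/
abbrev Space (d : ℕ) : Type := EuclideanSpace ℝ (Fin d)

/-- The Hilbert space `L²(ℝᵈ; ℂ)`. -/
abbrev L2 (d : ℕ) : Type := Lp ℂ 2 (volume : Measure (Space d))

variable {d : ℕ}

/-- The maximal operator of multiplication by the function `m`, with domain `{u ∈ L² | m u ∈ L²}`. -/
def mulOp (m : Space d → ℂ) : L2 d →ₗ.[ℂ] L2 d where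
  domain :=
    { carrier := {u | MemLp (fun x => m x * u x) 2 volume}
      zero_mem' := by
        refine (memLp_congr_ae ?_).2 (MemLp.zero' (p := 2) (ε := ℂ))
        filter_upwards [Lp.coeFn_zero ℂ 2 (volume : Measure (Space d))] with x hx
        change m x * (0 : L2 d) x = 0
        rw [hx, Pi.zero_apply, mul_zero]
      add_mem' := by
        intro u v hu hv
        refine (memLp_congr_ae ?_).2 (hu.add hv)
        filter_upwards [Lp.coeFn_add u v] with x hx
        change m x * (u + v : L2 d) x = m x * u x + m x * v x
        rw [hx, Pi.add_apply, mul_add]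
      smul_mem' := by
        intro z u hu
        refine (memLp_congr_ae ?_).2 (hu.const_smul z)
        filter_upwards [Lp.coeFn_smul z u] with x hx
        change m x * (z • u : L2 d) x = z * (m x * u x)
        rw [hx, Pi.smul_apply, smul_eq_mul, mul_left_comm] }
  toFun :=
    { toFun := fun u => MemLp.toLp (fun x => m x * (u : L2 d) x) u.2
      map_add' := by
        rintro ⟨u, hu⟩ ⟨v, hv⟩
        refine Eq.trans ?_ (MemLp.toLp_add hu hv)
        refine (MemLp.toLp_eq_toLp_iff _ _).2 ?_
        filter_upwards [Lp.coeFn_add u v] with x hx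
        change m x * (u + v : L2 d) x = m x * u x + m x * v x
        rw [hx, Pi.add_apply, mul_add]
      map_smul' := by
        rintro z ⟨u, hu⟩
        refine Eq.trans ?_ (MemLp.toLp_const_smul z hu)
        refine (MemLp.toLp_eq_toLp_iff _ _).2 ?_
        filter_upwards [Lp.coeFn_smul z u] with x hx
        change m x * (z • u : L2 d) x = z * (m x * u x)
        rw [hx, Pi.smul_apply, smul_eq_mul, mul_left_comm] }

/-- The Fourier multiplier with symbol `m`: the operator `𝓕⁻¹ m 𝓕` on its maximal domain
`{u ∈ L² | m 𝓕u ∈ L²}`, where `𝓕u(ξ) = ∫ e^{-2πi x·ξ} u(x) dx`. -/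
def fourierMul (m : Space d → ℂ) : L2 d →ₗ.[ℂ] L2 d where
  domain := (mulOp m).domain.comap (Lp.fourierTransformₗᵢ (Space d) ℂ).toLinearEquiv.toLinearMap
  toFun :=
    { toFun := fun u => (Lp.fourierTransformₗᵢ (Space d) ℂ).symm
        (mulOp m ⟨Lp.fourierTransformₗᵢ (Space d) ℂ (u : L2 d), u.2⟩)
      map_add' := by
        rintro ⟨u, hu⟩ ⟨v, hv⟩
        rw [← map_add, ← LinearPMap.map_add]
        congr 2
        exact Subtype.ext (map_add (Lp.fourierTransformₗᵢ (Space d) ℂ) u v)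
      map_smul' := by
        rintro z ⟨u, hu⟩
        rw [RingHom.id_apply, ← map_smul, ← LinearPMap.map_smul]
        congr 2
        exact Subtype.ext (map_smul (Lp.fourierTransformₗᵢ (Space d) ℂ) z u) }

/-- The Laplacian on `L²(ℝᵈ)`, with domain the Sobolev space `H²(ℝᵈ)`. -/
def laplacian (d : ℕ) : L2 d →ₗ.[ℂ] L2 d :=
  fourierMul fun ξ => ((-(2 * Real.pi * ‖ξ‖) ^ 2 : ℝ) : ℂ)

/-- The operator `|∇| = (-Δ)^{1/2}` on `L²(ℝᵈ)`, with domain the Sobolev space `H¹(ℝᵈ)`. -/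
def absGrad (d : ℕ) : L2 d →ₗ.[ℂ] L2 d :=
  fourierMul fun ξ => ((2 * Real.pi * ‖ξ‖ : ℝ) : ℂ)

/-- Multiplication by a real potential. -/
def potential (V : Space d → ℝ) : L2 d →ₗ.[ℂ] L2 d := mulOp fun x => (V x : ℂ)

/-- The Schrödinger operator `H = -½Δ + V`, on `D(Δ) ∩ D(V)` (which is `H²(ℝᵈ)` if `V` is
`Δ`-bounded). -/
def schrodinger (V : Space d → ℝ) : L2 d →ₗ.[ℂ] L2 d :=
  (-(1 / 2) : ℂ) • laplacian d + potential V

/-- `‖V u‖ ≤ (a₁/2) ‖Δ u‖ + a₂ ‖u‖` for all `u ∈ D(Δ)`; this includes `D(Δ) ⊆ D(V)`. -/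
def LaplacianBounded (V : Space d → ℝ) (a₁ a₂ : ℝ) : Prop :=
  ∀ u : (laplacian d).domain, ∃ hu : (u : L2 d) ∈ (potential V).domain,
    ‖potential V ⟨u, hu⟩‖ ≤ a₁ / 2 * ‖laplacian d u‖ + a₂ * ‖(u : L2 d)‖

open Classical in
/-- The resolvent `(H - z)⁻¹`: the bounded everywhere defined two-sided inverse of
`H - z : D(H) → L²` (and `0` if there is none). -/
def resolventOp (H : L2 d →ₗ.[ℂ] L2 d) (z : ℂ) : L2 d →L[ℂ] L2 d :=
  if h : ∃ R : L2 d →L[ℂ] L2 d,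
      (∀ u : H.domain, R (H u - z • (u : L2 d)) = u) ∧
      ∀ v : L2 d, ∃ hv : R v ∈ H.domain, H ⟨R v, hv⟩ - z • R v = v
  then h.choose else 0

/-- `g(H)` for self-adjoint `H` and continuous `g : ℝ → ℝ` vanishing at infinity. It is the
continuous functional calculus of the bounded normal operator `(H + i)⁻¹`, whose spectrum lies in
`{0} ∪ {(lam + i)⁻¹ | lam ∈ σ(H)}`, applied to the continuous function there that sends
`(lam + i)⁻¹` to `g lam` and `0` to `0`. -/
def funcCalc (H : L2 d →ₗ.[ℂ] L2 d) (g : ℝ → ℝ) : L2 d →L[ℂ] L2 d :=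
  cfc (fun w : ℂ => if w = 0 then 0 else ((g (w⁻¹ - Complex.I).re : ℝ) : ℂ))
    (resolventOp H (-Complex.I))

/-- The spectral subspace of the self-adjoint operator `H` for an open set `I ⊆ ℝ`, that is the
range of `χ_I(H)`: since `χ_I` is the pointwise supremum of the functions `f ∈ C_c(I)` with
`0 ≤ f ≤ 1`, it is the closed linear span of the ranges of `f(H)`, `f ∈ C_c(I)`. -/
def spectralSubspace (H : L2 d →ₗ.[ℂ] L2 d) (I : Set ℝ) : Submodule ℂ (L2 d) :=
  (⨆ f ∈ {f : ℝ → ℝ | Continuous f ∧ HasCompactSupport f ∧ tsupport f ⊆ I},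
    (funcCalc H f).range).topologicalClosure

/-- The spectral projection `χ_I(H)` of the self-adjoint operator `H` for an open set `I ⊆ ℝ`,
that is the orthogonal projection onto the spectral subspace. -/
def spectralProj (H : L2 d →ₗ.[ℂ] L2 d) (I : Set ℝ) : L2 d →L[ℂ] L2 d :=
  have : CompleteSpace (spectralSubspace H I) :=
    (Submodule.isClosed_topologicalClosure _).completeSpace_coe
  (spectralSubspace H I).starProjection

/-- The operator norm `‖T B‖ ∈ [0, ∞]` for `B` bounded and `T` possibly unbounded. It is `∞` if
the range of `B` is not contained in `D(T)`: an infimum over the empty set is `∞`. -/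
def opENorm (T : L2 d →ₗ.[ℂ] L2 d) (B : L2 d →L[ℂ] L2 d) : ℝ≥0∞ :=
  ⨆ u : L2 d, ⨆ _ : ‖u‖ ≤ 1, ⨅ h : B u ∈ T.domain, ‖T ⟨B u, h⟩‖ₑ

/-- The speed bound `k_I = ‖ |∇| χ_I(H) ‖`. -/
def speedBound (V : Space d → ℝ) (I : Set ℝ) : ℝ≥0∞ :=
  opENorm (absGrad d) (spectralProj (schrodinger V) I)

/-- The function `χ_A u` for a measurable set `A` and `u ∈ L²`. -/
def cutoffFun (A : Set (Space d)) (hA : MeasurableSet A) (u : L2 d) : L2 d :=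
  ((Lp.memLp u).indicator hA).toLp (A.indicator u)

theorem cutoffFun_coe (A : Set (Space d)) (hA : MeasurableSet A) (u : L2 d) :
    (cutoffFun A hA u : Space d → ℂ) =ᵐ[volume] A.indicator u :=
  MemLp.coeFn_toLp _

theorem cutoffFun_add (A : Set (Space d)) (hA : MeasurableSet A) (u v : L2 d) :
    cutoffFun A hA (u + v) = cutoffFun A hA u + cutoffFun A hA v := by
  refine Lp.ext ?_
  filter_upwards [Lp.coeFn_add u v, Lp.coeFn_add (cutoffFun A hA u) (cutoffFun A hA v),
    cutoffFun_coe A hA u, cutoffFun_coe A hA v, cutoffFun_coe A hA (u + v)] with x h₁ h₂ h₃ h₄ h₅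
  rw [h₅, h₂, Pi.add_apply, h₃, h₄]
  by_cases h : x ∈ A
  · rw [indicator_of_mem h, indicator_of_mem h, indicator_of_mem h, h₁, Pi.add_apply]
  · rw [indicator_of_notMem h, indicator_of_notMem h, indicator_of_notMem h, add_zero]

theorem cutoffFun_smul (A : Set (Space d)) (hA : MeasurableSet A) (z : ℂ) (u : L2 d) :
    cutoffFun A hA (z • u) = z • cutoffFun A hA u := by
  refine Lp.ext ?_
  filter_upwards [Lp.coeFn_smul z u, Lp.coeFn_smul z (cutoffFun A hA u),
    cutoffFun_coe A hA u, cutoffFun_coe A hA (z • u)] with x h₁ h₂ h₃ h₄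
  rw [h₄, h₂, Pi.smul_apply, h₃]
  by_cases h : x ∈ A
  · rw [indicator_of_mem h, indicator_of_mem h, h₁, Pi.smul_apply]
  · rw [indicator_of_notMem h, indicator_of_notMem h, smul_zero]

theorem cutoffFun_norm_le (A : Set (Space d)) (hA : MeasurableSet A) (u : L2 d) :
    ‖cutoffFun A hA u‖ ≤ 1 * ‖u‖ := by
  rw [one_mul, cutoffFun, Lp.norm_toLp, Lp.norm_def]
  exact ENNReal.toReal_mono (Lp.eLpNorm_ne_top u) (eLpNorm_indicator_le _)

/-- Multiplication by the characteristic function of the measurable set `A`, as a bounded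
operator on `L²`. -/
def cutoff (A : Set (Space d)) (hA : MeasurableSet A) : L2 d →L[ℂ] L2 d :=
  LinearMap.mkContinuous
    { toFun := cutoffFun A hA
      map_add' := cutoffFun_add A hA
      map_smul' := cutoffFun_smul A hA }
    1 (cutoffFun_norm_le A hA)

/-- `h` is the weak partial derivative `∂_{l 0} ⋯ ∂_{l (n-1)} f`. As `l` runs through
`Fin n → Fin d`, these are the derivatives `∂^α f` with `|α| = n`. -/
def IsWeakDeriv {n : ℕ} (l : Fin n → Fin d) (f h : Space d → ℝ) : Prop :=
  LocallyIntegrable f volume ∧ LocallyIntegrable h volume ∧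
    ∀ φ : Space d → ℝ, ContDiff ℝ ∞ φ → HasCompactSupport φ →
      ∫ x, f x * iteratedFDeriv ℝ n φ x (fun k => EuclideanSpace.single (l k) 1) =
        (-1) ^ n * ∫ x, h x * φ x

/-- `‖∂_{l 0} ⋯ ∂_{l (n-1)} f‖_{L^∞}` with the weak derivative. It is unique a.e. if it exists;
otherwise the value is `∞`, an infimum over the empty set. -/
def derivSupNorm {n : ℕ} (l : Fin n → Fin d) (f : Space d → ℝ) : ℝ≥0∞ :=
  ⨅ (h : Space d → ℝ) (_ : IsWeakDeriv l f h), eLpNorm h ∞ volume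

/-- The norm of the Sobolev space `W^{1,∞}(ℝᵈ)`, `max_{|α| ≤ 1} ‖∂^α f‖_{L^∞}`. -/
def sobolevNorm (f : Space d → ℝ) : ℝ≥0∞ :=
  ⨆ n ∈ Set.Icc 0 1, ⨆ l : Fin n → Fin d, derivSupNorm l f

/-- `w_t = ∫_t^∞ ‖W_r‖_{W^{1,∞}} dr`. -/
def tailNorm (W : ℝ → Space d → ℝ) (t : ℝ) : ℝ≥0∞ :=
  ∫⁻ r in Set.Ioi t, sobolevNorm (W r)

/-- `w'_t = max_{1 ≤ |α| ≤ 2} ∫_t^∞ ‖∂^α W_r‖_{L^∞} dr`. -/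
def tailNorm' (W : ℝ → Space d → ℝ) (t : ℝ) : ℝ≥0∞ :=
  ⨆ n ∈ Set.Icc 1 2, ⨆ l : Fin n → Fin d, ∫⁻ r in Set.Ioi t, derivSupNorm l (W r)

/-- `U_t = U(t, 0)`, `t ≥ 0`, is the evolution generated by `H_t = H + W_t`: a strongly continuous
family of unitary operators with `U_0 = 1` which solves `i ∂_t U_t = H_t U_t` weakly, that is
`⟨φ, U_t u⟩ = ⟨φ, u⟩ - i ∫₀ᵗ ⟨H_r φ, U_r u⟩ dr` for all `u ∈ L²` and `φ ∈ D(H)`. -/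
structure IsEvolution (H : L2 d →ₗ.[ℂ] L2 d) (W : ℝ → Space d → ℝ)
    (U : ℝ → unitary (L2 d →L[ℂ] L2 d)) : Prop where
  zero : U 0 = 1
  cont : ∀ u : L2 d, ContinuousOn (fun t => (U t : L2 d →L[ℂ] L2 d) u) (Set.Ici 0)
  weak_eq : ∀ (u : L2 d) (φ : H.domain) (t : ℝ), 0 ≤ t →
    inner ℂ (φ : L2 d) ((U t : L2 d →L[ℂ] L2 d) u) = inner ℂ (φ : L2 d) u -
      Complex.I * ∫ r in (0 : ℝ)..t, (inner ℂ (H φ) ((U r : L2 d →L[ℂ] L2 d) u) +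
        ∫ x, (W r x : ℂ) * inner ℂ ((φ : L2 d) x) (((U r : L2 d →L[ℂ] L2 d) u : L2 d) x))

end

end MaxSpeed

open MaxSpeed

namespace MaxSpeed

open scoped SchwartzMap LineDeriv ComplexConjugate

variable {d : ℕ}

/-! ### Multiplication operators -/

/-! The equation is studied through the resolvent `Q = (H + μ)⁻¹` for a large `μ`. Kato–Rellich
together with a form bound on `V` makes `Q` bounded, positive and injective, and makes `⟨Qx, x⟩`
control `‖∇Qx‖²` (`exists_isRes`). With `B_t = W_t - μ` the evolution solves `i ∂_t θ = (Q⁻¹ + B_t)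
θ` weakly, tested against the range of `Q`. The Heisenberg equation is proved directly for
observables `K = Q L` (`IsSol.heisenberg`). Other observables are sandwiched between the
regularizations `Q (Q + ε)⁻¹`, which tend strongly to one (`IsSol.re_inner_sub_le`).

Energy. Let `R = (H + i)⁻¹`. Then `g(H)` is an absolutely convergent Laurent series in the unitary
Cayley transform `1 - 2iR`, namely the Fourier series of `θ ↦ g(-cot πθ)`. Hence a commutator with
`g(H)` inherits size and factorization from the commutator with `Q` (`exists_commutator_cfc`). Only
`W_t` fails to commute with `g(H)`, and this commutator is bounded by the Lipschitz constant of
`W_t`, whose tail integral is at most a multiple of `w♯_t`. Cook's argument gives the limit `G =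
g_+(H)` and `‖U_t G - g(H) U_t‖ ≤ σ(t)` with `σ(t) ≤ N w♯_t` (`exists_tendsto_heis`). A differential
inequality for the square root of the energy, followed backwards from a late time at which the state
is `g(H) U_b u`, shows that the states `U_t G u` have uniformly bounded gradients as long as `t`
stays away from zero (`sqrt_energy_le_of_tendsto_heis`).

Position. Take `t₀ = t^β`, write `⟨x⟩ = √(1 + |x|²)` and let `e` bound `⟨x⟩` on the initial ball. On
`[0, t₀]` a cutoff `J = j((⟨x⟩ - e)/t)` that vanishes on the initial ball has a commutator with `H`
of order `1/t` times a gradient. Since the energy is bounded, `‖J U_{t₀} G χ‖` is of order `σ(t₀) +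
t₀/t` (`IsScatter.exists_norm_mulR_le`). On `[t₀, t]` the observable is `f_r = η((⟨x⟩ - e - c'
r)/t)` with `k_I < c' < c` and `η' = h²`. Its Heisenberg derivative is `1/t` times `-c' h²` plus the
symmetrized radial velocity between two factors `h`. Where the energy lies in `I` the velocity is at
most `k_I < c'`, so the main term is not positive. Localizing the energy costs `1/t` for commuting
`h` with the energy cutoff and `σ(r)` for replacing `U_r G` by its energy-cut part. As `σ` is
integrable, `⟨f_r⟩` grows by `O(1/t)` in all (`IsScatter.exists_outgoing_le`).

At `t₀` one has `f ≤ m J²`, where `m` is the plateau value of `η`, and at `t` one has `f = m` on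
`{|x| ≥ ct + a}` once `t` is large. Taking the square root gives `σ(t^β) + t^{β-1} + t^{-1/2}`
(`IsScatter.exists_norm_cutoff_le`); for the remaining bounded times the trivial bound `‖G‖`
suffices. -/

/-- `v = m u` almost everywhere. -/
def HasMul (m : Space d → ℂ) (u v : L2 d) : Prop :=
  (v : Space d → ℂ) =ᵐ[volume] fun x => m x * u x

theorem hasMul_iff {m : Space d → ℂ} {u v : L2 d} :
    HasMul m u v ↔ ∃ h : u ∈ (mulOp m).domain, mulOp m ⟨u, h⟩ = v := by
  constructor
  · intro h
    have hu : MemLp (fun x => m x * u x) 2 volume := (memLp_congr_ae h).1 (Lp.memLp v)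
    refine ⟨hu, Lp.ext ?_⟩
    exact (MemLp.coeFn_toLp hu).trans h.symm
  · rintro ⟨h, rfl⟩
    exact MemLp.coeFn_toLp h

theorem HasMul.unique {m : Space d → ℂ} {u v w : L2 d} (h : HasMul m u v) (h' : HasMul m u w) :
    v = w := Lp.ext (h.trans h'.symm)

theorem HasMul.congr {m m' : Space d → ℂ} {u v : L2 d} (h : HasMul m u v)
    (hm : m =ᵐ[volume] m') : HasMul m' u v := by
  filter_upwards [h, hm] with x h1 h2
  rw [h1, h2]

theorem HasMul.add {m : Space d → ℂ} {u v u' v' : L2 d} (h : HasMul m u v) (h' : HasMul m u' v') :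
    HasMul m (u + u') (v + v') := by
  filter_upwards [h, h', Lp.coeFn_add u u', Lp.coeFn_add v v'] with x h1 h2 h3 h4
  rw [h3, h4, Pi.add_apply, Pi.add_apply, h1, h2, mul_add]

theorem HasMul.smul {m : Space d → ℂ} {u v : L2 d} (h : HasMul m u v) (z : ℂ) :
    HasMul m (z • u) (z • v) := by
  filter_upwards [h, Lp.coeFn_smul z u, Lp.coeFn_smul z v] with x h1 h3 h4
  rw [h3, h4, Pi.smul_apply, Pi.smul_apply, h1, smul_eq_mul, smul_eq_mul, mul_left_comm]

theorem HasMul.sub {m : Space d → ℂ} {u v u' v' : L2 d} (h : HasMul m u v) (h' : HasMul m u' v') :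
    HasMul m (u - u') (v - v') := by
  filter_upwards [h, h', Lp.coeFn_sub u u', Lp.coeFn_sub v v'] with x h1 h2 h3 h4
  rw [h3, h4, Pi.sub_apply, Pi.sub_apply, h1, h2, mul_sub]

theorem HasMul.add_symbol {m m' : Space d → ℂ} {u v v' : L2 d} (h : HasMul m u v)
    (h' : HasMul m' u v') : HasMul (fun x => m x + m' x) u (v + v') := by
  filter_upwards [h, h', Lp.coeFn_add v v'] with x h1 h2 h4
  rw [h4, Pi.add_apply, h1, h2, add_mul]

theorem HasMul.smul_symbol {m : Space d → ℂ} {u v : L2 d} (h : HasMul m u v) (z : ℂ) :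
    HasMul (fun x => z * m x) u (z • v) := by
  filter_upwards [h, Lp.coeFn_smul z v] with x h1 h4
  rw [h4, Pi.smul_apply, h1, smul_eq_mul, mul_assoc]

theorem HasMul.comp {m m' : Space d → ℂ} {u v w : L2 d} (h : HasMul m u v)
    (h' : HasMul m' v w) : HasMul (fun x => m' x * m x) u w := by
  filter_upwards [h, h'] with x h1 h2
  rw [h2, h1, mul_assoc]

theorem hasMul_one (u : L2 d) : HasMul (fun _ => 1) u u := by
  filter_upwards with x
  rw [one_mul]

theorem hasMul_const (z : ℂ) (u : L2 d) : HasMul (fun _ => z) u (z • u) := by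
  simpa using (hasMul_one u).smul_symbol z

theorem HasMul.inner_eq {m : Space d → ℂ} {u v u' v' : L2 d} (h : HasMul m u v)
    (h' : HasMul (fun x => conj (m x)) u' v') : inner ℂ u' v = inner ℂ v' u := by
  rw [L2.inner_def, L2.inner_def]
  refine integral_congr_ae ?_
  filter_upwards [h, h'] with x h1 h2
  rw [h1, h2]
  simp only [RCLike.inner_apply, map_mul, RCLike.conj_conj]
  ring

theorem HasMul.norm_le {m m' : Space d → ℂ} {u v u' v' : L2 d} (h : HasMul m u v)
    (h' : HasMul m' u' v') {C : ℝ} (hC : ∀ᵐ x, ‖m x * u x‖ ≤ C * ‖m' x * u' x‖) :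
    ‖v‖ ≤ C * ‖v'‖ := by
  refine Lp.norm_le_mul_norm_of_ae_le_mul ?_
  filter_upwards [h, h', hC] with x h1 h2 h3
  rw [h1, h2]
  exact h3

open Classical in
/-- Multiplication by an essentially bounded function, as a bounded operator on `L²`
(zero for other functions). -/
noncomputable def mulB (m : Space d → ℂ) : L2 d →L[ℂ] L2 d :=
  if h : MemLp m ∞ volume then
    LinearMap.mkContinuous
      { toFun := fun u => mulOp m ⟨u, (Lp.memLp u).mul h⟩
        map_add' := fun u v => (mulOp m).map_add ⟨u, (Lp.memLp u).mul h⟩ ⟨v, (Lp.memLp v).mul h⟩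
        map_smul' := fun z u => (mulOp m).map_smul z ⟨u, (Lp.memLp u).mul h⟩ }
      (eLpNorm m ∞ volume).toReal (by
        intro u
        refine Lp.norm_le_mul_norm_of_ae_le_mul ?_
        have h1 : HasMul m u (mulOp m ⟨u, (Lp.memLp u).mul h⟩) := hasMul_iff.2 ⟨_, rfl⟩
        filter_upwards [h1, ae_le_eLpNormEssSup (f := m) (μ := volume)] with x hx hx'
        change ‖(mulOp m ⟨u, (Lp.memLp u).mul h⟩ : L2 d) x‖ ≤ _
        rw [hx, norm_mul]
        gcongr
        rw [eLpNorm_exponent_top, ← toReal_enorm]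
        exact ENNReal.toReal_mono (by rw [← eLpNorm_exponent_top]; exact h.2.ne) hx')
  else 0

theorem hasMul_mulB {m : Space d → ℂ} (h : MemLp m ∞ volume) (u : L2 d) : HasMul m u (mulB m u) := by
  rw [mulB, dif_pos h]
  exact hasMul_iff.2 ⟨_, rfl⟩

theorem HasMul.mulB_eq {m : Space d → ℂ} (h : MemLp m ∞ volume) {u v : L2 d} (hv : HasMul m u v) :
    mulB m u = v := (hasMul_mulB h u).unique hv

theorem norm_mulB_apply_le {m : Space d → ℂ} {C : ℝ} (hC0 : 0 ≤ C) (hC : ∀ᵐ x, ‖m x‖ ≤ C)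
    (u : L2 d) : ‖mulB m u‖ ≤ C * ‖u‖ := by
  by_cases h : MemLp m ∞ volume
  · refine (hasMul_mulB h u).norm_le (hasMul_one u) ?_
    filter_upwards [hC] with x hx
    rw [norm_mul, one_mul]
    gcongr
  · rw [mulB, dif_neg h]
    simpa using by positivity

theorem norm_mulB_le {m : Space d → ℂ} {C : ℝ} (hC0 : 0 ≤ C) (hC : ∀ᵐ x, ‖m x‖ ≤ C) :
    ‖mulB m‖ ≤ C :=
  ContinuousLinearMap.opNorm_le_bound _ hC0 (norm_mulB_apply_le hC0 hC)

theorem norm_mulB_le_eLpNorm {m : Space d → ℂ} : ‖mulB m‖ₑ ≤ eLpNorm m ∞ volume := by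
  by_cases h : MemLp m ∞ volume
  · have := norm_mulB_le (m := m) (C := (eLpNorm m ∞ volume).toReal) ENNReal.toReal_nonneg (by
      filter_upwards [ae_le_eLpNormEssSup (f := m) (μ := volume)] with x hx'
      rw [eLpNorm_exponent_top, ← toReal_enorm]
      exact ENNReal.toReal_mono (by rw [← eLpNorm_exponent_top]; exact h.2.ne) hx')
    rw [← ofReal_norm]
    exact ENNReal.ofReal_le_of_le_toReal this
  · rw [mulB, dif_neg h, ← ofReal_norm, norm_zero, ENNReal.ofReal_zero]
    exact zero_le

theorem memLp_conj {m : Space d → ℂ} (h : MemLp m ∞ volume) :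
    MemLp (fun x => conj (m x)) ∞ volume := h.star

theorem mulB_inner {m : Space d → ℂ} (h : MemLp m ∞ volume) (u v : L2 d) :
    inner ℂ u (mulB m v) = inner ℂ (mulB (fun x => conj (m x)) u) v :=
  (hasMul_mulB h v).inner_eq (hasMul_mulB (memLp_conj h) u)

theorem mulB_inner_ofReal {m : Space d → ℝ} (u v : L2 d) :
    inner ℂ u (mulB (fun x => (m x : ℂ)) v) = inner ℂ (mulB (fun x => (m x : ℂ)) u) v := by
  by_cases h : MemLp (fun x => (m x : ℂ)) ∞ volume
  · simpa using mulB_inner h u v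
  · rw [mulB, dif_neg h]
    simp

theorem isSelfAdjoint_mulB (m : Space d → ℝ) :
    IsSelfAdjoint (mulB (fun x => (m x : ℂ)) : L2 d →L[ℂ] L2 d) :=
  ContinuousLinearMap.isSelfAdjoint_iff_isSymmetric.2 fun u v => (mulB_inner_ofReal u v).symm

/-! ### Fourier multipliers -/

/-- The Fourier transform on `L²`. -/
noncomputable abbrev FT : L2 d ≃ₗᵢ[ℂ] L2 d := Lp.fourierTransformₗᵢ (Space d) ℂ

/-- `v = 𝓕⁻¹ m 𝓕 u`. -/
def HasFMul (m : Space d → ℂ) (u v : L2 d) : Prop := HasMul m (FT u) (FT v)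

theorem hasFMul_iff {m : Space d → ℂ} {u v : L2 d} :
    HasFMul m u v ↔ ∃ h : u ∈ (fourierMul m).domain, fourierMul m ⟨u, h⟩ = v := by
  rw [HasFMul, hasMul_iff]
  constructor
  · rintro ⟨h, h'⟩
    refine ⟨h, ?_⟩
    change FT.symm (mulOp m ⟨FT u, h⟩) = v
    rw [h', LinearIsometryEquiv.symm_apply_apply]
  · rintro ⟨h, h'⟩
    refine ⟨h, ?_⟩
    rw [← h']
    change _ = FT (FT.symm (mulOp m ⟨FT u, h⟩))
    rw [LinearIsometryEquiv.apply_symm_apply]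

theorem hasFMul_fourierMul {m : Space d → ℂ} (u : (fourierMul m).domain) :
    HasFMul m (u : L2 d) (fourierMul m u) := hasFMul_iff.2 ⟨u.2, rfl⟩

theorem HasFMul.unique {m : Space d → ℂ} {u v w : L2 d} (h : HasFMul m u v) (h' : HasFMul m u w) :
    v = w := FT.injective (HasMul.unique h h')

theorem HasFMul.add {m : Space d → ℂ} {u v u' v' : L2 d} (h : HasFMul m u v)
    (h' : HasFMul m u' v') : HasFMul m (u + u') (v + v') := by
  rw [HasFMul, map_add, map_add]
  exact HasMul.add h h'

theorem HasFMul.sub {m : Space d → ℂ} {u v u' v' : L2 d} (h : HasFMul m u v)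
    (h' : HasFMul m u' v') : HasFMul m (u - u') (v - v') := by
  rw [HasFMul, map_sub, map_sub]
  exact HasMul.sub h h'

theorem HasFMul.smul {m : Space d → ℂ} {u v : L2 d} (h : HasFMul m u v) (z : ℂ) :
    HasFMul m (z • u) (z • v) := by
  rw [HasFMul, map_smul, map_smul]
  exact HasMul.smul h z

theorem HasFMul.inner_eq {m : Space d → ℂ} {u v u' v' : L2 d} (h : HasFMul m u v)
    (h' : HasFMul (fun x => conj (m x)) u' v') : inner ℂ u' v = inner ℂ v' u := by
  rw [← FT.inner_map_map u' v, ← FT.inner_map_map v' u]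
  exact HasMul.inner_eq h h'

theorem HasFMul.norm_le {m m' : Space d → ℂ} {u v u' v' : L2 d} (h : HasFMul m u v)
    (h' : HasFMul m' u' v') {C : ℝ} (hC : ∀ᵐ x, ‖m x * FT u x‖ ≤ C * ‖m' x * FT u' x‖) :
    ‖v‖ ≤ C * ‖v'‖ := by
  rw [← FT.norm_map v, ← FT.norm_map v']
  exact HasMul.norm_le h h' hC

theorem hasFMul_toLp {m : Space d → ℂ} {φ ψ : 𝓢(Space d, ℂ)} (h : ∀ ξ, 𝓕 ψ ξ = m ξ * 𝓕 φ ξ) :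
    HasFMul m (φ.toLp 2) (ψ.toLp 2) := by
  have h1 : FT (φ.toLp 2) = (𝓕 φ).toLp 2 := SchwartzMap.toLp_fourier_eq φ
  have h2 : FT (ψ.toLp 2) = (𝓕 ψ).toLp 2 := SchwartzMap.toLp_fourier_eq ψ
  rw [HasFMul, h1, h2]
  filter_upwards [(𝓕 φ).coeFn_toLp 2, (𝓕 ψ).coeFn_toLp 2] with ξ h3 h4
  rw [h3, h4, h]

/-- Test functions detect `HasFMul`. -/
theorem hasFMul_of_schwartz {m : Space d → ℂ} (hm : m.HasTemperateGrowth) {u v : L2 d}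
    (h : ∀ φ ψ : 𝓢(Space d, ℂ), (∀ ξ, 𝓕 ψ ξ = conj (m ξ) * 𝓕 φ ξ) →
      inner ℂ (ψ.toLp 2 : L2 d) u = inner ℂ (φ.toLp 2 : L2 d) v) : HasFMul m u v := by
  have hmc : (fun x => conj (m x)).HasTemperateGrowth := by
    have : (fun x => conj (m x)) = (Complex.conjCLE : ℂ → ℂ) ∘ m := by
      ext; simp
    rw [this]
    exact (Complex.conjCLE.hasTemperateGrowth).comp hm
  have hl : ∀ w : L2 d, LocallyIntegrable w volume := fun w =>
    (Lp.memLp w).locallyIntegrable (by norm_num)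
  have hl' : LocallyIntegrable (fun x => m x * FT u x) volume := by
    have := (hl (FT u)).locallyIntegrableOn univ |>.continuousOn_mul
      (hm.1.continuous.continuousOn (s := univ)) isOpen_univ.isLocallyClosed
    exact locallyIntegrableOn_univ.1 this
  -- Both sides are locally integrable on the Fourier side, so equality may be tested against real
  -- functions in `C_c^∞`.
  refine ae_eq_of_integral_contDiff_smul_eq (hl _) hl' fun g hg hgc => ?_
  have hgC : HasCompactSupport fun x => (g x : ℂ) := hgc.comp_left Complex.ofReal_zero
  let G : 𝓢(Space d, ℂ) := hgC.toSchwartzMap (Complex.ofRealCLM.contDiff.comp hg)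
  have hG : ∀ x, G x = g x := fun x => rfl
  -- The test pair is chosen through its Fourier transforms `G` and `conj m · G`; both are Schwartz
  -- because `m` has temperate growth.
  have key := h (𝓕⁻ G) (𝓕⁻ (SchwartzMap.smulLeftCLM ℂ (fun x => conj (m x)) G)) (by
    intro ξ
    rw [fourier_fourierInv_eq, fourier_fourierInv_eq, SchwartzMap.smulLeftCLM_apply_apply hmc,
      smul_eq_mul])
  rw [← FT.inner_map_map, ← FT.inner_map_map (_ : L2 d) v] at key
  have h1 : ∀ φ : 𝓢(Space d, ℂ), FT (φ.toLp 2) = (𝓕 φ).toLp 2 := SchwartzMap.toLp_fourier_eq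
  rw [h1, h1, fourier_fourierInv_eq, fourier_fourierInv_eq, L2.inner_def, L2.inner_def] at key
  refine Eq.trans ?_ (key.symm.trans ?_)
  · refine integral_congr_ae ?_
    filter_upwards [G.coeFn_toLp 2] with x hx
    rw [hx, hG]
    simp [mul_comm]
  · refine integral_congr_ae ?_
    filter_upwards [(SchwartzMap.smulLeftCLM ℂ (fun x => conj (m x)) G).coeFn_toLp 2] with x hx
    rw [hx, SchwartzMap.smulLeftCLM_apply_apply hmc, hG]
    simp only [smul_eq_mul, RCLike.inner_apply, map_mul, RCLike.conj_conj, Complex.conj_ofReal,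
      Complex.real_smul]
    ring

end MaxSpeed

namespace MaxSpeed

open scoped SchwartzMap LineDeriv ComplexConjugate

variable {d : ℕ}

/-! ### Derivatives on `L²` -/

/-- The symbol of the Laplacian. -/
noncomputable def symLap (ξ : Space d) : ℂ := ((-(2 * Real.pi * ‖ξ‖) ^ 2 : ℝ) : ℂ)

/-- The symbol of `|∇|`. -/
noncomputable def symGrad (ξ : Space d) : ℂ := ((2 * Real.pi * ‖ξ‖ : ℝ) : ℂ)

/-- The symbol of `∂_j`. -/
noncomputable def symPar (j : Fin d) (ξ : Space d) : ℂ := 2 * Real.pi * Complex.I * (ξ j : ℂ)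

/-- The `j`-th coordinate vector. -/
noncomputable abbrev ee (j : Fin d) : Space d := EuclideanSpace.single j 1

theorem inner_ee (ξ : Space d) (j : Fin d) : inner ℝ ξ (ee j) = ξ j := by
  simp [ee, EuclideanSpace.inner_single_right]

theorem temperate_coord (j : Fin d) : (fun ξ : Space d => ξ j).HasTemperateGrowth := by
  have : (fun ξ : Space d => ξ j) = fun ξ => inner ℝ ξ (ee j) := by
    ext ξ; rw [inner_ee]
  rw [this]
  fun_prop

theorem temperate_symPar (j : Fin d) : (symPar j).HasTemperateGrowth := by
  have h := Complex.ofRealCLM.hasTemperateGrowth.comp (temperate_coord j)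
  exact (Function.HasTemperateGrowth.const (2 * Real.pi * Complex.I : ℂ)).mul h

theorem symLap_eq (ξ : Space d) : symLap ξ = ∑ j, symPar j ξ * symPar j ξ := by
  have h : ∀ j, symPar j ξ * symPar j ξ = ((-(2 * Real.pi) ^ 2 * (ξ j) ^ 2 : ℝ) : ℂ) := by
    intro j
    simp only [symPar]
    push_cast
    linear_combination (2 * Real.pi) ^ 2 * (ξ j : ℂ) ^ 2 * Complex.I_sq
  simp_rw [h]
  rw [← Complex.ofReal_sum, ← Finset.mul_sum, symLap, mul_pow, EuclideanSpace.norm_sq_eq]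
  simp

theorem temperate_symLap : (symLap : Space d → ℂ).HasTemperateGrowth := by
  have : (symLap : Space d → ℂ) = fun ξ => ∑ j, symPar j ξ * symPar j ξ := by
    ext ξ; exact symLap_eq ξ
  rw [this]
  exact Function.HasTemperateGrowth.sum fun j _ => (temperate_symPar j).mul (temperate_symPar j)

theorem conj_symLap (ξ : Space d) : conj (symLap ξ) = symLap ξ := Complex.conj_ofReal _

theorem conj_symGrad (ξ : Space d) : conj (symGrad ξ) = symGrad ξ := Complex.conj_ofReal _

theorem conj_symPar (j : Fin d) (ξ : Space d) : conj (symPar j ξ) = -symPar j ξ := by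
  have h : conj (2 : ℂ) = 2 := Complex.conj_ofNat 2
  simp [symPar, h]

theorem symGrad_sq (ξ : Space d) : symGrad ξ * symGrad ξ = -symLap ξ := by
  simp only [symGrad, symLap]
  push_cast
  ring

/-- The Laplacian of a Schwartz function. -/
noncomputable def lapS (φ : 𝓢(Space d, ℂ)) : 𝓢(Space d, ℂ) :=
  ∑ j : Fin d, ∂_{ee j} (∂_{ee j} φ)

theorem schwartz_fourier_injective {φ ψ : 𝓢(Space d, ℂ)} (h : 𝓕 φ = 𝓕 ψ) : φ = ψ := by
  have h1 := congrArg (fun χ : 𝓢(Space d, ℂ) => (𝓕⁻ χ : 𝓢(Space d, ℂ))) h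
  simpa using h1

theorem fourier_par (φ : 𝓢(Space d, ℂ)) (j : Fin d) (ξ : Space d) :
    𝓕 (∂_{ee j} φ) ξ = symPar j ξ * 𝓕 φ ξ := by
  have h : (inner ℝ · (ee j) : Space d → ℝ).HasTemperateGrowth := by fun_prop
  rw [SchwartzMap.fourier_lineDerivOp_eq, smul_apply,
    SchwartzMap.smulLeftCLM_apply_apply h, inner_ee, symPar]
  simp [mul_assoc]

theorem fourier_lapS (φ : 𝓢(Space d, ℂ)) (ξ : Space d) :
    𝓕 (lapS φ) ξ = symLap ξ * 𝓕 φ ξ := by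
  have h : 𝓕 (lapS φ) = ∑ j : Fin d, 𝓕 (∂_{ee j} (∂_{ee j} φ)) := by
    simp [lapS]
  rw [h, symLap_eq, sum_apply, Finset.sum_mul]
  refine Finset.sum_congr rfl fun j _ => ?_
  rw [fourier_par, fourier_par, mul_assoc]

theorem hasFMul_par (φ : 𝓢(Space d, ℂ)) (j : Fin d) :
    HasFMul (symPar j) (φ.toLp 2) ((∂_{ee j} φ).toLp 2) := hasFMul_toLp (fourier_par φ j)

theorem hasFMul_lapS (φ : 𝓢(Space d, ℂ)) :
    HasFMul symLap (φ.toLp 2) ((lapS φ).toLp 2) := hasFMul_toLp (fourier_lapS φ)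

/-- The symbol is real, so `Δ` on Schwartz functions is its own formal adjoint, and injectivity of
the Fourier transform leaves `lapS φ` as the only admissible partner of `φ`. Membership in `H²` is
proved below by this weak criterion. -/
theorem hasFMul_symLap_of_schwartz {u v : L2 d}
    (h : ∀ φ : 𝓢(Space d, ℂ), inner ℂ ((lapS φ).toLp 2 : L2 d) u = inner ℂ (φ.toLp 2 : L2 d) v) :
    HasFMul symLap u v := by
  refine hasFMul_of_schwartz temperate_symLap fun φ ψ hψ => ?_
  have : ψ = lapS φ := by
    have h1 : 𝓕 ψ = 𝓕 (lapS φ) := by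
      ext ξ; rw [hψ, fourier_lapS, conj_symLap]
    exact schwartz_fourier_injective h1
  rw [this]
  exact h φ

theorem hasFMul_symPar_of_schwartz {j : Fin d} {u v : L2 d}
    (h : ∀ φ : 𝓢(Space d, ℂ),
      inner ℂ ((∂_{ee j} φ).toLp 2 : L2 d) u = -inner ℂ (φ.toLp 2 : L2 d) v) :
    HasFMul (symPar j) u v := by
  refine hasFMul_of_schwartz (temperate_symPar j) fun φ ψ hψ => ?_
  have : ψ = -∂_{ee j} φ := by
    have h1 : 𝓕 ψ = 𝓕 (-∂_{ee j} φ) := by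
      have h2 : 𝓕 (-∂_{ee j} φ) = -𝓕 (∂_{ee j} φ) :=
        map_neg (SchwartzMap.fourierTransformCLM ℂ (V := Space d) (E := ℂ)) _
      ext ξ; rw [h2, neg_apply, hψ, fourier_par, conj_symPar, neg_mul]
    exact schwartz_fourier_injective h1
  rw [this]
  have h3 : ((-∂_{ee j} φ).toLp 2 : L2 d) = -(∂_{ee j} φ).toLp 2 := rfl
  rw [h3, inner_neg_left, h φ, neg_neg]

theorem HasFMul.symLap_inner {u v u' v' : L2 d} (h : HasFMul symLap u v)
    (h' : HasFMul symLap u' v') : inner ℂ u' v = inner ℂ v' u :=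
  h.inner_eq (by simpa only [conj_symLap] using h')

theorem HasFMul.symPar_inner {j : Fin d} {u v u' v' : L2 d} (h : HasFMul (symPar j) u v)
    (h' : HasFMul (symPar j) u' v') : inner ℂ u' v = -inner ℂ v' u := by
  have h2 : HasFMul (fun x => conj (symPar j x)) u' (-v') := by
    have := HasMul.smul_symbol h' (-1)
    simp only [conj_symPar, HasFMul, map_neg]
    simpa using this
  rw [h.inner_eq h2, inner_neg_left]

theorem exists_hasMul {m m' : Space d → ℂ} (hm : AEStronglyMeasurable m volume) {u v : L2 d}
    (h : HasMul m' u v) (hle : ∀ x, ‖m x‖ ≤ 1 + ‖m' x‖) : ∃ w, HasMul m u w := by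
  have hu : MemLp (fun x => m x * u x) 2 volume := by
    have h1 : MemLp (fun x => ‖u x‖ + ‖v x‖) 2 volume := (Lp.memLp u).norm.add (Lp.memLp v).norm
    refine h1.mono (hm.mul (Lp.aestronglyMeasurable u)) ?_
    filter_upwards [h] with x hx
    rw [norm_mul, Real.norm_of_nonneg (by positivity), hx, norm_mul]
    nlinarith [hle x, norm_nonneg (u x)]
  exact ⟨_, hasMul_iff.2 ⟨hu, rfl⟩⟩

theorem exists_hasFMul {m m' : Space d → ℂ} (hm : AEStronglyMeasurable m volume) {u v : L2 d}
    (h : HasFMul m' u v) (hle : ∀ x, ‖m x‖ ≤ 1 + ‖m' x‖) : ∃ w, HasFMul m u w := by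
  obtain ⟨w, hw⟩ := exists_hasMul hm h hle
  exact ⟨FT.symm w, by rwa [HasFMul, LinearIsometryEquiv.apply_symm_apply]⟩

theorem norm_symLap (ξ : Space d) : ‖symLap ξ‖ = (2 * Real.pi * ‖ξ‖) ^ 2 := by
  rw [symLap, Complex.norm_real, norm_neg, Real.norm_of_nonneg (by positivity)]

theorem norm_symGrad (ξ : Space d) : ‖symGrad ξ‖ = 2 * Real.pi * ‖ξ‖ := by
  rw [symGrad, Complex.norm_real, Real.norm_of_nonneg (by positivity)]

theorem norm_symPar (j : Fin d) (ξ : Space d) : ‖symPar j ξ‖ = 2 * Real.pi * |ξ j| := by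
  simp [symPar, abs_of_pos Real.pi_pos]

theorem norm_symPar_le (j : Fin d) (ξ : Space d) : ‖symPar j ξ‖ ≤ ‖symGrad ξ‖ := by
  rw [norm_symPar, norm_symGrad]
  gcongr
  simpa using PiLp.norm_apply_le ξ j

theorem continuous_symGrad : Continuous (symGrad : Space d → ℂ) := by
  unfold symGrad; fun_prop

theorem exists_grad {u v : L2 d} (h : HasFMul symLap u v) : ∃ w, HasFMul symGrad u w := by
  refine exists_hasFMul continuous_symGrad.aestronglyMeasurable h fun ξ => ?_
  rw [norm_symGrad, norm_symLap]
  nlinarith [sq_nonneg (2 * Real.pi * ‖ξ‖ - 1)]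

theorem exists_par {u v : L2 d} (h : HasFMul symGrad u v) (j : Fin d) :
    ∃ w, HasFMul (symPar j) u w :=
  exists_hasFMul (temperate_symPar j).1.continuous.aestronglyMeasurable h fun ξ => by
    linarith [norm_symPar_le j ξ]

theorem HasFMul.par_norm_le {j : Fin d} {u v w : L2 d} (h : HasFMul (symPar j) u v)
    (h' : HasFMul symGrad u w) : ‖v‖ ≤ ‖w‖ := by
  have := h.norm_le h' (C := 1) (ae_of_all _ fun ξ => by
    rw [norm_mul, norm_mul, one_mul]; gcongr; exact norm_symPar_le j ξ)
  simpa using this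

/-- Integration by parts `⟨u', Δ u⟩ = -∑ ⟨∂_j u', ∂_j u⟩`. -/
theorem inner_lap_eq {u v u' : L2 d} {p p' : Fin d → L2 d} (h : HasFMul symLap u v)
    (hp : ∀ j, HasFMul (symPar j) u (p j)) (hp' : ∀ j, HasFMul (symPar j) u' (p' j)) :
    inner ℂ u' v = -∑ j, inner ℂ (p' j) (p j) := by
  rw [← FT.inner_map_map]
  simp_rw [← FT.inner_map_map (p' _)]
  simp_rw [L2.inner_def]
  rw [← integral_finsetSum _ (fun j _ => L2.integrable_inner _ _), ← integral_neg]
  refine integral_congr_ae ?_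
  filter_upwards [h, ae_all_iff.2 hp, ae_all_iff.2 hp'] with ξ h1 h2 h3
  simp only [h1, h2, h3, RCLike.inner_apply, map_mul, conj_symPar, symLap_eq]
  rw [← Finset.sum_neg_distrib, Finset.sum_mul, Finset.sum_mul]
  refine Finset.sum_congr rfl fun j _ => ?_
  ring

/-- Plancherel and `∑ |symPar j|² = symGrad²`. The squares are kept together, since a bound for each
`∂_j` separately would lose the constant one between the gradient and `|∇|`, on which the sharp
speed depends. -/
theorem sum_par_norm_sq {u w : L2 d} {p : Fin d → L2 d}
    (hp : ∀ j, HasFMul (symPar j) u (p j)) (hw : HasFMul symGrad u w) :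
    ∑ j, ‖p j‖ ^ 2 = ‖w‖ ^ 2 := by
  have key : ∑ j, inner ℂ (p j) (p j) = inner ℂ w w := by
    simp_rw [← FT.inner_map_map (p _), ← FT.inner_map_map w]
    simp_rw [L2.inner_def]
    rw [← integral_finsetSum _ (fun j _ => L2.integrable_inner _ _)]
    refine integral_congr_ae ?_
    filter_upwards [hw, ae_all_iff.2 hp] with ξ h1 h2
    simp only [h1, h2, RCLike.inner_apply, map_mul, conj_symPar, conj_symGrad]
    have : symGrad ξ * FT u ξ * (symGrad ξ * conj (FT u ξ)) =
        -(∑ j, symPar j ξ * symPar j ξ) * FT u ξ * conj (FT u ξ) := by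
      rw [← symLap_eq, ← symGrad_sq]; ring
    rw [this, ← Finset.sum_neg_distrib, Finset.sum_mul, Finset.sum_mul]
    refine Finset.sum_congr rfl fun j _ => ?_
    ring
  simp_rw [inner_self_eq_norm_sq_to_K] at key
  exact_mod_cast key

theorem inner_lap_self {u v w : L2 d} (h : HasFMul symLap u v) (hw : HasFMul symGrad u w) :
    inner ℂ u v = ((-‖w‖ ^ 2 : ℝ) : ℂ) := by
  choose p hp using fun j => exists_par hw j
  rw [inner_lap_eq h hp hp, ← sum_par_norm_sq hp hw]
  simp_rw [inner_self_eq_norm_sq_to_K]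
  push_cast
  rfl

end MaxSpeed

namespace MaxSpeed

open scoped SchwartzMap LineDeriv ComplexConjugate

variable {d : ℕ}

/-! ### Multiplication by smooth functions -/

/-- A real function `η` with first derivatives `η₁ j` and pure second derivatives `η₂ j`, all
bounded and of temperate growth. -/
structure SmoothMul (η : Space d → ℝ) (η₁ η₂ : Fin d → Space d → ℝ) : Prop where
  temperate : η.HasTemperateGrowth
  temperate₁ : ∀ j, (η₁ j).HasTemperateGrowth
  temperate₂ : ∀ j, (η₂ j).HasTemperateGrowth
  deriv₁ : ∀ j x, fderiv ℝ η x (ee j) = η₁ j x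
  deriv₂ : ∀ j x, fderiv ℝ (η₁ j) x (ee j) = η₂ j x
  bdd : ∃ C, ∀ x, |η x| ≤ C
  bdd₁ : ∃ C, ∀ j x, |η₁ j x| ≤ C
  bdd₂ : ∃ C, ∀ j x, |η₂ j x| ≤ C

/-- Multiplication by a bounded real function. -/
noncomputable abbrev mulR (η : Space d → ℝ) : L2 d →L[ℂ] L2 d := mulB fun x => (η x : ℂ)

theorem memLp_top_ofReal {η : Space d → ℝ} (h : Continuous η) {C : ℝ} (hC : ∀ x, |η x| ≤ C) :
    MemLp (fun x => (η x : ℂ)) ∞ volume :=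
  memLp_top_of_bound (Complex.continuous_ofReal.comp h).aestronglyMeasurable C
    (ae_of_all _ fun x => by simpa using hC x)

namespace SmoothMul

variable {η : Space d → ℝ} {η₁ η₂ : Fin d → Space d → ℝ}

theorem memLp (h : SmoothMul η η₁ η₂) : MemLp (fun x => (η x : ℂ)) ∞ volume :=
  memLp_top_ofReal h.temperate.1.continuous h.bdd.choose_spec

theorem memLp₁ (h : SmoothMul η η₁ η₂) (j : Fin d) : MemLp (fun x => (η₁ j x : ℂ)) ∞ volume :=
  memLp_top_ofReal (h.temperate₁ j).1.continuous (h.bdd₁.choose_spec j)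

theorem memLp₂ (h : SmoothMul η η₁ η₂) (j : Fin d) : MemLp (fun x => (η₂ j x : ℂ)) ∞ volume :=
  memLp_top_ofReal (h.temperate₂ j).1.continuous (h.bdd₂.choose_spec j)

end SmoothMul

/-- Multiplication of Schwartz functions by a real function. -/
noncomputable abbrev mulS (η : Space d → ℝ) : 𝓢(Space d, ℂ) →L[ℝ] 𝓢(Space d, ℂ) :=
  SchwartzMap.smulLeftCLM ℂ η

theorem mulS_apply {η : Space d → ℝ} (hη : η.HasTemperateGrowth) (φ : 𝓢(Space d, ℂ)) (x : Space d) :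
    mulS η φ x = (η x : ℂ) * φ x := by
  rw [mulS, SchwartzMap.smulLeftCLM_apply_apply hη, Complex.real_smul]

theorem hasMul_mulS {η : Space d → ℝ} (hη : η.HasTemperateGrowth) (φ : 𝓢(Space d, ℂ)) :
    HasMul (fun x => (η x : ℂ)) (φ.toLp 2) ((mulS η φ).toLp 2) := by
  filter_upwards [φ.coeFn_toLp 2, (mulS η φ).coeFn_toLp 2] with x h1 h2
  rw [h1, h2, mulS_apply hη]

theorem mulR_toLp {η : Space d → ℝ} (hη : η.HasTemperateGrowth)
    (h : MemLp (fun x => (η x : ℂ)) ∞ volume) (φ : 𝓢(Space d, ℂ)) :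
    mulR η (φ.toLp 2) = ((mulS η φ).toLp 2 : L2 d) := (hasMul_mulS hη φ).mulB_eq h

theorem par_mulS {η η₁ : Space d → ℝ} (hη : η.HasTemperateGrowth) (hη₁ : η₁.HasTemperateGrowth)
    {j : Fin d} (hd : ∀ x, fderiv ℝ η x (ee j) = η₁ x) (φ : 𝓢(Space d, ℂ)) :
    ∂_{ee j} (mulS η φ) = mulS η (∂_{ee j} φ) + mulS η₁ φ := by
  ext x
  rw [add_apply, mulS_apply hη, mulS_apply hη₁, SchwartzMap.lineDerivOp_apply_eq_fderiv,
    SchwartzMap.lineDerivOp_apply_eq_fderiv]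
  have h1 : (mulS η φ : Space d → ℂ) = fun y => η y • φ y := by
    ext y; rw [mulS_apply hη, Complex.real_smul]
  rw [h1]
  have h2 : DifferentiableAt ℝ η x := hη.1.differentiable (by simp) x
  rw [fderiv_fun_smul h2 (φ.differentiableAt)]
  simp [hd]

/-- The Leibniz rule in adjoint order: the first derivatives stand outside the products with `η₁ j`,
so that in a weak formulation they can be moved onto the other function. -/
theorem SmoothMul.mulS_lapS {η : Space d → ℝ} {η₁ η₂ : Fin d → Space d → ℝ}
    (h : SmoothMul η η₁ η₂) (φ : 𝓢(Space d, ℂ)) :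
    mulS η (lapS φ) = lapS (mulS η φ) - (2 : ℂ) • ∑ j : Fin d, ∂_{ee j} (mulS (η₁ j) φ) +
      ∑ j : Fin d, mulS (η₂ j) φ := by
  have h1 : ∀ j : Fin d, ∂_{ee j} (∂_{ee j} (mulS η φ)) =
      mulS η (∂_{ee j} (∂_{ee j} φ)) + mulS (η₁ j) (∂_{ee j} φ) +
        (mulS (η₁ j) (∂_{ee j} φ) + mulS (η₂ j) φ) := by
    intro j
    rw [par_mulS h.temperate (h.temperate₁ j) (h.deriv₁ j), LineDeriv.lineDerivOp_add,
      par_mulS h.temperate (h.temperate₁ j) (h.deriv₁ j),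
      par_mulS (h.temperate₁ j) (h.temperate₂ j) (h.deriv₂ j)]
  have h2 : ∀ j : Fin d, ∂_{ee j} (mulS (η₁ j) φ) = mulS (η₁ j) (∂_{ee j} φ) + mulS (η₂ j) φ :=
    fun j => par_mulS (h.temperate₁ j) (h.temperate₂ j) (h.deriv₂ j) φ
  simp only [lapS, map_sum, h1, h2, Finset.sum_add_distrib, smul_add, two_smul]
  abel

theorem SmoothMul.par {η : Space d → ℝ} {η₁ η₂ : Fin d → Space d → ℝ}
    (h : SmoothMul η η₁ η₂) {j : Fin d} {u v : L2 d} (hu : HasFMul (symPar j) u v) :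
    HasFMul (symPar j) (mulR η u) (mulR η v + mulR (η₁ j) u) := by
  refine hasFMul_symPar_of_schwartz fun φ => ?_
  rw [mulB_inner_ofReal, inner_add_right, mulB_inner_ofReal, mulB_inner_ofReal,
    mulR_toLp h.temperate h.memLp, mulR_toLp h.temperate h.memLp,
    mulR_toLp (h.temperate₁ j) (h.memLp₁ j)]
  have h1 := hu.symPar_inner (hasFMul_par (mulS η φ) j)
  have h2 : (∂_{ee j} (mulS η φ)).toLp 2 volume =
      (mulS η (∂_{ee j} φ)).toLp 2 volume + (mulS (η₁ j) φ).toLp 2 volume := by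
    rw [par_mulS h.temperate (h.temperate₁ j) (h.deriv₁ j)]; rfl
  rw [h1, h2, inner_add_left]
  ring

/-- Multiplication by `η` preserves `H²`. The proof is by duality: multiplication by `η` is moved
onto the Schwartz test function, where the product rule is classical. -/
theorem SmoothMul.lap {η : Space d → ℝ} {η₁ η₂ : Fin d → Space d → ℝ}
    (h : SmoothMul η η₁ η₂) {u v : L2 d} {p : Fin d → L2 d} (hu : HasFMul symLap u v)
    (hp : ∀ j, HasFMul (symPar j) u (p j)) :
    HasFMul symLap (mulR η u)
      (mulR η v + (2 : ℂ) • ∑ j, mulR (η₁ j) (p j) + ∑ j, mulR (η₂ j) u) := by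
  refine hasFMul_symLap_of_schwartz fun φ => ?_
  have h0 : (mulS η (lapS φ)).toLp 2 volume = (lapS (mulS η φ)).toLp 2 volume -
      (2 : ℂ) • ∑ j : Fin d, (∂_{ee j} (mulS (η₁ j) φ)).toLp 2 volume +
      ∑ j : Fin d, (mulS (η₂ j) φ).toLp 2 volume := by
    have key := congrArg (SchwartzMap.toLpCLM ℂ ℂ (E := Space d) 2 volume) (h.mulS_lapS φ)
    rw [map_add, map_sub, map_smul, map_sum, map_sum] at key
    exact key
  have h1 : ∀ j, inner ℂ ((∂_{ee j} (mulS (η₁ j) φ)).toLp 2 volume) u =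
      -inner ℂ (φ.toLp 2 : L2 d) (mulR (η₁ j) (p j)) := by
    intro j
    rw [mulB_inner_ofReal, mulR_toLp (h.temperate₁ j) (h.memLp₁ j),
      (hp j).symPar_inner (hasFMul_par _ j), neg_neg]
  have h2 : ∀ j, inner ℂ ((mulS (η₂ j) φ).toLp 2 volume) u =
      inner ℂ (φ.toLp 2 : L2 d) (mulR (η₂ j) u) := by
    intro j
    rw [mulB_inner_ofReal, mulR_toLp (h.temperate₂ j) (h.memLp₂ j)]
  have h3 : inner ℂ ((lapS (mulS η φ)).toLp 2 volume) u =
      inner ℂ (φ.toLp 2 : L2 d) (mulR η v) := by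
    rw [mulB_inner_ofReal, mulR_toLp h.temperate h.memLp, hu.symLap_inner (hasFMul_lapS _)]
  rw [mulB_inner_ofReal, mulR_toLp h.temperate h.memLp, h0, inner_add_left, inner_sub_left,
    inner_smul_left, sum_inner, sum_inner, inner_add_right, inner_add_right, inner_smul_right,
    inner_sum, inner_sum, h3]
  simp only [h1, h2, Finset.sum_neg_distrib]
  have : conj (2 : ℂ) = 2 := Complex.conj_ofNat 2
  rw [this]
  ring

end MaxSpeed

namespace MaxSpeed

open scoped SchwartzMap LineDeriv ComplexConjugate

variable {d : ℕ}

/-! ### Schwartz functions are a core of the Laplacian -/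

theorem HasFMul.id_sub_lap {u v : L2 d} (h : HasFMul symLap u v) :
    HasFMul (fun ξ => 1 - symLap ξ) u (u - v) := by
  rw [HasFMul, map_sub]
  filter_upwards [h, Lp.coeFn_sub (FT u) (FT v)] with ξ h1 h2
  rw [h2, Pi.sub_apply, h1]
  ring

theorem norm_one_sub_symLap (ξ : Space d) : ‖1 - symLap ξ‖ = 1 + (2 * Real.pi * ‖ξ‖) ^ 2 := by
  have : 1 - symLap ξ = ((1 + (2 * Real.pi * ‖ξ‖) ^ 2 : ℝ) : ℂ) := by
    simp only [symLap]; push_cast; ring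
  rw [this, Complex.norm_real, Real.norm_of_nonneg (by positivity)]

/-- The symbol `1 - symLap` equals `1 + |2πξ|²` and dominates every symbol used here, so smallness
of `u - Δu` yields smallness of `u`, `Δu` and all `∂_j u` at once. -/
theorem HasFMul.norm_le_id_sub_lap {m : Space d → ℂ} {u v w : L2 d} (h : HasFMul symLap u v)
    (hw : HasFMul m u w) (hm : ∀ ξ, ‖m ξ‖ ≤ 1 + (2 * Real.pi * ‖ξ‖) ^ 2) : ‖w‖ ≤ ‖u - v‖ := by
  have := hw.norm_le h.id_sub_lap (C := 1) (ae_of_all _ fun ξ => by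
    rw [norm_mul, norm_mul, one_mul, norm_one_sub_symLap]; gcongr; exact hm ξ)
  simpa using this

theorem norm_symPar_le_one_add (j : Fin d) (ξ : Space d) :
    ‖symPar j ξ‖ ≤ 1 + (2 * Real.pi * ‖ξ‖) ^ 2 := by
  have := norm_symPar_le j ξ
  rw [norm_symGrad] at this
  nlinarith [sq_nonneg (2 * Real.pi * ‖ξ‖ - 1)]

theorem hasFMul_one (u : L2 d) : HasFMul (fun _ => 1) u u := hasMul_one _

/-- The map `φ ↦ φ - Δφ` from Schwartz functions to `L²`. -/
noncomputable def idSubLapS : 𝓢(Space d, ℂ) →ₗ[ℂ] L2 d where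
  toFun φ := φ.toLp 2 volume - (lapS φ).toLp 2 volume
  map_add' φ ψ := by
    have h : lapS (φ + ψ) = lapS φ + lapS ψ := by
      simp only [lapS, LineDeriv.lineDerivOp_add, Finset.sum_add_distrib]
    rw [h]
    change (φ.toLp 2 volume + ψ.toLp 2 volume) - ((lapS φ).toLp 2 volume + (lapS ψ).toLp 2 volume)
      = _
    abel
  map_smul' z φ := by
    have h : lapS (z • φ) = z • lapS φ := by
      simp only [lapS, LineDeriv.lineDerivOp_smul, Finset.smul_sum]
    rw [h, RingHom.id_apply, smul_sub]
    rfl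

/-- A vector orthogonal to the range satisfies `Δv = v` weakly, hence in `H²`, and then `‖v‖ ≤ ‖v -
Δv‖ = 0`. -/
theorem dense_idSubLapS : (LinearMap.range (idSubLapS (d := d))).topologicalClosure = ⊤ := by
  rw [Submodule.topologicalClosure_eq_top_iff, Submodule.eq_bot_iff]
  intro v hv
  have h : HasFMul symLap v v := by
    refine hasFMul_symLap_of_schwartz fun φ => ?_
    have := (Submodule.mem_orthogonal _ _).1 hv (idSubLapS φ) ⟨φ, rfl⟩
    change inner ℂ (φ.toLp 2 volume - (lapS φ).toLp 2 volume) v = 0 at this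
    rw [inner_sub_left, sub_eq_zero] at this
    exact this.symm
  have h2 := h.norm_le_id_sub_lap (hasFMul_one v) (fun ξ => by
    rw [norm_one]; nlinarith [sq_nonneg (2 * Real.pi * ‖ξ‖)])
  rw [sub_self, norm_zero] at h2
  exact norm_le_zero_iff.1 h2

theorem exists_schwartz_near {u v : L2 d} {p : Fin d → L2 d} (hu : HasFMul symLap u v)
    (hp : ∀ j, HasFMul (symPar j) u (p j)) {ε : ℝ} (hε : 0 < ε) :
    ∃ φ : 𝓢(Space d, ℂ), ‖φ.toLp 2 volume - u‖ < ε ∧ ‖(lapS φ).toLp 2 volume - v‖ < ε ∧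
      ∀ j, ‖(∂_{ee j} φ).toLp 2 volume - p j‖ < ε := by
  have h1 : u - v ∈ (LinearMap.range (idSubLapS (d := d))).topologicalClosure := by
    rw [dense_idSubLapS]; trivial
  rw [← SetLike.mem_coe, Submodule.topologicalClosure_coe, Metric.mem_closure_iff] at h1
  obtain ⟨_, ⟨φ, rfl⟩, hφ⟩ := h1 ε hε
  have hlap := (hasFMul_lapS φ).sub hu
  have h2 : ‖(φ.toLp 2 volume - u) - ((lapS φ).toLp 2 volume - v)‖ < ε := by
    rw [dist_comm, dist_eq_norm] at hφ
    have : (φ.toLp 2 volume - u) - ((lapS φ).toLp 2 volume - v) = idSubLapS φ - (u - v) := by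
      change _ = (φ.toLp 2 volume - (lapS φ).toLp 2 volume) - (u - v)
      abel
    rwa [this]
  refine ⟨φ, ?_, ?_, fun j => ?_⟩
  · refine (hlap.norm_le_id_sub_lap (hasFMul_one _) fun ξ => ?_).trans_lt h2
    rw [norm_one]; nlinarith [sq_nonneg (2 * Real.pi * ‖ξ‖)]
  · refine (hlap.norm_le_id_sub_lap hlap fun ξ => ?_).trans_lt h2
    rw [norm_symLap]; linarith
  · exact (hlap.norm_le_id_sub_lap ((hasFMul_par φ j).sub (hp j))
      (norm_symPar_le_one_add j)).trans_lt h2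

theorem exists_schwartz_seq {u v : L2 d} {p : Fin d → L2 d} (hu : HasFMul symLap u v)
    (hp : ∀ j, HasFMul (symPar j) u (p j)) :
    ∃ φ : ℕ → 𝓢(Space d, ℂ), Tendsto (fun n => (φ n).toLp 2 volume) atTop (𝓝 u) ∧
      Tendsto (fun n => (lapS (φ n)).toLp 2 volume) atTop (𝓝 v) ∧
      ∀ j, Tendsto (fun n => (∂_{ee j} (φ n)).toLp 2 volume) atTop (𝓝 (p j)) := by
  choose φ h1 h2 h3 using fun n : ℕ =>
    exists_schwartz_near hu hp (ε := 1 / ((n : ℝ) + 1)) (by positivity)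
  have hlim := tendsto_one_div_add_atTop_nhds_zero_nat (𝕜 := ℝ)
  refine ⟨φ, ?_, ?_, fun j => ?_⟩
  · exact tendsto_iff_norm_sub_tendsto_zero.2
      (squeeze_zero (fun _ => norm_nonneg _) (fun n => (h1 n).le) hlim)
  · exact tendsto_iff_norm_sub_tendsto_zero.2
      (squeeze_zero (fun _ => norm_nonneg _) (fun n => (h2 n).le) hlim)
  · exact tendsto_iff_norm_sub_tendsto_zero.2
      (squeeze_zero (fun _ => norm_nonneg _) (fun n => (h3 n j).le) hlim)

/-! ### The commutator of the Laplacian with a Lipschitz potential -/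

/-- The Schwartz function `φ̄ χ`. -/
noncomputable def sesqS (φ χ : 𝓢(Space d, ℂ)) : 𝓢(Space d, ℂ) :=
  SchwartzMap.pairing (ContinuousLinearMap.mul ℝ ℂ)
    (SchwartzMap.postcompCLM (Complex.conjCLE : ℂ →L[ℝ] ℂ) φ) χ

theorem sesqS_apply (φ χ : 𝓢(Space d, ℂ)) (x : Space d) : sesqS φ χ x = conj (φ x) * χ x := by
  simp [sesqS, SchwartzMap.pairing_apply_apply]

theorem par_sesqS (φ χ : 𝓢(Space d, ℂ)) (j : Fin d) :
    ∂_{ee j} (sesqS φ χ) = sesqS (∂_{ee j} φ) χ + sesqS φ (∂_{ee j} χ) := by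
  ext x
  rw [add_apply, sesqS_apply, sesqS_apply, SchwartzMap.lineDerivOp_apply_eq_fderiv,
    SchwartzMap.lineDerivOp_apply_eq_fderiv, SchwartzMap.lineDerivOp_apply_eq_fderiv]
  have h1 : (sesqS φ χ : Space d → ℂ) = fun y => Complex.conjCLE (φ y) * χ y := by
    ext y; rw [sesqS_apply]; rfl
  have h2 : HasFDerivAt (fun y => Complex.conjCLE (φ y))
      ((Complex.conjCLE : ℂ →L[ℝ] ℂ).comp (fderiv ℝ φ x)) x :=
    (Complex.conjCLE : ℂ →L[ℝ] ℂ).hasFDerivAt.comp x (φ.differentiableAt).hasFDerivAt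
  rw [h1, (h2.fun_mul (χ.differentiableAt).hasFDerivAt).fderiv]
  simp
  ring

theorem integral_norm_sesqS_le (φ χ : 𝓢(Space d, ℂ)) :
    ∫ x, ‖sesqS φ χ x‖ ≤ ‖φ.toLp 2 volume‖ * ‖χ.toLp 2 volume‖ := by
  have h := integral_mul_norm_le_Lp_mul_Lq (μ := (volume : Measure (Space d))) (f := φ) (g := χ)
    (p := 2) (q := 2) (by constructor <;> norm_num) (by simpa using φ.memLp 2)
    (by simpa using χ.memLp 2)
  have h1 : ∀ ψ : 𝓢(Space d, ℂ), ‖ψ.toLp 2 volume‖ = (∫ x, ‖ψ x‖ ^ (2 : ℝ)) ^ (1 / 2 : ℝ) := by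
    intro ψ
    rw [SchwartzMap.norm_toLp' (by norm_num) (by norm_num)]
    norm_num
  rw [h1, h1]
  refine le_trans (le_of_eq ?_) h
  refine integral_congr_ae (ae_of_all _ fun x => ?_)
  simp [sesqS_apply]

/-- The function `conj (Δφ) χ - conj φ Δχ` is the divergence of the current `F j = conj (∂_j φ) χ -
conj φ ∂_j χ`. Against `W` it therefore meets only first derivatives of `W`, entering through their
norms `M j` as functionals on `L¹`; Cauchy–Schwarz bounds the `L¹` norm of the current. -/
theorem inner_lap_commutator_schwartz {W : Space d → ℝ} (hW : MemLp (fun x => (W x : ℂ)) ∞ volume)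
    {M : Fin d → ℝ} (hM0 : ∀ j, 0 ≤ M j)
    (hM : ∀ j (φ : 𝓢(Space d, ℂ)), ‖∫ x, (W x : ℂ) * (∂_{ee j} φ : 𝓢(Space d, ℂ)) x‖ ≤ M j * ∫ x, ‖φ x‖)
    (φ χ : 𝓢(Space d, ℂ)) :
    ‖inner ℂ ((lapS φ).toLp 2 volume) (mulR W (χ.toLp 2 volume)) -
      inner ℂ (mulR W (φ.toLp 2 volume)) ((lapS χ).toLp 2 volume)‖ ≤
      ∑ j : Fin d, M j * (‖(∂_{ee j} φ).toLp 2 volume‖ * ‖χ.toLp 2 volume‖ +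
        ‖φ.toLp 2 volume‖ * ‖(∂_{ee j} χ).toLp 2 volume‖) := by
  set F : Fin d → 𝓢(Space d, ℂ) := fun j => sesqS (∂_{ee j} φ) χ - sesqS φ (∂_{ee j} χ) with hF
  have hint : ∀ j, Integrable (fun x => (W x : ℂ) * (∂_{ee j} (F j) : 𝓢(Space d, ℂ)) x) volume := fun j =>
    memLp_one_iff_integrable.1 (((∂_{ee j} (F j)).memLp 1 volume).mul hW)
  have key : inner ℂ ((lapS φ).toLp 2 volume) (mulR W (χ.toLp 2 volume)) -
      inner ℂ (mulR W (φ.toLp 2 volume)) ((lapS χ).toLp 2 volume) =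
      ∑ j : Fin d, ∫ x, (W x : ℂ) * (∂_{ee j} (F j) : 𝓢(Space d, ℂ)) x := by
    rw [← integral_finsetSum _ fun j _ => hint j, L2.inner_def, L2.inner_def,
      ← integral_sub (L2.integrable_inner _ _) (L2.integrable_inner _ _)]
    refine integral_congr_ae ?_
    filter_upwards [hasMul_mulB hW (χ.toLp 2 volume), hasMul_mulB hW (φ.toLp 2 volume),
      φ.coeFn_toLp 2 volume, χ.coeFn_toLp 2 volume, (lapS φ).coeFn_toLp 2 volume,
      (lapS χ).coeFn_toLp 2 volume] with x h1 h2 h3 h4 h5 h6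
    rw [h1, h2, h3, h4, h5, h6]
    have h7 : ∀ j : Fin d, (∂_{ee j} (F j) : 𝓢(Space d, ℂ)) x =
        conj ((∂_{ee j} (∂_{ee j} φ) : 𝓢(Space d, ℂ)) x) * χ x -
        conj (φ x) * (∂_{ee j} (∂_{ee j} χ) : 𝓢(Space d, ℂ)) x := by
      intro j
      have : ∂_{ee j} (F j) = (sesqS (∂_{ee j} (∂_{ee j} φ)) χ + sesqS (∂_{ee j} φ) (∂_{ee j} χ)) -
          (sesqS (∂_{ee j} φ) (∂_{ee j} χ) + sesqS φ (∂_{ee j} (∂_{ee j} χ))) := by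
        rw [← par_sesqS, ← par_sesqS]
        exact map_sub (LineDeriv.lineDerivOpCLM ℝ 𝓢(Space d, ℂ) (ee j)) _ _
      rw [this]
      simp only [sub_apply, add_apply, sesqS_apply]
      ring
    simp only [h7, RCLike.inner_apply, map_mul, Complex.conj_ofReal, lapS, sum_apply, map_sum]
    rw [Finset.mul_sum, Finset.sum_mul, ← Finset.sum_sub_distrib]
    refine Finset.sum_congr rfl fun j _ => ?_
    ring
  rw [key]
  refine (norm_sum_le _ _).trans (Finset.sum_le_sum fun j _ => (hM j (F j)).trans ?_)
  refine mul_le_mul_of_nonneg_left ?_ (hM0 j)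
  have h8 : ∫ x, ‖F j x‖ ≤ ∫ x, (‖sesqS (∂_{ee j} φ) χ x‖ + ‖sesqS φ (∂_{ee j} χ) x‖) := by
    refine integral_mono (F j).integrable.norm
      ((SchwartzMap.integrable _).norm.add (SchwartzMap.integrable _).norm) fun x => ?_
    simp only [hF, sub_apply]
    exact norm_sub_le _ _
  refine h8.trans ?_
  rw [integral_add (SchwartzMap.integrable _).norm (SchwartzMap.integrable _).norm]
  exact add_le_add (integral_norm_sesqS_le _ _) (integral_norm_sesqS_le _ _)

theorem inner_lap_commutator {W : Space d → ℝ} (hW : MemLp (fun x => (W x : ℂ)) ∞ volume)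
    {M : Fin d → ℝ} (hM0 : ∀ j, 0 ≤ M j)
    (hM : ∀ j (φ : 𝓢(Space d, ℂ)), ‖∫ x, (W x : ℂ) * (∂_{ee j} φ : 𝓢(Space d, ℂ)) x‖ ≤ M j * ∫ x, ‖φ x‖)
    {u u' v v' : L2 d} {p q : Fin d → L2 d} (hu : HasFMul symLap u u')
    (hp : ∀ j, HasFMul (symPar j) u (p j)) (hv : HasFMul symLap v v')
    (hq : ∀ j, HasFMul (symPar j) v (q j)) :
    ‖inner ℂ u' (mulR W v) - inner ℂ (mulR W u) v'‖ ≤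
      ∑ j : Fin d, M j * (‖p j‖ * ‖v‖ + ‖u‖ * ‖q j‖) := by
  obtain ⟨φ, h1, h2, h3⟩ := exists_schwartz_seq hu hp
  obtain ⟨χ, k1, k2, k3⟩ := exists_schwartz_seq hv hq
  refine le_of_tendsto_of_tendsto' (b := (atTop : Filter ℕ)) (f := fun n =>
    ‖inner ℂ ((lapS (φ n)).toLp 2 volume) (mulR W ((χ n).toLp 2 volume)) -
      inner ℂ (mulR W ((φ n).toLp 2 volume)) ((lapS (χ n)).toLp 2 volume)‖) ?_ ?_
    (fun n => inner_lap_commutator_schwartz hW hM0 hM (φ n) (χ n))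
  · exact ((h2.inner (((mulR W).continuous.tendsto _).comp k1)).sub
      ((((mulR W).continuous.tendsto _).comp h1).inner k2)).norm
  · exact tendsto_finsetSum _ fun j _ =>
      (((h3 j).norm.mul k1.norm).add (h1.norm.mul (k3 j).norm)).const_mul _

end MaxSpeed

namespace MaxSpeed

open scoped SchwartzMap LineDeriv ComplexConjugate

variable {d : ℕ}

/-! ### Weak derivatives tested against Schwartz functions -/

theorem exists_smooth_cutoff (d : ℕ) : ∃ χ : ℕ → Space d → ℝ, ∃ C : ℝ, (∀ n, ContDiff ℝ ∞ (χ n)) ∧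
    (∀ n, HasCompactSupport (χ n)) ∧ (∀ n x, ‖χ n x‖ ≤ 1) ∧ (∀ n x, ‖fderiv ℝ (χ n) x‖ ≤ C) ∧
    (∀ x, Tendsto (fun n => χ n x) atTop (𝓝 1)) ∧
    ∀ x, Tendsto (fun n => fderiv ℝ (χ n) x) atTop (𝓝 0) := by
  let b : ContDiffBump (0 : Space d) := ⟨1, 2, by norm_num, by norm_num⟩
  have hb : ContDiff ℝ ∞ b := b.contDiff
  have hbc : HasCompactSupport (fderiv ℝ b) := b.hasCompactSupport.fderiv ℝ
  obtain ⟨C, hC⟩ := hbc.exists_bound_of_continuous (hb.continuous_fderiv (by simp))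
  have hs : ∀ n : ℕ, (1 / ((n : ℝ) + 1)) ≠ 0 := fun n => by positivity
  let χ : ℕ → Space d → ℝ := fun n x => b ((1 / ((n : ℝ) + 1)) • x)
  have hfd : ∀ n x, fderiv ℝ (χ n) x =
      (1 / ((n : ℝ) + 1)) • fderiv ℝ b ((1 / ((n : ℝ) + 1)) • x) := fun n x =>
    fderiv_comp_smul _
  have hlim := tendsto_one_div_add_atTop_nhds_zero_nat (𝕜 := ℝ)
  have hnorm : ∀ n x, ‖fderiv ℝ (χ n) x‖ ≤ 1 / ((n : ℝ) + 1) * C := by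
    intro n x
    rw [hfd, norm_smul, Real.norm_of_nonneg (by positivity)]
    gcongr
    exact hC _
  have hC0 : 0 ≤ C := (norm_nonneg _).trans (hC 0)
  refine ⟨χ, C, fun n => hb.comp (contDiff_const_smul _), fun n => ?_, fun n x => ?_, fun n x => ?_,
    fun x => ?_, fun x => ?_⟩
  · exact b.hasCompactSupport.comp_homeomorph (Homeomorph.smulOfNeZero _ (hs n))
  · rw [Real.norm_of_nonneg b.nonneg]
    exact b.le_one
  · refine (hnorm n x).trans (mul_le_of_le_one_left hC0 ?_)
    rw [div_le_one (by positivity)]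
    linarith [n.cast_nonneg (α := ℝ)]
  · have h0 : Tendsto (fun n : ℕ => (1 / ((n : ℝ) + 1)) • x) atTop (𝓝 0) := by
      simpa using hlim.smul_const x
    have := (hb.continuous.tendsto 0).comp h0
    rwa [show b 0 = 1 from b.one_of_mem_closedBall (by simp [b])] at this
  · rw [tendsto_zero_iff_norm_tendsto_zero]
    exact squeeze_zero (fun _ => norm_nonneg _) (fun n => hnorm n x) (by simpa using hlim.mul_const C)

/-- Passage from `C_c^∞` to Schwartz test functions: multiply by cutoffs tending to one whose
gradients are bounded and tend to zero, and use dominated convergence. -/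
theorem IsWeakDeriv.integral_eq_real {j : Fin d} {f h : Space d → ℝ}
    (hfh : IsWeakDeriv (fun _ : Fin 1 => j) f h) (hf : MemLp f ∞ volume) (hh : MemLp h ∞ volume)
    (φ : 𝓢(Space d, ℝ)) :
    ∫ x, f x * fderiv ℝ φ x (ee j) = -∫ x, h x * φ x := by
  obtain ⟨χ, C, h1, h2, h3, h4, h5, h6⟩ := exists_smooth_cutoff d
  have hint1 : Integrable (fun x => f x * φ x) volume :=
    memLp_one_iff_integrable.1 ((φ.memLp 1 volume).mul hf)
  have hint2 : Integrable (fun x => f x * fderiv ℝ φ x (ee j)) volume := by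
    have := memLp_one_iff_integrable.1 (((∂_{ee j} φ : 𝓢(Space d, ℝ)).memLp 1 volume).mul hf)
    exact this
  have hint3 : Integrable (fun x => h x * φ x) volume :=
    memLp_one_iff_integrable.1 ((φ.memLp 1 volume).mul hh)
  have hd : ∀ n x, fderiv ℝ (fun y => χ n y * φ y) x (ee j) =
      χ n x * fderiv ℝ φ x (ee j) + φ x * fderiv ℝ (χ n) x (ee j) := by
    intro n x
    rw [fderiv_fun_mul ((h1 n).differentiable (by simp) x) (φ.differentiableAt)]
    simp
  have key : ∀ n, ∫ x, f x * fderiv ℝ (fun y => χ n y * φ y) x (ee j) =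
      -∫ x, h x * (χ n x * φ x) := by
    intro n
    have := hfh.2.2 (fun y => χ n y * φ y) ((h1 n).mul (φ.smooth ⊤)) ((h2 n).mul_right)
    simpa [iteratedFDeriv_one_apply] using this
  have lim1 : Tendsto (fun n => ∫ x, f x * fderiv ℝ (fun y => χ n y * φ y) x (ee j)) atTop
      (𝓝 (∫ x, f x * fderiv ℝ φ x (ee j))) := by
    refine tendsto_integral_of_dominated_convergence
      (fun x => ‖f x * fderiv ℝ φ x (ee j)‖ + C * ‖f x * φ x‖) (fun n => ?_)
      (hint2.norm.add (hint1.norm.const_mul C)) (fun n => ae_of_all _ fun x => ?_)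
      (ae_of_all _ fun x => ?_)
    · refine hf.1.mul (Continuous.aestronglyMeasurable ?_)
      have : ContDiff ℝ ∞ (fun y => χ n y * φ y) := (h1 n).mul (φ.smooth ⊤)
      exact (this.continuous_fderiv (by simp)).clm_apply continuous_const
    · rw [hd, mul_add]
      refine (norm_add_le _ _).trans (add_le_add ?_ ?_)
      · rw [norm_mul, norm_mul, norm_mul]
        have := h3 n x
        gcongr
        exact mul_le_of_le_one_left (norm_nonneg _) this
      · have h7 : ‖fderiv ℝ (χ n) x (ee j)‖ ≤ C := by
          refine ((fderiv ℝ (χ n) x).le_opNorm _).trans ?_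
          simpa [ee] using h4 n x
        rw [← mul_assoc, norm_mul, mul_comm]
        gcongr
    · simp_rw [hd]
      have h8 : Tendsto (fun n => fderiv ℝ (χ n) x (ee j)) atTop (𝓝 0) := by
        have := ((ContinuousLinearMap.apply ℝ ℝ (ee j)).continuous.tendsto _).comp (h6 x)
        simpa [Function.comp_def] using this
      have := (((h5 x).mul_const (fderiv ℝ φ x (ee j))).add (h8.const_mul (φ x))).const_mul (f x)
      simpa using this
  have lim2 : Tendsto (fun n => -∫ x, h x * (χ n x * φ x)) atTop (𝓝 (-∫ x, h x * φ x)) := by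
    refine (tendsto_integral_of_dominated_convergence
      (fun x => ‖h x * φ x‖) (fun n => ?_) hint3.norm (fun n => ae_of_all _ fun x => ?_)
      (ae_of_all _ fun x => ?_)).neg
    · exact hh.1.mul ((h1 n).continuous.mul φ.continuous).aestronglyMeasurable
    · rw [norm_mul, norm_mul, norm_mul]
      have := h3 n x
      gcongr
      exact mul_le_of_le_one_left (norm_nonneg _) this
    · have := ((h5 x).mul_const (φ x)).const_mul (h x)
      simpa using this
  simp_rw [key] at lim1
  exact tendsto_nhds_unique lim1 lim2

theorem IsWeakDeriv.norm_integral_le {j : Fin d} {f h : Space d → ℝ}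
    (hfh : IsWeakDeriv (fun _ : Fin 1 => j) f h) (hf : MemLp f ∞ volume) (hh : MemLp h ∞ volume)
    (φ : 𝓢(Space d, ℂ)) :
    ‖∫ x, (f x : ℂ) * (∂_{ee j} φ : 𝓢(Space d, ℂ)) x‖ ≤
      (eLpNorm h ∞ volume).toReal * ∫ x, ‖φ x‖ := by
  have hfc : MemLp (fun x => (f x : ℂ)) ∞ volume := hf.ofReal
  have hhc : MemLp (fun x => (h x : ℂ)) ∞ volume := hh.ofReal
  have hint1 : Integrable (fun x => (f x : ℂ) * (∂_{ee j} φ : 𝓢(Space d, ℂ)) x) volume :=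
    memLp_one_iff_integrable.1 (((∂_{ee j} φ : 𝓢(Space d, ℂ)).memLp 1 volume).mul hfc)
  have hint2 : Integrable (fun x => (h x : ℂ) * φ x) volume :=
    memLp_one_iff_integrable.1 ((φ.memLp 1 volume).mul hhc)
  have hcomp : ∀ L : ℂ →L[ℝ] ℝ, ∀ x, fderiv ℝ (SchwartzMap.postcompCLM (𝕜 := ℝ) L φ) x (ee j) =
      L ((∂_{ee j} φ : 𝓢(Space d, ℂ)) x) := by
    intro L x
    rw [SchwartzMap.lineDerivOp_apply_eq_fderiv]
    have : (SchwartzMap.postcompCLM (𝕜 := ℝ) L φ : Space d → ℝ) = fun y => L (φ y) := by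
      ext y; simp
    rw [this]
    have h2 := (L.hasFDerivAt (x := φ x)).comp x (φ.differentiableAt (x := x)).hasFDerivAt
    rw [show (fun y => L (φ y)) = L ∘ φ from rfl, h2.fderiv]
    rfl
  have hL : ∀ L : ℂ →L[ℝ] ℝ, (∀ (a : ℝ) (z : ℂ), L ((a : ℂ) * z) = a * L z) →
      L (∫ x, (f x : ℂ) * (∂_{ee j} φ : 𝓢(Space d, ℂ)) x) = L (-∫ x, (h x : ℂ) * φ x) := by
    intro L hLm
    rw [← L.integral_comp_comm hint1, map_neg, ← L.integral_comp_comm hint2]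
    simp_rw [hLm, ← hcomp L]
    rw [hfh.integral_eq_real hf hh]
    simp
  have key : ∫ x, (f x : ℂ) * (∂_{ee j} φ : 𝓢(Space d, ℂ)) x = -∫ x, (h x : ℂ) * φ x :=
    Complex.ext (hL Complex.reCLM (by simp)) (hL Complex.imCLM (by simp))
  rw [key, norm_neg, ← integral_const_mul]
  refine norm_integral_le_of_norm_le ((φ.integrable).norm.const_mul _) ?_
  filter_upwards [ae_le_eLpNormEssSup (f := h) (μ := volume)] with x hx
  rw [norm_mul, Complex.norm_real]
  gcongr
  rw [eLpNorm_exponent_top, ← toReal_enorm]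
  exact ENNReal.toReal_mono (by rw [← eLpNorm_exponent_top]; exact hh.2.ne) hx

/-! ### A measurable Lipschitz constant -/

/-- The graph of `∂_j` is a subset of the separable space `L¹ × L¹`, hence separable. Countably many
test functions make the Lipschitz constant of `W_r` a measurable function of `r`. -/
theorem exists_dense_schwartz_seq (j : Fin d) : ∃ ψ : ℕ → 𝓢(Space d, ℂ),
    ∀ φ : 𝓢(Space d, ℂ), ∀ ε > 0, ∃ n, ∫ x, ‖ψ n x - φ x‖ < ε ∧
      ∫ x, ‖(∂_{ee j} (ψ n) : 𝓢(Space d, ℂ)) x - (∂_{ee j} φ : 𝓢(Space d, ℂ)) x‖ < ε := by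
  let T : 𝓢(Space d, ℂ) → Lp ℂ 1 (volume : Measure (Space d)) × Lp ℂ 1 (volume : Measure (Space d)) :=
    fun φ => (φ.toLp 1 volume, (∂_{ee j} φ).toLp 1 volume)
  have : Fact ((1 : ℝ≥0∞) ≠ ⊤) := ⟨by simp⟩
  have : SecondCountableTopology (Lp ℂ 1 (volume : Measure (Space d))) :=
    Lp.SecondCountableTopology
  have : Nonempty (Set.range T) := ⟨⟨T 0, 0, rfl⟩⟩
  choose ψ hψ using fun n => (TopologicalSpace.denseSeq (Set.range T) n).2
  refine ⟨ψ, fun φ ε hε => ?_⟩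
  obtain ⟨n, hn⟩ := (TopologicalSpace.denseRange_denseSeq (Set.range T)).exists_dist_lt
    (⟨T φ, φ, rfl⟩ : Set.range T) hε
  refine ⟨n, ?_⟩
  rw [Subtype.dist_eq, ← hψ n, dist_comm, dist_eq_norm, Prod.norm_def, max_lt_iff] at hn
  have h1 : ∀ χ χ' : 𝓢(Space d, ℂ), ‖χ.toLp 1 volume - χ'.toLp 1 volume‖ = ∫ x, ‖χ x - χ' x‖ := by
    intro χ χ'
    have : χ.toLp 1 volume - χ'.toLp 1 volume = (χ - χ').toLp 1 volume := rfl
    rw [this, SchwartzMap.norm_toLp_one]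
    simp
  exact ⟨by rw [← h1]; exact hn.1, by rw [← h1]; exact hn.2⟩

/-- A dense sequence of test functions for `∂_j`. -/
noncomputable def testSeq (j : Fin d) : ℕ → 𝓢(Space d, ℂ) := (exists_dense_schwartz_seq j).choose

/-- The norm of `∂_j f` as a functional on `L¹`. -/
noncomputable def parNorm (j : Fin d) (f : Space d → ℝ) : ℝ≥0∞ :=
  ⨆ n, ‖∫ x, (f x : ℂ) * (∂_{ee j} (testSeq j n) : 𝓢(Space d, ℂ)) x‖ₑ /
    ENNReal.ofReal (∫ x, ‖testSeq j n x‖)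

theorem parNorm_le_derivSupNorm (j : Fin d) {f : Space d → ℝ} (hf : MemLp f ∞ volume) :
    parNorm j f ≤ derivSupNorm (fun _ : Fin 1 => j) f := by
  refine le_iInf₂ fun h hfh => iSup_le fun n => ?_
  by_cases htop : eLpNorm h ∞ volume = ⊤
  · rw [htop]; exact le_top
  have hh : MemLp h ∞ volume := ⟨hfh.2.1.aestronglyMeasurable, Ne.lt_top htop⟩
  refine ENNReal.div_le_of_le_mul ?_
  rw [← ofReal_norm, ← ENNReal.ofReal_toReal htop, ← ENNReal.ofReal_mul ENNReal.toReal_nonneg]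
  exact ENNReal.ofReal_le_ofReal (hfh.norm_integral_le hf hh _)

/-- Both sides are continuous in the graph norm of `∂_j` on `L¹` because `f` is bounded, so the
bound extends from the dense sequence to every Schwartz function. -/
theorem norm_integral_le_parNorm (j : Fin d) {f : Space d → ℝ} (hf : MemLp f ∞ volume)
    (hp : parNorm j f ≠ ⊤) (φ : 𝓢(Space d, ℂ)) :
    ‖∫ x, (f x : ℂ) * (∂_{ee j} φ : 𝓢(Space d, ℂ)) x‖ ≤ (parNorm j f).toReal * ∫ x, ‖φ x‖ := by
  have hfc : MemLp (fun x => (f x : ℂ)) ∞ volume := hf.ofReal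
  have hint : ∀ ψ : 𝓢(Space d, ℂ), Integrable (fun x => (f x : ℂ) * ψ x) volume := fun ψ =>
    memLp_one_iff_integrable.1 ((ψ.memLp 1 volume).mul hfc)
  set F := (eLpNorm f ∞ volume).toReal
  set P := (parNorm j f).toReal
  have hF0 : 0 ≤ F := ENNReal.toReal_nonneg
  have hP0 : 0 ≤ P := ENNReal.toReal_nonneg
  have hbound : ∀ ψ : 𝓢(Space d, ℂ), ‖∫ x, (f x : ℂ) * ψ x‖ ≤ F * ∫ x, ‖ψ x‖ := by
    intro ψ
    rw [← integral_const_mul]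
    refine norm_integral_le_of_norm_le ((ψ.integrable).norm.const_mul _) ?_
    filter_upwards [ae_le_eLpNormEssSup (f := f) (μ := volume)] with x hx
    rw [norm_mul, Complex.norm_real]
    gcongr
    simp only [F]
    rw [eLpNorm_exponent_top, ← toReal_enorm]
    exact ENNReal.toReal_mono (by rw [← eLpNorm_exponent_top]; exact hf.2.ne) hx
  have hseq : ∀ n, ‖∫ x, (f x : ℂ) * (∂_{ee j} (testSeq j n) : 𝓢(Space d, ℂ)) x‖ ≤
      P * ∫ x, ‖testSeq j n x‖ := by
    intro n
    -- A quotient with zero denominator carries no information; in that case the test function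
    -- itself is zero.
    by_cases h0 : ∫ x, ‖testSeq j n x‖ = 0
    · have h1 : testSeq j n = 0 := by
        have := (integral_eq_zero_iff_of_nonneg (fun x => norm_nonneg _)
          (testSeq j n).integrable.norm).1 h0
        have h2 : (testSeq j n : Space d → ℂ) =ᵐ[volume] (0 : 𝓢(Space d, ℂ)) := by
          filter_upwards [this] with x hx
          simpa using hx
        exact DFunLike.coe_injective ((Continuous.ae_eq_iff_eq volume (testSeq j n).continuous
          (0 : 𝓢(Space d, ℂ)).continuous).1 h2)
      rw [h1, LineDeriv.lineDerivOp_zero]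
      simp
    · have hpos : 0 < ∫ x, ‖testSeq j n x‖ :=
        lt_of_le_of_ne (integral_nonneg fun x => norm_nonneg _) (Ne.symm h0)
      have h1 : ‖∫ x, (f x : ℂ) * (∂_{ee j} (testSeq j n) : 𝓢(Space d, ℂ)) x‖ₑ /
          ENNReal.ofReal (∫ x, ‖testSeq j n x‖) ≤ parNorm j f :=
        le_iSup (fun n => ‖∫ x, (f x : ℂ) * (∂_{ee j} (testSeq j n) : 𝓢(Space d, ℂ)) x‖ₑ /
          ENNReal.ofReal (∫ x, ‖testSeq j n x‖)) n
      rw [ENNReal.div_le_iff (by simpa using hpos) ENNReal.ofReal_ne_top, ← ofReal_norm,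
        ← ENNReal.ofReal_toReal hp, ← ENNReal.ofReal_mul hP0,
        ENNReal.ofReal_le_ofReal_iff (by positivity)] at h1
      exact h1
  refine le_of_forall_pos_le_add fun ε hε => ?_
  -- The approximation errors enter with the factors `F` (derivative) and `P` (function), hence the
  -- division by `F + P + 1`.
  obtain ⟨n, h1, h2⟩ := (exists_dense_schwartz_seq j).choose_spec φ (ε / (F + P + 1)) (by positivity)
  change ∫ x, ‖testSeq j n x - φ x‖ < _ at h1
  change ∫ x, ‖(∂_{ee j} (testSeq j n) : 𝓢(Space d, ℂ)) x - _‖ < _ at h2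
  set ψ := testSeq j n
  have h3 : ‖(∫ x, (f x : ℂ) * (∂_{ee j} ψ : 𝓢(Space d, ℂ)) x) -
      ∫ x, (f x : ℂ) * (∂_{ee j} φ : 𝓢(Space d, ℂ)) x‖ ≤ F * (ε / (F + P + 1)) := by
    rw [← integral_sub (hint _) (hint _)]
    have h4 := hbound (∂_{ee j} ψ - ∂_{ee j} φ)
    simp only [sub_apply, mul_sub] at h4
    exact h4.trans (by gcongr)
  have h5 : ∫ x, ‖ψ x‖ ≤ (∫ x, ‖φ x‖) + ε / (F + P + 1) := by
    have : ∫ x, ‖ψ x‖ ≤ ∫ x, (‖φ x‖ + ‖(ψ - φ) x‖) := by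
      refine integral_mono ψ.integrable.norm (φ.integrable.norm.add (ψ - φ).integrable.norm) ?_
      intro x
      have := norm_add_le (φ x) (ψ x - φ x)
      simpa using this
    rw [integral_add φ.integrable.norm (ψ - φ).integrable.norm] at this
    exact this.trans (add_le_add le_rfl (by simpa using h1.le))
  have h6 := norm_sub_norm_le (∫ x, (f x : ℂ) * (∂_{ee j} φ : 𝓢(Space d, ℂ)) x)
    (∫ x, (f x : ℂ) * (∂_{ee j} ψ : 𝓢(Space d, ℂ)) x)
  rw [norm_sub_rev] at h6
  have h7 := (hseq n).trans (mul_le_mul_of_nonneg_left h5 hP0)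
  have h8 : (F + P) * (ε / (F + P + 1)) ≤ ε := by
    rw [← mul_div_assoc, div_le_iff₀ (by positivity)]
    nlinarith
  nlinarith

end MaxSpeed

namespace MaxSpeed

open scoped SchwartzMap LineDeriv ComplexConjugate

variable {d : ℕ}

/-! ### Time-dependent potentials -/

/-- The sublevel set at `a` consists of those `r` for which the slice of `{|W| > a}` is null, and
the measures of slices depend measurably on `r`. -/
theorem measurable_eLpNorm_top {W : ℝ → Space d → ℝ} (hW : Measurable (Function.uncurry W)) :
    Measurable fun r => eLpNorm (W r) ⊤ volume := by
  refine measurable_of_Iic fun a => ?_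
  have h : (fun r => eLpNorm (W r) ⊤ volume) ⁻¹' Iic a =
      {r | volume (Prod.mk r ⁻¹' {z : ℝ × Space d | a < ‖Function.uncurry W z‖ₑ}) = 0} := by
    ext r
    simp only [mem_preimage, mem_Iic, mem_ofPred_eq, eLpNorm_exponent_top, preimage_ofPred_eq,
      Function.uncurry_apply_pair]
    have h1 : eLpNormEssSup (W r) volume ≤ a ↔ ∀ᵐ x, ‖W r x‖ₑ ≤ a :=
      ⟨fun h => by
        filter_upwards [ae_le_eLpNormEssSup (f := W r) (μ := volume)] with x hx
        exact hx.trans h, fun h => essSup_le_of_ae_le _ h⟩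
    rw [h1, ae_iff]
    simp only [not_le]
  rw [h]
  have h2 : MeasurableSet {z : ℝ × Space d | a < ‖Function.uncurry W z‖ₑ} :=
    measurableSet_lt measurable_const hW.enorm
  exact (measurable_measure_prodMk_left h2) (measurableSet_singleton 0)

theorem exists_measurable_version {W : ℝ → Space d → ℝ}
    (hW : AEStronglyMeasurable (Function.uncurry W) volume) :
    ∃ W' : ℝ → Space d → ℝ, Measurable (Function.uncurry W') ∧
      ∀ᵐ r : ℝ, W r =ᵐ[volume] W' r := by
  obtain ⟨m, hm, h⟩ := hW
  refine ⟨fun r x => m (r, x), hm.measurable, ?_⟩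
  rw [Measure.volume_eq_prod] at h
  exact Measure.ae_ae_of_ae_prod h

theorem measurable_integral_mul {W : ℝ → Space d → ℝ} (hW : Measurable (Function.uncurry W))
    {φ : Space d → ℂ} (hφ : StronglyMeasurable φ) :
    Measurable fun r => ∫ x, (W r x : ℂ) * φ x := by
  have h : StronglyMeasurable (Function.uncurry fun r x => (W r x : ℂ) * φ x) :=
    ((Complex.measurable_ofReal.comp hW).mul (hφ.measurable.comp measurable_snd)).stronglyMeasurable
  exact h.integral_prod_right.measurable

theorem measurable_parNorm {W : ℝ → Space d → ℝ} (hW : Measurable (Function.uncurry W))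
    (j : Fin d) : Measurable fun r => parNorm j (W r) := by
  refine Measurable.iSup fun n => Measurable.div_const ?_ _
  exact (measurable_integral_mul hW (SchwartzMap.continuous _).stronglyMeasurable).enorm

theorem parNorm_congr {j : Fin d} {f f' : Space d → ℝ} (h : f =ᵐ[volume] f') :
    parNorm j f = parNorm j f' := by
  unfold parNorm
  refine iSup_congr fun n => ?_
  congr 2
  refine integral_congr_ae ?_
  filter_upwards [h] with x hx
  rw [hx]

/-- By convention `mulR (W r)` is zero when `W r` is not essentially bounded, so the matrix element
is a parameter integral restricted to the measurable set of bounded slices. -/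
theorem measurable_inner_mulR {W : ℝ → Space d → ℝ} (hW : Measurable (Function.uncurry W))
    (u v : L2 d) : Measurable fun r => inner ℂ u (mulR (W r) v) := by
  classical
  have hmeas : ∀ r, Measurable (W r) := fun r => hW.comp measurable_prodMk_left
  have h : (fun r => inner ℂ u (mulR (W r) v)) = fun r =>
      if eLpNorm (W r) ⊤ volume < ⊤ then ∫ x, (W r x : ℂ) * (v x * conj (u x)) else 0 := by
    ext r
    have hn : eLpNorm (fun x => (W r x : ℂ)) ⊤ volume = eLpNorm (W r) ⊤ volume := by
      refine eLpNorm_congr_norm_ae (ae_of_all _ fun x => ?_)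
      simp
    split_ifs with hr
    · have hm : MemLp (fun x => (W r x : ℂ)) ⊤ volume :=
        ⟨(Complex.measurable_ofReal.comp (hmeas r)).aestronglyMeasurable, by rwa [hn]⟩
      rw [L2.inner_def]
      refine integral_congr_ae ?_
      filter_upwards [hasMul_mulB hm v] with x hx
      rw [hx, RCLike.inner_apply]
      ring
    · have hm : ¬ MemLp (fun x => (W r x : ℂ)) ⊤ volume := fun h2 => hr (by rw [← hn]; exact h2.2)
      rw [mulR, mulB, dif_neg hm]
      simp
  rw [h]
  refine Measurable.ite (measurableSet_lt (measurable_eLpNorm_top hW) measurable_const) ?_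
    measurable_const
  exact measurable_integral_mul hW ((Lp.stronglyMeasurable v).mul
    (Complex.continuous_conj.comp_stronglyMeasurable (Lp.stronglyMeasurable u)))

theorem ae_eLpNorm_lt_top {W : ℝ → Space d → ℝ} (hW : Measurable (Function.uncurry W))
    (hWb : ∀ T : ℝ, ∫⁻ t in Set.Ioc 0 T, eLpNorm (W t) ⊤ volume < ⊤) :
    ∀ᵐ r ∂(volume.restrict (Ioi (0 : ℝ))), eLpNorm (W r) ⊤ volume < ⊤ := by
  have h : Ioi (0 : ℝ) = ⋃ n : ℕ, Ioc 0 (n : ℝ) := by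
    ext r
    simp only [mem_Ioi, mem_iUnion, mem_Ioc]
    exact ⟨fun h => ⟨_, h, Nat.le_ceil r⟩, fun ⟨n, h, _⟩ => h⟩
  rw [h, ae_restrict_iUnion_iff]
  exact fun n => ae_lt_top (measurable_eLpNorm_top hW) (hWb n).ne

/-- The Lipschitz constant of `W r`, summed over the coordinates. -/
noncomputable def lipNorm (f : Space d → ℝ) : ℝ≥0∞ := ∑ j, parNorm j f

/-- Apart from monotonicity, this is what the two choices of `w♯` have in common: each dominates the
tail integral of every first derivative. The factor `d` counts the coordinates. Comparing with the
measurable `parNorm` avoids measurability questions about `derivSupNorm`. -/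
theorem lintegral_lipNorm_le {W W' : ℝ → Space d → ℝ} (hW' : Measurable (Function.uncurry W'))
    (hWW' : ∀ᵐ r : ℝ, W r =ᵐ[volume] W' r)
    (hWb : ∀ T : ℝ, ∫⁻ t in Set.Ioc 0 T, eLpNorm (W t) ⊤ volume < ⊤) {w : ℝ → ℝ≥0∞}
    (hw : w = tailNorm W ∨ w = tailNorm' W) {t : ℝ} (ht : 0 ≤ t) :
    ∫⁻ r in Ioi t, lipNorm (W' r) ≤ d * w t := by
  have hWb' : ∀ T : ℝ, ∫⁻ t in Set.Ioc 0 T, eLpNorm (W' t) ⊤ volume < ⊤ := fun T => by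
    refine lt_of_eq_of_lt (lintegral_congr_ae ?_) (hWb T)
    filter_upwards [ae_restrict_of_ae hWW'] with r hr
    exact eLpNorm_congr_ae hr.symm
  have hfin := ae_eLpNorm_lt_top hW' hWb'
  have hle : ∀ j : Fin d, ∀ᵐ r ∂(volume.restrict (Ioi t)),
      parNorm j (W' r) ≤ derivSupNorm (fun _ : Fin 1 => j) (W r) := by
    intro j
    filter_upwards [ae_restrict_of_ae hWW', ae_restrict_of_ae_restrict_of_subset
      (Ioi_subset_Ioi ht) hfin] with r h1 h2
    rw [← parNorm_congr h1]
    refine parNorm_le_derivSupNorm j ⟨?_, by rwa [eLpNorm_congr_ae h1]⟩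
    exact AEStronglyMeasurable.congr
      (hW'.comp measurable_prodMk_left).aestronglyMeasurable h1.symm
  unfold lipNorm
  rw [lintegral_finsetSum _ fun j _ => measurable_parNorm hW' j]
  have hj : ∀ j : Fin d, ∫⁻ r in Ioi t, parNorm j (W' r) ≤ w t := by
    intro j
    refine (lintegral_mono_ae (hle j)).trans ?_
    rcases hw with rfl | rfl
    · refine lintegral_mono fun r => ?_
      exact le_iSup₂_of_le 1 (by simp) (le_iSup (fun l : Fin 1 → Fin d => derivSupNorm l (W r))
        (fun _ => j))
    · exact le_iSup₂_of_le 1 (by simp) (le_iSup (fun l : Fin 1 → Fin d =>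
        ∫⁻ r in Ioi t, derivSupNorm l (W r)) (fun _ => j))
  refine (Finset.sum_le_sum fun j _ => hj j).trans ?_
  simp

end MaxSpeed

namespace MaxSpeed

open scoped SchwartzMap LineDeriv ComplexConjugate

variable {d : ℕ}

/-! ### Bounded Fourier multipliers and the free resolvent -/

/-- The bounded Fourier multiplier with symbol `m`. -/
noncomputable def fmulB (m : Space d → ℂ) : L2 d →L[ℂ] L2 d :=
  (FT.symm : L2 d ≃ₗᵢ[ℂ] L2 d).toContinuousLinearEquiv.toContinuousLinearMap ∘L mulB m ∘L
    (FT : L2 d ≃ₗᵢ[ℂ] L2 d).toContinuousLinearEquiv.toContinuousLinearMap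

theorem fmulB_apply (m : Space d → ℂ) (u : L2 d) : fmulB m u = FT.symm (mulB m (FT u)) := rfl

theorem hasFMul_fmulB {m : Space d → ℂ} (hm : MemLp m ⊤ volume) (u : L2 d) :
    HasFMul m u (fmulB m u) := by
  rw [HasFMul, fmulB_apply, LinearIsometryEquiv.apply_symm_apply]
  exact hasMul_mulB hm _

theorem HasFMul.comp {m m' : Space d → ℂ} {u v w : L2 d} (h : HasFMul m u v)
    (h' : HasFMul m' v w) : HasFMul (fun x => m' x * m x) u w := HasMul.comp h h'

theorem HasFMul.congr {m m' : Space d → ℂ} {u v : L2 d} (h : HasFMul m u v)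
    (hm : ∀ x, m x = m' x) : HasFMul m' u v := HasMul.congr h (ae_of_all _ hm)

/-- The symbol of `-½Δ + μ`. -/
noncomputable def symT (μ : ℝ) (ξ : Space d) : ℝ := 1 / 2 * (2 * Real.pi * ‖ξ‖) ^ 2 + μ

theorem symT_pos {μ : ℝ} (hμ : 0 < μ) (ξ : Space d) : 0 < symT μ ξ := by
  unfold symT; positivity

theorem le_symT {μ : ℝ} (ξ : Space d) : μ ≤ symT μ ξ := by
  unfold symT; nlinarith [sq_nonneg (2 * Real.pi * ‖ξ‖)]

theorem continuous_symT (μ : ℝ) : Continuous (symT μ : Space d → ℝ) := by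
  unfold symT; fun_prop

theorem symLap_eq_symT (μ : ℝ) (ξ : Space d) : symLap ξ = ((-2 * (symT μ ξ - μ) : ℝ) : ℂ) := by
  simp only [symLap, symT]
  push_cast
  ring

theorem memLp_inv_symT {μ : ℝ} (hμ : 0 < μ) :
    MemLp (fun ξ : Space d => (((symT μ ξ)⁻¹ : ℝ) : ℂ)) ⊤ volume :=
  memLp_top_ofReal ((continuous_symT μ).inv₀ fun ξ => (symT_pos hμ ξ).ne') (C := μ⁻¹) fun ξ => by
    rw [abs_of_pos (inv_pos.2 (symT_pos hμ ξ))]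
    exact inv_anti₀ hμ (le_symT ξ)

theorem memLp_inv_sqrt_symT {μ : ℝ} (hμ : 0 < μ) :
    MemLp (fun ξ : Space d => (((Real.sqrt (symT μ ξ))⁻¹ : ℝ) : ℂ)) ⊤ volume :=
  memLp_top_ofReal (((continuous_symT μ).sqrt).inv₀ fun ξ => (Real.sqrt_pos.2 (symT_pos hμ ξ)).ne')
    (C := (Real.sqrt μ)⁻¹) fun ξ => by
    rw [abs_of_pos (inv_pos.2 (Real.sqrt_pos.2 (symT_pos hμ ξ)))]
    exact inv_anti₀ (Real.sqrt_pos.2 hμ) (Real.sqrt_le_sqrt (le_symT ξ))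

/-- The free resolvent `(-½Δ + μ)⁻¹`. -/
noncomputable def freeRes (μ : ℝ) : L2 d →L[ℂ] L2 d :=
  fmulB fun ξ => (((symT μ ξ)⁻¹ : ℝ) : ℂ)

/-- The square root of the free resolvent. -/
noncomputable def freeResSqrt (μ : ℝ) : L2 d →L[ℂ] L2 d :=
  fmulB fun ξ => (((Real.sqrt (symT μ ξ))⁻¹ : ℝ) : ℂ)

theorem freeRes_lap {μ : ℝ} (hμ : 0 < μ) (x : L2 d) :
    HasFMul symLap (freeRes μ x) ((2 * μ : ℂ) • freeRes μ x - (2 : ℂ) • x) := by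
  have h : HasFMul (fun ξ => (((symT μ ξ)⁻¹ : ℝ) : ℂ)) x (freeRes μ x) :=
    hasFMul_fmulB (memLp_inv_symT hμ) x
  rw [HasFMul, map_sub, map_smul, map_smul]
  filter_upwards [h, Lp.coeFn_sub ((2 * μ : ℂ) • FT (freeRes μ x)) ((2 : ℂ) • FT x),
    Lp.coeFn_smul (2 * μ : ℂ) (FT (freeRes μ x)), Lp.coeFn_smul (2 : ℂ) (FT x)] with ξ h1 h2 h3 h4
  rw [h2, Pi.sub_apply, h3, h4, Pi.smul_apply, Pi.smul_apply, h1, symLap_eq_symT μ]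
  have h5 : (symT μ ξ : ℂ) ≠ 0 := by exact_mod_cast (symT_pos hμ ξ).ne'
  push_cast
  simp only [smul_eq_mul]
  field_simp
  ring

theorem freeRes_of_lap {μ : ℝ} (hμ : 0 < μ) {u v : L2 d} (h : HasFMul symLap u v) :
    freeRes μ ((-(1 / 2) : ℂ) • v + (μ : ℂ) • u) = u := by
  have h2 : HasFMul (fun ξ => (symT μ ξ : ℂ)) u ((-(1 / 2) : ℂ) • v + (μ : ℂ) • u) := by
    have h3 := (HasMul.smul_symbol h (-(1 / 2) : ℂ)).add_symbol (hasMul_const (μ : ℂ) (FT u))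
    rw [HasFMul, map_add, map_smul, map_smul]
    refine h3.congr (ae_of_all _ fun ξ => ?_)
    beta_reduce
    rw [symLap_eq_symT μ]
    push_cast
    ring
  have h4 := (h2.comp (hasFMul_fmulB (memLp_inv_symT hμ) _)).congr (m' := fun _ => 1) fun ξ => by
    have h5 : (symT μ ξ : ℂ) ≠ 0 := by exact_mod_cast (symT_pos hμ ξ).ne'
    push_cast
    field_simp
  exact h4.unique (hasFMul_one u)

theorem freeResSqrt_sq {μ : ℝ} (hμ : 0 < μ) (x : L2 d) :
    freeResSqrt μ (freeResSqrt μ x) = freeRes μ x := by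
  have h := (hasFMul_fmulB (memLp_inv_sqrt_symT hμ) x).comp
    (hasFMul_fmulB (memLp_inv_sqrt_symT hμ) (freeResSqrt μ x))
  refine (h.congr fun ξ => ?_).unique (hasFMul_fmulB (memLp_inv_symT hμ) x)
  rw [← Complex.ofReal_mul, ← mul_inv, Real.mul_self_sqrt (symT_pos hμ ξ).le]

theorem freeResSqrt_inner {μ : ℝ} (hμ : 0 < μ) (x y : L2 d) :
    inner ℂ x (freeResSqrt μ y) = inner ℂ (freeResSqrt μ x) y :=
  (hasFMul_fmulB (memLp_inv_sqrt_symT hμ) y).inner_eq (by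
    simp only [Complex.conj_ofReal]
    exact hasFMul_fmulB (memLp_inv_sqrt_symT hμ) x)

theorem norm_freeRes_le {μ : ℝ} (hμ : 0 < μ) (x : L2 d) : ‖freeRes μ x‖ ≤ μ⁻¹ * ‖x‖ := by
  refine (hasFMul_fmulB (memLp_inv_symT hμ) x).norm_le (hasFMul_one x) (ae_of_all _ fun ξ => ?_)
  rw [norm_mul, one_mul, Complex.norm_real, Real.norm_of_nonneg (inv_pos.2 (symT_pos hμ ξ)).le]
  gcongr
  exact le_symT ξ

/-- The symbol of `Δ(-½Δ + μ)⁻¹` is `-2 + 2μ / symT`, which lies between `-2` and `0`. The factor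
two cancels the half in `a₁ / 2` of the relative bound. -/
theorem norm_lap_freeRes_le {μ : ℝ} (hμ : 0 < μ) {x v : L2 d}
    (h : HasFMul symLap (freeRes μ x) v) : ‖v‖ ≤ 2 * ‖x‖ := by
  have h1 := (hasFMul_fmulB (memLp_inv_symT hμ) x).comp h
  refine h1.norm_le (hasFMul_one x) (ae_of_all _ fun ξ => ?_)
  have h2 := symT_pos hμ ξ
  rw [norm_mul, one_mul, symLap_eq_symT μ, ← Complex.ofReal_mul, Complex.norm_real, Real.norm_eq_abs]
  gcongr
  rw [abs_le]
  have h3 : -2 * (symT μ ξ - μ) * (symT μ ξ)⁻¹ = -2 + 2 * (μ / symT μ ξ) := by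
    field_simp
    ring
  have h4 : μ / symT μ ξ ≤ 1 := (div_le_one h2).2 (le_symT ξ)
  have h5 : 0 ≤ μ / symT μ ξ := by positivity
  rw [h3]
  constructor <;> linarith

/-! ### The Schrödinger operator -/

/-- `f = (-½Δ + V) u`. -/
def HasSch (V : Space d → ℝ) (u f : L2 d) : Prop :=
  ∃ v w, HasFMul symLap u v ∧ HasMul (fun x => (V x : ℂ)) u w ∧ f = (-(1 / 2) : ℂ) • v + w

theorem hasSch_iff {V : Space d → ℝ} {u f : L2 d} :
    HasSch V u f ↔ ∃ h : u ∈ (schrodinger V).domain, schrodinger V ⟨u, h⟩ = f := by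
  constructor
  · rintro ⟨v, w, h1, h2, rfl⟩
    obtain ⟨k1, k2⟩ := hasFMul_iff.1 h1
    obtain ⟨l1, l2⟩ := hasMul_iff.1 h2
    refine ⟨⟨k1, l1⟩, ?_⟩
    rw [← k2, ← l2]
    rfl
  · rintro ⟨⟨k1, l1⟩, rfl⟩
    exact ⟨_, _, hasFMul_iff.2 ⟨k1, rfl⟩, hasMul_iff.2 ⟨l1, rfl⟩, rfl⟩

theorem HasSch.inner_symm {V : Space d → ℝ} {u f u' f' : L2 d} (h : HasSch V u f)
    (h' : HasSch V u' f') : inner ℂ u' f = inner ℂ f' u := by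
  obtain ⟨v, w, h1, h2, rfl⟩ := h
  obtain ⟨v', w', h1', h2', rfl⟩ := h'
  rw [inner_add_right, inner_add_left, inner_smul_right, inner_smul_left, h1.symLap_inner h1',
    h2.inner_eq (by simpa only [Complex.conj_ofReal] using h2')]
  have h3 : conj (2 : ℂ) = 2 := Complex.conj_ofNat 2
  simp [h3]

theorem LaplacianBounded.exists_hasMul {V : Space d → ℝ} {a₁ a₂ : ℝ} (h : LaplacianBounded V a₁ a₂)
    {u v : L2 d} (hu : HasFMul symLap u v) :
    ∃ w, HasMul (fun x => (V x : ℂ)) u w ∧ ‖w‖ ≤ a₁ / 2 * ‖v‖ + a₂ * ‖u‖ := by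
  obtain ⟨k1, k2⟩ := hasFMul_iff.1 hu
  obtain ⟨l1, l2⟩ := h ⟨u, k1⟩
  refine ⟨_, hasMul_iff.2 ⟨l1, rfl⟩, ?_⟩
  rw [← k2]
  exact l2

/-- The operator `V (-½Δ + μ)⁻¹`. -/
theorem LaplacianBounded.exists_potential_freeRes {V : Space d → ℝ} {a₁ a₂ : ℝ} (ha₁ : 0 ≤ a₁)
    (ha₂ : 0 < a₂) (h : LaplacianBounded V a₁ a₂) {μ : ℝ} (hμ : 0 < μ) :
    ∃ A : L2 d →L[ℂ] L2 d, (∀ x, HasMul (fun x => (V x : ℂ)) (freeRes μ x) (A x)) ∧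
      ‖A‖ ≤ a₁ + a₂ / μ := by
  choose f hf hf' using fun x => h.exists_hasMul (freeRes_lap hμ x)
  let A : L2 d →ₗ[ℂ] L2 d :=
    { toFun := f
      map_add' := fun x y => (hf (x + y)).unique (by rw [map_add]; exact (hf x).add (hf y))
      map_smul' := fun z x => (hf (z • x)).unique (by rw [map_smul]; exact (hf x).smul z) }
  have hA : ∀ x, ‖A x‖ ≤ (a₁ + a₂ / μ) * ‖x‖ := by
    intro x
    refine (hf' x).trans ?_
    have h1 := norm_lap_freeRes_le hμ (freeRes_lap hμ x)
    have h2 := norm_freeRes_le hμ x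
    calc _ ≤ a₁ / 2 * (2 * ‖x‖) + a₂ * (μ⁻¹ * ‖x‖) := by gcongr
      _ = _ := by field_simp
  exact ⟨A.mkContinuous _ hA, hf, A.mkContinuous_norm_le (by positivity) hA⟩

end MaxSpeed

namespace MaxSpeed

open scoped SchwartzMap LineDeriv ComplexConjugate

variable {d : ℕ}

/-! ### The form bound -/

/-- For self-adjoint `X` the norm of `X^(2^n)` is `‖X‖^(2^n)`. If `‖X‖` exceeded `a`, these powers
would outgrow `C a^k` for every constant `C`. -/
theorem norm_le_of_pow_two_pow_le {E : Type*} [NormedRing E] [StarRing E] [CStarRing E] {X : E}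
    (hX : IsSelfAdjoint X) {a C : ℝ} (ha : 0 < a) (h : ∀ k : ℕ, ‖X ^ (k + 1)‖ ≤ C * a ^ k) :
    ‖X‖ ≤ a := by
  by_contra hlt
  push Not at hlt
  have hr : 1 < ‖X‖ / a := (one_lt_div ha).2 hlt
  have hb : ∀ n : ℕ, (‖X‖ / a) ^ (2 ^ n) ≤ C / a := by
    intro n
    obtain ⟨k, hk⟩ : ∃ k, 2 ^ n = k + 1 := ⟨2 ^ n - 1, by have := Nat.one_le_two_pow (n := n); omega⟩
    have h1 : ‖X ^ (2 ^ n)‖ = ‖X‖ ^ (2 ^ n) := by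
      have := hX.nnnorm_pow_two_pow n
      simpa using congrArg NNReal.toReal this
    have h2 := h k
    rw [← hk, h1] at h2
    rw [div_pow, div_le_div_iff₀ (by positivity) ha, hk, pow_succ a]
    rw [hk] at h2
    nlinarith
  have h3 := (tendsto_pow_atTop_atTop_of_one_lt hr).comp
    (tendsto_pow_atTop_atTop_of_one_lt (one_lt_two (α := ℕ)))
  obtain ⟨n, hn⟩ := (h3.eventually (eventually_gt_atTop (C / a))).exists
  exact absurd (hb n) (not_le.2 hn)

/-- The potential truncated to `[-n, n]`. -/
noncomputable def clampV (V : Space d → ℝ) (n : ℕ) (x : Space d) : ℝ := max (-n) (min (V x) n)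

theorem abs_clampV_le (V : Space d → ℝ) (n : ℕ) (x : Space d) : |clampV V n x| ≤ n := by
  have : (0 : ℝ) ≤ n := n.cast_nonneg
  unfold clampV
  rw [abs_le]
  exact ⟨le_max_left _ _, max_le (by linarith) (min_le_right _ _)⟩

theorem abs_clampV_le_abs (V : Space d → ℝ) (n : ℕ) (x : Space d) : |clampV V n x| ≤ |V x| := by
  have : (0 : ℝ) ≤ n := n.cast_nonneg
  unfold clampV
  rw [abs_le]
  constructor
  · refine le_trans ?_ (le_max_right _ _)
    exact le_min (neg_abs_le _) (by linarith [abs_nonneg (V x)])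
  · exact max_le (by linarith [abs_nonneg (V x)]) ((min_le_left _ _).trans (le_abs_self _))

theorem tendsto_clampV (V : Space d → ℝ) (x : Space d) :
    Tendsto (fun n => clampV V n x) atTop (𝓝 (V x)) := by
  refine tendsto_const_nhds.congr' ?_
  filter_upwards [eventually_ge_atTop ⌈|V x|⌉₊] with n hn
  have h1 : |V x| ≤ n := (Nat.le_ceil _).trans (by exact_mod_cast hn)
  rw [abs_le] at h1
  unfold clampV
  rw [min_eq_left h1.2, max_eq_right h1.1]

theorem memLp_clampV {V : Space d → ℝ} (hV : AEStronglyMeasurable V volume) (n : ℕ) :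
    MemLp (fun x => (clampV V n x : ℂ)) ⊤ volume := by
  refine memLp_top_of_bound ?_ n (ae_of_all _ fun x => by
    rw [Complex.norm_real]; exact abs_clampV_le V n x)
  have hc : Continuous fun y : ℝ => ((max (-(n : ℝ)) (min y n) : ℝ) : ℂ) := by fun_prop
  exact hc.comp_aestronglyMeasurable hV

/-- An operator bound on `V S²` passes to the form bound on `S V S` with the same constant: `(S B
S)^(k+1) = S (B S²)^k (B S)` and `‖B S²‖ ≤ a`. Truncating `V` makes `B` bounded, so the outer
factors form a finite constant, which the power argument removes. -/
theorem norm_sqrt_clamp_sqrt_le {V : Space d → ℝ} (hV : AEStronglyMeasurable V volume)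
    {a μ : ℝ} (ha : 0 < a) (hμ : 0 < μ) {A : L2 d →L[ℂ] L2 d}
    (hA : ∀ x, HasMul (fun x => (V x : ℂ)) (freeRes μ x) (A x)) (hAa : ‖A‖ ≤ a) (n : ℕ) :
    ‖freeResSqrt μ * mulR (clampV V n) * freeResSqrt μ‖ ≤ a := by
  set S : L2 d →L[ℂ] L2 d := freeResSqrt μ with hS
  set B : L2 d →L[ℂ] L2 d := mulR (clampV V n)
  have hSS : S * S = freeRes μ := by ext1 x; exact freeResSqrt_sq hμ x
  have hSsa : IsSelfAdjoint S := ContinuousLinearMap.isSelfAdjoint_iff_isSymmetric.2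
    fun x y => (freeResSqrt_inner hμ x y).symm
  have hBsa : IsSelfAdjoint B := isSelfAdjoint_mulB _
  have hsa : IsSelfAdjoint (S * B * S) := by
    rw [isSelfAdjoint_iff, star_mul, star_mul, hSsa.star_eq, hBsa.star_eq, mul_assoc]
  have hBP : ‖B * freeRes μ‖ ≤ a := by
    refine (ContinuousLinearMap.opNorm_le_bound _ (norm_nonneg A) fun x => ?_).trans hAa
    refine le_trans ?_ (A.le_opNorm x)
    have := (hasMul_mulB (memLp_clampV hV n) (freeRes μ x)).norm_le (hA x) (C := 1)
      (ae_of_all _ fun y => by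
        rw [norm_mul, norm_mul, one_mul, Complex.norm_real, Complex.norm_real]
        gcongr
        exact abs_clampV_le_abs V n y)
    simpa using this
  refine norm_le_of_pow_two_pow_le hsa (C := ‖S‖ * ‖B * S‖) ha fun k => ?_
  have hpow : (S * B * S) ^ (k + 1) = S * (B * freeRes μ) ^ k * (B * S) := by
    induction k with
    | zero => simp [mul_assoc]
    | succ k ih =>
      rw [pow_succ, ih, pow_succ (B * freeRes μ), ← hSS]
      simp only [mul_assoc]
  rw [hpow]
  calc ‖S * (B * freeRes μ) ^ k * (B * S)‖ ≤ ‖S‖ * ‖(B * freeRes μ) ^ k‖ * ‖B * S‖ :=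
        (norm_mul_le _ _).trans (by gcongr; exact norm_mul_le _ _)
    _ ≤ ‖S‖ * a ^ k * ‖B * S‖ := by
        gcongr
        rcases Nat.eq_zero_or_pos k with rfl | hk
        · rw [pow_zero, pow_zero]; exact ContinuousLinearMap.norm_id_le
        · exact (norm_pow_le' _ hk).trans (by gcongr)
    _ = _ := by ring

/-- Write `u = S y`, so that `‖y‖²` is the form of `-½Δ + μ` at `u`. The bound holds for every
truncation of `V` by the preceding lemma and survives the limit by dominated convergence. -/
theorem abs_inner_potential_le {V : Space d → ℝ} (hV : AEStronglyMeasurable V volume)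
    {a μ : ℝ} (ha : 0 < a) (hμ : 0 < μ) {A : L2 d →L[ℂ] L2 d}
    (hA : ∀ x, HasMul (fun x => (V x : ℂ)) (freeRes μ x) (A x)) (hAa : ‖A‖ ≤ a)
    {u v w g : L2 d} (hu : HasFMul symLap u v) (hw : HasMul (fun x => (V x : ℂ)) u w)
    (hg : HasFMul symGrad u g) :
    ‖inner ℂ u w‖ ≤ a * (1 / 2 * ‖g‖ ^ 2 + μ * ‖u‖ ^ 2) := by
  set f := (-(1 / 2) : ℂ) • v + (μ : ℂ) • u with hf
  set y := freeResSqrt μ f with hy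
  have hSy : freeResSqrt μ y = u := by rw [hy, freeResSqrt_sq hμ, hf, freeRes_of_lap hμ hu]
  have hny : ‖y‖ ^ 2 = 1 / 2 * ‖g‖ ^ 2 + μ * ‖u‖ ^ 2 := by
    have h1 : inner ℂ y y = inner ℂ u f := by
      rw [← hSy]
      conv_lhs => rw [hy, freeResSqrt_inner hμ]
    rw [hf, inner_add_right, inner_smul_right, inner_smul_right, inner_lap_self hu hg,
      inner_self_eq_norm_sq_to_K, inner_self_eq_norm_sq_to_K] at h1
    have h2 : ((‖y‖ ^ 2 : ℝ) : ℂ) = ((1 / 2 * ‖g‖ ^ 2 + μ * ‖u‖ ^ 2 : ℝ) : ℂ) := by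
      push_cast at h1 ⊢
      refine h1.trans ?_
      simp
    exact_mod_cast h2
  have hn : ∀ n, ‖inner ℂ u (mulR (clampV V n) u)‖ ≤ a * (1 / 2 * ‖g‖ ^ 2 + μ * ‖u‖ ^ 2) := by
    intro n
    have h1 : inner ℂ u (mulR (clampV V n) u) =
        inner ℂ y ((freeResSqrt μ * mulR (clampV V n) * freeResSqrt μ : L2 d →L[ℂ] L2 d) y) := by
      rw [mul_apply_eq_comp, mul_apply_eq_comp, hSy, freeResSqrt_inner hμ, hSy]
    rw [h1, ← hny]
    refine (norm_inner_le_norm _ _).trans ?_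
    have := ContinuousLinearMap.le_of_opNorm_le _ (norm_sqrt_clamp_sqrt_le hV ha hμ hA hAa n) y
    nlinarith [norm_nonneg y]
  have hlim : Tendsto (fun n => inner ℂ u (mulR (clampV V n) u)) atTop (𝓝 (inner ℂ u w)) := by
    have h1 : ∀ n, inner ℂ u (mulR (clampV V n) u) = ∫ x, (clampV V n x : ℂ) * u x * conj (u x) := by
      intro n
      rw [L2.inner_def]
      refine integral_congr_ae ?_
      filter_upwards [hasMul_mulB (memLp_clampV hV n) u] with x hx
      rw [hx, RCLike.inner_apply]
    have h2 : inner ℂ u w = ∫ x, (V x : ℂ) * u x * conj (u x) := by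
      rw [L2.inner_def]
      refine integral_congr_ae ?_
      filter_upwards [hw] with x hx
      rw [hx, RCLike.inner_apply]
    simp_rw [h1, h2]
    have hu' := (Lp.aestronglyMeasurable u)
    refine tendsto_integral_of_dominated_convergence (fun x => ‖inner ℂ (u x) (w x)‖) (fun n => ?_)
      (L2.integrable_inner u w).norm (fun n => ?_) (ae_of_all _ fun x => ?_)
    · exact ((memLp_clampV hV n).1.mul hu').mul
        (Complex.continuous_conj.comp_aestronglyMeasurable hu')
    · filter_upwards [hw] with x hx
      rw [hx, RCLike.inner_apply, norm_mul, norm_mul, norm_mul, norm_mul, Complex.norm_real,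
        Complex.norm_real]
      gcongr
      exact abs_clampV_le_abs V n x
    · exact (((Complex.continuous_ofReal.tendsto _).comp (tendsto_clampV V x)).mul_const _).mul_const _
  exact le_of_tendsto hlim.norm (Eventually.of_forall hn)

/-- The resolvent `Q = (H + μ)⁻¹` of the Schrödinger operator at a large negative number. -/
structure IsRes (V : Space d → ℝ) (μ C : ℝ) (Q : L2 d →L[ℂ] L2 d) : Prop where
  selfAdjoint : IsSelfAdjoint Q
  sch : ∀ x, HasSch V (Q x) (x - (μ : ℂ) • Q x)
  left_inv : ∀ u f, HasSch V u f → Q (f + (μ : ℂ) • u) = u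
  nonneg : 0 ≤ C
  grad_le : ∀ x g, HasFMul symGrad (Q x) g → ‖g‖ ^ 2 ≤ C * (inner ℂ (Q x) x).re
  norm_le : ∀ x, ‖Q x‖ ^ 2 ≤ C * (inner ℂ (Q x) x).re

/-- Kato–Rellich: `Q = (-½Δ + μ)⁻¹ (1 + A)⁻¹` with `A = V(-½Δ + μ)⁻¹` of norm below one. Symmetry of
`H` makes `Q` self-adjoint and, by duality, a left inverse as well. -/
theorem exists_isRes {V : Space d → ℝ} (hV : AEStronglyMeasurable V volume) {a₁ a₂ : ℝ}
    (ha₁ : 0 ≤ a₁) (ha₁' : a₁ < 1) (ha₂ : 0 < a₂) (hVΔ : LaplacianBounded V a₁ a₂) :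
    ∃ (μ C : ℝ) (Q : L2 d →L[ℂ] L2 d), IsRes V μ C Q := by
  -- With this `μ` the bound `a₁ + a₂ / μ` becomes `(1 + a₁) / 2`, which is below one.
  set μ := 2 * a₂ / (1 - a₁) with hμdef
  have h1a : 0 < 1 - a₁ := by linarith
  have hμ : 0 < μ := by positivity
  obtain ⟨A, hA, hA2⟩ := hVΔ.exists_potential_freeRes ha₁ ha₂ hμ
  set a := a₁ + a₂ / μ with hadef
  have ha' : a = (1 + a₁) / 2 := by rw [hadef, hμdef]; field_simp; ring
  have ha : 0 < a := by positivity
  have ha1 : a < 1 := by rw [ha']; linarith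
  obtain ⟨B, hB⟩ : ∃ B : L2 d →L[ℂ] L2 d, (1 + A) * B = 1 := by
    have h := isUnit_one_sub_of_norm_lt_one (x := -A) (by rw [norm_neg]; exact hA2.trans_lt ha1)
    rw [sub_neg_eq_add] at h
    obtain ⟨U, hU⟩ := h
    exact ⟨(U⁻¹ : (L2 d →L[ℂ] L2 d)ˣ), by rw [← hU, Units.mul_inv]⟩
  let Q : L2 d →L[ℂ] L2 d := freeRes μ * B
  have hsch : ∀ x, HasSch V (Q x) (x - (μ : ℂ) • Q x) := by
    intro x
    refine ⟨_, _, freeRes_lap hμ (B x), hA (B x), ?_⟩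
    have h1 : B x + A (B x) = x := by
      have := congrArg (fun T : L2 d →L[ℂ] L2 d => T x) hB
      simpa using this
    change x - (μ : ℂ) • freeRes μ (B x) = _
    rw [show x - (μ : ℂ) • freeRes μ (B x) = (B x + A (B x)) - (μ : ℂ) • freeRes μ (B x) by rw [h1]]
    module
  have hsa : IsSelfAdjoint Q := by
    refine ContinuousLinearMap.isSelfAdjoint_iff_isSymmetric.2 fun x y => ?_
    have := (hsch x).inner_symm (hsch y)
    rw [inner_sub_left, inner_sub_right, inner_smul_left, inner_smul_right, Complex.conj_ofReal] at this
    have h2 : inner ℂ (Q y) x = inner ℂ y (Q x) := by linear_combination this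
    have h3 := congrArg conj h2
    rw [inner_conj_symm, inner_conj_symm] at h3
    exact h3.symm
  have hsa' : ∀ x y, inner ℂ (Q x) y = inner ℂ x (Q y) :=
    ContinuousLinearMap.isSelfAdjoint_iff_isSymmetric.1 hsa
  have hleft : ∀ u f, HasSch V u f → Q (f + (μ : ℂ) • u) = u := by
    intro u f h
    refine ext_inner_left ℂ fun x => ?_
    have := h.inner_symm (hsch x)
    rw [inner_sub_left, inner_smul_left, Complex.conj_ofReal] at this
    rw [← hsa', inner_add_right, inner_smul_right, this]
    ring
  -- Coercivity: `⟨Qx, x⟩` is the form of `H + μ` at `Qx`, and `V` can cancel at most the fraction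
  -- `a` of the free form.
  have hform : ∀ x g, HasFMul symGrad (Q x) g →
      (1 - a) * (1 / 2 * ‖g‖ ^ 2 + μ * ‖Q x‖ ^ 2) ≤ (inner ℂ (Q x) x).re := by
    intro x g hg
    obtain ⟨v, w, h1, h2, h3⟩ := hsch x
    have h4 := abs_inner_potential_le hV ha hμ hA hA2 h1 h2 hg
    have h5 : inner ℂ (Q x) x = (((1 / 2 * ‖g‖ ^ 2 + μ * ‖Q x‖ ^ 2 : ℝ)) : ℂ) + inner ℂ (Q x) w := by
      have h6 : x = (-(1 / 2) : ℂ) • v + (w + (μ : ℂ) • Q x) := by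
        rw [← add_assoc, ← h3]; abel
      rw [show inner ℂ (Q x) x = inner ℂ (Q x) ((-(1 / 2) : ℂ) • v + (w + (μ : ℂ) • Q x)) by
        rw [← h6], inner_add_right, inner_add_right, inner_smul_right, inner_smul_right,
        inner_lap_self h1 hg, inner_self_eq_norm_sq_to_K]
      push_cast
      simp
      ring
    have h6 := (abs_le.1 (Complex.abs_re_le_norm (inner ℂ (Q x) w))).1
    rw [h5, Complex.add_re, Complex.ofReal_re]
    linarith
  have hgr : ∀ x, ∃ g, HasFMul symGrad (Q x) g := fun x => by
    obtain ⟨v, w, h1, -, -⟩ := hsch x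
    exact exists_grad h1
  refine ⟨μ, max (2 / (1 - a)) (1 / ((1 - a) * μ)), Q, hsa, hsch, hleft, ?_, fun x g hg => ?_,
    fun x => ?_⟩
  · exact le_max_of_le_left (by have : 0 < 1 - a := by linarith
                                positivity)
  · have h1 : 0 < 1 - a := by linarith
    have h2 := hform x g hg
    have h0 : 0 ≤ (inner ℂ (Q x) x).re := le_trans (by positivity) h2
    calc ‖g‖ ^ 2 ≤ 2 / (1 - a) * (inner ℂ (Q x) x).re := by
          rw [div_mul_eq_mul_div, le_div_iff₀ h1]
          have : 0 ≤ (1 - a) * (μ * ‖Q x‖ ^ 2) := by positivity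
          linarith
      _ ≤ _ := by gcongr; exact le_max_left _ _
  · have h1 : 0 < 1 - a := by linarith
    obtain ⟨g, hg⟩ := hgr x
    have h2 := hform x g hg
    have h0 : 0 ≤ (inner ℂ (Q x) x).re := le_trans (by positivity) h2
    calc ‖Q x‖ ^ 2 ≤ 1 / ((1 - a) * μ) * (inner ℂ (Q x) x).re := by
          rw [div_mul_eq_mul_div, le_div_iff₀ (by positivity)]
          have : 0 ≤ (1 - a) * (1 / 2 * ‖g‖ ^ 2) := by positivity
          linarith
      _ ≤ _ := by gcongr; exact le_max_right _ _

end MaxSpeed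

namespace MaxSpeed

open scoped ComplexConjugate

/-! ### Commutators with the powers of a unitary element -/

section Algebra

variable {A : Type*} [CStarAlgebra A]

/-- The commutator is a derivation, so the `n`-th power costs a factor `n`. The left factor `q`
commutes with `u` and is carried along: with `q = Q` the commutator keeps its smoothing factor, and
`q = 1` serves when no such factor is available. -/
theorem commutator_pow {T q u Y : A} (hu : ‖u‖ ≤ 1) (hq : Commute q u)
    (h : T * u - u * T = q * Y) (n : ℕ) :
    ∃ Y', T * u ^ n - u ^ n * T = q * Y' ∧ ‖Y'‖ ≤ n * ‖Y‖ := by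
  induction n with
  | zero => exact ⟨0, by simp, by simp⟩
  | succ n ih =>
    obtain ⟨Y', h1, h2⟩ := ih
    refine ⟨Y' * u + u ^ n * Y, ?_, ?_⟩
    · have h3 : q * (u ^ n * Y) = u ^ n * (q * Y) := by
        rw [← mul_assoc, (hq.pow_right n).eq, mul_assoc]
      rw [mul_add, ← mul_assoc, ← h1, h3, ← h, pow_succ]
      noncomm_ring
    · have h4 : ‖u ^ n * Y‖ ≤ ‖Y‖ := by
        rcases Nat.eq_zero_or_pos n with rfl | hn
        · simp
        · refine (norm_mul_le _ _).trans (mul_le_of_le_one_left (norm_nonneg _) ?_)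
          exact (norm_pow_le' _ hn).trans (pow_le_one₀ (norm_nonneg _) hu)
      have h5 : ‖Y' * u‖ ≤ ‖Y'‖ :=
        (norm_mul_le _ _).trans (mul_le_of_le_one_right (norm_nonneg _) hu)
      push_cast
      linarith [norm_add_le (Y' * u) (u ^ n * Y)]

theorem commutator_zpow {T q Y : A} {u : Aˣ} (hu : ‖(u : A)‖ ≤ 1) (hu' : ‖((u⁻¹ : Aˣ) : A)‖ ≤ 1)
    (hq : Commute q u) (h : T * u - u * T = q * Y) (n : ℤ) :
    ∃ Y', T * ((u ^ n : Aˣ) : A) - ((u ^ n : Aˣ) : A) * T = q * Y' ∧ ‖Y'‖ ≤ |(n : ℝ)| * ‖Y‖ := by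
  have hinv : T * ((u⁻¹ : Aˣ) : A) - ((u⁻¹ : Aˣ) : A) * T =
      q * (-(((u⁻¹ : Aˣ) : A) * Y * ((u⁻¹ : Aˣ) : A))) := by
    have h1 : q * (-(((u⁻¹ : Aˣ) : A) * Y * ((u⁻¹ : Aˣ) : A))) =
        -(((u⁻¹ : Aˣ) : A) * (q * Y) * ((u⁻¹ : Aˣ) : A)) := by
      rw [mul_neg, ← mul_assoc, ← mul_assoc, ← mul_assoc, hq.units_inv_right.eq]
    rw [h1, ← h, mul_sub, sub_mul, ← mul_assoc, ← mul_assoc, Units.inv_mul, one_mul,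
      mul_assoc, mul_assoc, Units.mul_inv, mul_one]
    abel
  have hnorm : ‖-(((u⁻¹ : Aˣ) : A) * Y * ((u⁻¹ : Aˣ) : A))‖ ≤ ‖Y‖ := by
    rw [norm_neg]
    refine (norm_mul_le _ _).trans ((mul_le_of_le_one_right (norm_nonneg _) hu').trans ?_)
    exact (norm_mul_le _ _).trans (mul_le_of_le_one_left (norm_nonneg _) hu')
  rcases Int.eq_nat_or_neg n with ⟨k, rfl | rfl⟩
  · obtain ⟨Y', h1, h2⟩ := commutator_pow hu hq h k
    exact ⟨Y', by simpa using h1, by simpa using h2⟩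
  · obtain ⟨Y', h1, h2⟩ := commutator_pow hu' hq.units_inv_right hinv k
    refine ⟨Y', by simpa using h1, ?_⟩
    simp only [Int.cast_neg, Int.cast_natCast, abs_neg, Nat.abs_cast]
    exact h2.trans (by gcongr)

theorem commutator_hasSum {T q Y : A} {u : Aˣ} (hu : ‖(u : A)‖ ≤ 1) (hu' : ‖((u⁻¹ : Aˣ) : A)‖ ≤ 1)
    (hq : Commute q u) (h : T * u - u * T = q * Y) {c : ℤ → ℂ}
    (hc : Summable fun n : ℤ => |(n : ℝ)| * ‖c n‖) {G : A}
    (hG : HasSum (fun n => c n • ((u ^ n : Aˣ) : A)) G) :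
    ∃ Y', T * G - G * T = q * Y' ∧ ‖Y'‖ ≤ (∑' n : ℤ, |(n : ℝ)| * ‖c n‖) * ‖Y‖ := by
  choose Y' h1 h2 using commutator_zpow hu hu' hq h
  have hb : ∀ n, ‖c n • Y' n‖ ≤ |(n : ℝ)| * ‖c n‖ * ‖Y‖ := fun n => by
    rw [norm_smul]
    calc ‖c n‖ * ‖Y' n‖ ≤ ‖c n‖ * (|(n : ℝ)| * ‖Y‖) := by gcongr; exact h2 n
      _ = _ := by ring
  have hs : Summable fun n => c n • Y' n := Summable.of_norm_bounded (hc.mul_right _) hb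
  refine ⟨∑' n, c n • Y' n, ?_, ?_⟩
  · have h3 := (hG.mul_left T).sub (hG.mul_right T)
    have h4 := hs.hasSum.mul_left q
    have h5 : (fun n => T * c n • ((u ^ n : Aˣ) : A) - c n • ((u ^ n : Aˣ) : A) * T) =
        fun n => q * c n • Y' n := by
      ext1 n
      rw [mul_smul_comm, mul_smul_comm, ← h1 n, smul_sub, smul_mul_assoc]
    rw [h5] at h3
    exact h3.unique h4
  · rw [← tsum_mul_right]
    exact tsum_of_norm_bounded (hc.mul_right _).hasSum hb

/-- The point `-1/ζ` is not real, hence outside the spectrum of the self-adjoint `Q`. -/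
theorem isUnit_one_add_smul {Q : A} (hQ : IsSelfAdjoint Q) {ζ : ℂ} (hζ : ζ.im ≠ 0) :
    IsUnit (1 + ζ • Q) := by
  have hζ0 : ζ ≠ 0 := fun h => hζ (by rw [h]; rfl)
  have h1 : -ζ⁻¹ ∉ spectrum ℂ Q := fun h => by
    have h2 := hQ.mem_spectrum_eq_re h
    have h3 := congrArg Complex.im h2
    simp only [Complex.neg_im, Complex.inv_im, Complex.ofReal_im] at h3
    rw [neg_eq_zero, neg_div, neg_eq_zero, div_eq_zero_iff] at h3
    rcases h3 with h3 | h3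
    · exact hζ h3
    · exact hζ0 (Complex.normSq_eq_zero.1 h3)
  rw [spectrum.notMem_iff] at h1
  have h2 : 1 + ζ • Q = (-ζ) • (algebraMap ℂ A (-ζ⁻¹) - Q) := by
    rw [smul_sub, Algebra.algebraMap_eq_smul_one, smul_smul, neg_mul_neg, mul_inv_cancel₀ hζ0,
      one_smul, neg_smul, sub_neg_eq_add]
  rw [h2]
  exact (h1.smul (Units.mk0 (-ζ) (neg_ne_zero.2 hζ0)))

/-- The relation between `R = (H + i)⁻¹` and `Q = (H + μ)⁻¹`, where `u = (H + i) Q`. -/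
structure IsCayley (μ : ℝ) (Q R : A) (u : Aˣ) : Prop where
  selfAdjoint : IsSelfAdjoint Q
  unit_eq : (u : A) = 1 + (Complex.I - μ) • Q
  left : u * R = Q

namespace IsCayley

variable {μ : ℝ} {Q R : A} {u : Aˣ}

theorem commute_unit (h : IsCayley μ Q R u) : Commute Q u := by
  rw [h.unit_eq]
  exact (Commute.one_right Q).add_right ((Commute.refl Q).smul_right _)

theorem R_eq (h : IsCayley μ Q R u) : R = ((u⁻¹ : Aˣ) : A) * Q := by
  rw [← h.left, ← mul_assoc, Units.inv_mul, one_mul]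

theorem commute (h : IsCayley μ Q R u) : Commute Q R := by
  rw [h.R_eq]
  exact h.commute_unit.units_inv_right.mul_right (Commute.refl Q)

theorem right (h : IsCayley μ Q R u) : R * u = Q := by
  rw [h.R_eq, mul_assoc, h.commute_unit.eq, ← mul_assoc, Units.inv_mul, one_mul]

theorem unit_mul (h : IsCayley μ Q R u) : u * (1 - (Complex.I - μ : ℂ) • R) = 1 := by
  rw [mul_sub, mul_one, mul_smul_comm, h.left, h.unit_eq]
  abel

theorem star_unit (h : IsCayley μ Q R u) : star (u : A) = 1 - (Complex.I + μ : ℂ) • Q := by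
  rw [h.unit_eq, star_add, star_one, star_smul, h.selfAdjoint.star_eq]
  have : star (Complex.I - μ) = -(Complex.I + μ) := by simp; ring
  rw [this, neg_smul, sub_eq_add_neg]

theorem cayley_eq (h : IsCayley μ Q R u) :
    1 - (2 * Complex.I) • R = star (u : A) * ((u⁻¹ : Aˣ) : A) := by
  have : (1 - (2 * Complex.I) • R) * u = star (u : A) := by
    rw [sub_mul, one_mul, smul_mul_assoc, h.right, h.star_unit, h.unit_eq, add_sub_assoc, ← sub_smul]
    rw [sub_eq_add_neg (1 : A), ← neg_smul]
    congr 2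
    ring
  rw [← this, mul_assoc, Units.mul_inv, mul_one]

theorem cayley_mem_unitary (h : IsCayley μ Q R u) : 1 - (2 * Complex.I) • R ∈ unitary A := by
  have hc : Commute (star (u : A)) u := by
    rw [h.star_unit, h.unit_eq]
    refine Commute.add_right (Commute.one_right _) (Commute.smul_right ?_ _)
    exact (Commute.one_left _).sub_left ((Commute.refl Q).smul_left _)
  have h1 : star ((u⁻¹ : Aˣ) : A) * star (u : A) = 1 := by
    rw [← star_mul, Units.mul_inv, star_one]
  have h2 : star (u : A) * star ((u⁻¹ : Aˣ) : A) = 1 := by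
    rw [← star_mul, Units.inv_mul, star_one]
  rw [h.cayley_eq, Unitary.mem_iff, star_mul, star_star]
  constructor
  · calc star ((u⁻¹ : Aˣ) : A) * u * (star (u : A) * ((u⁻¹ : Aˣ) : A)) =
          star ((u⁻¹ : Aˣ) : A) * (u * star (u : A)) * ((u⁻¹ : Aˣ) : A) := by noncomm_ring
      _ = star ((u⁻¹ : Aˣ) : A) * star (u : A) * (u * ((u⁻¹ : Aˣ) : A)) := by
          rw [← hc.eq]; noncomm_ring
      _ = 1 := by rw [h1, Units.mul_inv, one_mul]
  · have hc' : Commute (star (u : A)) ((u⁻¹ : Aˣ) : A) := hc.units_inv_right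
    calc star (u : A) * ((u⁻¹ : Aˣ) : A) * (star ((u⁻¹ : Aˣ) : A) * u) =
          ((u⁻¹ : Aˣ) : A) * (star (u : A) * star ((u⁻¹ : Aˣ) : A)) * u := by
          rw [hc'.eq]; noncomm_ring
      _ = 1 := by rw [h2, mul_one, Units.inv_mul]

theorem isStarNormal (h : IsCayley μ Q R u) : IsStarNormal R := by
  have h1 := h.cayley_mem_unitary
  have h2 : IsStarNormal (1 - (2 * Complex.I) • R) := ⟨by
    rw [Commute, SemiconjBy, (Unitary.mem_iff.1 h1).1, (Unitary.mem_iff.1 h1).2]⟩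
  have h3 : R = (2 * Complex.I)⁻¹ • (1 - (1 - (2 * Complex.I) • R)) := by
    rw [sub_sub_cancel, smul_smul, inv_mul_cancel₀ (by simp), one_smul]
  rw [h3]
  refine ⟨?_⟩
  rw [star_smul, star_sub, star_one]
  refine (Commute.smul_left (Commute.smul_right ?_ _) _)
  exact (Commute.one_left _).sub_left ((Commute.one_right _).sub_right h2.star_comm_self)

/-- The Cayley transform `1 - 2iR` is unitary, so by spectral mapping the spectrum of `R` lies on
the circle that corresponds to the real energies together with infinity. -/
theorem spectrum_subset (h : IsCayley μ Q R u) {w : ℂ} (hw : w ∈ spectrum ℂ R) :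
    ‖1 - 2 * Complex.I * w‖ = 1 := by
  have h1 : 1 - 2 * Complex.I * w ∈ spectrum ℂ (1 - (2 * Complex.I) • R) := by
    have h2 := spectrum.subset_polynomial_aeval R
      (1 - Polynomial.C (2 * Complex.I) * Polynomial.X : Polynomial ℂ) ⟨w, hw, rfl⟩
    simpa [Algebra.smul_def] using h2
  have h3 := Unitary.spectrum_subset_circle (𝕜 := ℂ) ⟨_, h.cayley_mem_unitary⟩ h1
  simpa using h3

/-- Commutators with `Q` control commutators with `R`. -/
theorem commutator (h : IsCayley μ Q R u) {T q Y : A} (hq : Commute q Q)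
    (hT : T * Q - Q * T = q * Y) :
    T * (1 - (2 * Complex.I) • R) - (1 - (2 * Complex.I) • R) * T =
      q * (-(2 * Complex.I) • (((u⁻¹ : Aˣ) : A) * Y * ((u⁻¹ : Aˣ) : A))) := by
  have hqu : Commute q u := by
    rw [h.unit_eq]
    exact (Commute.one_right q).add_right (hq.smul_right _)
  -- Since `u R = R u = Q`, the left side is `u T Q - Q T u`. Inserting `u = 1 + (i - μ) Q` cancels
  -- the terms `Q T Q` and leaves the commutator of `T` with `Q`.
  have h1 : u * (T * R - R * T) * u = q * Y := by
    have h2 : u * (T * R - R * T) * u = u * T * (R * u) - u * R * T * u := by noncomm_ring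
    rw [h2, h.right, h.left, h.unit_eq, ← hT]
    simp only [mul_add, add_mul, one_mul, mul_one, smul_mul_assoc, mul_smul_comm, mul_assoc]
    abel
  have h3 : T * R - R * T = q * (((u⁻¹ : Aˣ) : A) * Y * ((u⁻¹ : Aˣ) : A)) := by
    calc T * R - R * T = ((u⁻¹ : Aˣ) : A) * (u * (T * R - R * T) * u) * ((u⁻¹ : Aˣ) : A) := by
          rw [← mul_assoc, ← mul_assoc, Units.inv_mul, one_mul, mul_assoc, Units.mul_inv, mul_one]
      _ = _ := by
          rw [h1, ← mul_assoc, ← hqu.units_inv_right.eq]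
          noncomm_ring
  rw [mul_smul_comm, ← h3, neg_smul, smul_sub]
  rw [mul_sub, sub_mul, mul_one, one_mul, mul_smul_comm, smul_mul_assoc]
  abel

end IsCayley

end Algebra

end MaxSpeed

namespace MaxSpeed

open scoped ComplexConjugate

/-! ### The functional calculus through the Cayley transform -/

section FunctionalCalculus

/-- The function of the resolvent `(lam + i)⁻¹` that corresponds to `g lam`. -/
noncomputable def cayleyFun (g : ℝ → ℝ) (w : ℂ) : ℂ :=
  if w = 0 then 0 else ((g (w⁻¹ - Complex.I).re : ℝ) : ℂ)

@[simp] theorem cayleyFun_zero (g : ℝ → ℝ) : cayleyFun g 0 = 0 := if_pos rfl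

theorem cayleyFun_mul (f g : ℝ → ℝ) :
    cayleyFun (fun x => f x * g x) = fun w => cayleyFun f w * cayleyFun g w := by
  ext w
  by_cases hw : w = 0 <;> simp [cayleyFun, hw]

theorem star_cayleyFun (g : ℝ → ℝ) (w : ℂ) : star (cayleyFun g w) = cayleyFun g w := by
  by_cases hw : w = 0 <;> simp [cayleyFun, hw]

theorem norm_cayleyFun_le {g : ℝ → ℝ} {C : ℝ} (hg : ∀ x, |g x| ≤ C) (w : ℂ) :
    ‖cayleyFun g w‖ ≤ C := by
  by_cases hw : w = 0
  · simpa [cayleyFun, hw] using (abs_nonneg _).trans (hg 0)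
  · simpa [cayleyFun, hw] using hg _

/-- On the circle that contains the spectrum of `(H + i)⁻¹`, the inverse is `lam + i`. -/
theorem inv_im_of_circle {w : ℂ} (hw : ‖1 - 2 * Complex.I * w‖ = 1) (h0 : w ≠ 0) :
    w⁻¹ = ((w⁻¹ - Complex.I).re : ℝ) + Complex.I := by
  have h1 : (1 - 2 * Complex.I * w) = w * (w⁻¹ - 2 * Complex.I) := by
    rw [mul_sub, mul_inv_cancel₀ h0]; ring
  have h2 : ‖w⁻¹ - 2 * Complex.I‖ = ‖w⁻¹‖ := by
    rw [h1, norm_mul] at hw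
    rw [norm_inv, eq_inv_of_mul_eq_one_right hw]
  have h3 := congrArg (· ^ 2) h2
  simp only [← Complex.normSq_eq_norm_sq, Complex.normSq_apply] at h3
  have h4 : (w⁻¹).im = 1 := by
    simp only [Complex.sub_re, Complex.sub_im, Complex.mul_re, Complex.mul_im, Complex.I_re,
      Complex.I_im, Complex.re_ofNat, Complex.im_ofNat] at h3
    nlinarith
  apply Complex.ext
  · simp
  · rw [h4]; simp

/-- At `w = 0` continuity holds only within the circle: there `|w⁻¹| ≤ |lam| + 1`, so a small `w`
means a large energy `lam`, outside the compact support of `g`. -/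
theorem continuousOn_cayleyFun {g : ℝ → ℝ} (hg : Continuous g) (hc : HasCompactSupport g) :
    ContinuousOn (cayleyFun g) {w : ℂ | ‖1 - 2 * Complex.I * w‖ = 1} := by
  intro w hw
  by_cases h0 : w = 0
  · subst h0
    obtain ⟨B, hB⟩ := hc.isCompact.isBounded.exists_norm_le
    have hB0 : 0 < |B| + 2 := by positivity
    have hev : ∀ᶠ z in 𝓝[{w : ℂ | ‖1 - 2 * Complex.I * w‖ = 1}] (0 : ℂ), cayleyFun g z = 0 := by
      have h1 : ∀ᶠ z : ℂ in 𝓝[{w : ℂ | ‖1 - 2 * Complex.I * w‖ = 1}] (0 : ℂ), ‖z‖ < (|B| + 2)⁻¹ :=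
        nhdsWithin_le_nhds (continuous_norm.continuousAt.eventually_lt continuousAt_const
          (by rw [norm_zero]; exact inv_pos.2 hB0))
      filter_upwards [h1, self_mem_nhdsWithin] with z hz hz'
      by_cases hz0 : z = 0
      · rw [hz0, cayleyFun_zero]
      rw [cayleyFun, if_neg hz0]
      have h2 := inv_im_of_circle hz' hz0
      have h3 : |B| + 2 < ‖z⁻¹‖ := by
        rw [norm_inv]
        exact (lt_inv_comm₀ (norm_pos_iff.2 hz0) hB0).1 hz
      have h4 : ‖z⁻¹‖ ≤ |(z⁻¹ - Complex.I).re| + 1 := by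
        conv_lhs => rw [h2]
        refine (norm_add_le _ _).trans ?_
        rw [Complex.norm_real, Complex.norm_I, Real.norm_eq_abs]
      have h5 : (z⁻¹ - Complex.I).re ∉ tsupport g := fun h => by
        have := hB _ h
        rw [Real.norm_eq_abs] at this
        linarith [le_abs_self B]
      rw [image_eq_zero_of_notMem_tsupport h5, Complex.ofReal_zero]
    refine ContinuousWithinAt.congr_of_eventuallyEq continuousWithinAt_const hev (cayleyFun_zero g)
  · have h1 : ContinuousAt (fun z : ℂ => ((g (z⁻¹ - Complex.I).re : ℝ) : ℂ)) w := by
      refine Complex.continuous_ofReal.continuousAt.comp (hg.continuousAt.comp ?_)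
      exact Complex.continuous_re.continuousAt.comp ((continuousAt_inv₀ h0).sub continuousAt_const)
    refine (h1.congr ?_).continuousWithinAt
    filter_upwards [isOpen_ne.mem_nhds h0] with z hz
    rw [cayleyFun, if_neg hz]

variable {A : Type*} [CStarAlgebra A] {μ : ℝ} {Q R : A} {u : Aˣ}

theorem isSelfAdjoint_cfc_cayleyFun (g : ℝ → ℝ) (R : A) : IsSelfAdjoint (cfc (cayleyFun g) R) := by
  rw [IsSelfAdjoint, ← cfc_star]
  simp only [star_cayleyFun]

theorem norm_cfc_cayleyFun_le {g : ℝ → ℝ} {C : ℝ} (hg : ∀ x, |g x| ≤ C) (R : A) :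
    ‖cfc (cayleyFun g) R‖ ≤ C :=
  norm_cfc_le ((abs_nonneg _).trans (hg 0)) fun w _ => norm_cayleyFun_le hg w

namespace IsCayley

theorem continuousOn_cayleyFun (h : IsCayley μ Q R u) {g : ℝ → ℝ} (hg : Continuous g)
    (hc : HasCompactSupport g) : ContinuousOn (cayleyFun g) (spectrum ℂ R) :=
  (MaxSpeed.continuousOn_cayleyFun hg hc).mono fun _ hw => h.spectrum_subset hw

theorem cfc_mul (h : IsCayley μ Q R u) {f g : ℝ → ℝ} (hf : Continuous f)
    (hfc : HasCompactSupport f) (hg : Continuous g) (hgc : HasCompactSupport g) :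
    cfc (cayleyFun (fun x => f x * g x)) R = cfc (cayleyFun f) R * cfc (cayleyFun g) R := by
  rw [cayleyFun_mul]
  exact _root_.cfc_mul _ _ R (h.continuousOn_cayleyFun hf hfc) (h.continuousOn_cayleyFun hg hgc)

theorem commute_cfc (h : IsCayley μ Q R u) (f : ℂ → ℂ) : Commute Q (cfc f R) := by
  refine (Commute.cfc h.commute.symm ?_ f).symm
  have := h.commute.star_star
  rw [h.selfAdjoint.star_eq] at this
  exact this.symm

/-- `g(H) = (H + μ)⁻¹ L` with `L = l(H)`, `l lam = (lam + μ) g lam`. -/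
theorem mul_cfc (h : IsCayley μ Q R u) {g : ℝ → ℝ} (hg : Continuous g)
    (hgc : HasCompactSupport g) :
    Q * cfc (cayleyFun fun x => (x + μ) * g x) R = cfc (cayleyFun g) R := by
  have : IsStarNormal R := h.isStarNormal
  set l : ℝ → ℝ := fun x => (x + μ) * g x with hl
  have hlc : Continuous l := (continuous_id.add continuous_const).mul hg
  have hls : HasCompactSupport l := hgc.mul_left
  have h1 : cfc (fun w : ℂ => 1 - (Complex.I - μ) * w) R = 1 - (Complex.I - μ : ℂ) • R := by
    rw [cfc_sub _ _ R, cfc_const_one ℂ R]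
    congr 1
    exact cfc_const_mul_id _ R
  -- With `w (lam + i) = 1` one has `w (lam + μ) = 1 - (i - μ) w`. Multiplying by `u` afterwards
  -- turns `R` into `Q` and the right factor into one.
  have h2 : R * cfc (cayleyFun l) R = (1 - (Complex.I - μ : ℂ) • R) * cfc (cayleyFun g) R := by
    rw [← h1]
    conv_lhs => enter [1]; rw [← cfc_id ℂ R]
    rw [← _root_.cfc_mul _ _ R continuousOn_id (h.continuousOn_cayleyFun hlc hls),
      ← _root_.cfc_mul _ _ R (by fun_prop) (h.continuousOn_cayleyFun hg hgc)]
    refine cfc_congr fun w hw => ?_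
    by_cases h0 : w = 0
    · simp [h0]
    · have h3 := inv_im_of_circle (h.spectrum_subset hw) h0
      simp only [cayleyFun, if_neg h0, id, hl, Complex.ofReal_mul, Complex.ofReal_add]
      set x := (w⁻¹ - Complex.I).re
      have h4 : w * ((x : ℂ) + Complex.I) = 1 := by rw [← h3, mul_inv_cancel₀ h0]
      linear_combination ((g x : ℝ) : ℂ) * h4
  rw [← h.left, mul_assoc, h2, ← mul_assoc, h.unit_mul, one_mul]

end IsCayley

/-! ### The Fourier series of the transformed function -/

/-- `lam = -cot(π θ)` as a variable. -/
noncomputable def cotPull (g : ℝ → ℝ) (θ : ℝ) : ℂ :=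
  if Real.sin (Real.pi * θ) = 0 then 0
  else ((g (-(Real.cos (Real.pi * θ) / Real.sin (Real.pi * θ))) : ℝ) : ℂ)

theorem cotPull_periodic (g : ℝ → ℝ) : Function.Periodic (cotPull g) 1 := by
  intro θ
  simp only [cotPull, mul_add, mul_one, Real.sin_add_pi, Real.cos_add_pi, neg_eq_zero, neg_div_neg_eq]

/-- Where the sine vanishes the cotangent is unbounded, so the compact support of `g` makes the
function zero nearby; elsewhere it is a composition of smooth functions. -/
theorem contDiff_cotPull {g : ℝ → ℝ} (hg : ContDiff ℝ ∞ g) (hc : HasCompactSupport g) :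
    ContDiff ℝ ∞ (cotPull g) := by
  rw [contDiff_iff_contDiffAt]
  intro θ
  by_cases h0 : Real.sin (Real.pi * θ) = 0
  · obtain ⟨B, hB⟩ := hc.isCompact.isBounded.exists_norm_le
    have hev : cotPull g =ᶠ[𝓝 θ] fun _ => 0 := by
      have h1 : ∀ᶠ t in 𝓝 θ, Real.sin (Real.pi * t) ^ 2 * (1 + B ^ 2) < 1 := by
        refine ContinuousAt.eventually_lt (Continuous.continuousAt (by fun_prop))
          continuousAt_const ?_
        simp [h0]
      filter_upwards [h1] with t ht
      rw [cotPull]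
      split_ifs with hs
      · rfl
      · rw [Complex.ofReal_eq_zero]
        refine image_eq_zero_of_notMem_tsupport fun hmem => ?_
        have h2 := hB _ hmem
        rw [norm_neg, Real.norm_eq_abs, abs_div, div_le_iff₀ (abs_pos.2 hs)] at h2
        have h3 := Real.sin_sq_add_cos_sq (Real.pi * t)
        have h4 : Real.cos (Real.pi * t) ^ 2 ≤ B ^ 2 * Real.sin (Real.pi * t) ^ 2 := by
          rw [← sq_abs (Real.cos _), ← sq_abs (Real.sin _), ← mul_pow]
          exact pow_le_pow_left₀ (abs_nonneg _) h2 2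
        nlinarith
    exact contDiffAt_const.congr_of_eventuallyEq hev
  · have hev : cotPull g =ᶠ[𝓝 θ]
        fun t => ((g (-(Real.cos (Real.pi * t) / Real.sin (Real.pi * t))) : ℝ) : ℂ) := by
      have h1 : ∀ᶠ t in 𝓝 θ, Real.sin (Real.pi * t) ≠ 0 :=
        (Continuous.continuousAt (by fun_prop)).eventually_ne h0
      filter_upwards [h1] with t ht
      rw [cotPull, if_neg ht]
    refine ContDiffAt.congr_of_eventuallyEq ?_ hev
    refine Complex.ofRealCLM.contDiff.contDiffAt.comp θ (hg.contDiffAt.comp θ ?_)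
    have hπ : ContDiffAt ℝ ∞ (fun t : ℝ => Real.pi * t) θ := contDiffAt_const.mul contDiffAt_id
    exact ((Real.contDiff_cos.contDiffAt.comp θ hπ).div (Real.contDiff_sin.contDiffAt.comp θ hπ)
      h0).neg

theorem norm_fourierCoeffOn_le {a b : ℝ} (hab : a < b) {f : ℝ → ℂ} {C : ℝ}
    (hf : ∀ x ∈ Set.uIoc a b, ‖f x‖ ≤ C) (n : ℤ) : ‖fourierCoeffOn hab f n‖ ≤ C := by
  have hba : 0 < b - a := sub_pos.2 hab
  rw [fourierCoeffOn_eq_integral, norm_smul, Real.norm_eq_abs, abs_of_pos (by positivity)]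
  have h1 : ‖∫ x in a..b, fourier (-n) (x : AddCircle (b - a)) • f x‖ ≤ C * |b - a| := by
    refine intervalIntegral.norm_integral_le_of_norm_le_const fun x hx => ?_
    rw [norm_smul, fourier_apply, Circle.norm_coe, one_mul]
    exact hf x hx
  rw [abs_of_pos hba] at h1
  calc 1 / (b - a) * _ ≤ 1 / (b - a) * (C * (b - a)) := by gcongr
    _ = C := by field_simp

theorem norm_fourierCoeffOn_deriv {f : ℝ → ℂ} {a b : ℝ} (hab : a < b) (h1 : b - a = 1)
    (hf : ContDiff ℝ ∞ f) (hp : f a = f b) {n : ℤ} (hn : n ≠ 0) :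
    ‖fourierCoeffOn hab f n‖ = (2 * Real.pi * |(n : ℝ)|)⁻¹ * ‖fourierCoeffOn hab (deriv f) n‖ := by
  have hd : Differentiable ℝ f := hf.differentiable (by simp)
  have hcd : Continuous (deriv f) := hf.continuous_deriv (by simp)
  rw [fourierCoeffOn_of_hasDerivAt hab hn (fun x _ => (hd x).hasDerivAt)
    (hcd.intervalIntegrable _ _)]
  rw [hp, sub_self, mul_zero, zero_sub, ← Complex.ofReal_sub, h1, Complex.ofReal_one, one_mul,
    norm_mul, norm_neg, norm_div]
  simp [abs_of_pos Real.pi_pos]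

/-- Three integrations by parts, without boundary terms by periodicity. Two powers of `n` make the
series summable; the third pays for the weight `|n|` with which commutators of the `n`-th power
grow. -/
theorem exists_fourierCoeffOn_bound {f : ℝ → ℂ} (hf : ContDiff ℝ ∞ f)
    (hp : Function.Periodic f 1) {a b : ℝ} (hab : a < b) (h1 : b - a = 1) :
    ∃ C, ∀ n : ℤ, |(n : ℝ)| * ‖fourierCoeffOn hab f n‖ ≤ C * (1 / |(n : ℝ)| ^ 2) := by
  have hb : b = a + 1 := by linarith
  have hper : ∀ {h : ℝ → ℂ}, Function.Periodic h 1 → Function.Periodic (deriv h) 1 := by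
    intro h hh x
    rw [← deriv_comp_add_const, show (fun x => h (x + 1)) = h from funext hh]
  have hcd : ∀ {h : ℝ → ℂ}, ContDiff ℝ ∞ h → ContDiff ℝ ∞ (deriv h) := fun {h} hh =>
    (contDiff_infty_iff_deriv.1 hh).2
  set f₃ := deriv (deriv (deriv f))
  have hf₃ : Continuous f₃ := (hcd (hcd (hcd hf))).continuous
  obtain ⟨C, hC⟩ := (isCompact_Icc (a := a) (b := b)).exists_bound_of_continuousOn hf₃.continuousOn
  refine ⟨C, fun n => ?_⟩
  rcases eq_or_ne n 0 with rfl | hn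
  · simp
  have h2 : ‖fourierCoeffOn hab f₃ n‖ ≤ C := norm_fourierCoeffOn_le hab (fun x hx =>
    hC x (by rw [uIoc_of_le hab.le] at hx; exact ⟨hx.1.le, hx.2⟩)) n
  have hn' : 1 ≤ |(n : ℝ)| := by exact_mod_cast Int.one_le_abs hn
  rw [norm_fourierCoeffOn_deriv hab h1 hf (by rw [hb]; exact (hp a).symm) hn,
    norm_fourierCoeffOn_deriv hab h1 (hcd hf) (by rw [hb]; exact (hper hp a).symm) hn,
    norm_fourierCoeffOn_deriv hab h1 (hcd (hcd hf)) (by rw [hb]; exact (hper (hper hp) a).symm) hn]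
  have h3 : (2 * Real.pi * |(n : ℝ)|)⁻¹ ≤ |(n : ℝ)|⁻¹ := by
    refine inv_anti₀ (by positivity) ?_
    nlinarith [Real.pi_gt_three]
  have hC0 : 0 ≤ C := (norm_nonneg _).trans h2
  calc |(n : ℝ)| * ((2 * Real.pi * |(n : ℝ)|)⁻¹ * ((2 * Real.pi * |(n : ℝ)|)⁻¹ *
        ((2 * Real.pi * |(n : ℝ)|)⁻¹ * ‖fourierCoeffOn hab f₃ n‖)))
      ≤ |(n : ℝ)| * (|(n : ℝ)|⁻¹ * (|(n : ℝ)|⁻¹ * (|(n : ℝ)|⁻¹ * C))) := by gcongr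
    _ = C * (1 / |(n : ℝ)| ^ 2) := by field_simp

/-- On the circle write `1 - 2iw = exp(2πiθ)`. Then `w = -exp(iπθ) sin πθ` and `w⁻¹ = -cot πθ + i`,
so the energy is `-cot πθ`, and the Fourier series of `cotPull g` is a Laurent series in `1 - 2iw`.
-/
theorem exists_hasSum_cayleyFun {g : ℝ → ℝ} (hg : ContDiff ℝ ∞ g) (hc : HasCompactSupport g) :
    ∃ c : ℤ → ℂ, (Summable fun n : ℤ => |(n : ℝ)| * ‖c n‖) ∧ Summable c ∧
      ∀ w : ℂ, ‖1 - 2 * Complex.I * w‖ = 1 →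
        HasSum (fun n : ℤ => c n * (1 - 2 * Complex.I * w) ^ n) (cayleyFun g w) := by
  have hfact : Fact ((0 : ℝ) < 1) := ⟨one_pos⟩
  have hP := contDiff_cotPull hg hc
  have hper := cotPull_periodic g
  have h01 : (0 : ℝ) < 0 + 1 := lt_add_of_pos_right 0 one_pos
  obtain ⟨C, hC⟩ := exists_fourierCoeffOn_bound hP hper h01 (by norm_num)
  set c : ℤ → ℂ := fourierCoeffOn h01 (cotPull g) with hcdef
  have hs1 : Summable fun n : ℤ => |(n : ℝ)| * ‖c n‖ := by
    refine Summable.of_nonneg_of_le (fun n => by positivity) hC ?_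
    refine Summable.mul_left _ ?_
    simpa using Real.summable_one_div_int_pow.2 (one_lt_two)
  have hs2 : Summable c := by
    refine Summable.of_norm_bounded_eventually hs1 ?_
    filter_upwards [(Set.finite_singleton (0 : ℤ)).compl_mem_cofinite] with n hn
    have : 1 ≤ |(n : ℝ)| := by exact_mod_cast Int.one_le_abs hn
    nlinarith [norm_nonneg (c n)]
  refine ⟨c, hs1, hs2, fun w hw => ?_⟩
  obtain ⟨φ, hφ⟩ := (Complex.norm_eq_one_iff _).1 hw
  set θ : ℝ := Int.fract (φ / (2 * Real.pi)) with hθ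
  have hθexp : Complex.exp (2 * Real.pi * Complex.I * θ) = 1 - 2 * Complex.I * w := by
    rw [← hφ, Complex.exp_eq_exp_iff_exists_int]
    refine ⟨-⌊φ / (2 * Real.pi)⌋, ?_⟩
    have : (θ : ℂ) = (φ / (2 * Real.pi) : ℂ) - (⌊φ / (2 * Real.pi)⌋ : ℂ) := by
      rw [hθ, ← Int.self_sub_floor]; push_cast; rfl
    rw [this]
    have hπ : (Real.pi : ℂ) ≠ 0 := by exact_mod_cast Real.pi_ne_zero
    push_cast
    field_simp
    ring
  let F : C(AddCircle (1 : ℝ), ℂ) := ⟨AddCircle.liftIco 1 0 (cotPull g),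
    AddCircle.liftIco_zero_continuous (by simpa using (hper 0).symm) hP.continuous.continuousOn⟩
  have hFc : fourierCoeff F = c := by
    ext n
    exact fourierCoeff_liftIco_eq (cotPull g) n
  have hsum := has_pointwise_sum_fourier_series_of_summable (f := F) (by rw [hFc]; exact hs2)
    (θ : AddCircle (1 : ℝ))
  have hθ01 : θ ∈ Ico (0 : ℝ) (0 + 1) := by
    rw [zero_add]; exact ⟨Int.fract_nonneg _, Int.fract_lt_one _⟩
  have hFθ : F (θ : AddCircle (1 : ℝ)) = cotPull g θ := by
    change AddCircle.liftIco 1 0 (cotPull g) (θ : AddCircle (1 : ℝ)) = _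
    exact AddCircle.liftIco_coe_apply hθ01
  have hFw : cotPull g θ = cayleyFun g w := by
    have h2 : w = -Complex.exp (Real.pi * θ * Complex.I) * Complex.sin (Real.pi * θ) := by
      have h3 : Complex.exp (2 * Real.pi * Complex.I * θ) =
          Complex.exp (Real.pi * θ * Complex.I) * Complex.exp (Real.pi * θ * Complex.I) := by
        rw [← Complex.exp_add]; ring_nf
      have h4 : Complex.exp (Real.pi * θ * Complex.I) * Complex.exp (-(Real.pi * θ) * Complex.I) = 1 := by
        rw [← Complex.exp_add]; simp
      rw [h3] at hθexp
      rw [Complex.sin]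
      linear_combination (Complex.I / 2) * h4 - (Complex.I / 2) * hθexp + w * Complex.I_sq
    have h6 : (Complex.sin (Real.pi * θ)) = ((Real.sin (Real.pi * θ) : ℝ) : ℂ) := by push_cast; rfl
    by_cases h0 : Real.sin (Real.pi * θ) = 0
    · rw [cotPull, if_pos h0, h2, h6, h0]
      simp
    · have hne : w ≠ 0 := by
        rw [h2, h6]
        exact mul_ne_zero (neg_ne_zero.2 (Complex.exp_ne_zero _)) (by exact_mod_cast h0)
      rw [cotPull, if_neg h0, cayleyFun, if_neg hne]
      congr 2
      have h7 : w⁻¹ = -(Complex.cos (Real.pi * θ) / Complex.sin (Real.pi * θ)) + Complex.I := by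
        have hs : Complex.sin (Real.pi * θ) ≠ 0 := by rw [h6]; exact_mod_cast h0
        rw [h2, mul_inv, inv_neg, ← Complex.exp_neg, ← neg_mul, Complex.exp_mul_I, Complex.cos_neg,
          Complex.sin_neg]
        field_simp
        ring
      have h8 : -(Complex.cos (Real.pi * θ) / Complex.sin (Real.pi * θ)) =
          ((-(Real.cos (Real.pi * θ) / Real.sin (Real.pi * θ)) : ℝ) : ℂ) := by push_cast; rfl
      rw [h7, h8, add_sub_cancel_right, Complex.ofReal_re]
  rw [hFθ, hFw, hFc] at hsum
  refine hsum.congr_fun ?_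
  intro n
  rw [smul_eq_mul, fourier_coe_apply, ← hθexp, ← Complex.exp_int_mul]
  congr 2
  push_cast
  ring

/-! ### Commutators with functions of `H` -/

section Commutator

variable {A : Type*} [CStarAlgebra A] {μ : ℝ} {Q R : A} {u : Aˣ}

/-- On the spectrum `|1 - 2iw| = 1`, so summability of the coefficients gives uniform convergence,
which the functional calculus turns into norm convergence. -/
theorem IsCayley.hasSum_cfc (h : IsCayley μ Q R u) {g : ℝ → ℝ}
    {c : ℤ → ℂ} (hc : Summable c)
    (hsum : ∀ w : ℂ, ‖1 - 2 * Complex.I * w‖ = 1 →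
      HasSum (fun n : ℤ => c n * (1 - 2 * Complex.I * w) ^ n) (cayleyFun g w))
    {U : Aˣ} (hU : (U : A) = 1 - (2 * Complex.I) • R) :
    HasSum (fun n => c n • ((U ^ n : Aˣ) : A)) (cfc (cayleyFun g) R) := by
  have hR : IsStarNormal R := h.isStarNormal
  set e : ℂ → ℂ := fun w => 1 - 2 * Complex.I * w with he
  have hne : ∀ w ∈ spectrum ℂ R, e w ≠ 0 := fun w hw h0 => by
    have := h.spectrum_subset hw
    rw [show 1 - 2 * Complex.I * w = 0 from h0, norm_zero] at this
    exact zero_ne_one this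
  have hcont : ∀ n : ℤ, ContinuousOn (fun w => e w ^ n) (spectrum ℂ R) := fun n =>
    ContinuousOn.zpow₀ (by fun_prop) n fun w hw => Or.inl (hne w hw)
  have hcfcU : cfc e R = U := by
    rw [hU, he, cfc_sub _ _ R, cfc_const_one ℂ R]
    congr 1
    exact cfc_const_mul_id _ R
  have hpow : ∀ n : ℕ, cfc (fun w => e w ^ n) R = (U : A) ^ n := fun n => by
    rw [cfc_pow e n R (by fun_prop), hcfcU]
  have hzpow : ∀ n : ℤ, cfc (fun w => e w ^ n) R = ((U ^ n : Aˣ) : A) := by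
    intro n
    obtain ⟨k, rfl | rfl⟩ := Int.eq_nat_or_neg n
    · simpa using hpow k
    · rw [zpow_neg, zpow_natCast]
      refine Units.eq_inv_of_mul_eq_one_right ?_
      rw [Units.val_pow_eq_pow_val, ← hpow k,
        ← _root_.cfc_mul _ (fun w => e w ^ k) R (hcont _) (by fun_prop), ← cfc_const_one ℂ R]
      refine cfc_congr fun w hw => ?_
      simp only [zpow_neg, zpow_natCast]
      exact inv_mul_cancel₀ (pow_ne_zero _ (hne w hw))
  have hunif : TendstoUniformlyOn (fun (s : Finset ℤ) w => ∑ n ∈ s, c n * e w ^ n) (cayleyFun g)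
      atTop (spectrum ℂ R) := by
    have h1 := tendstoUniformlyOn_tsum (f := fun n w => c n * e w ^ n) (s := spectrum ℂ R) hc.norm
      (fun n w hw => by
        rw [norm_mul, norm_zpow, show ‖e w‖ = 1 from h.spectrum_subset hw, one_zpow, mul_one])
    exact h1.congr_right fun w hw => (hsum w (h.spectrum_subset hw)).tsum_eq
  have h2 := tendsto_cfc_fun (a := R) hunif (Eventually.of_forall fun s =>
    continuousOn_finsetSum s fun n _ => continuousOn_const.mul (hcont n))
  refine h2.congr fun s => ?_
  have h3 := cfc_sum (fun n w => c n * e w ^ n) R s fun n _ => continuousOn_const.mul (hcont n)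
  have h4 : (∑ n ∈ s, fun w => c n * e w ^ n) = fun w => ∑ n ∈ s, c n * e w ^ n := by
    ext w; rw [Finset.sum_apply]
  rw [← h4, h3]
  refine Finset.sum_congr rfl fun n _ => ?_
  rw [cfc_const_mul _ _ R (hcont n), hzpow]

theorem norm_le_one_of_mem_unitary {V : A} (hV : V ∈ unitary A) : ‖V‖ ≤ 1 := by
  obtain h | h := subsingleton_or_nontrivial A
  · simp [Subsingleton.elim V 0]
  · exact (CStarRing.norm_of_mem_unitary hV).le

/-- Commutators with `(H + μ)⁻¹` control commutators with `g(H)`. -/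
theorem exists_commutator_cfc (μ : ℝ) {g : ℝ → ℝ} (hg : ContDiff ℝ ∞ g)
    (hgc : HasCompactSupport g) {Q R : A} {u : Aˣ} (h : IsCayley μ Q R u) :
    ∃ C : ℝ, 0 ≤ C ∧ ∀ T q Y : A, Commute q Q → T * Q - Q * T = q * Y →
      ∃ Y', T * cfc (cayleyFun g) R - cfc (cayleyFun g) R * T = q * Y' ∧ ‖Y'‖ ≤ C * ‖Y‖ := by
  obtain ⟨c, hc1, hc2, hsum⟩ := exists_hasSum_cayleyFun hg hgc
  set C₀ := ‖((u⁻¹ : Aˣ) : A)‖ with hC₀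
  refine ⟨(∑' n : ℤ, |(n : ℝ)| * ‖c n‖) * (2 * (C₀ * C₀)), by positivity, fun T q Y hq hT => ?_⟩
  have hmem := h.cayley_mem_unitary
  set U : Aˣ := Unitary.toUnits ⟨_, hmem⟩ with hUdef
  have hU : (U : A) = 1 - (2 * Complex.I) • R := rfl
  have hU' : ((U⁻¹ : Aˣ) : A) = star (1 - (2 * Complex.I) • R) := rfl
  have hn1 : ‖(U : A)‖ ≤ 1 := by rw [hU]; exact norm_le_one_of_mem_unitary hmem
  have hn2 : ‖((U⁻¹ : Aˣ) : A)‖ ≤ 1 := by rw [hU', norm_star]; exact norm_le_one_of_mem_unitary hmem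
  have hqR : Commute q R := by
    rw [h.R_eq]
    refine Commute.mul_right (Commute.units_inv_right ?_) hq
    rw [h.unit_eq]
    exact (Commute.one_right q).add_right (hq.smul_right _)
  have hqU : Commute q U := by
    rw [hU]
    exact (Commute.one_right q).sub_right (hqR.smul_right _)
  obtain ⟨Y', h1, h2⟩ := commutator_hasSum hn1 hn2 hqU (h.commutator hq hT) hc1
    (h.hasSum_cfc hc2 hsum hU)
  refine ⟨Y', h1, h2.trans ?_⟩
  rw [mul_assoc (∑' n : ℤ, |(n : ℝ)| * ‖c n‖)]
  have h0 : 0 ≤ ∑' n : ℤ, |(n : ℝ)| * ‖c n‖ := tsum_nonneg fun n => by positivity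
  refine mul_le_mul_of_nonneg_left ?_ h0
  rw [norm_smul, norm_neg, norm_mul, Complex.norm_I, mul_one, Complex.norm_ofNat]
  calc 2 * ‖((u⁻¹ : Aˣ) : A) * Y * ((u⁻¹ : Aˣ) : A)‖ ≤ 2 * (C₀ * ‖Y‖ * C₀) := by
        gcongr
        refine (norm_mul_le _ _).trans ?_
        gcongr
        exact norm_mul_le _ _
    _ = _ := by ring

end Commutator

end FunctionalCalculus

end MaxSpeed

namespace MaxSpeed

open scoped ComplexConjugate

variable {d : ℕ} {V : Space d → ℝ} {μ C : ℝ} {Q : L2 d →L[ℂ] L2 d}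

/-! ### The resolvent and its gradient -/

/-- The operator `Q u⁻¹` shows that the resolvent at `-i` exists. The operator actually chosen by
`resolventOp` is then tied to `Q` only through its defining property and the left inverse property
of `Q`. -/
theorem IsRes.exists_isCayley (h : IsRes V μ C Q) :
    ∃ u, IsCayley μ Q (resolventOp (schrodinger V) (-Complex.I)) u := by
  obtain ⟨u, hu⟩ := isUnit_one_add_smul (Q := Q) h.selfAdjoint (ζ := Complex.I - μ) (by simp)
  have hux : ∀ x, (u : L2 d →L[ℂ] L2 d) x = x + (Complex.I - μ : ℂ) • Q x := fun x => by
    rw [hu]; rfl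
  have hex : ∃ R : L2 d →L[ℂ] L2 d,
      (∀ x : (schrodinger V).domain, R (schrodinger V x - (-Complex.I) • (x : L2 d)) = x) ∧
      ∀ v : L2 d, ∃ hv : R v ∈ (schrodinger V).domain,
        schrodinger V ⟨R v, hv⟩ - (-Complex.I) • R v = v := by
    refine ⟨Q * ((u⁻¹ : (L2 d →L[ℂ] L2 d)ˣ) : L2 d →L[ℂ] L2 d), fun x => ?_, fun v => ?_⟩
    · have h1 := h.left_inv _ _ (hasSch_iff.2 ⟨x.2, rfl⟩)
      set y := schrodinger V ⟨x, x.2⟩ + (μ : ℂ) • (x : L2 d) with hy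
      have h2 : schrodinger V x - (-Complex.I) • (x : L2 d) = (u : L2 d →L[ℂ] L2 d) y := by
        rw [hux, h1, hy, sub_smul, neg_smul]
        abel
      rw [h2, mul_apply_eq_comp, ← mul_apply_eq_comp _ (u : L2 d →L[ℂ] L2 d), Units.inv_mul]
      exact h1
    · set y := ((u⁻¹ : (L2 d →L[ℂ] L2 d)ˣ) : L2 d →L[ℂ] L2 d) v
      have h1 : (u : L2 d →L[ℂ] L2 d) y = v := by
        rw [← mul_apply_eq_comp, Units.mul_inv]; rfl
      obtain ⟨k1, k2⟩ := hasSch_iff.1 (h.sch y)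
      refine ⟨k1, ?_⟩
      change schrodinger V ⟨Q y, k1⟩ - (-Complex.I) • Q y = v
      rw [k2, ← h1, hux, sub_smul, neg_smul]
      abel
  refine ⟨u, h.selfAdjoint, hu, ?_⟩
  have hR : resolventOp (schrodinger V) (-Complex.I) = hex.choose := dif_pos hex
  ext1 v
  obtain ⟨k1, k2⟩ : ∃ hv : resolventOp (schrodinger V) (-Complex.I) v ∈ (schrodinger V).domain,
      schrodinger V ⟨_, hv⟩ - (-Complex.I) • resolventOp (schrodinger V) (-Complex.I) v = v := by
    rw [hR]
    exact hex.choose_spec.2 v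
  rw [sub_eq_iff_eq_add] at k2
  have h1 := h.left_inv _ _ (hasSch_iff.2 ⟨k1, k2⟩ :
    HasSch V (resolventOp (schrodinger V) (-Complex.I) v)
      (v + (-Complex.I) • resolventOp (schrodinger V) (-Complex.I) v))
  rw [mul_apply_eq_comp, hux]
  rw [map_add, map_add, map_smul, map_smul] at h1
  rw [← eq_sub_iff_add_eq]
  nth_rewrite 1 [← h1]
  module

/-- `D j` is the bounded operator `∂_j Q`. -/
def IsGrad (Q : L2 d →L[ℂ] L2 d) (D : Fin d → L2 d →L[ℂ] L2 d) : Prop :=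
  ∀ j x, HasFMul (symPar j) (Q x) (D j x)

theorem IsRes.exists_symGrad (h : IsRes V μ C Q) (x : L2 d) : ∃ g, HasFMul symGrad (Q x) g := by
  obtain ⟨v, w, h1, -, -⟩ := h.sch x
  exact exists_grad h1

theorem IsRes.exists_isGrad (h : IsRes V μ C Q) : ∃ D, IsGrad Q D := by
  have hex : ∀ j x, ∃ p, HasFMul (symPar j) (Q x) p ∧ ‖p‖ ≤ Real.sqrt (C * ‖Q‖) * ‖x‖ := by
    intro j x
    obtain ⟨g, hg⟩ := h.exists_symGrad x
    obtain ⟨p, hp⟩ := exists_par hg j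
    refine ⟨p, hp, (hp.par_norm_le hg).trans ?_⟩
    refine abs_le_of_sq_le_sq' ?_ (by positivity) |>.2
    rw [mul_pow, Real.sq_sqrt (mul_nonneg h.nonneg (norm_nonneg _))]
    refine (h.grad_le _ _ hg).trans ?_
    rw [mul_assoc]
    refine mul_le_mul_of_nonneg_left ?_ h.nonneg
    refine (Complex.re_le_norm _).trans ((norm_inner_le_norm _ _).trans ?_)
    rw [pow_two, ← mul_assoc]
    gcongr
    exact Q.le_opNorm x
  choose p hp hn using hex
  exact ⟨fun j => LinearMap.mkContinuous
    { toFun := p j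
      map_add' := fun x y => (hp j (x + y)).unique (by rw [map_add]; exact (hp j x).add (hp j y))
      map_smul' := fun z x => (hp j (z • x)).unique (by rw [map_smul]; exact (hp j x).smul z) }
    _ (hn j), hp⟩

theorem IsRes.sum_grad_sq_le (h : IsRes V μ C Q) {D : Fin d → L2 d →L[ℂ] L2 d} (hD : IsGrad Q D)
    (x : L2 d) : ∑ j, ‖D j x‖ ^ 2 ≤ C * (inner ℂ (Q x) x).re := by
  obtain ⟨g, hg⟩ := h.exists_symGrad x
  rw [sum_par_norm_sq (fun j => hD j x) hg]
  exact h.grad_le _ _ hg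

theorem IsRes.inner_nonneg (h : IsRes V μ C Q) (x : L2 d) : 0 ≤ (inner ℂ (Q x) x).re := by
  by_contra hlt
  push Not at hlt
  have h1 := h.norm_le x
  have h2 : C * (inner ℂ (Q x) x).re ≤ 0 := mul_nonpos_of_nonneg_of_nonpos h.nonneg hlt.le
  have h3 : ‖Q x‖ = 0 := by nlinarith [norm_nonneg (Q x)]
  rw [norm_eq_zero] at h3
  rw [h3, inner_zero_left, Complex.zero_re] at hlt
  exact lt_irrefl _ hlt

theorem IsRes.inner_right (h : IsRes V μ C Q) (x y : L2 d) : inner ℂ x (Q y) = inner ℂ (Q x) y :=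
  (ContinuousLinearMap.isSelfAdjoint_iff_isSymmetric.1 h.selfAdjoint x y).symm

theorem IsRes.injective (h : IsRes V μ C Q) {x : L2 d} (hx : Q x = 0) : x = 0 := by
  have h1 := h.sch x
  obtain ⟨v, w, h2, h3, h4⟩ := h1
  rw [hx] at h2 h3 h4
  have h5 : HasSch V (0 : L2 d) ((-(1 / 2) : ℂ) • v + w) := ⟨v, w, h2, h3, rfl⟩
  rw [← h4, smul_zero, sub_zero] at h5
  obtain ⟨k1, k2⟩ := hasSch_iff.1 h5
  rw [← k2]
  exact (schrodinger V).map_zero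

/-- The operator `[H, η] (H + μ)⁻¹`. -/
noncomputable def commOp (Q : L2 d →L[ℂ] L2 d) (D : Fin d → L2 d →L[ℂ] L2 d)
    (η₁ η₂ : Fin d → Space d → ℝ) : L2 d →L[ℂ] L2 d :=
  -(∑ j, mulR (η₁ j) * D j) - (1 / 2 : ℂ) • ∑ j, mulR (η₂ j) * Q

theorem commOp_apply (D : Fin d → L2 d →L[ℂ] L2 d) (η₁ η₂ : Fin d → Space d → ℝ) (x : L2 d) :
    commOp Q D η₁ η₂ x = -(∑ j, mulR (η₁ j) (D j x)) - (1 / 2 : ℂ) • ∑ j, mulR (η₂ j) (Q x) := by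
  simp only [commOp, sub_apply, neg_apply, smul_apply, sum_apply, mul_apply_eq_comp]

theorem HasMul.mulR_comm {m : Space d → ℂ} {u v : L2 d} (h : HasMul m u v) {η : Space d → ℝ}
    (hη : MemLp (fun x => (η x : ℂ)) ⊤ volume) : HasMul m (mulR η u) (mulR η v) := by
  filter_upwards [h, hasMul_mulB hη u, hasMul_mulB hη v] with x h1 h2 h3
  rw [mulR, h3, h2, h1]
  ring

/-- This is `[η, Q] = Q [H, η] Q`. The potential commutes with `η`, so only the Leibniz terms of the
Laplacian remain. The factor `Q` kept on the left is what later bounds the gradient of a commutator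
error. -/
theorem IsRes.mulR_mul_sub (h : IsRes V μ C Q) {D : Fin d → L2 d →L[ℂ] L2 d} (hD : IsGrad Q D)
    {η : Space d → ℝ} {η₁ η₂ : Fin d → Space d → ℝ} (hη : SmoothMul η η₁ η₂) :
    mulR η * Q - Q * mulR η = Q * commOp Q D η₁ η₂ := by
  ext1 x
  obtain ⟨v, w, h1, h2, h3⟩ := h.sch x
  have h4 := hη.lap h1 (fun j => hD j x)
  have h5 := h2.mulR_comm hη.memLp
  have h6 := h.left_inv _ _ ⟨_, _, h4, h5, rfl⟩
  simp only [sub_apply, mul_apply_eq_comp]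
  rw [← h6, ← map_sub, commOp_apply]
  congr 1
  have h7 : x = (-(1 / 2) : ℂ) • v + w + (μ : ℂ) • Q x := by rw [← h3]; abel
  conv_lhs => enter [2]; rw [h7]
  rw [map_add, map_add, map_smul, map_smul]
  module

theorem norm_commOp_apply_le {D : Fin d → L2 d →L[ℂ] L2 d} {η₁ η₂ : Fin d → Space d → ℝ} {κ : ℝ}
    (hκ : 0 ≤ κ) (h₁ : ∀ j x, |η₁ j x| ≤ κ) (h₂ : ∀ j x, |η₂ j x| ≤ κ) (x : L2 d) :
    ‖commOp Q D η₁ η₂ x‖ ≤ κ * (∑ j, ‖D j x‖ + d * ‖Q x‖) := by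
  have hb : ∀ {f : Space d → ℝ}, (∀ x, |f x| ≤ κ) → ∀ u : L2 d, ‖mulR f u‖ ≤ κ * ‖u‖ :=
    fun hf u => norm_mulB_apply_le hκ (ae_of_all _ fun x => by
      rw [Complex.norm_real]; exact hf x) u
  rw [commOp_apply]
  refine (norm_sub_le _ _).trans ?_
  rw [norm_neg, norm_smul, mul_add, Finset.mul_sum]
  refine add_le_add ((norm_sum_le _ _).trans (Finset.sum_le_sum fun j _ => hb (h₁ j) _)) ?_
  have h3 : ‖∑ j, mulR (η₂ j) (Q x)‖ ≤ ∑ _j : Fin d, κ * ‖Q x‖ :=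
    (norm_sum_le _ _).trans (Finset.sum_le_sum fun j _ => hb (h₂ j) _)
  rw [Finset.sum_const, Finset.card_univ, Fintype.card_fin, nsmul_eq_mul] at h3
  have h4 : ‖(1 / 2 : ℂ)‖ = 1 / 2 := by simp
  rw [h4]
  have h5 : 0 ≤ (d : ℝ) * (κ * ‖Q x‖) := by positivity
  linarith

theorem norm_commOp_le {D : Fin d → L2 d →L[ℂ] L2 d} {η₁ η₂ : Fin d → Space d → ℝ} {κ : ℝ}
    (hκ : 0 ≤ κ) (h₁ : ∀ j x, |η₁ j x| ≤ κ) (h₂ : ∀ j x, |η₂ j x| ≤ κ) :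
    ‖commOp Q D η₁ η₂‖ ≤ κ * (∑ j, ‖D j‖ + d * ‖Q‖) := by
  refine ContinuousLinearMap.opNorm_le_bound _ (by positivity) fun x => ?_
  refine (norm_commOp_apply_le hκ h₁ h₂ x).trans ?_
  rw [mul_assoc, add_mul, Finset.sum_mul, mul_assoc]
  gcongr with j
  · exact (D j).le_opNorm x
  · exact Q.le_opNorm x

theorem IsRes.inner_mulR_sub (h : IsRes V μ C Q) {D : Fin d → L2 d →L[ℂ] L2 d} (hD : IsGrad Q D)
    {η : Space d → ℝ} {η₁ η₂ : Fin d → Space d → ℝ} (hη : SmoothMul η η₁ η₂) (x y : L2 d) :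
    inner ℂ x (mulR η (Q y)) - inner ℂ (mulR η (Q x)) y = inner ℂ (Q x) (commOp Q D η₁ η₂ y) := by
  have h1 := congrArg (fun T : L2 d →L[ℂ] L2 d => T y) (h.mulR_mul_sub hD hη)
  simp only [sub_apply, mul_apply_eq_comp] at h1
  rw [sub_eq_iff_eq_add] at h1
  rw [h1, inner_add_right, h.inner_right, h.inner_right, ← mulB_inner_ofReal]
  simp [mulR]

/-- After inserting `x = (H + μ) Q x` and the same for `y`, the contributions of `V` and `μ` cancel
against the multiplication operator `W`; the factor `1/2` is that of `-½Δ`. -/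
theorem IsRes.norm_inner_mulR_sub_le (h : IsRes V μ C Q) {D : Fin d → L2 d →L[ℂ] L2 d}
    (hD : IsGrad Q D) {W : Space d → ℝ} (hW : MemLp W ⊤ volume) (hp : ∀ j, parNorm j W ≠ ⊤)
    (x y : L2 d) :
    ‖inner ℂ x (mulR W (Q y)) - inner ℂ (mulR W (Q x)) y‖ ≤
      1 / 2 * ∑ j, (parNorm j W).toReal * (‖D j x‖ * ‖Q y‖ + ‖Q x‖ * ‖D j y‖) := by
  have hW' : MemLp (fun x => (W x : ℂ)) ⊤ volume := hW.ofReal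
  obtain ⟨v, w, h1, h2, h3⟩ := h.sch x
  obtain ⟨v', w', h1', h2', h3'⟩ := h.sch y
  have h4 := inner_lap_commutator hW' (fun j => ENNReal.toReal_nonneg)
    (fun j φ => norm_integral_le_parNorm j hW (hp j) φ) h1 (fun j => hD j x) h1' (fun j => hD j y)
  have h5 : inner ℂ w (mulR W (Q y)) = inner ℂ (mulR W (Q x)) w' := by
    rw [← mulB_inner_ofReal]
    exact ((h2'.mulR_comm hW').inner_eq (by simpa only [Complex.conj_ofReal] using h2)).symm
  have h6 : inner ℂ (Q x) (mulR W (Q y)) = inner ℂ (mulR W (Q x)) (Q y) := mulB_inner_ofReal _ _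
  have h7 : x = (-(1 / 2) : ℂ) • v + w + (μ : ℂ) • Q x := by rw [← h3]; abel
  have h8 : y = (-(1 / 2) : ℂ) • v' + w' + (μ : ℂ) • Q y := by rw [← h3']; abel
  have h9 : inner ℂ x (mulR W (Q y)) - inner ℂ (mulR W (Q x)) y =
      (-(1 / 2) : ℂ) * (inner ℂ v (mulR W (Q y)) - inner ℂ (mulR W (Q x)) v') := by
    conv_lhs => enter [1, 2]; rw [h7]
    conv_lhs => enter [2, 3]; rw [h8]
    simp only [inner_add_left, inner_add_right, inner_smul_left, inner_smul_right,
      Complex.conj_ofReal]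
    rw [h5, h6]
    have : conj (-(1 / 2) : ℂ) = -(1 / 2) := by
      rw [show (-(1 / 2) : ℂ) = ((-(1 / 2) : ℝ) : ℂ) by push_cast; rfl, Complex.conj_ofReal]
    rw [this]
    ring
  rw [h9, norm_mul]
  have h10 : ‖(-(1 / 2) : ℂ)‖ = 1 / 2 := by simp
  rw [h10]
  gcongr

/-! ### The speed bound -/

/-- Apply the supremum that defines the speed bound to the normalized vector; a finite value forces
this vector into the domain of `|∇|`, since otherwise its term would be `∞`. -/
theorem norm_symGrad_le_speedBound {V : Space d → ℝ} {I : Set ℝ} (hfin : speedBound V I ≠ ⊤)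
    {v : L2 d} (hv : v ∈ spectralSubspace (schrodinger V) I) :
    ∃ w, HasFMul symGrad v w ∧ ‖w‖ ≤ (speedBound V I).toReal * ‖v‖ := by
  have hP : spectralProj (schrodinger V) I v = v := by
    have : CompleteSpace (spectralSubspace (schrodinger V) I) :=
      (Submodule.isClosed_topologicalClosure _).completeSpace_coe
    exact Submodule.starProjection_eq_self_iff.2 hv
  by_cases h0 : v = 0
  · refine ⟨0, ?_, by rw [norm_zero]; positivity⟩
    have := (hasFMul_fourierMul (m := (symGrad : Space d → ℂ)) 0)
    rw [LinearPMap.map_zero] at this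
    rw [h0]
    exact this
  have hn : 0 < ‖v‖ := norm_pos_iff.2 h0
  set u : L2 d := ((‖v‖⁻¹ : ℝ) : ℂ) • v with hu
  have hu1 : ‖u‖ ≤ 1 := by
    rw [hu, norm_smul, Complex.norm_real, norm_inv, norm_norm, inv_mul_cancel₀ hn.ne']
  have hPu : spectralProj (schrodinger V) I u = u := by rw [hu, map_smul, hP]
  have h1 : ⨅ h : spectralProj (schrodinger V) I u ∈ (absGrad d).domain,
      ‖absGrad d ⟨spectralProj (schrodinger V) I u, h⟩‖ₑ ≤ speedBound V I :=
    le_iSup₂_of_le (f := fun (u : L2 d) (_ : ‖u‖ ≤ 1) =>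
      ⨅ h : spectralProj (schrodinger V) I u ∈ (absGrad d).domain,
        ‖absGrad d ⟨spectralProj (schrodinger V) I u, h⟩‖ₑ) u hu1 le_rfl
  by_cases hdom : spectralProj (schrodinger V) I u ∈ (absGrad d).domain
  · rw [iInf_pos hdom] at h1
    have h2 : HasFMul symGrad (spectralProj (schrodinger V) I u) (absGrad d ⟨_, hdom⟩) :=
      hasFMul_fourierMul (m := (symGrad : Space d → ℂ)) ⟨_, hdom⟩
    set w := absGrad d ⟨_, hdom⟩
    have h3 : v = (‖v‖ : ℂ) • u := by
      rw [hu, smul_smul, ← Complex.ofReal_mul, mul_inv_cancel₀ hn.ne', Complex.ofReal_one, one_smul]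
    refine ⟨(‖v‖ : ℂ) • w, ?_, ?_⟩
    · have h4 := HasFMul.smul h2 (‖v‖ : ℂ)
      change HasFMul symGrad ((‖v‖ : ℂ) • spectralProj (schrodinger V) I u) _ at h4
      rw [hPu, ← h3] at h4
      exact h4
    · rw [norm_smul, Complex.norm_real, norm_norm, mul_comm]
      refine mul_le_mul_of_nonneg_right ?_ hn.le
      have h5 := ENNReal.toReal_mono hfin h1
      rwa [toReal_enorm] at h5
  · rw [iInf_neg hdom, top_le_iff] at h1
    exact absurd h1 hfin

theorem funcCalc_mem_spectralSubspace {H : L2 d →ₗ.[ℂ] L2 d} {f : ℝ → ℝ} (hf : Continuous f)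
    (hc : HasCompactSupport f) {I : Set ℝ} (hI : tsupport f ⊆ I) (u : L2 d) :
    funcCalc H f u ∈ spectralSubspace H I := by
  refine Submodule.le_topologicalClosure _ ?_
  have h1 : (funcCalc H f).range ≤
      ⨆ f ∈ {f : ℝ → ℝ | Continuous f ∧ HasCompactSupport f ∧ tsupport f ⊆ I},
        (funcCalc H f).range :=
    le_iSup₂_of_le (f := fun (f : ℝ → ℝ)
      (_ : f ∈ {f : ℝ → ℝ | Continuous f ∧ HasCompactSupport f ∧ tsupport f ⊆ I}) =>
        (funcCalc H f).range) f ⟨hf, hc, hI⟩ le_rfl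
  exact h1 ⟨u, rfl⟩

end MaxSpeed

namespace MaxSpeed

open scoped ComplexConjugate

/-! ### Weak solutions of the Schrödinger equation and the Heisenberg equation -/

section Dynamics

/-- A fine partition and a telescoping sum. Errors are measured against the integral of a weight
`N`, so no pointwise differentiability is needed, which suits perturbations that are merely locally
integrable in time. -/
theorem eq_integral_of_local {F G : ℝ → ℂ} {N : ℝ → ℝ} {a b : ℝ} (hab : a ≤ b)
    (hG : IntervalIntegrable G volume a b) (hN : IntervalIntegrable N volume a b)
    (h : ∀ ε > 0, ∃ δ > 0, ∀ s r, a ≤ s → s ≤ r → r ≤ b → r - s < δ →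
      ‖F r - F s - ∫ x in s..r, G x‖ ≤ ε * ∫ x in s..r, N x) :
    F b - F a = ∫ x in a..b, G x := by
  have hsub : ∀ {s r : ℝ}, a ≤ s → s ≤ r → r ≤ b → uIcc s r ⊆ uIcc a b := fun h1 h2 h3 => by
    rw [uIcc_of_le h2, uIcc_of_le hab]
    exact Icc_subset_Icc h1 h3
  have key : ∀ ε > 0, ‖F b - F a - ∫ x in a..b, G x‖ ≤ ε * ∫ x in a..b, N x := by
    intro ε hε
    obtain ⟨δ, hδ, hloc⟩ := h ε hε
    obtain ⟨n, hn⟩ := exists_nat_gt ((b - a) / δ)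
    have hn0 : (0 : ℝ) < n := lt_of_le_of_lt (div_nonneg (sub_nonneg.2 hab) hδ.le) hn
    set p : ℕ → ℝ := fun k => a + k * ((b - a) / n) with hp
    have hstep : 0 ≤ (b - a) / n := div_nonneg (sub_nonneg.2 hab) hn0.le
    have hpn : p n = b := by simp only [hp]; field_simp; ring
    have hp0 : p 0 = a := by simp [hp]
    have hmono : Monotone p := fun i j hij => by
      simp only [hp]
      have : (i : ℝ) ≤ j := by exact_mod_cast hij
      gcongr
    have ha : ∀ k, a ≤ p k := fun k => hp0 ▸ hmono (Nat.zero_le k)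
    have hind : ∀ k ≤ n, ‖F (p k) - F a - ∫ x in a..p k, G x‖ ≤ ε * ∫ x in a..p k, N x := by
      intro k
      induction k with
      | zero => intro; simp [hp0]
      | succ k ih =>
        intro hk
        have hb : p (k + 1) ≤ b := hpn ▸ hmono hk
        have h1 : p k ≤ p (k + 1) := hmono (Nat.le_succ k)
        have h2 := ih (by omega)
        have h3 := hloc (p k) (p (k + 1)) (ha k) h1 hb (by
          simp only [hp]; push_cast
          rw [div_lt_iff₀ hδ] at hn
          have : (b - a) / n < δ := by rw [div_lt_iff₀ hn0]; linarith
          linarith)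
        have h4 := hsub le_rfl (ha k) (h1.trans hb)
        have h5 := hsub (ha k) h1 hb
        rw [← intervalIntegral.integral_add_adjacent_intervals (hG.mono_set h4) (hG.mono_set h5),
          ← intervalIntegral.integral_add_adjacent_intervals (hN.mono_set h4) (hN.mono_set h5),
          mul_add]
        refine le_trans ?_ (add_le_add h2 h3)
        refine le_trans (le_of_eq ?_) (norm_add_le _ _)
        congr 1
        ring
    have := hind n le_rfl
    rwa [hpn] at this
  have h0 : ‖F b - F a - ∫ x in a..b, G x‖ ≤ 0 := by
    refine le_of_forall_pos_le_add fun e he => ?_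
    set M := |∫ x in a..b, N x| + 1
    have hM : 0 < M := by positivity
    refine (key (e / M) (by positivity)).trans ?_
    rw [zero_add, div_mul_eq_mul_div, div_le_iff₀ hM]
    gcongr
    exact (le_abs_self _).trans (by simp [M])
  exact sub_eq_zero.1 (norm_le_zero_iff.1 h0)

theorem exists_uniform {X : Type*} [NormedAddCommGroup X] {f : ℝ → ℝ → X}
    (hf : Continuous (Function.uncurry f)) (a b : ℝ) {ε : ℝ} (hε : 0 < ε) :
    ∃ δ > 0, ∀ s ∈ Icc a b, ∀ r ∈ Icc a b, ∀ s' ∈ Icc a b, ∀ r' ∈ Icc a b,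
      |s - s'| < δ → |r - r'| < δ → ‖f s r - f s' r'‖ ≤ ε := by
  have h1 := (isCompact_Icc (a := a) (b := b)).prod (isCompact_Icc (a := a) (b := b))
  have h2 := h1.uniformContinuousOn_of_continuous hf.continuousOn
  rw [Metric.uniformContinuousOn_iff] at h2
  obtain ⟨δ, hδ, h3⟩ := h2 ε hε
  refine ⟨δ, hδ, fun s hs r hr s' hs' r' hr' h4 h5 => ?_⟩
  have := h3 (s, r) ⟨hs, hr⟩ (s', r') ⟨hs', hr'⟩ (by
    rw [Prod.dist_eq]; exact max_lt h4 h5)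
  rw [dist_eq_norm] at this
  exact this.le

variable {E : Type*} [NormedAddCommGroup E] [InnerProductSpace ℂ E]

/-- A time dependent bounded symmetric perturbation, with locally integrable norm. -/
structure IsPert (B : ℝ → E →L[ℂ] E) (n : ℝ → ℝ) : Prop where
  meas : ∀ u v, Measurable fun r => inner ℂ u (B r v)
  symm : ∀ r u v, inner ℂ u (B r v) = inner ℂ (B r u) v
  bound : ∀ r, ‖B r‖ ≤ n r
  int : ∀ T, IntegrableOn n (Ioc 0 T)

/-- A weak solution of `i ∂_t θ = (Q⁻¹ + B_t) θ`, `t ≥ 0`. -/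
structure IsSol (Q : E →L[ℂ] E) (B : ℝ → E →L[ℂ] E) (θ : ℝ → E) : Prop where
  cont : Continuous θ
  eq : ∀ x s t, 0 ≤ s → s ≤ t → inner ℂ (Q x) (θ t) - inner ℂ (Q x) (θ s) =
    -Complex.I * ∫ r in s..t, (inner ℂ x (θ r) + inner ℂ (Q x) (B r (θ r)))

variable {B : ℝ → E →L[ℂ] E} {n : ℝ → ℝ} {Q : E →L[ℂ] E} {θ η : ℝ → E}

theorem IsPert.nonneg (hB : IsPert B n) (r : ℝ) : 0 ≤ n r := (norm_nonneg _).trans (hB.bound r)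

theorem IsPert.intervalIntegrable_bound (hB : IsPert B n) {s t : ℝ} (hs : 0 ≤ s) (hst : s ≤ t) :
    IntervalIntegrable n volume s t := by
  rw [intervalIntegrable_iff_integrableOn_Ioc_of_le hst]
  exact (hB.int t).mono_set (Ioc_subset_Ioc_left hs)

theorem IsPert.norm_inner_le (hB : IsPert B n) (r : ℝ) (x y : E) :
    ‖inner ℂ x (B r y)‖ ≤ ‖x‖ * ‖y‖ * n r := by
  calc ‖inner ℂ x (B r y)‖ ≤ ‖x‖ * ‖B r y‖ := norm_inner_le_norm _ _
    _ ≤ ‖x‖ * (n r * ‖y‖) := by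
        gcongr
        exact (B r).le_of_opNorm_le (hB.bound r) y
    _ = _ := by ring

theorem IsSol.eq_left (hθ : IsSol Q B θ) (x : E) {s t : ℝ} (hs : 0 ≤ s)
    (hst : s ≤ t) : inner ℂ (θ t) (Q x) - inner ℂ (θ s) (Q x) =
      Complex.I * ∫ r in s..t, (inner ℂ (θ r) x + inner ℂ (B r (θ r)) (Q x)) := by
  have h := congrArg conj (hθ.eq x s t hs hst)
  rw [map_sub, inner_conj_symm, inner_conj_symm, map_mul, map_neg, Complex.conj_I, neg_neg,
    intervalIntegral.integral_of_le hst, ← integral_conj] at h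
  rw [h, intervalIntegral.integral_of_le hst]
  congr 2
  ext r
  rw [map_add, inner_conj_symm, inner_conj_symm]

variable [SecondCountableTopology E]

theorem IsPert.measurable_inner (hB : IsPert B n) {x y : ℝ → E} (hx : Continuous x)
    (hy : Continuous y) : Measurable fun r => inner ℂ (x r) (B r (y r)) := by
  borelize E
  have h : StronglyMeasurable (Function.uncurry fun (p : E × E) (r : ℝ) => inner ℂ p.1 (B r p.2)) := by
    refine stronglyMeasurable_uncurry_of_continuous_of_stronglyMeasurable (fun r => ?_) fun p =>
      (hB.meas p.1 p.2).stronglyMeasurable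
    exact Continuous.inner continuous_fst ((B r).continuous.comp continuous_snd)
  exact (h.comp_measurable ((hx.measurable.prodMk hy.measurable).prodMk measurable_id)).measurable

theorem IsPert.intervalIntegrable (hB : IsPert B n) {x y : ℝ → E} (hx : Continuous x)
    (hy : Continuous y) {s t : ℝ} (hs : 0 ≤ s) (hst : s ≤ t) :
    IntervalIntegrable (fun r => inner ℂ (x r) (B r (y r))) volume s t := by
  obtain ⟨M, hM⟩ := (isCompact_Icc (a := s) (b := t)).exists_bound_of_continuousOn
    (f := fun r => ‖x r‖ * ‖y r‖) (by fun_prop)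
  refine ((hB.intervalIntegrable_bound hs hst).const_mul M).mono_fun'
    (hB.measurable_inner hx hy).aestronglyMeasurable ?_
  refine (ae_restrict_iff' measurableSet_uIoc).2 (ae_of_all _ fun r hr => ?_)
  rw [uIoc_of_le hst] at hr
  refine (hB.norm_inner_le r _ _).trans ?_
  refine mul_le_mul_of_nonneg_right ?_ (hB.nonneg r)
  exact (le_abs_self _).trans (hM r ⟨hr.1.le, hr.2⟩)

theorem IsPert.intervalIntegrable' (hB : IsPert B n) {x y : ℝ → E} (hx : Continuous x)
    (hy : Continuous y) {s t : ℝ} (hs : 0 ≤ s) (hst : s ≤ t) :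
    IntervalIntegrable (fun r => inner ℂ (B r (x r)) (y r)) volume s t := by
  simp_rw [← hB.symm]
  exact hB.intervalIntegrable hx hy hs hst

/-- The product rule when `θ` and `η` are differentiable only against the range of `Q`. On a short
interval the observable changes first, then `θ` tested against `Q L` with `L` and `η` frozen, then
`η` tested against `Q L'` with `θ` frozen; hence `K` must factor through `Q` on both sides. -/
theorem IsSol.heisenberg (hB : IsPert B n) (hθ : IsSol Q B θ) (hη : IsSol Q B η)
    {K K' L L' : ℝ → E →L[ℂ] E} (hK : ∀ r x, K r x = Q (L r x))
    (hK' : ∀ r x y, inner ℂ x (K r y) = inner ℂ (Q (L' r x)) y)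
    (hKd : ∀ r, HasDerivAt K (K' r) r) (hK'c : Continuous K') (hL : Continuous L)
    (hL' : Continuous L') {a b : ℝ} (ha : 0 ≤ a) (hab : a ≤ b) :
    IntervalIntegrable (fun r => inner ℂ (θ r) (K' r (η r)) + Complex.I *
        (inner ℂ (θ r) (L r (η r)) + inner ℂ (B r (θ r)) (K r (η r)) -
          (inner ℂ (L' r (θ r)) (η r) + inner ℂ (Q (L' r (θ r))) (B r (η r))))) volume a b ∧
      inner ℂ (θ b) (K b (η b)) - inner ℂ (θ a) (K a (η a)) =
        ∫ r in a..b, (inner ℂ (θ r) (K' r (η r)) + Complex.I *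
        (inner ℂ (θ r) (L r (η r)) + inner ℂ (B r (θ r)) (K r (η r)) -
          (inner ℂ (L' r (θ r)) (η r) + inner ℂ (Q (L' r (θ r))) (B r (η r))))) := by
  have hKc : Continuous K := continuous_iff_continuousAt.2 fun r => (hKd r).continuousAt
  have hθc := hθ.cont
  have hηc := hη.cont
  have hint : IntervalIntegrable (fun r => inner ℂ (θ r) (K' r (η r)) + Complex.I *
        (inner ℂ (θ r) (L r (η r)) + inner ℂ (B r (θ r)) (K r (η r)) -
          (inner ℂ (L' r (θ r)) (η r) + inner ℂ (Q (L' r (θ r))) (B r (η r))))) volume a b := by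
    have c1 : Continuous fun r => inner ℂ (θ r) (K' r (η r)) := by fun_prop
    have c2 : Continuous fun r => inner ℂ (θ r) (L r (η r)) := by fun_prop
    have c3 : Continuous fun r => inner ℂ (L' r (θ r)) (η r) := by fun_prop
    exact (c1.intervalIntegrable _ _).add ((((c2.intervalIntegrable _ _).add
      (hB.intervalIntegrable' hθc (by fun_prop) ha hab)).sub ((c3.intervalIntegrable _ _).add
        (hB.intervalIntegrable (by fun_prop) hηc ha hab))).const_mul _)
  refine ⟨hint, ?_⟩
  obtain ⟨M₁, hM₁⟩ := (isCompact_Icc (a := a) (b := b)).exists_bound_of_continuousOn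
    hθc.continuousOn
  obtain ⟨M₂, hM₂⟩ := (isCompact_Icc (a := a) (b := b)).exists_bound_of_continuousOn
    hηc.continuousOn
  have hM₁0 : 0 ≤ M₁ := (norm_nonneg _).trans (hM₁ a (left_mem_Icc.2 hab))
  have hM₂0 : 0 ≤ M₂ := (norm_nonneg _).trans (hM₂ a (left_mem_Icc.2 hab))
  -- The summands of the weight belong, in order, to the errors from freezing `K'`, `L`, `K` next to
  -- `B`, `L'`, and `Q L'` next to `B`.
  refine eq_integral_of_local (F := fun r => inner ℂ (θ r) (K r (η r)))
    (N := fun r => 1 + M₁ + M₁ * n r + (M₂ + M₂ * n r)) hab hint ?_ fun ε hε => ?_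
  · have := hB.intervalIntegrable_bound ha hab
    exact (intervalIntegrable_const.add (this.const_mul _)).add
      (intervalIntegrable_const.add (this.const_mul _))
  obtain ⟨δ₁, hδ₁, u₁⟩ := exists_uniform (f := fun s r => inner ℂ (θ r) (K' s (η r)))
    (by fun_prop) a b hε
  obtain ⟨δ₂, hδ₂, u₂⟩ := exists_uniform (f := fun s r => L s (η r)) (by fun_prop) a b hε
  obtain ⟨δ₃, hδ₃, u₃⟩ := exists_uniform (f := fun s r => K s (η r)) (by fun_prop) a b hε
  obtain ⟨δ₄, hδ₄, u₄⟩ := exists_uniform (f := fun s r => L' s (θ r)) (by fun_prop) a b hε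
  obtain ⟨δ₅, hδ₅, u₅⟩ := exists_uniform (f := fun s r => Q (L' s (θ r))) (by fun_prop) a b hε
  refine ⟨min δ₁ (min δ₂ (min δ₃ (min δ₄ δ₅))), by positivity, fun s r has hsr hrb hδ => ?_⟩
  simp only [lt_min_iff] at hδ
  obtain ⟨e₁, e₂, e₃, e₄, e₅⟩ := hδ
  have hs0 : 0 ≤ s := ha.trans has
  have d1 : inner ℂ (θ r) (K r (η r)) - inner ℂ (θ r) (K s (η r)) =
      ∫ σ in s..r, inner ℂ (θ r) (K' σ (η r)) := by
    have hd : ∀ σ ∈ uIcc s r, HasDerivAt (fun σ => inner ℂ (θ r) (K σ (η r)))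
        (inner ℂ (θ r) (K' σ (η r))) σ := fun σ _ => by
      have h1 : HasDerivAt (fun σ => K σ (η r)) (K' σ (η r)) σ :=
        ((ContinuousLinearMap.apply ℂ E (η r)).restrictScalars ℝ).hasFDerivAt.comp_hasDerivAt σ
          (hKd σ)
      have h2 := (hasDerivAt_const σ (θ r)).inner ℂ h1
      rwa [inner_zero_left, add_zero] at h2
    refine (intervalIntegral.integral_eq_sub_of_hasDerivAt hd ?_).symm
    exact Continuous.intervalIntegrable (by fun_prop) _ _
  have d2 := hθ.eq_left (L s (η r)) hs0 hsr
  have d3 := hη.eq (L' s (θ s)) s r hs0 hsr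
  rw [← hK] at d2
  have i1 : IntervalIntegrable (fun σ => inner ℂ (θ r) (K' σ (η r))) volume s r :=
    Continuous.intervalIntegrable (by fun_prop) _ _
  have i2 : IntervalIntegrable (fun σ => inner ℂ (θ σ) (L s (η r)) +
      inner ℂ (B σ (θ σ)) (K s (η r))) volume s r :=
    (Continuous.intervalIntegrable (by fun_prop) _ _).add
      (hB.intervalIntegrable' hθc continuous_const hs0 hsr)
  have i3 : IntervalIntegrable (fun σ => inner ℂ (L' s (θ s)) (η σ) +
      inner ℂ (Q (L' s (θ s))) (B σ (η σ))) volume s r :=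
    (Continuous.intervalIntegrable (by fun_prop) _ _).add
      (hB.intervalIntegrable continuous_const hηc hs0 hsr)
  have i4 : IntervalIntegrable (fun r => inner ℂ (θ r) (K' r (η r)) + Complex.I *
        (inner ℂ (θ r) (L r (η r)) + inner ℂ (B r (θ r)) (K r (η r)) -
          (inner ℂ (L' r (θ r)) (η r) + inner ℂ (Q (L' r (θ r))) (B r (η r))))) volume s r :=
    hint.mono_set (by
      rw [uIcc_of_le hsr, uIcc_of_le hab]
      exact Icc_subset_Icc has hrb)
  have hF : inner ℂ (θ r) (K r (η r)) - inner ℂ (θ s) (K s (η s)) =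
      ∫ σ in s..r, (inner ℂ (θ r) (K' σ (η r)) + Complex.I * ((inner ℂ (θ σ) (L s (η r)) +
      inner ℂ (B σ (θ σ)) (K s (η r))) - (inner ℂ (L' s (θ s)) (η σ) +
      inner ℂ (Q (L' s (θ s))) (B σ (η σ))))) := by
    rw [intervalIntegral.integral_add i1 ((i2.sub i3).const_mul _),
      intervalIntegral.integral_const_mul, intervalIntegral.integral_sub i2 i3, mul_sub, ← d1, ← d2]
    rw [hK' s (θ s) (η s)]
    have d4 : inner ℂ (θ s) (K s (η r)) = inner ℂ (Q (L' s (θ s))) (η r) := hK' _ _ _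
    linear_combination d3 + d4
  rw [hF, ← intervalIntegral.integral_sub (i1.add ((i2.sub i3).const_mul _)) i4,
    ← intervalIntegral.integral_const_mul]
  have iN : IntervalIntegrable (fun σ => ε * (1 + M₁ + M₁ * n σ + (M₂ + M₂ * n σ))) volume s r := by
    have := hB.intervalIntegrable_bound hs0 hsr
    exact ((intervalIntegrable_const.add (this.const_mul _)).add
      (intervalIntegrable_const.add (this.const_mul _))).const_mul _
  refine intervalIntegral.norm_integral_le_of_norm_le hsr (ae_of_all _ fun σ hσ => ?_) iN
  have mr : r ∈ Icc a b := ⟨has.trans hsr, hrb⟩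
  have ms : s ∈ Icc a b := ⟨has, hsr.trans hrb⟩
  have mσ : σ ∈ Icc a b := ⟨has.trans hσ.1.le, hσ.2.trans hrb⟩
  have hrσ : |r - σ| ≤ r - s := by rw [abs_of_nonneg (by linarith [hσ.2])]; linarith [hσ.1]
  have hsσ : |s - σ| ≤ r - s := by rw [abs_of_nonpos (by linarith [hσ.1])]; linarith [hσ.2]
  have hσσ : |σ - σ| < δ₁ := by simpa using hδ₁
  have w1 := u₁ σ mσ r mr σ mσ σ mσ hσσ (by linarith)
  have w2 := u₂ s ms r mr σ mσ σ mσ (by linarith) (by linarith)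
  have w3 := u₃ s ms r mr σ mσ σ mσ (by linarith) (by linarith)
  have w4 := u₄ s ms s ms σ mσ σ mσ (by linarith) (by linarith)
  have w5 := u₅ s ms s ms σ mσ σ mσ (by linarith) (by linarith)
  have z2 : ‖inner ℂ (θ σ) (L s (η r) - L σ (η σ))‖ ≤ M₁ * ε :=
    (norm_inner_le_norm _ _).trans (mul_le_mul (hM₁ σ mσ) w2 (norm_nonneg _) hM₁0)
  have z3 : ‖inner ℂ (B σ (θ σ)) (K s (η r) - K σ (η σ))‖ ≤ M₁ * ε * n σ := by
    rw [← hB.symm]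
    refine (hB.norm_inner_le σ _ _).trans ?_
    exact mul_le_mul_of_nonneg_right (mul_le_mul (hM₁ σ mσ) w3 (norm_nonneg _) hM₁0) (hB.nonneg σ)
  have z4 : ‖inner ℂ (L' s (θ s) - L' σ (θ σ)) (η σ)‖ ≤ ε * M₂ :=
    (norm_inner_le_norm _ _).trans (mul_le_mul w4 (hM₂ σ mσ) (norm_nonneg _) hε.le)
  have z5 : ‖inner ℂ (Q (L' s (θ s)) - Q (L' σ (θ σ))) (B σ (η σ))‖ ≤ ε * M₂ * n σ := by
    refine (hB.norm_inner_le σ _ _).trans ?_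
    exact mul_le_mul_of_nonneg_right (mul_le_mul w5 (hM₂ σ mσ) (norm_nonneg _) hε.le) (hB.nonneg σ)
  rw [inner_sub_right] at z2 z3
  rw [inner_sub_left] at z4 z5
  have hsplit : ∀ A A' x₂ x₂' x₃ x₃' x₄ x₄' x₅ x₅' : ℂ,
      A + Complex.I * ((x₂ + x₃) - (x₄ + x₅)) - (A' + Complex.I * (x₂' + x₃' - (x₄' + x₅'))) =
      (A - A') + Complex.I * ((x₂ - x₂') + (x₃ - x₃') - ((x₄ - x₄') + (x₅ - x₅'))) := by
    intros; ring
  rw [hsplit]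
  refine (norm_add_le _ _).trans ?_
  rw [norm_mul, Complex.norm_I, one_mul]
  refine (add_le_add w1 ((norm_sub_le _ _).trans (add_le_add (norm_add_le _ _)
    (norm_add_le _ _)))).trans ?_
  linarith

end Dynamics

end MaxSpeed

namespace MaxSpeed

open scoped ComplexConjugate

/-! ### Yosida regularization of a positive operator -/

section Regularization

variable {E : Type*} [NormedAddCommGroup E] [InnerProductSpace ℂ E]

/-- A bounded positive operator. -/
structure IsPos (Q : E →L[ℂ] E) : Prop where
  symm : ∀ x y, inner ℂ x (Q y) = inner ℂ (Q x) y
  pos : ∀ x, 0 ≤ (inner ℂ (Q x) x).re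

/-- `P = (Q + ε)⁻¹`. -/
structure IsYosida (Q : E →L[ℂ] E) (ε : ℝ) (P : E →L[ℂ] E) : Prop where
  pos : 0 < ε
  right : ∀ x, Q (P x) + (ε : ℂ) • P x = x
  comm : ∀ x, Q (P x) = P (Q x)
  symm : ∀ x y, inner ℂ x (P y) = inner ℂ (P x) y

theorem IsPos.exists_isYosida [CompleteSpace E] {Q : E →L[ℂ] E} (hQ : IsPos Q) {ε : ℝ}
    (hε : 0 < ε) : ∃ P, IsYosida Q ε P := by
  have h0 : 0 ≤ Q := (ContinuousLinearMap.nonneg_iff_isPositive Q).2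
    ⟨fun x y => (hQ.symm x y).symm, fun x => hQ.pos x⟩
  have h1 : -ε ∉ spectrum ℝ Q := fun h => by
    have := spectrum_nonneg_of_nonneg h0 h
    linarith
  rw [spectrum.notMem_iff] at h1
  have h2 : IsUnit (Q + (ε : ℂ) • 1) := by
    have : Q + (ε : ℂ) • 1 = -(algebraMap ℝ (E →L[ℂ] E) (-ε) - Q) := by
      rw [Algebra.algebraMap_eq_smul_one, neg_smul, neg_sub, sub_neg_eq_add]
      congr 1
    rw [this]
    exact h1.neg
  obtain ⟨u, hu⟩ := h2
  have hux : ∀ x, (u : E →L[ℂ] E) x = Q x + (ε : ℂ) • x := fun x => by rw [hu]; rfl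
  set P : E →L[ℂ] E := ((u⁻¹ : (E →L[ℂ] E)ˣ) : E →L[ℂ] E)
  have r1 : ∀ x, Q (P x) + (ε : ℂ) • P x = x := fun x => by
    rw [← hux, ← mul_apply_eq_comp, Units.mul_inv]; rfl
  have r2 : ∀ x, P (Q x) + (ε : ℂ) • P x = x := fun x => by
    rw [← map_smul, ← map_add, ← hux, ← mul_apply_eq_comp, Units.inv_mul]; rfl
  refine ⟨P, hε, r1, fun x => ?_, fun x y => ?_⟩
  · have := (r1 x).trans (r2 x).symm
    exact add_right_cancel this
  · conv_lhs => rw [← r1 x]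
    conv_rhs => rw [← r1 y]
    rw [inner_add_left, inner_add_right, inner_smul_left, inner_smul_right, Complex.conj_ofReal,
      hQ.symm]

variable {Q P : E →L[ℂ] E} {ε : ℝ}

/-- In `x = Q P x + ε P x` the cross term of the squared norm is not negative by positivity of `Q`,
so each summand is a contraction of `x`. -/
theorem IsYosida.norm_le (h : IsYosida Q ε P) (hQ : IsPos Q) (x : E) :
    ‖Q (P x)‖ ≤ ‖x‖ ∧ ‖(ε : ℂ) • P x‖ ≤ ‖x‖ := by
  have h1 : ‖x‖ ^ 2 = ‖Q (P x)‖ ^ 2 + 2 * (ε * (inner ℂ (Q (P x)) (P x)).re) +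
      ‖(ε : ℂ) • P x‖ ^ 2 := by
    conv_lhs => rw [← h.right x]
    rw [norm_add_sq (𝕜 := ℂ), inner_smul_right]
    simp
  have h2 := mul_nonneg h.pos.le (hQ.pos (P x))
  constructor
  · refine abs_le_of_sq_le_sq' ?_ (norm_nonneg _) |>.2
    nlinarith [sq_nonneg ‖(ε : ℂ) • P x‖]
  · refine abs_le_of_sq_le_sq' ?_ (norm_nonneg _) |>.2
    nlinarith [sq_nonneg ‖Q (P x)‖]

theorem IsYosida.inner_re (h : IsYosida Q ε P) (x : E) :
    (inner ℂ (P x) x).re = (inner ℂ (Q (P x)) (P x)).re + ε * ‖P x‖ ^ 2 := by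
  conv_lhs => enter [1, 3]; rw [← h.right x]
  rw [inner_add_right, inner_smul_right, Complex.add_re, inner_self_eq_norm_sq_to_K,
    ← inner_conj_symm (P x), Complex.conj_re]
  congr 1
  rw [Complex.re_ofReal_mul]
  norm_cast

theorem IsYosida.le_inner_re (h : IsYosida Q ε P) (x : E) :
    (inner ℂ (Q (P x)) (P x)).re ≤ (inner ℂ (P x) x).re := by
  rw [h.inner_re]
  linarith [mul_nonneg h.pos.le (sq_nonneg ‖P x‖)]

/-- Up to the factor `ε` and a sign, the energy `⟨Px, x⟩` differs from the expectation of `Q P` by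
`‖x‖²`. The norm is conserved and `Q P` has the form `Q L`, so the Heisenberg equation applies to
the energy. -/
theorem IsYosida.inner_eq (h : IsYosida Q ε P) (x : E) :
    ε * (inner ℂ (P x) x).re = ‖x‖ ^ 2 - (inner ℂ x (Q (P x))).re := by
  have h1 : (ε : ℂ) • P x = x - Q (P x) := eq_sub_of_add_eq' (h.right x)
  have h2 : ((ε : ℂ) * inner ℂ x (P x)).re = ‖x‖ ^ 2 - (inner ℂ x (Q (P x))).re := by
    rw [← inner_smul_right, h1, inner_sub_right, Complex.sub_re, inner_self_eq_norm_sq_to_K]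
    norm_cast
  rw [← h2, Complex.re_ofReal_mul, h.symm]

/-- The operators `Q P` are contractions and differ from the identity by `ε P`, which tends to zero
on the range of `Q`. This range is dense because `Q` is symmetric and injective. -/
theorem tendsto_yosida (hQ : IsPos Q) (hinj : ∀ x, Q x = 0 → x = 0) [CompleteSpace E]
    {ε : ℕ → ℝ} (hε : Tendsto ε atTop (𝓝 0)) {P : ℕ → E →L[ℂ] E} (hP : ∀ k, IsYosida Q (ε k) (P k))
    {y : ℕ → E} {x : E} (hy : Tendsto y atTop (𝓝 x)) :
    Tendsto (fun k => Q (P k (y k))) atTop (𝓝 x) := by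
  have hdense : ∀ δ > 0, ∃ v, ‖x - Q v‖ < δ := by
    intro δ hδ
    have h1 : (Q.range).topologicalClosure = ⊤ := by
      rw [Submodule.topologicalClosure_eq_top_iff, Submodule.eq_bot_iff]
      intro z hz
      refine hinj z ?_
      rw [← inner_self_eq_zero (𝕜 := ℂ), ← hQ.symm]
      have := hz (Q (Q z)) ⟨Q z, rfl⟩
      rwa [← inner_conj_symm, map_eq_zero] at this
    have h2 : x ∈ closure (Q.range : Set E) := by
      rw [← Submodule.topologicalClosure_coe, h1]; trivial
    obtain ⟨_, ⟨v, rfl⟩, hv⟩ := Metric.mem_closure_iff.1 h2 δ hδ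
    exact ⟨v, by rw [← dist_eq_norm]; exact hv⟩
  have hR : Tendsto (fun k => Q (P k x)) atTop (𝓝 x) := by
    rw [Metric.tendsto_atTop]
    intro δ hδ
    obtain ⟨v, hv⟩ := hdense (δ / 2) (by positivity)
    have h3 : Tendsto (fun k => |ε k| * ‖v‖) atTop (𝓝 0) := by
      simpa using (hε.abs.mul_const ‖v‖)
    obtain ⟨N, hN⟩ := (Metric.tendsto_atTop.1 h3) (δ / 2) (by positivity)
    refine ⟨N, fun k hk => ?_⟩
    have h4 := hN k hk
    rw [Real.dist_eq, sub_zero, abs_of_nonneg (by positivity)] at h4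
    rw [dist_comm, dist_eq_norm]
    have h5 : x - Q (P k x) = (ε k : ℂ) • P k (x - Q v) + (ε k : ℂ) • Q (P k v) := by
      rw [map_sub, smul_sub, (hP k).comm v, sub_add_cancel]
      exact (eq_sub_of_add_eq' ((hP k).right x)).symm
    rw [h5]
    refine (norm_add_le _ _).trans_lt ?_
    have h6 := ((hP k).norm_le hQ (x - Q v)).2
    have h7 : ‖(ε k : ℂ) • Q (P k v)‖ ≤ |ε k| * ‖v‖ := by
      rw [norm_smul, Complex.norm_real, Real.norm_eq_abs]
      gcongr
      exact ((hP k).norm_le hQ v).1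
    linarith
  have h8 : Tendsto (fun k => Q (P k (y k - x))) atTop (𝓝 0) := by
    refine squeeze_zero_norm (fun k => ((hP k).norm_le hQ _).1) ?_
    exact tendsto_iff_norm_sub_tendsto_zero.1 hy
  simpa using h8.add hR

end Regularization

/-! ### Energy growth and the regularized Heisenberg inequality -/

section Dynamics

variable {E : Type*} [NormedAddCommGroup E] [InnerProductSpace ℂ E] [SecondCountableTopology E]
  {B : ℝ → E →L[ℂ] E} {n : ℝ → ℝ} {Q : E →L[ℂ] E} {θ η : ℝ → E}

/-- For a function `L` of `Q` and `K = Q L`, only the perturbation changes the matrix elements. -/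
theorem IsSol.heisenberg_const (hB : IsPert B n) (hθ : IsSol Q B θ) (hη : IsSol Q B η)
    {K L : E →L[ℂ] E} (hK : ∀ x, K x = Q (L x)) (hKs : ∀ x y, inner ℂ x (K y) = inner ℂ (K x) y)
    (hLs : ∀ x y, inner ℂ x (L y) = inner ℂ (L x) y) {a b : ℝ} (ha : 0 ≤ a) (hab : a ≤ b) :
    inner ℂ (θ b) (K (η b)) - inner ℂ (θ a) (K (η a)) =
      ∫ r in a..b, Complex.I * (inner ℂ (B r (θ r)) (K (η r)) - inner ℂ (K (θ r)) (B r (η r))) := by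
  have h := (hθ.heisenberg hB hη (K := fun _ => K) (K' := fun _ => 0) (L := fun _ => L)
    (L' := fun _ => L) (fun _ => hK) (fun _ x y => by rw [hKs, hK]) (fun r => hasDerivAt_const r K)
    continuous_const continuous_const continuous_const ha hab).2
  rw [h]
  congr 1
  ext r
  rw [hLs, ← hK, zero_apply, inner_zero_right]
  ring

/-- The energy of a solution changes slowly if the commutators `[B_t, Q]` are small as forms. -/
theorem IsSol.sqrt_energy_le (hB : IsPert B n) (hθ : IsSol Q B θ) (hQ : IsPos Q) {ε : ℝ}
    {P : E →L[ℂ] E} (hP : IsYosida Q ε P) {N : ℝ} (hN : ∀ r, ‖θ r‖ = N) {m : ℝ → ℝ} {a b : ℝ}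
    (ha : 0 ≤ a) (hab : a ≤ b) (hm : IntervalIntegrable m volume a b) (hm0 : ∀ r, 0 ≤ m r)
    (hBQ : ∀ᵐ r ∂(volume.restrict (Ioc a b)), ∀ y, ‖inner ℂ y (B r (Q y)) - inner ℂ (B r (Q y)) y‖ ≤
      m r * Real.sqrt (inner ℂ (Q y) y).re * ‖Q y‖) :
    Real.sqrt (inner ℂ (P (θ a)) (θ a)).re ≤
      Real.sqrt (inner ℂ (P (θ b)) (θ b)).re + N * ∫ r in a..b, m r := by
  have hθc := hθ.cont
  have hN0 : 0 ≤ N := hN 0 ▸ norm_nonneg _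
  set F : ℝ → ℝ := fun r => (inner ℂ (P (θ r)) (θ r)).re with hF
  have hFc : Continuous F := by fun_prop
  have hF0 : ∀ r, 0 ≤ F r := fun r => (hQ.pos _).trans (hP.le_inner_re _)
  -- A substitute for Gronwall: at the maximal energy `S²` the integrated inequality reads `S² ≤ F b
  -- + N S ∫ m`, which gives `S ≤ √(F b) + N ∫ m`.
  obtain ⟨z, hz, hzmax⟩ := (isCompact_Icc (a := a) (b := b)).exists_isMaxOn
    (nonempty_Icc.2 hab) hFc.continuousOn
  set S := Real.sqrt (F z) with hS
  have hstep : ∀ c ∈ Icc a b, F c ≤ F b + N * S * ∫ r in a..b, m r := by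
    intro c hc
    have hc0 : 0 ≤ c := ha.trans hc.1
    have h1 := hθ.heisenberg_const hB hθ (K := Q * P) (L := P) (fun x => rfl)
      (fun x y => by
        rw [mul_apply_eq_comp, mul_apply_eq_comp, hQ.symm, hP.symm, ← hP.comm]) hP.symm hc0 hc.2
    have hsub : Ioc c b ⊆ Ioc a b := Ioc_subset_Ioc_left hc.1
    have hmc : IntervalIntegrable m volume c b := hm.mono_set (by
      rw [uIcc_of_le hc.2, uIcc_of_le hab]; exact Icc_subset_Icc hc.1 le_rfl)
    have h2 : ‖∫ r in c..b, Complex.I * (inner ℂ (B r (θ r)) ((Q * P) (θ r)) -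
        inner ℂ ((Q * P) (θ r)) (B r (θ r)))‖ ≤ ∫ r in c..b, ε * (N * S) * m r := by
      refine intervalIntegral.norm_integral_le_of_norm_le hc.2 ?_ (hmc.const_mul _)
      have h3 := (ae_restrict_iff' measurableSet_Ioc).1 hBQ
      filter_upwards [h3] with r hr hrc
      have h4 := hr (hsub hrc) (P (θ r))
      set y := P (θ r) with hy
      -- Insert `θ = Q y + ε y`. The part with `Q y` in both slots cancels by symmetry of `B`, and
      -- the remaining factor `ε` is the one that multiplies the energy, so the bound is uniform in
      -- `ε`.
      have h5 : inner ℂ (B r (θ r)) (Q y) - inner ℂ (Q y) (B r (θ r)) =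
          (ε : ℂ) * (inner ℂ y (B r (Q y)) - inner ℂ (B r (Q y)) y) := by
        conv_lhs => rw [← hP.right (θ r), ← hy]
        rw [map_add, map_smul, inner_add_left, inner_add_right, inner_smul_left, inner_smul_right,
          Complex.conj_ofReal, ← hB.symm r (Q y) (Q y), ← hB.symm r y (Q y), ← hB.symm r (Q y) y]
        ring
      rw [norm_mul, Complex.norm_I, one_mul, mul_apply_eq_comp, ← hy, h5, norm_mul,
        Complex.norm_real, Real.norm_eq_abs, abs_of_pos hP.pos]
      have h6 : Real.sqrt (inner ℂ (Q y) y).re ≤ S := by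
        refine Real.sqrt_le_sqrt ((hP.le_inner_re _).trans ?_)
        exact hzmax ⟨hc.1.trans hrc.1.le, hrc.2⟩
      have h7 : ‖Q y‖ ≤ N := hN r ▸ (hP.norm_le hQ _).1
      calc ε * _ ≤ ε * (m r * S * N) := by
            refine mul_le_mul_of_nonneg_left (h4.trans ?_) hP.pos.le
            exact mul_le_mul (mul_le_mul_of_nonneg_left h6 (hm0 r)) h7 (norm_nonneg _)
              (mul_nonneg (hm0 r) (Real.sqrt_nonneg _))
        _ = _ := by ring
    rw [← h1, intervalIntegral.integral_const_mul] at h2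
    have h8 := (Complex.abs_re_le_norm _).trans h2
    rw [Complex.sub_re, mul_apply_eq_comp, mul_apply_eq_comp] at h8
    have e1 := hP.inner_eq (θ b)
    have e2 := hP.inner_eq (θ c)
    rw [hN] at e1 e2
    have h9 : ε * (F c - F b) ≤ ε * (N * S * ∫ r in c..b, m r) := by
      have : ε * (F c - F b) = (inner ℂ (θ b) (Q (P (θ b)))).re - (inner ℂ (θ c) (Q (P (θ c)))).re := by
        rw [mul_sub, hF]; simp only; rw [e1, e2]; ring
      rw [this]
      refine (le_abs_self _).trans (h8.trans (le_of_eq (by ring)))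
    have h10 := le_of_mul_le_mul_left h9 hP.pos
    have h11 : ∫ r in c..b, m r ≤ ∫ r in a..b, m r := by
      rw [intervalIntegral.integral_of_le hc.2, intervalIntegral.integral_of_le hab]
      refine setIntegral_mono_set ?_ (ae_of_all _ hm0) (Eventually.of_forall hsub)
      rwa [intervalIntegrable_iff_integrableOn_Ioc_of_le hab] at hm
    have h12 : N * S * ∫ r in c..b, m r ≤ N * S * ∫ r in a..b, m r :=
      mul_le_mul_of_nonneg_left h11 (mul_nonneg hN0 (Real.sqrt_nonneg _))
    linarith
  have hω : 0 ≤ ∫ r in a..b, m r := intervalIntegral.integral_nonneg hab fun r _ => hm0 r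
  have k1 := hstep z hz
  have k2 : S ^ 2 = F z := Real.sq_sqrt (hF0 z)
  have k3 : Real.sqrt (F b) ^ 2 = F b := Real.sq_sqrt (hF0 b)
  have k4 : Real.sqrt (F a) ≤ S := Real.sqrt_le_sqrt (hzmax (left_mem_Icc.2 hab))
  refine k4.trans ?_
  by_contra hlt
  push Not at hlt
  have k5 : 0 ≤ Real.sqrt (F b) := Real.sqrt_nonneg _
  have k6 : 0 ≤ N * ∫ r in a..b, m r := mul_nonneg hN0 hω
  change Real.sqrt (F b) + N * ∫ r in a..b, m r < S at hlt
  nlinarith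

/-- The regularized Heisenberg inequality for a time dependent observable that commutes with the
perturbation. -/
theorem IsSol.re_inner_sub_le [CompleteSpace E] (hB : IsPert B n) (hθ : IsSol Q B θ) (hη : IsSol Q B η)
    (hQ : IsPos Q) (hinj : ∀ x, Q x = 0 → x = 0) {M M' : ℝ → E →L[ℂ] E}
    (hM : ∀ r x y, inner ℂ x (M r y) = inner ℂ (M r x) y) (hMB : ∀ r x, M r (B r x) = B r (M r x))
    (hMd : ∀ r, HasDerivAt M (M' r) r) (hM'c : Continuous M') {a b : ℝ} (ha : 0 ≤ a) (hab : a ≤ b)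
    {β : ℝ → ℝ} (hβ : IntervalIntegrable β volume a b)
    (hle : ∀ ε > 0, ∀ P, IsYosida Q ε P → ∀ᵐ r ∂(volume.restrict (Ioc a b)),
      (inner ℂ (Q (P (θ r))) (M' r (Q (P (η r)))) + Complex.I *
        (inner ℂ (P (θ r)) (M r (Q (P (η r)))) - inner ℂ (M r (Q (P (θ r)))) (P (η r)))).re ≤ β r) :
    (inner ℂ (θ b) (M b (η b)) - inner ℂ (θ a) (M a (η a))).re ≤ ∫ r in a..b, β r := by
  have hθc := hθ.cont
  have hηc := hη.cont
  have hMc : Continuous M := continuous_iff_continuousAt.2 fun r => (hMd r).continuousAt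
  set ε : ℕ → ℝ := fun k => 1 / ((k : ℝ) + 1) with hε
  have hεpos : ∀ k, 0 < ε k := fun k => by positivity
  have hεlim : Tendsto ε atTop (𝓝 0) := tendsto_one_div_add_atTop_nhds_zero_nat
  choose P hP using fun k => hQ.exists_isYosida (hεpos k)
  have hRs : ∀ k x y, inner ℂ x (Q (P k y)) = inner ℂ (Q (P k x)) y := fun k x y => by
    rw [hQ.symm, (hP k).symm, ← (hP k).comm]
  -- The contribution of the perturbation to the derivative of `R M R`. It does not vanish for fixed
  -- `ε`, but tends to zero because `M` commutes with `B` and `R` tends strongly to one.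
  set wt : ℕ → ℝ → ℂ := fun k r => inner ℂ (B r (θ r)) (Q (P k (M r (Q (P k (η r)))))) -
    inner ℂ (Q (P k (M r (Q (P k (θ r)))))) (B r (η r)) with hwt
  have hwti : ∀ k, IntervalIntegrable (wt k) volume a b := fun k =>
    (hB.intervalIntegrable' hθc (by fun_prop) ha hab).sub
      (hB.intervalIntegrable (by fun_prop) hηc ha hab)
  have hineq : ∀ k, (inner ℂ (Q (P k (θ b))) (M b (Q (P k (η b)))) -
      inner ℂ (Q (P k (θ a))) (M a (Q (P k (η a))))).re ≤
      (∫ r in a..b, β r) + ∫ r in a..b, ‖wt k r‖ := by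
    intro k
    set R : E →L[ℂ] E := Q * P k with hR
    have hRx : ∀ x, R x = Q (P k x) := fun _ => rfl
    have hd : ∀ r, HasDerivAt (fun r => R * M r * R) (R * M' r * R) r := fun r => by
      let T : (E →L[ℂ] E) →L[ℝ] (E →L[ℂ] E) :=
        ((ContinuousLinearMap.mul ℂ (E →L[ℂ] E)).flip R ∘L
          (ContinuousLinearMap.mul ℂ (E →L[ℂ] E) R)).restrictScalars ℝ
      exact T.hasFDerivAt.comp_hasDerivAt r (hMd r)
    have hMR : ∀ r x y, inner ℂ x (R (M r (R y))) = inner ℂ (R (M r (R x))) y := fun r x y => by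
      rw [hRx, hRs, hM, ← hRx, hRx y, hRs]; rfl
    -- With `R = Q P` the sandwiched observable is `Q (P M R)`, the factorization that the
    -- Heisenberg equation needs.
    obtain ⟨h1, h2⟩ := hθ.heisenberg hB hη (K := fun r => R * M r * R) (K' := fun r => R * M' r * R)
      (L := fun r => P k * M r * R) (L' := fun r => P k * M r * R) (fun r x => rfl)
      (fun r x y => hMR r x y) hd (by fun_prop) (by fun_prop) (by fun_prop) ha hab
    have h3 : ∀ x y r, inner ℂ x ((R * M r * R) y) = inner ℂ (Q (P k x)) (M r (Q (P k y))) :=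
      fun x y r => hRs k _ _
    rw [← h3, ← h3, h2, ← intervalIntegral.integral_add hβ (hwti k).norm]
    rw [intervalIntegral.integral_of_le hab, intervalIntegral.integral_of_le hab]
    rw [intervalIntegrable_iff_integrableOn_Ioc_of_le hab] at h1
    have hβ' := (intervalIntegrable_iff_integrableOn_Ioc_of_le hab).1 (hβ.add (hwti k).norm)
    rw [← RCLike.re_eq_complex_re, ← integral_re h1]
    refine integral_mono_ae h1.re hβ' ?_
    filter_upwards [hle (ε k) (hεpos k) (P k) (hP k)] with r hr
    have h4 : inner ℂ (θ r) ((R * M' r * R) (η r)) = inner ℂ (Q (P k (θ r))) (M' r (Q (P k (η r)))) :=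
      hRs k _ _
    have h5 : inner ℂ (θ r) ((P k * M r * R) (η r)) = inner ℂ (P k (θ r)) (M r (Q (P k (η r)))) :=
      (hP k).symm _ _
    have h6 : inner ℂ ((P k * M r * R) (θ r)) (η r) = inner ℂ (M r (Q (P k (θ r)))) (P k (η r)) :=
      ((hP k).symm _ _).symm
    have h7 : inner ℂ (θ r) ((R * M' r * R) (η r)) + Complex.I *
        (inner ℂ (θ r) ((P k * M r * R) (η r)) + inner ℂ (B r (θ r)) ((R * M r * R) (η r)) -
          (inner ℂ ((P k * M r * R) (θ r)) (η r) + inner ℂ (Q ((P k * M r * R) (θ r))) (B r (η r)))) =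
        (inner ℂ (Q (P k (θ r))) (M' r (Q (P k (η r)))) + Complex.I *
        (inner ℂ (P k (θ r)) (M r (Q (P k (η r)))) - inner ℂ (M r (Q (P k (θ r)))) (P k (η r)))) +
        Complex.I * wt k r := by
      rw [h4, h5, h6]
      simp only [hwt, mul_apply_eq_comp, hRx]
      ring
    rw [h7, RCLike.re_eq_complex_re, Complex.add_re]
    refine add_le_add hr ((Complex.re_le_norm _).trans ?_)
    rw [norm_mul, Complex.norm_I, one_mul]
  have hlim : ∀ x y r, Tendsto (fun k => inner ℂ (Q (P k x)) (M r (Q (P k y)))) atTop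
      (𝓝 (inner ℂ x (M r y))) := fun x y r =>
    (tendsto_yosida hQ hinj hεlim hP tendsto_const_nhds).inner
      (((M r).continuous.tendsto _).comp (tendsto_yosida hQ hinj hεlim hP tendsto_const_nhds))
  have hwlim : Tendsto (fun k => ∫ r in a..b, ‖wt k r‖) atTop (𝓝 0) := by
    obtain ⟨C₁, hC₁⟩ := (isCompact_Icc (a := a) (b := b)).exists_bound_of_continuousOn
      (f := fun r => ‖θ r‖ * (‖M r‖ * ‖η r‖)) (by fun_prop)
    have h0 : ∫ r in a..b, (0 : ℝ) = 0 := intervalIntegral.integral_zero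
    rw [← h0]
    refine intervalIntegral.tendsto_integral_filter_of_dominated_convergence
      (fun r => 2 * C₁ * n r) (Eventually.of_forall fun k => by
        rw [uIoc_of_le hab]; exact (hwti k).norm.1.aestronglyMeasurable)
      (Eventually.of_forall fun k => ae_of_all _ fun r hr => ?_)
      ((hB.intervalIntegrable_bound ha hab).const_mul _) (ae_of_all _ fun r hr => ?_)
    · rw [uIoc_of_le hab] at hr
      have hC := (le_abs_self _).trans (hC₁ r ⟨hr.1.le, hr.2⟩)
      have hRMR : ∀ x, ‖Q (P k (M r (Q (P k x))))‖ ≤ ‖M r‖ * ‖x‖ := fun x =>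
        (((hP k).norm_le hQ _).1.trans ((M r).le_opNorm _)).trans (by
          gcongr; exact ((hP k).norm_le hQ _).1)
      rw [norm_norm]
      refine (norm_sub_le _ _).trans ?_
      rw [← hB.symm]
      have h1 : ‖inner ℂ (θ r) (B r (Q (P k (M r (Q (P k (η r)))))))‖ ≤ C₁ * n r :=
        (hB.norm_inner_le r _ _).trans (mul_le_mul_of_nonneg_right
          ((mul_le_mul_of_nonneg_left (hRMR _) (norm_nonneg _)).trans hC) (hB.nonneg r))
      have h2 : ‖inner ℂ (Q (P k (M r (Q (P k (θ r)))))) (B r (η r))‖ ≤ C₁ * n r :=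
        (hB.norm_inner_le r _ _).trans (mul_le_mul_of_nonneg_right
          ((mul_le_mul_of_nonneg_right (hRMR _) (norm_nonneg _)).trans
            ((le_of_eq (by ring)).trans hC)) (hB.nonneg r))
      linarith
    · have ht : ∀ x, Tendsto (fun k => Q (P k (M r (Q (P k x))))) atTop (𝓝 (M r x)) := fun x =>
        tendsto_yosida hQ hinj hεlim hP (((M r).continuous.tendsto _).comp
          (tendsto_yosida hQ hinj hεlim hP tendsto_const_nhds))
      have h1 : Tendsto (fun k => wt k r) atTop
          (𝓝 (inner ℂ (B r (θ r)) (M r (η r)) - inner ℂ (M r (θ r)) (B r (η r)))) :=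
        (tendsto_const_nhds.inner (ht _)).sub ((ht _).inner tendsto_const_nhds)
      have h2 : inner ℂ (B r (θ r)) (M r (η r)) - inner ℂ (M r (θ r)) (B r (η r)) = 0 := by
        rw [← hB.symm, ← hMB, hM, sub_self]
      rw [h2] at h1
      simpa using h1.norm
  refine le_of_tendsto_of_tendsto ((Complex.continuous_re.tendsto _).comp
    ((hlim (θ b) (η b) b).sub (hlim (θ a) (η a) a))) (tendsto_const_nhds.add hwlim)
    (Eventually.of_forall hineq) |>.trans_eq (add_zero _)

end Dynamics

end MaxSpeed

namespace MaxSpeed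

open scoped ComplexConjugate

/-! ### The asymptotic observable -/

section Asymptotic

variable {E : Type*} [NormedAddCommGroup E] [InnerProductSpace ℂ E] [CompleteSpace E]

/-- The observable `K` in the Heisenberg picture. -/
noncomputable def heis (U : unitary (E →L[ℂ] E)) (K : E →L[ℂ] E) : E →L[ℂ] E :=
  ((U⁻¹ : unitary (E →L[ℂ] E)) : E →L[ℂ] E) * K * (U : E →L[ℂ] E)

theorem unitary_apply_inv (U : unitary (E →L[ℂ] E)) (x : E) :
    (U : E →L[ℂ] E) (((U⁻¹ : unitary (E →L[ℂ] E)) : E →L[ℂ] E) x) = x := by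
  rw [← mul_apply_eq_comp, ← Submonoid.coe_mul, mul_inv_cancel]; rfl

theorem apply_heis (U : unitary (E →L[ℂ] E)) (K : E →L[ℂ] E) (x : E) :
    (U : E →L[ℂ] E) (heis U K x) = K ((U : E →L[ℂ] E) x) := unitary_apply_inv U _

theorem inner_heis (U : unitary (E →L[ℂ] E)) (K : E →L[ℂ] E) (x y : E) :
    inner ℂ x (heis U K y) = inner ℂ ((U : E →L[ℂ] E) x) (K ((U : E →L[ℂ] E) y)) := by
  rw [← Unitary.inner_map_map U, apply_heis]

theorem norm_heis_apply (U : unitary (E →L[ℂ] E)) (K : E →L[ℂ] E) (x : E) :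
    ‖heis U K x‖ = ‖K ((U : E →L[ℂ] E) x)‖ := by
  rw [← Unitary.norm_map U, apply_heis]

variable {K : E →L[ℂ] E} {U : ℝ → unitary (E →L[ℂ] E)}

theorem tendsto_heis_symm {G : E →L[ℂ] E} (hKs : ∀ x y, inner ℂ x (K y) = inner ℂ (K x) y)
    (hG : Tendsto (fun r => heis (U r) K) atTop (𝓝 G)) (x y : E) :
    inner ℂ x (G y) = inner ℂ (G x) y := by
  have h1 : ∀ z, Tendsto (fun r => heis (U r) K z) atTop (𝓝 (G z)) := fun z =>
    ((ContinuousLinearMap.apply ℂ E z).continuous.tendsto G).comp hG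
  refine tendsto_nhds_unique (tendsto_const_nhds.inner (h1 y))
    (((h1 x).inner tendsto_const_nhds).congr fun r => ?_)
  rw [inner_heis, ← inner_conj_symm, inner_heis, hKs, inner_conj_symm]

variable [SecondCountableTopology E] {B : ℝ → E →L[ℂ] E} {n : ℝ → ℝ} {Q L : E →L[ℂ] E}
  {m : ℝ → ℝ}

/-- The Hamiltonian part commutes with `K`, so only the commutator with `B` drives the change.
Testing the difference applied to `u` against itself turns the weak identity into a norm bound. -/
theorem norm_heis_sub_le (hB : IsPert B n) (hU : ∀ u, IsSol Q B fun r => (U r : E →L[ℂ] E) u)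
    (hK : ∀ x, K x = Q (L x)) (hKs : ∀ x y, inner ℂ x (K y) = inner ℂ (K x) y)
    (hLs : ∀ x y, inner ℂ x (L y) = inner ℂ (L x) y) {a b : ℝ} (ha : 0 ≤ a) (hab : a ≤ b)
    (hm : IntervalIntegrable m volume a b)
    (hBK : ∀ᵐ r ∂(volume.restrict (Ioi 0)), ‖B r * K - K * B r‖ ≤ m r) :
    ‖heis (U b) K - heis (U a) K‖ ≤ ∫ r in a..b, m r := by
  have hBK' := (ae_restrict_iff' measurableSet_Ioi).1 hBK
  have hm0 : 0 ≤ ∫ r in a..b, m r := by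
    rw [intervalIntegral.integral_of_le hab]
    refine setIntegral_nonneg_of_ae_restrict ?_
    refine (ae_restrict_iff' measurableSet_Ioc).2 ?_
    filter_upwards [hBK'] with r hr hra
    exact (norm_nonneg _).trans (hr (ha.trans_lt hra.1))
  refine ContinuousLinearMap.opNorm_le_bound _ hm0 fun u => ?_
  set v := (heis (U b) K - heis (U a) K) u with hv
  have h1 : inner ℂ v v = ∫ r in a..b, Complex.I *
      (inner ℂ (B r ((U r : E →L[ℂ] E) v)) (K ((U r : E →L[ℂ] E) u)) -
        inner ℂ (K ((U r : E →L[ℂ] E) v)) (B r ((U r : E →L[ℂ] E) u))) := by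
    rw [← (hU v).heisenberg_const hB (hU u) hK hKs hLs ha hab, ← inner_heis, ← inner_heis,
      ← inner_sub_right]
    rfl
  have h2 : ‖inner ℂ v v‖ ≤ ∫ r in a..b, ‖v‖ * ‖u‖ * m r := by
    rw [h1]
    refine intervalIntegral.norm_integral_le_of_norm_le hab ?_ (hm.const_mul _)
    filter_upwards [hBK'] with r hr hra
    have h3 := hr (ha.trans_lt hra.1)
    rw [norm_mul, Complex.norm_I, one_mul, ← hB.symm, ← hKs, ← inner_sub_right]
    refine (norm_inner_le_norm _ _).trans ?_
    rw [Unitary.norm_map]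
    have h4 := (B r * K - K * B r).le_of_opNorm_le h3 ((U r : E →L[ℂ] E) u)
    rw [Unitary.norm_map] at h4
    calc _ ≤ ‖v‖ * (m r * ‖u‖) := mul_le_mul_of_nonneg_left h4 (norm_nonneg _)
      _ = _ := by ring
  rw [intervalIntegral.integral_const_mul, inner_self_eq_norm_sq_to_K, norm_pow] at h2
  have h5 : ‖((‖v‖ : ℝ) : ℂ)‖ = ‖v‖ := by simp
  change ‖((‖v‖ : ℝ) : ℂ)‖ ^ 2 ≤ _ at h2
  rw [h5] at h2
  rcases eq_or_ne ‖v‖ 0 with h0 | h0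
  · rw [h0]; positivity
  · have h6 : 0 < ‖v‖ := lt_of_le_of_ne (norm_nonneg _) (Ne.symm h0)
    refine le_of_mul_le_mul_left ?_ h6
    calc ‖v‖ * ‖v‖ = ‖v‖ ^ 2 := (sq _).symm
      _ ≤ _ := h2
      _ = _ := by ring

/-- Cook's method: integrability of the commutator bound makes the Heisenberg observables a Cauchy
family in norm, and its tail integral is the rate. -/
theorem exists_tendsto_heis (hB : IsPert B n) (hU : ∀ u, IsSol Q B fun r => (U r : E →L[ℂ] E) u)
    (hK : ∀ x, K x = Q (L x)) (hKs : ∀ x y, inner ℂ x (K y) = inner ℂ (K x) y)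
    (hLs : ∀ x y, inner ℂ x (L y) = inner ℂ (L x) y)
    (hm : ∀ a > 0, IntegrableOn m (Ioi a)) (hm0 : ∀ r, 0 ≤ m r)
    (hBK : ∀ᵐ r ∂(volume.restrict (Ioi 0)), ‖B r * K - K * B r‖ ≤ m r) :
    ∃ G, Tendsto (fun r => heis (U r) K) atTop (𝓝 G) ∧
      ∀ a > 0, ‖heis (U a) K - G‖ ≤ ∫ r in Ioi a, m r := by
  have hmi : ∀ {a b : ℝ}, 0 < a → a ≤ b → IntervalIntegrable m volume a b := fun {a b} ha hab => by
    rw [intervalIntegrable_iff_integrableOn_Ioc_of_le hab]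
    exact (hm a ha).mono_set Ioc_subset_Ioi_self
  have hle : ∀ {a b : ℝ}, 0 < a → a ≤ b → ‖heis (U b) K - heis (U a) K‖ ≤ ∫ r in Ioi a, m r := by
    intro a b ha hab
    refine (norm_heis_sub_le hB hU hK hKs hLs ha.le hab (hmi ha hab) hBK).trans ?_
    rw [intervalIntegral.integral_of_le hab]
    exact setIntegral_mono_set (hm a ha) (ae_of_all _ hm0) (Eventually.of_forall Ioc_subset_Ioi_self)
  have hlim : Tendsto (fun a => ∫ r in Ioi a, m r) atTop (𝓝 0) := by
    have h1 := intervalIntegral_tendsto_integral_Ioi 1 (hm 1 one_pos) tendsto_id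
    have h2 := (tendsto_const_nhds (x := ∫ r in Ioi (1 : ℝ), m r)).sub h1
    rw [sub_self] at h2
    refine h2.congr' ?_
    filter_upwards [eventually_ge_atTop 1] with a ha
    have h3 : Ioi (1 : ℝ) = Ioc 1 a ∪ Ioi a := (Ioc_union_Ioi_eq_Ioi ha).symm
    rw [id, h3, setIntegral_union (Ioc_disjoint_Ioi le_rfl) measurableSet_Ioi
      ((hm 1 one_pos).mono_set Ioc_subset_Ioi_self) (hm a (by linarith)),
      intervalIntegral.integral_of_le ha]
    ring
  have hcauchy : CauchySeq fun r => heis (U r) K := by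
    rw [Metric.cauchySeq_iff']
    intro δ hδ
    obtain ⟨N, hN1, hN2⟩ := ((hlim.eventually (gt_mem_nhds hδ)).and (eventually_gt_atTop 0)).exists
    refine ⟨N, fun r hr => ?_⟩
    rw [dist_eq_norm]
    exact (hle hN2 hr).trans_lt hN1
  obtain ⟨G, hG⟩ := cauchySeq_tendsto_of_complete hcauchy
  refine ⟨G, hG, fun a ha => ?_⟩
  rw [norm_sub_rev]
  refine le_of_tendsto (hG.sub_const _).norm ?_
  filter_upwards [eventually_ge_atTop a] with b hb
  exact hle ha hb

/-- States with asymptotic energy in a bounded set have bounded energy for all times. -/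
theorem sqrt_energy_le_of_tendsto_heis (hB : IsPert B n)
    (hU : ∀ u, IsSol Q B fun r => (U r : E →L[ℂ] E) u) (hQ : IsPos Q)
    (hK : ∀ x, K x = Q (L x)) (hm : ∀ a > 0, IntegrableOn m (Ioi a)) (hm0 : ∀ r, 0 ≤ m r)
    (hBQ : ∀ᵐ r ∂(volume.restrict (Ioi 0)), ∀ y,
      ‖inner ℂ y (B r (Q y)) - inner ℂ (B r (Q y)) y‖ ≤
        m r * Real.sqrt (inner ℂ (Q y) y).re * ‖Q y‖)
    {G : E →L[ℂ] E} (hG : Tendsto (fun r => heis (U r) K) atTop (𝓝 G)) {ε : ℝ} {P : E →L[ℂ] E}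
    (hP : IsYosida Q ε P) {a : ℝ} (ha : 0 < a) (u : E) :
    Real.sqrt (inner ℂ (P ((U a : E →L[ℂ] E) (G u))) ((U a : E →L[ℂ] E) (G u))).re ≤
      (Real.sqrt ‖Q‖ * ‖L‖ + ‖K‖ * ∫ r in Ioi a, m r) * ‖u‖ := by
  have h1 : Tendsto (fun b => (U a : E →L[ℂ] E) (heis (U b) K u)) atTop
      (𝓝 ((U a : E →L[ℂ] E) (G u))) :=
    ((U a : E →L[ℂ] E).continuous.tendsto _).comp
      (((ContinuousLinearMap.apply ℂ E u).continuous.tendsto G).comp hG)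
  have h2 : Tendsto (fun b => Real.sqrt (inner ℂ (P ((U a : E →L[ℂ] E) (heis (U b) K u)))
      ((U a : E →L[ℂ] E) (heis (U b) K u))).re) atTop
      (𝓝 (Real.sqrt (inner ℂ (P ((U a : E →L[ℂ] E) (G u))) ((U a : E →L[ℂ] E) (G u))).re)) :=
    (Real.continuous_sqrt.tendsto _).comp ((Complex.continuous_re.tendsto _).comp
      (((P.continuous.tendsto _).comp h1).inner h1))
  refine le_of_tendsto h2 ?_
  filter_upwards [eventually_ge_atTop a] with b hb
  set v := heis (U b) K u with hv
  have hsub : Ioc a b ⊆ Ioi 0 := fun r hr => ha.trans hr.1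
  have hmi : IntervalIntegrable m volume a b := by
    rw [intervalIntegrable_iff_integrableOn_Ioc_of_le hb]
    exact (hm a ha).mono_set Ioc_subset_Ioi_self
  have h3 := (hU v).sqrt_energy_le hB hQ hP (N := ‖v‖) (fun r => Unitary.norm_map _ _) ha.le hb hmi
    hm0 (ae_restrict_of_ae_restrict_of_subset hsub hBQ)
  refine h3.trans ?_
  -- At the late time `b` the state is `K U_b u = Q L U_b u`, whose energy is at most `‖Q‖ ‖L‖²
  -- ‖u‖²` whatever `b` and `ε` are.
  rw [hv, apply_heis, ← hv]
  set x := (U b : E →L[ℂ] E) u with hx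
  have hxn : ‖x‖ = ‖u‖ := Unitary.norm_map _ _
  have h4 : Real.sqrt (inner ℂ (P (K x)) (K x)).re ≤ Real.sqrt ‖Q‖ * ‖L‖ * ‖u‖ := by
    have h5 : (inner ℂ (P (K x)) (K x)).re ≤ ‖Q‖ * (‖L‖ * ‖u‖) ^ 2 := by
      have hLx : ‖L x‖ ≤ ‖L‖ * ‖u‖ := hxn ▸ L.le_opNorm x
      rw [hK x]
      refine (Complex.re_le_norm _).trans ((norm_inner_le_norm _ _).trans ?_)
      rw [← hP.comm]
      calc ‖Q (P (L x))‖ * ‖Q (L x)‖ ≤ ‖L x‖ * (‖Q‖ * ‖L x‖) := by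
            gcongr
            · exact (hP.norm_le hQ _).1
            · exact Q.le_opNorm _
        _ = ‖Q‖ * ‖L x‖ ^ 2 := by ring
        _ ≤ _ := by gcongr
    refine (Real.sqrt_le_sqrt h5).trans ?_
    rw [Real.sqrt_mul (norm_nonneg _), Real.sqrt_sq (by positivity), mul_assoc]
  have h6 : ‖v‖ ≤ ‖K‖ * ‖u‖ := by
    rw [hv, norm_heis_apply, ← hxn]
    exact K.le_opNorm x
  have h7 : ∫ r in a..b, m r ≤ ∫ r in Ioi a, m r := by
    rw [intervalIntegral.integral_of_le hb]
    exact setIntegral_mono_set (hm a ha) (ae_of_all _ hm0) (Eventually.of_forall Ioc_subset_Ioi_self)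
  have h8 : 0 ≤ ∫ r in a..b, m r := intervalIntegral.integral_nonneg hb fun r _ => hm0 r
  have h9 : ‖v‖ * ∫ r in a..b, m r ≤ ‖K‖ * ‖u‖ * ∫ r in Ioi a, m r :=
    mul_le_mul h6 h7 h8 (by positivity)
  calc _ ≤ Real.sqrt ‖Q‖ * ‖L‖ * ‖u‖ + ‖K‖ * ‖u‖ * ∫ r in Ioi a, m r := add_le_add h4 h9
    _ = _ := by ring

end Asymptotic

end MaxSpeed

namespace MaxSpeed

open scoped ComplexConjugate

variable {d : ℕ} {V : Space d → ℝ} {μ C : ℝ} {Q : L2 d →L[ℂ] L2 d}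

/-! ### The velocity estimate -/

theorem mulR_mul {a b : Space d → ℝ} (ha : MemLp (fun x => (a x : ℂ)) ⊤ volume)
    (hb : MemLp (fun x => (b x : ℂ)) ⊤ volume) (u : L2 d) :
    mulR (fun x => a x * b x) u = mulR a (mulR b u) := by
  have h1 := (hasMul_mulB hb u).comp (hasMul_mulB ha _)
  have hab : MemLp (fun x => ((a x * b x : ℝ) : ℂ)) ⊤ volume := by
    simp only [Complex.ofReal_mul]
    exact hb.mul ha
  exact HasMul.mulB_eq hab (by simpa only [Complex.ofReal_mul] using h1)

theorem inner_mulR_self_im (a : Space d → ℝ) (u : L2 d) : (inner ℂ u (mulR a u)).im = 0 := by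
  rw [← Complex.conj_eq_iff_im, inner_conj_symm]
  exact (mulB_inner_ofReal u u).symm

theorem hasMul_sum {ι : Type*} (s : Finset ι) {m : ι → Space d → ℂ} {u : L2 d} {v : ι → L2 d}
    (h : ∀ i ∈ s, HasMul (m i) u (v i)) : HasMul (fun x => ∑ i ∈ s, m i x) u (∑ i ∈ s, v i) := by
  classical
  induction s using Finset.induction_on with
  | empty =>
    have := hasMul_const 0 u
    rw [zero_smul] at this
    simpa using this
  | insert i s hi ih =>
    simp only [Finset.sum_insert hi]
    exact (h i (Finset.mem_insert_self i s)).add_symbol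
      (ih fun j hj => h j (Finset.mem_insert_of_mem hj))

theorem norm_mulR_apply_le {a : Space d → ℝ} {C : ℝ} (hC0 : 0 ≤ C) (hC : ∀ x, |a x| ≤ C)
    (u : L2 d) : ‖mulR a u‖ ≤ C * ‖u‖ :=
  norm_mulB_apply_le hC0 (ae_of_all _ fun x => by rw [Complex.norm_real]; exact hC x) u

/-- The pointwise bound `|ρ| ≤ 1` is used for the vector as a whole, so that the velocity estimate
loses no dimensional constant. -/
theorem sum_norm_mulR_sq_le {ρ : Fin d → Space d → ℝ}
    (hρ : ∀ j, Continuous (ρ j)) (h1 : ∀ x, ∑ j, ρ j x ^ 2 ≤ 1) (u : L2 d) :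
    ∑ j, ‖mulR (ρ j) u‖ ^ 2 ≤ ‖u‖ ^ 2 := by
  have hb : ∀ j x, |ρ j x| ≤ 1 := fun j x => by
    rw [← sq_le_one_iff_abs_le_one]
    exact (Finset.single_le_sum (f := fun j => ρ j x ^ 2) (fun i _ => sq_nonneg _)
      (Finset.mem_univ j)).trans (h1 x)
  have hm : ∀ j, MemLp (fun x => (ρ j x : ℂ)) ⊤ volume := fun j => memLp_top_ofReal (hρ j) (hb j)
  have h2 : ∀ j, ‖mulR (ρ j) u‖ ^ 2 = (inner ℂ u (mulR (ρ j) (mulR (ρ j) u))).re := fun j => by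
    rw [mulB_inner_ofReal, inner_self_eq_norm_sq_to_K]
    norm_cast
  simp_rw [h2]
  rw [← Complex.re_sum, ← inner_sum]
  have h3 := hasMul_sum Finset.univ fun j _ => (hasMul_mulB (hm j) u).comp (hasMul_mulB (hm j) _)
  have h4 : ‖∑ j, mulR (ρ j) (mulR (ρ j) u)‖ ≤ 1 * ‖u‖ := by
    refine h3.norm_le (hasMul_one u) (ae_of_all _ fun x => ?_)
    rw [norm_mul, one_mul, one_mul]
    refine mul_le_of_le_one_left (norm_nonneg _) ?_
    have : (∑ j, (ρ j x : ℂ) * (ρ j x : ℂ)) = ((∑ j, ρ j x ^ 2 : ℝ) : ℂ) := by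
      push_cast; exact Finset.sum_congr rfl fun j _ => (sq _).symm
    rw [this, Complex.norm_real, Real.norm_eq_abs, abs_of_nonneg (Finset.sum_nonneg fun j _ => sq_nonneg _)]
    exact h1 x
  calc _ ≤ ‖u‖ * ‖∑ j, mulR (ρ j) (mulR (ρ j) u)‖ :=
        (Complex.re_le_norm _).trans (norm_inner_le_norm _ _)
    _ ≤ ‖u‖ * (1 * ‖u‖) := by gcongr
    _ = ‖u‖ ^ 2 := by ring

/-- An outgoing cutoff `f` with gradient `∇f = s h² ρ`, `|ρ| ≤ 1`. -/
structure IsOutgoing (s κ : ℝ) (f h : Space d → ℝ) (f₁ f₂ h₁ h₂ ρ : Fin d → Space d → ℝ) : Prop where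
  smooth : SmoothMul f f₁ f₂
  smooth' : SmoothMul h h₁ h₂
  deriv_eq : ∀ j x, f₁ j x = s * (h x * (h x * ρ j x))
  continuous : ∀ j, Continuous (ρ j)
  sum_le : ∀ x, ∑ j, ρ j x ^ 2 ≤ 1
  nonneg : 0 ≤ s
  nonneg' : 0 ≤ κ
  le_one : ∀ x, |h x| ≤ 1
  bound₁ : ∀ j x, |f₁ j x| ≤ κ
  bound₂ : ∀ j x, |f₂ j x| ≤ κ
  bound₁' : ∀ j x, |h₁ j x| ≤ κ
  bound₂' : ∀ j x, |h₂ j x| ≤ κ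

variable {s κ : ℝ} {f h : Space d → ℝ} {f₁ f₂ h₁ h₂ ρ : Fin d → Space d → ℝ}

theorem IsOutgoing.memLp_ρ (hf : IsOutgoing s κ f h f₁ f₂ h₁ h₂ ρ) (j : Fin d) :
    MemLp (fun x => (ρ j x : ℂ)) ⊤ volume :=
  memLp_top_ofReal (hf.continuous j) (C := 1) fun x => by
    rw [← sq_le_one_iff_abs_le_one]
    exact (Finset.single_le_sum (f := fun j => ρ j x ^ 2) (fun i _ => sq_nonneg _)
      (Finset.mem_univ j)).trans (hf.sum_le x)

theorem IsOutgoing.mulR_deriv (hf : IsOutgoing s κ f h f₁ f₂ h₁ h₂ ρ) (j : Fin d) (u : L2 d) :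
    mulR (f₁ j) u = (s : ℂ) • mulR h (mulR h (mulR (ρ j) u)) := by
  have h1 : MemLp (fun x => ((h x * ρ j x : ℝ) : ℂ)) ⊤ volume := by
    simp only [Complex.ofReal_mul]
    exact (hf.memLp_ρ j).mul hf.smooth'.memLp
  have h2 : mulR (fun x => h x * (h x * ρ j x)) u = mulR h (mulR h (mulR (ρ j) u)) := by
    rw [mulR_mul hf.smooth'.memLp h1, mulR_mul hf.smooth'.memLp (hf.memLp_ρ j)]
  have h3 : MemLp (fun x => ((h x * (h x * ρ j x) : ℝ) : ℂ)) ⊤ volume := by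
    simp only [Complex.ofReal_mul] at h1 ⊢
    exact h1.mul hf.smooth'.memLp
  have h4 := (hasMul_mulB h3 u).smul_symbol (s : ℂ)
  rw [← h2]
  refine HasMul.mulB_eq (hf.smooth.memLp₁ j) (h4.congr (ae_of_all _ fun x => ?_))
  simp only [hf.deriv_eq, Complex.ofReal_mul]

theorem mulR_comm {a b : Space d → ℝ} (ha : MemLp (fun x => (a x : ℂ)) ⊤ volume)
    (hb : MemLp (fun x => (b x : ℂ)) ⊤ volume) (u : L2 d) :
    mulR a (mulR b u) = mulR b (mulR a u) := by
  rw [← mulR_mul ha hb, ← mulR_mul hb ha]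
  simp only [mul_comm]

/-- The form of `∂_t f + i [H, f]` is bounded by the velocity in the region of `∇f`. -/
theorem IsRes.velocity_le (hQ : IsRes V μ C Q) {D : Fin d → L2 d →L[ℂ] L2 d} (hD : IsGrad Q D)
    (hf : IsOutgoing s κ f h f₁ f₂ h₁ h₂ ρ) (c : ℝ) (x : L2 d) {w : L2 d}
    (hw : HasFMul symGrad (mulR h (Q x)) w) :
    (inner ℂ (Q x) ((-(c * s) : ℂ) • mulR h (mulR h (Q x))) + Complex.I *
      (inner ℂ x (mulR f (Q x)) - inner ℂ (mulR f (Q x)) x)).re ≤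
      s * (-(c * ‖mulR h (Q x)‖ ^ 2) + ‖mulR h (Q x)‖ * ‖w‖) := by
  set φ := Q x with hφ
  set y := mulR h φ with hy
  have hinner : ∀ (a : Space d → ℝ) (u v : L2 d), inner ℂ u (mulR a v) = inner ℂ (mulR a u) v :=
    fun a u v => mulB_inner_ofReal u v
  have e1 : inner ℂ φ ((-(c * s) : ℂ) • mulR h (mulR h φ)) = ((-(c * s) * ‖y‖ ^ 2 : ℝ) : ℂ) := by
    rw [inner_smul_right, hinner, ← hy, inner_self_eq_norm_sq_to_K]
    push_cast
    rfl
  set p : Fin d → L2 d := fun j => mulR h (D j x) + mulR (h₁ j) φ with hp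
  have hpp : ∀ j, HasFMul (symPar j) y (p j) := fun j => hf.smooth'.par (hD j x)
  have e2 : (Complex.I * (inner ℂ x (mulR f φ) - inner ℂ (mulR f φ) x)).re =
      s * ∑ j, (inner ℂ (mulR (ρ j) y) (p j)).im := by
    rw [hQ.inner_mulR_sub hD hf.smooth, commOp_apply, inner_sub_right, inner_neg_right, inner_sum,
      inner_smul_right, inner_sum]
    have h1 : (∑ j, inner ℂ (Q x) (mulR (f₂ j) (Q x))).im = 0 := by
      rw [Complex.im_sum]
      exact Finset.sum_eq_zero fun j _ => inner_mulR_self_im _ _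
    -- One factor `h` goes to each side of `h² ρ ∂`. Replacing `h ∂_j φ` by `∂_j (h φ)` costs a
    -- multiplication operator in the form, which is real and drops out of the imaginary part.
    have h2 : ∀ j, (inner ℂ (Q x) (mulR (f₁ j) (D j x))).im = s * (inner ℂ (mulR (ρ j) y) (p j)).im := by
      intro j
      have h3 : inner ℂ (Q x) (mulR (f₁ j) (D j x)) = (s : ℂ) * inner ℂ (mulR (ρ j) y) (mulR h (D j x)) := by
        rw [hf.mulR_deriv, inner_smul_right, hinner, ← hφ, ← hy, mulR_comm hf.smooth'.memLp (hf.memLp_ρ j),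
          hinner]
      have h4 : (inner ℂ (mulR (ρ j) y) (mulR (h₁ j) φ)).im = 0 := by
        rw [hy, ← hinner, ← hinner, mulR_comm (hf.memLp_ρ j) (hf.smooth'.memLp₁ j),
          mulR_comm hf.smooth'.memLp (hf.smooth'.memLp₁ j), ← mulR_mul hf.smooth'.memLp (hf.memLp_ρ j)]
        have h5 : MemLp (fun x => ((h x * ρ j x : ℝ) : ℂ)) ⊤ volume := by
          simp only [Complex.ofReal_mul]
          exact (hf.memLp_ρ j).mul hf.smooth'.memLp
        rw [← mulR_mul (hf.smooth'.memLp₁ j) h5]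
        exact inner_mulR_self_im _ _
      rw [h3, Complex.im_ofReal_mul, hp, inner_add_right, Complex.add_im, h4, add_zero]
    have h6 : (1 / 2 : ℂ) = ((1 / 2 : ℝ) : ℂ) := by push_cast; rfl
    rw [Complex.I_mul_re, Complex.sub_im, Complex.neg_im, h6, Complex.im_ofReal_mul, h1, mul_zero,
      sub_zero, neg_neg, Complex.im_sum, Finset.mul_sum]
    exact Finset.sum_congr rfl fun j _ => h2 j
  -- Cauchy–Schwarz over the space and the coordinates together, so that `‖|∇| h φ‖` appears with
  -- constant one.
  have e3 : ∑ j, (inner ℂ (mulR (ρ j) y) (p j)).im ≤ ‖y‖ * ‖w‖ := by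
    calc ∑ j, (inner ℂ (mulR (ρ j) y) (p j)).im ≤ ∑ j, ‖mulR (ρ j) y‖ * ‖p j‖ :=
          Finset.sum_le_sum fun j _ =>
            ((le_abs_self _).trans (Complex.abs_im_le_norm _)).trans (norm_inner_le_norm _ _)
      _ ≤ Real.sqrt (∑ j, ‖mulR (ρ j) y‖ ^ 2) * Real.sqrt (∑ j, ‖p j‖ ^ 2) :=
          Real.sum_mul_le_sqrt_mul_sqrt _ _ _
      _ ≤ Real.sqrt (‖y‖ ^ 2) * Real.sqrt (‖w‖ ^ 2) := by
          gcongr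
          · exact sum_norm_mulR_sq_le hf.continuous hf.sum_le y
          · exact (sum_par_norm_sq hpp hw).le
      _ = _ := by rw [Real.sqrt_sq (norm_nonneg _), Real.sqrt_sq (norm_nonneg _)]
  rw [Complex.add_re, e1, e2, Complex.ofReal_re]
  have := mul_le_mul_of_nonneg_left e3 hf.nonneg
  linarith

end MaxSpeed

/-! ### Speed below an energy cutoff -/

namespace MaxSpeed

open scoped ComplexConjugate

variable {d : ℕ} {V : Space d → ℝ} {μ C : ℝ} {Q : L2 d →L[ℂ] L2 d}
  {D : Fin d → L2 d →L[ℂ] L2 d}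

/-- Commutators with `g` are controlled by commutators with `Q`. -/
def HasComm (Q g : L2 d →L[ℂ] L2 d) (K : ℝ) : Prop :=
  0 ≤ K ∧ ∀ T q Y : L2 d →L[ℂ] L2 d, Commute q Q → T * Q - Q * T = q * Y →
    ∃ Y', T * g - g * T = q * Y' ∧ ‖Y'‖ ≤ K * ‖Y‖

/-- An energy cutoff `g`, below which the speed is at most `k`. -/
structure IsCut (Q g : L2 d →L[ℂ] L2 d) (k K : ℝ) : Prop where
  comm : HasComm Q g K
  norm_le : ‖g‖ ≤ 1
  speed_nonneg : 0 ≤ k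
  speed : ∀ v, ∃ w, HasFMul symGrad (g v) w ∧ ‖w‖ ≤ k * ‖g v‖

theorem IsRes.norm_symGrad_le (hQ : IsRes V μ C Q) {x w : L2 d} (hw : HasFMul symGrad (Q x) w) :
    ‖w‖ ≤ Real.sqrt (C * ‖Q‖) * ‖x‖ := by
  refine abs_le_of_sq_le_sq' ?_ (by positivity) |>.2
  rw [mul_pow, Real.sq_sqrt (mul_nonneg hQ.nonneg (norm_nonneg _)), mul_assoc]
  refine (hQ.grad_le _ _ hw).trans (mul_le_mul_of_nonneg_left ?_ hQ.nonneg)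
  calc _ ≤ ‖Q x‖ * ‖x‖ := (Complex.re_le_norm _).trans (norm_inner_le_norm _ _)
    _ ≤ ‖Q‖ * ‖x‖ * ‖x‖ := by gcongr; exact Q.le_opNorm x
    _ = _ := by ring

/-- Size of the commutator `[H, η] (H + μ)⁻¹` for a cutoff `η` with derivatives of size one. -/
noncomputable def commSize (Q : L2 d →L[ℂ] L2 d) (D : Fin d → L2 d →L[ℂ] L2 d) : ℝ :=
  ∑ j, ‖D j‖ + d * ‖Q‖

theorem commSize_nonneg : 0 ≤ commSize Q D := by unfold commSize; positivity

variable {s κ : ℝ} {f h : Space d → ℝ} {f₁ f₂ h₁ h₂ ρ : Fin d → Space d → ℝ}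

/-- Write `hφ = g(hφ) + [h, g]φ`. The first term has speed at most `k`. The second is `Q` applied to
a vector of size `κ`, so its gradient is of size `κ` too. -/
theorem IsRes.exists_speed_le (hQ : IsRes V μ C Q) (hD : IsGrad Q D)
    (hh : SmoothMul h h₁ h₂) (hκ : 0 ≤ κ) (hb₁ : ∀ j x, |h₁ j x| ≤ κ) (hb₂ : ∀ j x, |h₂ j x| ≤ κ)
    {g : L2 d →L[ℂ] L2 d} {k K : ℝ} (hg : IsCut Q g k K) {φ : L2 d} (hφ : g φ = φ) :
    ∃ w, HasFMul symGrad (mulR h φ) w ∧ ‖w‖ ≤ k * ‖mulR h φ‖ +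
      κ * (Real.sqrt (C * ‖Q‖) * (K * commSize Q D)) * ‖φ‖ := by
  obtain ⟨Y', h1, h2⟩ := hg.comm.2 _ Q _ (Commute.refl Q) (hQ.mulR_mul_sub hD hh)
  have h3 : mulR h φ = g (mulR h φ) + Q (Y' φ) := by
    have := congrArg (fun T : L2 d →L[ℂ] L2 d => T φ) h1
    simp only [sub_apply, mul_apply_eq_comp] at this
    rw [hφ] at this
    rw [← this]
    abel
  obtain ⟨w₁, hw₁, hw₁'⟩ := hg.speed (mulR h φ)
  obtain ⟨w₂, hw₂⟩ := hQ.exists_symGrad (Y' φ)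
  have h4 := hQ.norm_symGrad_le hw₂
  refine ⟨w₁ + w₂, ?_, ?_⟩
  · rw [h3]
    exact hw₁.add hw₂
  · have h5 : ‖Y' φ‖ ≤ K * (κ * commSize Q D) * ‖φ‖ :=
      Y'.le_of_opNorm_le (h2.trans (mul_le_mul_of_nonneg_left (norm_commOp_le hκ hb₁ hb₂)
        hg.comm.1)) φ
    have h6 : ‖g (mulR h φ)‖ ≤ ‖mulR h φ‖ := by
      simpa using g.le_of_opNorm_le hg.norm_le (mulR h φ)
    calc ‖w₁ + w₂‖ ≤ ‖w₁‖ + ‖w₂‖ := norm_add_le _ _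
      _ ≤ k * ‖mulR h φ‖ + Real.sqrt (C * ‖Q‖) * (K * (κ * commSize Q D) * ‖φ‖) :=
        add_le_add (hw₁'.trans (mul_le_mul_of_nonneg_left h6 hg.speed_nonneg))
          (h4.trans (mul_le_mul_of_nonneg_left h5 (Real.sqrt_nonneg _)))
      _ = _ := by ring

/-- Split `x = x₁ + z`, where `Q x₁` has its energy cut off. The `x₁` part obeys the velocity bound,
and `c ≥ k` makes its main term nonpositive. Every other term contains `Q z`. The vector `x` itself
never enters by its norm, since it will be `Pψ`, which is not bounded uniformly in `ε`. -/
theorem IsRes.outgoing_le (hQ : IsRes V μ C Q) (hD : IsGrad Q D)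
    (hf : IsOutgoing s κ f h f₁ f₂ h₁ h₂ ρ) {g : L2 d →L[ℂ] L2 d} {k K : ℝ} (hg : IsCut Q g k K)
    {c : ℝ} (hc : k ≤ c) (hcs : c * s ≤ κ) (x x₁ : L2 d) (hx₁ : g (Q x₁) = Q x₁) :
    (inner ℂ (Q x) ((-(c * s) : ℂ) • mulR h (mulR h (Q x))) + Complex.I *
      (inner ℂ x (mulR f (Q x)) - inner ℂ (mulR f (Q x)) x)).re ≤
      s * (κ * (Real.sqrt (C * ‖Q‖) * (K * commSize Q D)) * ‖Q x₁‖ ^ 2) +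
      κ * ‖Q (x - x₁)‖ * (2 * ‖Q x₁‖ + ‖Q (x - x₁)‖) +
      (2 * ‖commOp Q D f₁ f₂ x₁‖ + ‖commOp Q D f₁ f₂ (x - x₁)‖) * ‖Q (x - x₁)‖ := by
  set z := x - x₁ with hz
  set Y := commOp Q D f₁ f₂
  set T : L2 d →L[ℂ] L2 d := (-(c * s) : ℂ) • (mulR h * mulR h) with hT
  have hTx : ∀ v, T v = (-(c * s) : ℂ) • mulR h (mulR h v) := fun v => rfl
  have hxz : x = x₁ + z := by rw [hz]; abel
  have hb1 : ∀ v, ‖mulR h v‖ ≤ ‖v‖ := fun v => by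
    simpa using norm_mulR_apply_le zero_le_one hf.le_one v
  have hcs0 : 0 ≤ c * s := mul_nonneg (hg.speed_nonneg.trans hc) hf.nonneg
  have hTn : ∀ v, ‖T v‖ ≤ κ * ‖v‖ := fun v => by
    rw [hTx, norm_smul, norm_neg, ← Complex.ofReal_mul, Complex.norm_real, Real.norm_eq_abs,
      abs_of_nonneg hcs0]
    exact mul_le_mul hcs ((hb1 _).trans (hb1 _)) (norm_nonneg _) hf.nonneg'
  have hb : ∀ u v, inner ℂ u (mulR f (Q v)) - inner ℂ (mulR f (Q u)) v = inner ℂ (Q u) (Y v) :=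
    fun u v => hQ.inner_mulR_sub hD hf.smooth u v
  obtain ⟨w, hw, hw'⟩ := hQ.exists_speed_le hD hf.smooth' hf.nonneg' hf.bound₁' hf.bound₂' hg hx₁
  have key := hQ.velocity_le hD hf c x₁ hw
  rw [← hTx] at key ⊢
  set y := ‖mulR h (Q x₁)‖
  set A := Real.sqrt (C * ‖Q‖) * (K * commSize Q D) with hA
  have hA0 : 0 ≤ A := mul_nonneg (Real.sqrt_nonneg _) (mul_nonneg hg.comm.1 commSize_nonneg)
  have key2 : s * (-(c * y ^ 2) + y * ‖w‖) ≤ s * (κ * A * ‖Q x₁‖ ^ 2) := by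
    refine mul_le_mul_of_nonneg_left ?_ hf.nonneg
    have h1 : y * ‖w‖ ≤ y * (k * y + κ * A * ‖Q x₁‖) := mul_le_mul_of_nonneg_left hw' (norm_nonneg _)
    have h2 : y * (κ * A * ‖Q x₁‖) ≤ ‖Q x₁‖ * (κ * A * ‖Q x₁‖) :=
      mul_le_mul_of_nonneg_right (hb1 _) (mul_nonneg (mul_nonneg hf.nonneg' hA0) (norm_nonneg _))
    have h3 : 0 ≤ (c - k) * y ^ 2 := mul_nonneg (sub_nonneg.2 hc) (sq_nonneg _)
    nlinarith
  have hexp : inner ℂ (Q x) (T (Q x)) + Complex.I *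
      (inner ℂ x (mulR f (Q x)) - inner ℂ (mulR f (Q x)) x) =
      (inner ℂ (Q x₁) (T (Q x₁)) + Complex.I *
        (inner ℂ x₁ (mulR f (Q x₁)) - inner ℂ (mulR f (Q x₁)) x₁)) +
      (inner ℂ (Q x₁) (T (Q z)) + inner ℂ (Q z) (T (Q x₁)) + inner ℂ (Q z) (T (Q z))) +
      Complex.I * (-conj (inner ℂ (Q z) (Y x₁)) + inner ℂ (Q z) (Y x₁) + inner ℂ (Q z) (Y z)) := by
    have h1 : -conj (inner ℂ (Q z) (Y x₁)) =
        inner ℂ x₁ (mulR f (Q z)) - inner ℂ (mulR f (Q x₁)) z := by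
      rw [← hb, map_sub, inner_conj_symm, inner_conj_symm]
      ring
    rw [h1, ← hb, ← hb, hxz]
    simp only [map_add, inner_add_left, inner_add_right]
    ring
  have n1 : ‖inner ℂ (Q x₁) (T (Q z)) + inner ℂ (Q z) (T (Q x₁)) + inner ℂ (Q z) (T (Q z))‖ ≤
      κ * ‖Q z‖ * (2 * ‖Q x₁‖ + ‖Q z‖) := by
    have a1 : ∀ u v : L2 d, ‖inner ℂ u (T v)‖ ≤ ‖u‖ * (κ * ‖v‖) := fun u v =>
      (norm_inner_le_norm _ _).trans (mul_le_mul_of_nonneg_left (hTn v) (norm_nonneg _))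
    refine ((norm_add_le _ _).trans (add_le_add ((norm_add_le _ _).trans
      (add_le_add (a1 _ _) (a1 _ _))) (a1 _ _))).trans (le_of_eq (by ring))
  have n2 : ‖Complex.I * (-conj (inner ℂ (Q z) (Y x₁)) + inner ℂ (Q z) (Y x₁) +
      inner ℂ (Q z) (Y z))‖ ≤ (2 * ‖Y x₁‖ + ‖Y z‖) * ‖Q z‖ := by
    rw [norm_mul, Complex.norm_I, one_mul]
    have a1 : ∀ v : L2 d, ‖inner ℂ (Q z) (Y v)‖ ≤ ‖Q z‖ * ‖Y v‖ := fun v => norm_inner_le_norm _ _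
    refine ((norm_add_le _ _).trans (add_le_add (norm_add_le _ _) le_rfl)).trans ?_
    rw [norm_neg, RCLike.norm_conj]
    linarith [a1 x₁, a1 z]
  rw [hexp, Complex.add_re, Complex.add_re]
  linarith [(Complex.re_le_norm _).trans n1, (Complex.re_le_norm _).trans n2]

end MaxSpeed

namespace MaxSpeed

open scoped ComplexConjugate

/-! ### Propagation estimates -/

theorem IsYosida.commute {E : Type*} [NormedAddCommGroup E] [InnerProductSpace ℂ E]
    {Q P T : E →L[ℂ] E} {ε : ℝ} (h : IsYosida Q ε P) (hT : ∀ x, T (Q x) = Q (T x)) (x : E) :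
    T (P x) = P (T x) := by
  conv_rhs => rw [← h.right x]
  rw [map_add, map_smul, hT, map_add, map_smul, ← h.comm, h.right]

theorem IsRes.isPos {d : ℕ} {V : Space d → ℝ} {μ C : ℝ} {Q : L2 d →L[ℂ] L2 d}
    (h : IsRes V μ C Q) : IsPos Q := ⟨h.inner_right, h.inner_nonneg⟩

instance secondCountableTopology_L2 {d : ℕ} : SecondCountableTopology (L2 d) :=
  have : Fact ((2 : ℝ≥0∞) ≠ ⊤) := ⟨ENNReal.ofNat_ne_top⟩
  Lp.SecondCountableTopology

/-- The evolution `U` with perturbation `B`, with an asymptotic energy cutoff `G`, which is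
approached by `U⁻¹ g U` at the rate `σ`. -/
structure IsScatter {d : ℕ} (V : Space d → ℝ) (μ C : ℝ) (Q : L2 d →L[ℂ] L2 d)
    (D : Fin d → L2 d →L[ℂ] L2 d) (B : ℝ → L2 d →L[ℂ] L2 d) (n : ℝ → ℝ)
    (U : ℝ → unitary (L2 d →L[ℂ] L2 d)) (g G : L2 d →L[ℂ] L2 d) (σ : ℝ → ℝ) (A K : ℝ) : Prop where
  res : IsRes V μ C Q
  grad : IsGrad Q D
  pert : IsPert B n
  sol : ∀ u, IsSol Q B fun r => (U r : L2 d →L[ℂ] L2 d) u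
  zero : U 0 = 1
  comm_mul : ∀ η : Space d → ℝ, MemLp (fun x => (η x : ℂ)) ⊤ volume → ∀ r x,
    mulR η (B r x) = B r (mulR η x)
  symm : ∀ x y, inner ℂ x (G y) = inner ℂ (G x) y
  asymp : ∀ r > 0, ∀ x, ‖(U r : L2 d →L[ℂ] L2 d) (G x) - g ((U r : L2 d →L[ℂ] L2 d) x)‖ ≤ σ r * ‖x‖
  energy : ∀ ε P, IsYosida Q ε P → ∀ r > 0, ∀ u,
    ∑ j, ‖D j (P ((U r : L2 d →L[ℂ] L2 d) (G u)))‖ ≤ A * (1 + σ r) * ‖u‖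
  nonneg : 0 ≤ A
  rate_nonneg : ∀ r, 0 ≤ σ r
  rate_anti : AntitoneOn σ (Ioi 0)
  rate_int : IntegrableOn σ (Ioi 0)
  comm : HasComm Q g K

variable {d : ℕ} {V : Space d → ℝ} {μ C : ℝ} {Q : L2 d →L[ℂ] L2 d}
  {D : Fin d → L2 d →L[ℂ] L2 d} {B : ℝ → L2 d →L[ℂ] L2 d} {n : ℝ → ℝ}
  {U : ℝ → unitary (L2 d →L[ℂ] L2 d)} {g G : L2 d →L[ℂ] L2 d} {σ : ℝ → ℝ} {A K : ℝ}

theorem IsScatter.integral_rate_le (h : IsScatter V μ C Q D B n U g G σ A K) {a b : ℝ} (ha : 0 ≤ a)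
    (hab : a ≤ b) : IntervalIntegrable σ volume a b ∧ ∫ r in a..b, σ r ≤ ∫ r in Ioi 0, σ r := by
  have hsub : Ioc a b ⊆ Ioi 0 := fun x hx => ha.trans_lt hx.1
  rw [intervalIntegrable_iff_integrableOn_Ioc_of_le hab, intervalIntegral.integral_of_le hab]
  exact ⟨h.rate_int.mono_set hsub, setIntegral_mono_set h.rate_int (ae_of_all _ h.rate_nonneg)
    (Eventually.of_forall hsub)⟩

theorem norm_unitary_apply_le (U : ℝ → unitary (L2 d →L[ℂ] L2 d)) (G : L2 d →L[ℂ] L2 d) (r : ℝ)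
    (u : L2 d) :
    ‖(U r : L2 d →L[ℂ] L2 d) (G u)‖ ≤ ‖G‖ * ‖u‖ := by
  rw [Unitary.norm_map]
  exact G.le_opNorm u

/-- With `v` the vector to be estimated, `‖v‖²` is the matrix element of `J` between `U_t G v` and
`U_t y`, which vanishes at time zero because `J y = 0`. Its derivative is a commutator of size `κ`
times the gradient of `U_r G v`, and that gradient is bounded by the energy estimate; nothing is
assumed about the energy of `y`. -/
theorem IsScatter.norm_mulR_heis_le (h : IsScatter V μ C Q D B n U g G σ A K)
    {J : Space d → ℝ} {J₁ J₂ : Fin d → Space d → ℝ} (hJ : SmoothMul J J₁ J₂) {κ : ℝ}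
    (hκ : 0 ≤ κ) (b₁ : ∀ j x, |J₁ j x| ≤ κ) (b₂ : ∀ j x, |J₂ j x| ≤ κ) {t : ℝ} (ht : 0 < t)
    {y : L2 d} (hy : mulR J y = 0) :
    ‖G (((U t)⁻¹ : unitary (L2 d →L[ℂ] L2 d)).1 (mulR J ((U t : L2 d →L[ℂ] L2 d) y)))‖ ≤
      κ * ((A + d * ‖G‖) * t + A * ∫ r in Ioi 0, σ r) * ‖y‖ := by
  set z := ((U t)⁻¹ : unitary (L2 d →L[ℂ] L2 d)).1 (mulR J ((U t : L2 d →L[ℂ] L2 d) y)) with hz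
  set v := G z with hv
  set β : ℝ → ℝ := fun r => κ * ((A + d * ‖G‖) + A * σ r) * (‖v‖ * ‖y‖) with hβ
  obtain ⟨hσi, hσl⟩ := h.integral_rate_le le_rfl ht.le
  have hβi : IntervalIntegrable β volume 0 t :=
    ((intervalIntegrable_const.add (hσi.const_mul A)).const_mul κ).mul_const _
  have key := IsSol.re_inner_sub_le h.pert (h.sol (G v)) (h.sol y) h.res.isPos
    (fun x => h.res.injective) (M := fun _ => mulR J) (M' := fun _ => 0)
    (fun _ x y => mulB_inner_ofReal x y) (fun r x => h.comm_mul J hJ.memLp r x)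
    (fun r => hasDerivAt_const r _) continuous_const le_rfl ht.le hβi (by
      intro ε _ P hP
      refine (ae_restrict_iff' measurableSet_Ioc).2 (ae_of_all _ fun r hr => ?_)
      set θ := (U r : L2 d →L[ℂ] L2 d) (G v) with hθ
      set η := (U r : L2 d →L[ℂ] L2 d) y with hη
      -- The commutator is written so that the derivatives fall on `θ`, the state with bounded
      -- energy.
      have e1 : inner ℂ (P θ) (mulR J (Q (P η))) - inner ℂ (mulR J (Q (P θ))) (P η) =
          -conj (inner ℂ (Q (P η)) (commOp Q D J₁ J₂ (P θ))) := by
        rw [← h.res.inner_mulR_sub h.grad hJ, map_sub, inner_conj_symm, inner_conj_symm]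
        ring
      rw [zero_apply, inner_zero_right, zero_add, e1]
      refine (Complex.re_le_norm _).trans ?_
      rw [norm_mul, Complex.norm_I, one_mul, norm_neg, RCLike.norm_conj]
      refine (norm_inner_le_norm _ _).trans ?_
      have n1 : ‖Q (P η)‖ ≤ ‖y‖ := ((hP.norm_le h.res.isPos η).1).trans
        (Unitary.norm_map (U r) y).le
      have n2 : ‖Q (P θ)‖ ≤ ‖G‖ * ‖v‖ := ((hP.norm_le h.res.isPos θ).1).trans (norm_unitary_apply_le U G r v)
      have n3 : ‖commOp Q D J₁ J₂ (P θ)‖ ≤ κ * ((A + d * ‖G‖) + A * σ r) * ‖v‖ := by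
        refine (norm_commOp_apply_le hκ b₁ b₂ _).trans ?_
        rw [mul_assoc]
        refine mul_le_mul_of_nonneg_left ?_ hκ
        have := h.energy ε P hP r hr.1 v
        have := mul_le_mul_of_nonneg_left n2 (Nat.cast_nonneg (α := ℝ) d)
        linarith
      calc _ ≤ ‖y‖ * (κ * ((A + d * ‖G‖) + A * σ r) * ‖v‖) :=
            mul_le_mul n1 n3 (norm_nonneg _) (norm_nonneg _)
        _ = β r := by rw [hβ]; ring)
  have i1 : ∫ r in (0 : ℝ)..t, β r ≤
      κ * ((A + d * ‖G‖) * t + A * ∫ r in Ioi 0, σ r) * (‖v‖ * ‖y‖) := by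
    simp only [hβ]
    rw [intervalIntegral.integral_mul_const, intervalIntegral.integral_const_mul,
      intervalIntegral.integral_add intervalIntegrable_const (hσi.const_mul A),
      intervalIntegral.integral_const, intervalIntegral.integral_const_mul, sub_zero, smul_eq_mul,
      mul_comm t]
    have := h.nonneg
    gcongr
  have e0 : mulR J ((U 0 : L2 d →L[ℂ] L2 d) y) = 0 := by rw [h.zero]; exact hy
  have e1 : inner ℂ ((U t : L2 d →L[ℂ] L2 d) (G v)) (mulR J ((U t : L2 d →L[ℂ] L2 d) y)) =
      ((‖v‖ ^ 2 : ℝ) : ℂ) := by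
    have : mulR J ((U t : L2 d →L[ℂ] L2 d) y) = (U t : L2 d →L[ℂ] L2 d) z :=
      (unitary_apply_inv (U t) _).symm
    rw [this, Unitary.inner_map_map, ← h.symm, ← hv, inner_self_eq_norm_sq_to_K]
    norm_cast
  rw [e0, inner_zero_right, sub_zero, e1, Complex.ofReal_re] at key
  have k2 := key.trans i1
  by_cases hv0 : ‖v‖ = 0
  · rw [hv0]
    have := h.nonneg
    have : 0 ≤ ∫ r in Ioi 0, σ r := setIntegral_nonneg measurableSet_Ioi fun r _ => h.rate_nonneg r
    positivity
  · have hv1 : 0 < ‖v‖ := lt_of_le_of_ne (norm_nonneg _) (Ne.symm hv0)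
    refine le_of_mul_le_mul_left ?_ hv1
    linarith

/-- Up to time `t` a state does not leave its initial region by more than a large multiple of
`t`. -/
theorem IsScatter.exists_norm_mulR_le (h : IsScatter V μ C Q D B n U g G σ A K) :
    ∃ A₁, 0 ≤ A₁ ∧ ∀ (J : Space d → ℝ) (J₁ J₂ : Fin d → Space d → ℝ), SmoothMul J J₁ J₂ →
      (∀ x, |J x| ≤ 1) → ∀ κ, 0 ≤ κ → (∀ j x, |J₁ j x| ≤ κ) → (∀ j x, |J₂ j x| ≤ κ) → ∀ t > 0,
      ∀ y, mulR J y = 0 →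
      ‖mulR J ((U t : L2 d →L[ℂ] L2 d) (G y))‖ ≤ (2 * σ t + κ * (A₁ * (1 + t))) * ‖y‖ := by
  have hS : 0 ≤ ∫ r in Ioi 0, σ r := setIntegral_nonneg measurableSet_Ioi fun r _ => h.rate_nonneg r
  have hA := h.nonneg
  have hK := h.comm.1
  have hcs := commSize_nonneg (Q := Q) (D := D)
  refine ⟨(A + d * ‖G‖) + A * (∫ r in Ioi 0, σ r) + ‖Q‖ * (K * commSize Q D), by positivity, ?_⟩
  intro J J₁ J₂ hJ hJ1 κ hκ b₁ b₂ t ht y hy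
  have h1 := h.norm_mulR_heis_le hJ hκ b₁ b₂ ht hy
  obtain ⟨Y', e1, e2⟩ := h.comm.2 _ Q _ (Commute.refl Q) (h.res.mulR_mul_sub h.grad hJ)
  set Uy := (U t : L2 d →L[ℂ] L2 d) y with hUy
  have hUyn : ‖Uy‖ = ‖y‖ := Unitary.norm_map (U t) y
  set z := ((U t)⁻¹ : unitary (L2 d →L[ℂ] L2 d)).1 (mulR J Uy) with hz
  have hUz : (U t : L2 d →L[ℂ] L2 d) z = mulR J Uy := unitary_apply_inv (U t) _
  have hJn : ∀ v, ‖mulR J v‖ ≤ ‖v‖ := fun v => by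
    simpa using norm_mulR_apply_le zero_le_one hJ1 v
  have hzn : ‖z‖ ≤ ‖y‖ := by
    rw [← Unitary.norm_map (U t), hUz, ← hUyn]
    exact hJn _
  have e3 : mulR J (g Uy) - g (mulR J Uy) = Q (Y' Uy) :=
    congrArg (fun T : L2 d →L[ℂ] L2 d => T Uy) e1
  -- Replace `U G` by `g U` at the cost `σ t`, commute `J` with `g` at the cost `κ`, and return to
  -- `U G` acting on `z = U⁻¹ J U y` at the cost `σ t` again.
  have e4 : mulR J ((U t : L2 d →L[ℂ] L2 d) (G y)) =
      mulR J ((U t : L2 d →L[ℂ] L2 d) (G y) - g Uy) + Q (Y' Uy) -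
        ((U t : L2 d →L[ℂ] L2 d) (G z) - g ((U t : L2 d →L[ℂ] L2 d) z)) +
        (U t : L2 d →L[ℂ] L2 d) (G z) := by
    rw [hUz, map_sub, ← e3]
    abel
  have n1 : ‖mulR J ((U t : L2 d →L[ℂ] L2 d) (G y) - g Uy)‖ ≤ σ t * ‖y‖ :=
    (hJn _).trans (h.asymp t ht y)
  have n2 : ‖Q (Y' Uy)‖ ≤ ‖Q‖ * (K * (κ * commSize Q D) * ‖y‖) := by
    refine Q.le_opNorm_of_le ?_
    rw [← hUyn]
    exact Y'.le_of_opNorm_le (e2.trans (mul_le_mul_of_nonneg_left (norm_commOp_le hκ b₁ b₂) hK)) _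
  have n3 : ‖(U t : L2 d →L[ℂ] L2 d) (G z) - g ((U t : L2 d →L[ℂ] L2 d) z)‖ ≤ σ t * ‖y‖ :=
    (h.asymp t ht z).trans (mul_le_mul_of_nonneg_left hzn (h.rate_nonneg t))
  have n4 : ‖(U t : L2 d →L[ℂ] L2 d) (G z)‖ ≤
      κ * ((A + d * ‖G‖) * t + A * ∫ r in Ioi 0, σ r) * ‖y‖ := by
    rw [Unitary.norm_map]; exact h1
  rw [e4]
  refine (norm_add_le _ _).trans ((add_le_add ((norm_sub_le _ _).trans (add_le_add
    ((norm_add_le _ _).trans (add_le_add n1 n2)) n3)) n4).trans ?_)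
  have : 0 ≤ κ * (((A + d * ‖G‖) + A * (∫ r in Ioi 0, σ r) * t +
      ‖Q‖ * (K * commSize Q D) * t) * ‖y‖) := by positivity
  nlinarith

end MaxSpeed

/-! ### Growth of an outgoing observable -/

namespace MaxSpeed

open scoped ComplexConjugate

variable {d : ℕ} {V : Space d → ℝ} {μ C : ℝ} {Q : L2 d →L[ℂ] L2 d}
  {D : Fin d → L2 d →L[ℂ] L2 d} {B : ℝ → L2 d →L[ℂ] L2 d} {n : ℝ → ℝ}
  {U : ℝ → unitary (L2 d →L[ℂ] L2 d)} {g G : L2 d →L[ℂ] L2 d} {σ : ℝ → ℝ} {A K : ℝ}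

/-- An energy cutoff `gt = Q Lt` which is one on the range of `g`, below a cutoff `gc` with speed at
most `k`. -/
structure IsCutPair (Q g gt Lt gc : L2 d →L[ℂ] L2 d) (k K : ℝ) : Prop where
  cut : IsCut Q gc k K
  norm_le : ‖gt‖ ≤ 1
  eq_left : ∀ x, gt x = Q (Lt x)
  eq_right : ∀ x, gt x = Lt (Q x)
  gt_g : ∀ x, gt (g x) = g x
  gc_gt : ∀ x, gc (gt x) = gt x

set_option maxHeartbeats 1000000 in
/-- An observable `f` which grows outwards and moves outwards with a speed larger than `k` only
grows little. -/
theorem IsScatter.exists_outgoing_le (h : IsScatter V μ C Q D B n U g G σ A K)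
    {gt Lt gc : L2 d →L[ℂ] L2 d} {k K' : ℝ} (hg : IsCutPair Q g gt Lt gc k K') {c : ℝ}
    (hc : k ≤ c) :
    ∃ A₂, 0 ≤ A₂ ∧ ∀ (s κ : ℝ) (f η : ℝ → Space d → ℝ) (f₁ f₂ η₁ η₂ ρ : ℝ → Fin d → Space d → ℝ),
      (∀ r, IsOutgoing s κ (f r) (η r) (f₁ r) (f₂ r) (η₁ r) (η₂ r) (ρ r)) → c * s ≤ κ →
      (∀ r, HasDerivAt (fun r => mulR (f r)) ((-(c * s) : ℂ) • (mulR (η r) * mulR (η r))) r) →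
      Continuous (fun r => mulR (η r)) → ∀ a b, 1 ≤ a → a ≤ b → ∀ u,
      (inner ℂ ((U b : L2 d →L[ℂ] L2 d) (G u)) (mulR (f b) ((U b : L2 d →L[ℂ] L2 d) (G u))) -
        inner ℂ ((U a : L2 d →L[ℂ] L2 d) (G u)) (mulR (f a) ((U a : L2 d →L[ℂ] L2 d) (G u)))).re ≤
        κ * (A₂ * (s * (b - a) + 1)) * ‖u‖ ^ 2 := by
  have hS : 0 ≤ ∫ r in Ioi 0, σ r := setIntegral_nonneg measurableSet_Ioi fun r _ => h.rate_nonneg r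
  have hA := h.nonneg
  have hK := hg.cut.comm.1
  set S := commSize Q D with hSdef
  have hcs : 0 ≤ S := commSize_nonneg
  have hσ1 := h.rate_nonneg 1
  set N := ‖G‖ with hN
  have hN0 : 0 ≤ N := norm_nonneg _
  set X := Real.sqrt (C * ‖Q‖) * (K' * S) * N ^ 2 with hX
  have hX0 : 0 ≤ X := by positivity
  set Y := S * (‖Lt‖ * N) with hY
  have hY0 : 0 ≤ Y := by positivity
  set Z := 2 * (2 * N + 2 * σ 1) + 2 * (3 * Y + (A * (1 + σ 1) + d * N)) with hZ
  have hZ0 : 0 ≤ Z := by positivity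
  refine ⟨X + Z * ∫ r in Ioi 0, σ r, by positivity, ?_⟩
  intro s κ f η f₁ f₂ η₁ η₂ ρ hf hcsκ hfd hηc a b ha hab u
  have hs := (hf 0).nonneg
  have hκ := (hf 0).nonneg'
  have ha0 : 0 ≤ a := zero_le_one.trans ha
  obtain ⟨hσi, hσl⟩ := h.integral_rate_le ha0 hab
  set β : ℝ → ℝ := fun r => κ * (s * X + Z * σ r) * ‖u‖ ^ 2 with hβ
  have hβi : IntervalIntegrable β volume a b :=
    ((intervalIntegrable_const.add (hσi.const_mul Z)).const_mul κ).mul_const _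
  have key := IsSol.re_inner_sub_le h.pert (h.sol (G u)) (h.sol (G u)) h.res.isPos
    (fun x => h.res.injective) (M := fun r => mulR (f r))
    (M' := fun r => (-(c * s) : ℂ) • (mulR (η r) * mulR (η r)))
    (fun r x y => mulB_inner_ofReal x y) (fun r x => h.comm_mul _ (hf r).smooth.memLp r x)
    hfd (by fun_prop) ha0 hab hβi (by
      intro ε _ P hP
      refine (ae_restrict_iff' measurableSet_Ioc).2 (ae_of_all _ fun r hr => ?_)
      have hr1 : 1 < r := ha.trans_lt hr.1
      have hr0 : 0 < r := zero_lt_one.trans hr1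
      have hσ : σ r ≤ σ 1 := h.rate_anti (mem_Ioi.2 zero_lt_one) (mem_Ioi.2 hr0) hr1.le
      have hσ0 := h.rate_nonneg r
      set ψ := (U r : L2 d →L[ℂ] L2 d) (G u) with hψ
      have hψn : ‖ψ‖ ≤ N * ‖u‖ := norm_unitary_apply_le U G r u
      set x := P ψ with hx
      set φ := Q x with hφ
      have hφn : ‖φ‖ ≤ N * ‖u‖ := (hP.norm_le h.res.isPos ψ).1.trans hψn
      set x₁ := Lt φ with hx₁
      have hgt1 : ∀ v, ‖gt v‖ ≤ ‖v‖ := fun v => by simpa using gt.le_of_opNorm_le hg.norm_le v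
      have hgtQ : ∀ v, gt (Q v) = Q (gt v) := fun v => by rw [hg.eq_left, hg.eq_right]
      have hQx₁ : Q x₁ = gt φ := (hg.eq_left φ).symm
      have hx₁' : gc (Q x₁) = Q x₁ := by rw [hQx₁, hg.gc_gt]
      have main := h.res.outgoing_le h.grad (hf r) hg.cut hc hcsκ x x₁ hx₁'
      have n1 : ‖Q x₁‖ ≤ N * ‖u‖ := by rw [hQx₁]; exact (hgt1 φ).trans hφn
      have n2 : ‖Q (x - x₁)‖ ≤ 2 * σ r * ‖u‖ := by
        -- The cutoff `gt` commutes with `Q` and `P`, so the high-energy part is the contraction `Q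
        -- P` applied to `(1 - gt) ψ`.
        have e1 : Q (x - x₁) = Q (P (ψ - gt ψ)) := by
          rw [map_sub, hQx₁, map_sub, map_sub, hφ, hgtQ, hx, hP.commute hgtQ]
        rw [e1]
        refine (hP.norm_le h.res.isPos _).1.trans ?_
        set e := ψ - g ((U r : L2 d →L[ℂ] L2 d) u) with he
        -- Since `gt g = g`, the operator `1 - gt` kills `g U u`. Only `e`, the difference of `U G
        -- u` and `g U u`, remains, and it is of size `σ r`.
        have e2 : ψ - gt ψ = e - gt e := by
          rw [he, map_sub, hg.gt_g]; abel
        rw [e2]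
        have := h.asymp r hr0 u
        refine (norm_sub_le _ _).trans ?_
        linarith [hgt1 e]
      have n3 : ‖commOp Q D (f₁ r) (f₂ r) x₁‖ ≤ κ * Y * ‖u‖ := by
        refine ((commOp Q D (f₁ r) (f₂ r)).le_of_opNorm_le
          (norm_commOp_le hκ (hf r).bound₁ (hf r).bound₂) x₁).trans ?_
        have : ‖x₁‖ ≤ ‖Lt‖ * (N * ‖u‖) := Lt.le_opNorm_of_le hφn
        calc _ ≤ κ * S * (‖Lt‖ * (N * ‖u‖)) := mul_le_mul_of_nonneg_left this (by positivity)
          _ = _ := by rw [hY]; ring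
      have n4 : ‖commOp Q D (f₁ r) (f₂ r) (x - x₁)‖ ≤
          κ * (Y + (A * (1 + σ 1) + d * N)) * ‖u‖ := by
        rw [map_sub]
        refine (norm_sub_le _ _).trans ?_
        have k1 : ‖commOp Q D (f₁ r) (f₂ r) x‖ ≤ κ * ((A * (1 + σ 1) + d * N) * ‖u‖) := by
          refine (norm_commOp_apply_le hκ (hf r).bound₁ (hf r).bound₂ x).trans ?_
          refine mul_le_mul_of_nonneg_left ?_ hκ
          have k2 := h.energy ε P hP r hr0 u
          have k3 : A * (1 + σ r) * ‖u‖ ≤ A * (1 + σ 1) * ‖u‖ := by gcongr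
          have k4 := mul_le_mul_of_nonneg_left hφn (Nat.cast_nonneg (α := ℝ) d)
          linarith
        linarith
      rw [smul_apply, mul_apply_eq_comp]
      refine main.trans ?_
      have t1 : s * (κ * (Real.sqrt (C * ‖Q‖) * (K' * S)) * ‖Q x₁‖ ^ 2) ≤
          s * (κ * (Real.sqrt (C * ‖Q‖) * (K' * S)) * (N * ‖u‖) ^ 2) := by gcongr
      have t2 : κ * ‖Q (x - x₁)‖ * (2 * ‖Q x₁‖ + ‖Q (x - x₁)‖) ≤
          κ * (2 * σ r * ‖u‖) * (2 * (N * ‖u‖) + 2 * σ 1 * ‖u‖) := by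
        have : 2 * σ r * ‖u‖ ≤ 2 * σ 1 * ‖u‖ := by gcongr
        gcongr
        exact n2.trans this
      have t3 : (2 * ‖commOp Q D (f₁ r) (f₂ r) x₁‖ + ‖commOp Q D (f₁ r) (f₂ r) (x - x₁)‖) *
          ‖Q (x - x₁)‖ ≤ (2 * (κ * Y * ‖u‖) + κ * (Y + (A * (1 + σ 1) + d * N)) * ‖u‖) *
          (2 * σ r * ‖u‖) := by gcongr
      refine (add_le_add (add_le_add t1 t2) t3).trans (le_of_eq ?_)
      rw [hβ, hX, hZ]
      ring)
  refine key.trans ?_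
  simp only [hβ]
  rw [intervalIntegral.integral_mul_const, intervalIntegral.integral_const_mul,
    intervalIntegral.integral_add intervalIntegrable_const (hσi.const_mul Z),
    intervalIntegral.integral_const, intervalIntegral.integral_const_mul, smul_eq_mul]
  have hba : 0 ≤ b - a := sub_nonneg.2 hab
  refine mul_le_mul_of_nonneg_right (mul_le_mul_of_nonneg_left ?_ hκ) (sq_nonneg _)
  have t1 := mul_le_mul_of_nonneg_left hσl hZ0
  have t2 : 0 ≤ Z * (∫ r in Ioi 0, σ r) * (s * (b - a)) := by positivity
  nlinarith

end MaxSpeed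

namespace MaxSpeed

open scoped ComplexConjugate

/-! ### Cutoffs in the position -/

variable {d : ℕ}

/-- The smooth substitute `√(1 + |x|²)` for `|x|`. -/
noncomputable def jap (x : Space d) : ℝ := Real.sqrt (1 + ‖x‖ ^ 2)

/-- The first derivatives of `jap`. -/
noncomputable def jap₁ (j : Fin d) (x : Space d) : ℝ := x j * (jap x)⁻¹

/-- The pure second derivatives of `jap`. -/
noncomputable def jap₂ (j : Fin d) (x : Space d) : ℝ := (1 - jap₁ j x * jap₁ j x) * (jap x)⁻¹

theorem jap_sq (x : Space d) : jap x ^ 2 = 1 + ‖x‖ ^ 2 := Real.sq_sqrt (by positivity)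

theorem one_le_jap (x : Space d) : 1 ≤ jap x := by
  rw [jap, Real.one_le_sqrt]
  linarith [sq_nonneg ‖x‖]

theorem norm_le_jap (x : Space d) : ‖x‖ ≤ jap x :=
  Real.le_sqrt_of_sq_le (by linarith)

theorem jap_pos (x : Space d) : 0 < jap x := zero_lt_one.trans_le (one_le_jap x)

theorem jap_temperate : (jap : Space d → ℝ).HasTemperateGrowth := by
  have h := Function.hasTemperateGrowth_one_add_norm_sq_rpow (Space d) (1 / 2)
  have h2 : (jap : Space d → ℝ) = fun x => (1 + ‖x‖ ^ 2) ^ (1 / 2 : ℝ) := by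
    ext x; rw [jap, Real.sqrt_eq_rpow]
  rwa [h2]

theorem jap_inv_temperate : (fun x : Space d => (jap x)⁻¹).HasTemperateGrowth := by
  have h := Function.hasTemperateGrowth_one_add_norm_sq_rpow (Space d) (-(1 / 2))
  have h2 : (fun x : Space d => (jap x)⁻¹) = fun x => (1 + ‖x‖ ^ 2) ^ (-(1 / 2) : ℝ) := by
    ext x; rw [jap, Real.sqrt_eq_rpow, Real.rpow_neg (by positivity)]
  rwa [h2]

theorem coord_temperate (j : Fin d) : (fun x : Space d => x j).HasTemperateGrowth :=
  (EuclideanSpace.proj j : Space d →L[ℝ] ℝ).hasTemperateGrowth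

theorem jap₁_temperate (j : Fin d) : (jap₁ j : Space d → ℝ).HasTemperateGrowth :=
  (coord_temperate j).mul jap_inv_temperate

theorem jap₂_temperate (j : Fin d) : (jap₂ j : Space d → ℝ).HasTemperateGrowth :=
  ((Function.HasTemperateGrowth.const 1).sub ((jap₁_temperate j).mul (jap₁_temperate j))).mul
    jap_inv_temperate

theorem sum_jap₁_sq_le (x : Space d) : ∑ j, jap₁ j x ^ 2 ≤ 1 := by
  have h := jap_pos x
  simp only [jap₁, mul_pow]
  rw [← Finset.sum_mul, inv_pow, ← div_eq_mul_inv, div_le_one (by positivity), jap_sq,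
    EuclideanSpace.norm_sq_eq]
  simp only [Real.norm_eq_abs, sq_abs]
  linarith

theorem abs_jap₁_le (j : Fin d) (x : Space d) : |jap₁ j x| ≤ 1 := by
  rw [← sq_le_one_iff_abs_le_one]
  exact (Finset.single_le_sum (f := fun j => jap₁ j x ^ 2) (fun i _ => sq_nonneg _)
    (Finset.mem_univ j)).trans (sum_jap₁_sq_le x)

theorem abs_jap₂_le (j : Fin d) (x : Space d) : |jap₂ j x| ≤ 1 := by
  have h1 := (sq_le_one_iff_abs_le_one _).2 (abs_jap₁_le j x)
  rw [jap₂, abs_mul, abs_of_nonneg (by nlinarith), abs_of_pos (inv_pos.2 (jap_pos x))]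
  exact mul_le_one₀ (by nlinarith [mul_self_nonneg (jap₁ j x)]) (inv_pos.2 (jap_pos x)).le
    (inv_le_one_of_one_le₀ (one_le_jap x))

theorem jap_lineDeriv (j : Fin d) (x : Space d) : HasLineDerivAt ℝ jap (jap₁ j x) x (ee j) := by
  have h1 : HasFDerivAt (fun x : Space d => 1 + ‖x‖ ^ 2) (2 • innerSL ℝ x) x :=
    (hasStrictFDerivAt_norm_sq x).hasFDerivAt.const_add 1
  have h2 : HasLineDerivAt ℝ jap _ x (ee j) := (h1.sqrt (by positivity)).hasLineDerivAt (ee j)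
  have h3 : inner ℝ x (ee j) = x j := inner_ee x j
  have h4 : ((1 / (2 * Real.sqrt (1 + ‖x‖ ^ 2))) • (2 • innerSL ℝ x)) (ee j) = jap₁ j x := by
    rw [smul_apply, smul_apply, innerSL_apply_apply, h3, jap₁, smul_eq_mul, nsmul_eq_mul, ← jap]
    have := jap_pos x
    push_cast
    field_simp
  rwa [h4] at h2

theorem jap₁_lineDeriv (j : Fin d) (x : Space d) :
    HasLineDerivAt ℝ (jap₁ j) (jap₂ j x) x (ee j) := by
  have h1 : HasDerivAt (fun τ : ℝ => (x + τ • ee j) j) 1 0 := by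
    have : HasLineDerivAt ℝ (fun x : Space d => x j) ((EuclideanSpace.proj j : Space d →L[ℝ] ℝ) (ee j))
        x (ee j) :=
      ((EuclideanSpace.proj j : Space d →L[ℝ] ℝ).hasFDerivAt (x := x)).hasLineDerivAt (ee j)
    have h2 : (EuclideanSpace.proj j : Space d →L[ℝ] ℝ) (ee j) = 1 := by simp [ee]
    rwa [h2] at this
  have h0 := jap_pos x
  have e0 : x + (0 : ℝ) • ee j = x := by rw [zero_smul, add_zero]
  have h2 := HasDerivAt.inv (jap_lineDeriv j x) (by rw [e0]; exact h0.ne')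
  have h3 := HasDerivAt.mul h1 h2
  have h5 : 1 * (fun t : ℝ => jap (x + t • ee j))⁻¹ 0 +
      (x + (0 : ℝ) • ee j) j * (-jap₁ j x / jap (x + (0 : ℝ) • ee j) ^ 2) = jap₂ j x := by
    rw [Pi.inv_apply, e0, jap₂, jap₁]
    field_simp
    ring
  rw [h5] at h3
  exact h3

theorem fderiv_eq_of_lineDeriv {η : Space d → ℝ} (hη : η.HasTemperateGrowth) {x : Space d} {j : Fin d}
    {a : ℝ} (h : HasLineDerivAt ℝ η a x (ee j)) : fderiv ℝ η x (ee j) = a := by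
  rw [← (hη.1.differentiable (by simp) x).lineDeriv_eq_fderiv, h.lineDeriv]

variable {η η' η'' : ℝ → ℝ}

theorem comp_jap_lineDeriv {y : Space d} {s e a : ℝ} (h : HasDerivAt η a (s * (jap y - e)))
    (j : Fin d) :
    HasLineDerivAt ℝ (fun x => η (s * (jap x - e))) (s * (a * jap₁ j y)) y (ee j) := by
  have h1 : HasDerivAt (fun τ : ℝ => s * (jap (y + τ • ee j) - e)) (s * jap₁ j y) 0 :=
    (HasDerivAt.sub_const e (jap_lineDeriv j y)).const_mul s
  have h2 := HasDerivAt.comp (h₂ := η) (h₂' := a) 0 (by simpa using h) h1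
  rw [mul_left_comm] at h2
  exact h2

/-- The chain rule gives a factor `s` for the first derivatives. The second derivatives also keep a
term with only one `s`, coming from those of `jap`, so both are bounded by multiples of `s`; `s ≤ 1`
absorbs the term with `s²`. -/
theorem smoothMul_comp_jap (hη : η.HasTemperateGrowth) (hη' : η'.HasTemperateGrowth)
    (hη'' : η''.HasTemperateGrowth) (hd : ∀ y, HasDerivAt η (η' y) y)
    (hd' : ∀ y, HasDerivAt η' (η'' y) y) {M₀ M : ℝ} (h₀ : ∀ y, |η y| ≤ M₀) (h₁ : ∀ y, |η' y| ≤ M)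
    (h₂ : ∀ y, |η'' y| ≤ M) {s : ℝ} (hs : 0 ≤ s) (hs1 : s ≤ 1) (e : ℝ) :
    SmoothMul (fun x : Space d => η (s * (jap x - e)))
      (fun j x => s * (η' (s * (jap x - e)) * jap₁ j x))
      (fun j x => s * (s * (η'' (s * (jap x - e)) * (jap₁ j x * jap₁ j x)) +
        η' (s * (jap x - e)) * jap₂ j x)) ∧
    (∀ (j : Fin d) (x : Space d), |s * (η' (s * (jap x - e)) * jap₁ j x)| ≤ 2 * M * s) ∧
    ∀ (j : Fin d) (x : Space d), |s * (s * (η'' (s * (jap x - e)) * (jap₁ j x * jap₁ j x)) +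
        η' (s * (jap x - e)) * jap₂ j x)| ≤ 2 * M * s := by
  have hM : 0 ≤ M := (abs_nonneg _).trans (h₁ 0)
  have t0 : (fun x : Space d => s * (jap x - e)).HasTemperateGrowth :=
    (Function.HasTemperateGrowth.const s).mul (jap_temperate.sub (.const e))
  have t1 : ∀ j, (fun x : Space d => s * (η' (s * (jap x - e)) * jap₁ j x)).HasTemperateGrowth :=
    fun j => (Function.HasTemperateGrowth.const s).mul ((hη'.comp t0).mul (jap₁_temperate j))
  have b1 : ∀ (j : Fin d) (x : Space d), |s * (η' (s * (jap x - e)) * jap₁ j x)| ≤ 2 * M * s := by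
    intro j x
    rw [abs_mul, abs_mul, abs_of_nonneg hs]
    have : |η' (s * (jap x - e))| * |jap₁ j x| ≤ M * 1 :=
      mul_le_mul (h₁ _) (abs_jap₁_le j x) (abs_nonneg _) hM
    nlinarith
  have b2 : ∀ (j : Fin d) (x : Space d), |s * (s * (η'' (s * (jap x - e)) * (jap₁ j x * jap₁ j x)) +
        η' (s * (jap x - e)) * jap₂ j x)| ≤ 2 * M * s := by
    intro j x
    rw [abs_mul, abs_of_nonneg hs]
    have k1 : |η' (s * (jap x - e)) * jap₂ j x| ≤ M * 1 := by
      rw [abs_mul]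
      exact mul_le_mul (h₁ _) (abs_jap₂_le j x) (abs_nonneg _) hM
    have k2 : |s * (η'' (s * (jap x - e)) * (jap₁ j x * jap₁ j x))| ≤ 1 * (M * (1 * 1)) := by
      rw [abs_mul, abs_mul, abs_mul, abs_of_nonneg hs]
      have := abs_jap₁_le j x
      have := h₂ (s * (jap x - e))
      gcongr
    have := abs_add_le (s * (η'' (s * (jap x - e)) * (jap₁ j x * jap₁ j x)))
      (η' (s * (jap x - e)) * jap₂ j x)
    nlinarith
  refine ⟨⟨hη.comp t0, t1, fun j => ?_, fun j x => ?_, fun j x => ?_, ⟨M₀, fun x => h₀ _⟩,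
    ⟨_, b1⟩, ⟨_, b2⟩⟩, b1, b2⟩
  · exact (Function.HasTemperateGrowth.const s).mul
      (((Function.HasTemperateGrowth.const s).mul ((hη''.comp t0).mul
        ((jap₁_temperate j).mul (jap₁_temperate j)))).add ((hη'.comp t0).mul (jap₂_temperate j)))
  · exact fderiv_eq_of_lineDeriv (hη.comp t0) (comp_jap_lineDeriv (hd _) j)
  · refine fderiv_eq_of_lineDeriv (t1 j) ?_
    have k1 := comp_jap_lineDeriv (s := s) (e := e) (y := x) (hd' _) j
    have k2 := HasDerivAt.const_mul s (HasDerivAt.mul k1 (jap₁_lineDeriv j x))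
    have k3 : s * (s * (η'' (s * (jap x - e)) * jap₁ j x) * jap₁ j (x + (0 : ℝ) • ee j) +
        η' (s * (jap (x + (0 : ℝ) • ee j) - e)) * jap₂ j x) =
        s * (s * (η'' (s * (jap x - e)) * (jap₁ j x * jap₁ j x)) +
          η' (s * (jap x - e)) * jap₂ j x) := by
      rw [zero_smul, add_zero]
      ring
    rw [k3] at k2
    exact k2

end MaxSpeed

/-! ### Smooth steps on the line -/

namespace MaxSpeed

open scoped ComplexConjugate

variable {d : ℕ}

theorem exists_abs_le_of_hasCompactSupport {η : ℝ → ℝ} (hη : ContDiff ℝ ∞ η)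
    (hc : HasCompactSupport η) : ∃ M, ∀ y, |η y| ≤ M := by
  obtain ⟨M, hM⟩ := hc.exists_bound_of_continuous hη.continuous
  exact ⟨M, hM⟩

/-- A smooth step: zero for `y ≤ 0`, one for `y ≥ δ`. -/
theorem exists_step {δ : ℝ} (hδ : 0 < δ) : ∃ (η η' η'' : ℝ → ℝ) (M : ℝ),
    η.HasTemperateGrowth ∧ η'.HasTemperateGrowth ∧ η''.HasTemperateGrowth ∧
    (∀ y, HasDerivAt η (η' y) y) ∧ (∀ y, HasDerivAt η' (η'' y) y) ∧ (∀ y, |η y| ≤ 1) ∧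
    (∀ y, |η' y| ≤ M) ∧ (∀ y, |η'' y| ≤ M) ∧ (∀ y ≤ 0, η y = 0) ∧ ∀ y, δ ≤ y → η y = 1 := by
  set η : ℝ → ℝ := fun y => Real.smoothTransition (δ⁻¹ * y) with hη
  have hs : ContDiff ℝ ∞ η := Real.smoothTransition.contDiff.comp (contDiff_const.mul contDiff_id)
  have hs1 : ContDiff ℝ ∞ (deriv η) := (contDiff_infty_iff_deriv.1 hs).2
  have hs2 : ContDiff ℝ ∞ (deriv (deriv η)) := (contDiff_infty_iff_deriv.1 hs1).2
  have h0 : ∀ y ≤ 0, η y = 0 := fun y hy => Real.smoothTransition.zero_of_nonpos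
    (mul_nonpos_of_nonneg_of_nonpos (inv_pos.2 hδ).le hy)
  have h1 : ∀ y, δ ≤ y → η y = 1 := fun y hy => Real.smoothTransition.one_of_one_le (by
    rw [← div_eq_inv_mul]; exact (one_le_div hδ).2 hy)
  have hc1 : HasCompactSupport (deriv η) := by
    refine HasCompactSupport.intro (isCompact_Icc (a := 0) (b := δ)) fun y hy => ?_
    rw [mem_Icc, not_and_or, not_le, not_le] at hy
    rcases hy with hy | hy
    · have : η =ᶠ[𝓝 y] fun _ => 0 := by
        filter_upwards [Iio_mem_nhds hy] with z hz using h0 z (le_of_lt hz)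
      rw [this.deriv_eq, deriv_const]
    · have : η =ᶠ[𝓝 y] fun _ => 1 := by
        filter_upwards [Ioi_mem_nhds hy] with z hz using h1 z (le_of_lt hz)
      rw [this.deriv_eq, deriv_const]
  have hc2 : HasCompactSupport (deriv (deriv η)) := hc1.deriv
  obtain ⟨M₁, hM₁⟩ := exists_abs_le_of_hasCompactSupport hs1 hc1
  obtain ⟨M₂, hM₂⟩ := exists_abs_le_of_hasCompactSupport hs2 hc2
  have t1 := hc1.hasTemperateGrowth hs1
  have hb : ∀ y, |η y| ≤ 1 := fun y => by
    rw [abs_of_nonneg (Real.smoothTransition.nonneg _)]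
    exact Real.smoothTransition.le_one _
  have hd : ∀ y, HasDerivAt η (deriv η y) y := fun y =>
    (hs.differentiable (by simp) y).hasDerivAt
  refine ⟨η, deriv η, deriv (deriv η), max M₁ M₂, ?_, t1, hc2.hasTemperateGrowth hs2, hd,
    fun y => (hs1.differentiable (by simp) y).hasDerivAt, hb,
    fun y => (hM₁ y).trans (le_max_left _ _), fun y => (hM₂ y).trans (le_max_right _ _), h0, h1⟩
  refine Function.HasTemperateGrowth.of_fderiv (k := 0) (C := 1) ?_ (hs.differentiable (by simp))
    fun y => by simpa using hb y
  have : fderiv ℝ η = fun y => (ContinuousLinearMap.toSpanSingleton ℝ (deriv η y)) := by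
    ext y; simp
  rw [this]
  exact (ContinuousLinearMap.toSpanSingletonCLE (𝕜 := ℝ) (E := ℝ)).hasTemperateGrowth.comp t1

/-- A smooth step whose derivative is a square: zero for `y ≤ δ`, constant for `y ≥ 3δ`. -/
theorem exists_sq_step {δ : ℝ} (hδ : 0 < δ) : ∃ (η η' η'' h h' h'' : ℝ → ℝ) (M m : ℝ),
    η.HasTemperateGrowth ∧ η'.HasTemperateGrowth ∧ η''.HasTemperateGrowth ∧
    h.HasTemperateGrowth ∧ h'.HasTemperateGrowth ∧ h''.HasTemperateGrowth ∧
    (∀ y, HasDerivAt η (η' y) y) ∧ (∀ y, HasDerivAt η' (η'' y) y) ∧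
    (∀ y, HasDerivAt h (h' y) y) ∧ (∀ y, HasDerivAt h' (h'' y) y) ∧
    (∀ y, η' y = h y * h y) ∧ (∀ y, |h y| ≤ 1) ∧ 0 < m ∧ (∀ y, 0 ≤ η y) ∧ (∀ y, η y ≤ m) ∧
    (∀ y, |η' y| ≤ M) ∧ (∀ y, |η'' y| ≤ M) ∧ (∀ y, |h' y| ≤ M) ∧ (∀ y, |h'' y| ≤ M) ∧
    (∀ y ≤ δ, η y = 0) ∧ ∀ y, 3 * δ ≤ y → η y = m := by
  -- The bump has support `[δ, 3δ]`, and the step is the primitive of its square. Starting from the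
  -- bump makes the square root of the derivative smooth, as `h` must be.
  set b : ContDiffBump (2 * δ : ℝ) := ⟨δ / 2, δ, by positivity, by linarith⟩ with hb
  set h : ℝ → ℝ := fun y => b y with hh
  have s0 : ContDiff ℝ ∞ h := b.contDiff
  have s1 : ContDiff ℝ ∞ (deriv h) := (contDiff_infty_iff_deriv.1 s0).2
  have s2 : ContDiff ℝ ∞ (deriv (deriv h)) := (contDiff_infty_iff_deriv.1 s1).2
  have c0 : HasCompactSupport h := b.hasCompactSupport
  have c1 : HasCompactSupport (deriv h) := c0.deriv
  have c2 : HasCompactSupport (deriv (deriv h)) := c1.deriv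
  have t0 := c0.hasTemperateGrowth s0
  have t1 := c1.hasTemperateGrowth s1
  have t2 := c2.hasTemperateGrowth s2
  have d0 : ∀ y, HasDerivAt h (deriv h y) y := fun y => (s0.differentiable (by simp) y).hasDerivAt
  have d1 : ∀ y, HasDerivAt (deriv h) (deriv (deriv h) y) y := fun y =>
    (s1.differentiable (by simp) y).hasDerivAt
  have hh0 : ∀ y, 0 ≤ h y := fun y => b.nonneg
  have hh1 : ∀ y, |h y| ≤ 1 := fun y => by rw [abs_of_nonneg (hh0 y)]; exact b.le_one
  have hz : ∀ y, y ≤ δ ∨ 3 * δ ≤ y → h y = 0 := fun y hy => b.zero_of_le_dist (by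
    change δ ≤ dist y (2 * δ)
    rw [Real.dist_eq]
    rcases hy with hy | hy
    · rw [abs_of_nonpos (by linarith)]; linarith
    · rw [abs_of_nonneg (by linarith)]; linarith)
  set q : ℝ → ℝ := fun y => h y * h y with hq
  have qc : Continuous q := s0.continuous.mul s0.continuous
  have q0 : ∀ y, 0 ≤ q y := fun y => mul_self_nonneg _
  have qt : q.HasTemperateGrowth := t0.mul t0
  set η : ℝ → ℝ := fun y => ∫ u in δ..y, q u with hη
  have hd : ∀ y, HasDerivAt η (q y) y := fun y =>
    intervalIntegral.integral_hasDerivAt_right (qc.intervalIntegrable _ _)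
      qc.aestronglyMeasurable.stronglyMeasurableAtFilter qc.continuousAt
  have hmono : Monotone η := monotone_of_hasDerivAt_nonneg hd q0
  have e0 : ∀ y ≤ δ, η y = 0 := fun y hy => by
    simp only [hη]
    rw [intervalIntegral.integral_zero_ae]
    refine ae_of_all _ fun u hu => ?_
    rw [uIoc_of_ge hy] at hu
    simp only [hq]
    rw [hz u (Or.inl hu.2), mul_zero]
  have e1 : ∀ y, 3 * δ ≤ y → η y = η (3 * δ) := fun y hy => by
    simp only [hη]
    rw [← sub_eq_zero, intervalIntegral.integral_interval_sub_left (qc.intervalIntegrable _ _)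
      (qc.intervalIntegrable _ _), intervalIntegral.integral_zero_ae]
    refine ae_of_all _ fun u hu => ?_
    rw [uIoc_of_le hy] at hu
    simp only [hq]
    rw [hz u (Or.inr hu.1.le), mul_zero]
  have hle : ∀ y, η y ≤ η (3 * δ) := fun y => by
    rcases le_total y (3 * δ) with hy | hy
    · exact hmono hy
    · exact (e1 y hy).le
  have hge : ∀ y, 0 ≤ η y := fun y => by
    rcases le_total y δ with hy | hy
    · exact (e0 y hy).ge
    · exact (e0 δ le_rfl).symm.le.trans (hmono hy)
  have hpos : 0 < η (3 * δ) := by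
    refine intervalIntegral.intervalIntegral_pos_of_pos_on (qc.intervalIntegrable _ _) ?_
      (by linarith)
    intro y hy
    have : 0 < h y := b.pos_of_mem_ball (by
      change dist y (2 * δ) < δ
      rw [Real.dist_eq, abs_lt]
      constructor <;> linarith [hy.1, hy.2])
    exact mul_pos this this
  set q' : ℝ → ℝ := fun y => deriv h y * h y + h y * deriv h y with hq'
  have qt' : q'.HasTemperateGrowth := (t1.mul t0).add (t0.mul t1)
  have qd : ∀ y, HasDerivAt q (q' y) y := fun y => (d0 y).mul (d0 y)
  obtain ⟨M₁, hM₁⟩ := exists_abs_le_of_hasCompactSupport s1 c1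
  obtain ⟨M₂, hM₂⟩ := exists_abs_le_of_hasCompactSupport s2 c2
  have hM0 : 0 ≤ M₁ := (abs_nonneg _).trans (hM₁ 0)
  have hq1 : ∀ y, |q y| ≤ 1 := fun y => by
    simp only [hq]
    rw [abs_mul]
    exact mul_le_one₀ (hh1 y) (abs_nonneg _) (hh1 y)
  have hq1' : ∀ y, |q' y| ≤ 2 * M₁ := fun y => by
    have : |h y * deriv h y| ≤ 1 * M₁ := by
      rw [abs_mul]; exact mul_le_mul (hh1 y) (hM₁ y) (abs_nonneg _) zero_le_one
    simp only [hq']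
    rw [mul_comm (deriv h y)]
    linarith [abs_add_le (h y * deriv h y) (h y * deriv h y)]
  refine ⟨η, q, q', h, deriv h, deriv (deriv h), max 1 (max (2 * M₁) M₂), η (3 * δ), ?_, qt, qt', t0,
    t1, t2, hd, qd, d0, d1, fun y => rfl, hh1, hpos, hge, hle, fun y => (hq1 y).trans (le_max_left _ _),
    fun y => (hq1' y).trans ((le_max_left _ _).trans (le_max_right _ _)),
    fun y => (hM₁ y).trans (?_), fun y => (hM₂ y).trans ((le_max_right _ _).trans (le_max_right _ _)),
    e0, e1⟩
  · refine Function.HasTemperateGrowth.of_fderiv (k := 0) (C := η (3 * δ)) ?_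
      (fun y => (hd y).differentiableAt) fun y => by
        simpa [abs_of_nonneg (hge y)] using hle y
    have : fderiv ℝ η = fun y => (ContinuousLinearMap.toSpanSingleton ℝ (q y)) := by
      ext y; simp [(hd y).deriv]
    rw [this]
    exact (ContinuousLinearMap.toSpanSingletonCLE (𝕜 := ℝ) (E := ℝ)).hasTemperateGrowth.comp qt
  · exact (by linarith : M₁ ≤ 2 * M₁).trans ((le_max_left _ _).trans (le_max_right _ _))

end MaxSpeed

/-! ### Multiplication by cutoffs: order and dependence on time -/

namespace MaxSpeed

open scoped ComplexConjugate

variable {d : ℕ}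

theorem re_inner_mulR_le {a b : Space d → ℝ} (ha : MemLp (fun x => (a x : ℂ)) ⊤ volume)
    (hb : MemLp (fun x => (b x : ℂ)) ⊤ volume) (hab : ∀ x, a x ≤ b x) (u : L2 d) :
    (inner ℂ u (mulR a u)).re ≤ (inner ℂ u (mulR b u)).re := by
  rw [L2.inner_def, L2.inner_def, ← RCLike.re_eq_complex_re, ← integral_re (L2.integrable_inner _ _),
    ← integral_re (L2.integrable_inner _ _)]
  refine integral_mono_ae (L2.integrable_inner u _).re (L2.integrable_inner u _).re ?_
  filter_upwards [hasMul_mulB ha u, hasMul_mulB hb u] with x h1 h2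
  have key : ∀ (r : ℝ) (z : ℂ), RCLike.re (inner ℂ z ((r : ℂ) * z)) = r * ‖z‖ ^ 2 := fun r z => by
    rw [← smul_eq_mul, inner_smul_right, inner_self_eq_norm_sq_to_K, RCLike.re_eq_complex_re,
      Complex.re_ofReal_mul]
    norm_cast
  rw [h1, h2, key, key]
  exact mul_le_mul_of_nonneg_right (hab x) (sq_nonneg _)

theorem memLp_indicator {S : Set (Space d)} (hS : MeasurableSet S) :
    MemLp (fun x => ((S.indicator 1 x : ℝ) : ℂ)) ⊤ volume := by
  refine memLp_top_of_bound (Complex.measurable_ofReal.comp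
    (measurable_one.indicator hS)).aestronglyMeasurable 1 (ae_of_all _ fun x => ?_)
  rw [Complex.norm_real]
  by_cases hx : x ∈ S <;> simp [hx]

theorem cutoff_apply {S : Set (Space d)} (hS : MeasurableSet S) (u : L2 d) :
    cutoff S hS u = mulR (S.indicator 1) u := by
  refine (HasMul.mulB_eq (memLp_indicator hS) ?_).symm
  refine (cutoffFun_coe S hS u).trans (ae_of_all _ fun x => ?_)
  by_cases hx : x ∈ S <;> simp [hx]

theorem norm_cutoff_apply_le {S : Set (Space d)} (hS : MeasurableSet S) (u : L2 d) :
    ‖cutoff S hS u‖ ≤ ‖u‖ := (cutoffFun_norm_le S hS u).trans_eq (one_mul _)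

theorem mulR_self_inner {a : Space d → ℝ} (ha : MemLp (fun x => (a x : ℂ)) ⊤ volume) (u : L2 d) :
    (inner ℂ u (mulR (fun x => a x * a x) u)).re = ‖mulR a u‖ ^ 2 := by
  rw [mulR_mul ha ha, mulB_inner_ofReal, inner_self_eq_norm_sq_to_K]
  norm_cast

theorem re_inner_mulR_const_mul {a : Space d → ℝ} (m : ℝ)
    (ha : MemLp (fun x => (a x : ℂ)) ⊤ volume) (u : L2 d) :
    MemLp (fun x => ((m * a x : ℝ) : ℂ)) ⊤ volume ∧
    (inner ℂ u (mulR (fun x => m * a x) u)).re = m * (inner ℂ u (mulR a u)).re := by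
  have h1 : MemLp (fun x => ((m * a x : ℝ) : ℂ)) ⊤ volume := by
    simpa only [Complex.ofReal_mul] using ha.const_mul (m : ℂ)
  refine ⟨h1, ?_⟩
  have : mulR (fun x => m * a x) u = (m : ℂ) • mulR a u :=
    HasMul.mulB_eq h1 (((hasMul_mulB ha u).smul_symbol (m : ℂ)).congr
      (ae_of_all _ fun x => by push_cast; ring))
  rw [this, inner_smul_right, Complex.re_ofReal_mul]

theorem cutoff_mulR_eq_zero {S : Set (Space d)} (hS : MeasurableSet S) {J : Space d → ℝ}
    (hJ : MemLp (fun x => (J x : ℂ)) ⊤ volume) (h0 : ∀ x ∈ S, J x = 0) (u : L2 d) :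
    mulR J (cutoff S hS u) = 0 := by
  rw [cutoff_apply]
  refine ((hasMul_mulB (memLp_indicator hS) u).comp (hasMul_mulB hJ _)).unique ?_
  have := hasMul_const 0 u
  rw [zero_smul] at this
  refine this.congr (ae_of_all _ fun x => ?_)
  by_cases hx : x ∈ S
  · simp [h0 x hx]
  · simp [hx]

/-- The remainder is uniform in `y`, so moving a cutoff in time is differentiable in operator norm,
as the Heisenberg inequality requires. -/
theorem norm_taylor_le {η η' η'' : ℝ → ℝ} (hd : ∀ y, HasDerivAt η (η' y) y)
    (hd' : ∀ y, HasDerivAt η' (η'' y) y) {M : ℝ} (hM : ∀ y, |η'' y| ≤ M) (y z : ℝ) :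
    |η (y + z) - η y - z * η' y| ≤ M * z ^ 2 := by
  have hM0 : 0 ≤ M := (abs_nonneg _).trans (hM 0)
  have hlip : ∀ z, |η' (y + z) - η' y| ≤ M * |z| := fun z => by
    have := Convex.norm_image_sub_le_of_norm_hasDerivWithin_le (f := η') (f' := η'') (s := univ)
      (x := y) (y := y + z) (C := M) (fun x _ => (hd' x).hasDerivWithinAt) (fun x _ => hM x)
      convex_univ (mem_univ _) (mem_univ _)
    simpa using this
  have := Convex.norm_image_sub_le_of_norm_hasDerivWithin_le (f := fun z => η (y + z) - z * η' y)
    (f' := fun z => η' (y + z) - η' y) (s := uIcc 0 z) (x := 0) (y := z) (C := M * |z|)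
    (fun x _ => (((hd (y + x)).comp_const_add y x).sub (by
      simpa using (hasDerivAt_id x).mul_const (η' y))).hasDerivWithinAt)
    (fun x hx => (hlip x).trans (mul_le_mul_of_nonneg_left (by
      simpa using abs_sub_left_of_mem_uIcc hx) hM0))
    (convex_uIcc 0 z) left_mem_uIcc right_mem_uIcc
  simp only [Real.norm_eq_abs, sub_zero, zero_mul, add_zero] at this
  rw [mul_assoc, abs_mul_abs_self] at this
  rw [pow_two]
  convert this using 2
  ring

theorem hasDerivAt_of_norm_le {E : Type*} [NormedAddCommGroup E] [NormedSpace ℝ E] {f : ℝ → E}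
    {f' : E} {r M : ℝ} (h : ∀ r', ‖f r' - f r - (r' - r) • f'‖ ≤ M * (r' - r) ^ 2) :
    HasDerivAt f f' r := by
  rw [hasDerivAt_iff_isLittleO]
  have h1 : (fun r' => f r' - f r - (r' - r) • f') =O[𝓝 r] fun r' => (r' - r) ^ 2 :=
    Asymptotics.IsBigO.of_bound M (Eventually.of_forall fun r' => by
      rw [Real.norm_of_nonneg (sq_nonneg _)]; exact h r')
  refine h1.trans_isLittleO ?_
  have h2 : (fun z : ℝ => z ^ 2) =o[𝓝 0] fun z => z ^ 1 :=
    Asymptotics.isLittleO_pow_pow one_lt_two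
  have h3 : Tendsto (fun r' : ℝ => r' - r) (𝓝 r) (𝓝 0) := by
    have : Continuous fun r' : ℝ => r' - r := by fun_prop
    simpa using this.tendsto r
  have h4 := h2.comp_tendsto h3
  simp only [Function.comp_def, pow_one] at h4
  exact h4

theorem norm_mulR_sub_sub_le {a b h : Space d → ℝ} (ha : MemLp (fun x => (a x : ℂ)) ⊤ volume)
    (hb : MemLp (fun x => (b x : ℂ)) ⊤ volume) (hh : MemLp (fun x => (h x : ℂ)) ⊤ volume) {z N : ℝ}
    (hN : ∀ x, |a x - b x - z * (h x * h x)| ≤ N) :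
    ‖mulR a - mulR b - (z : ℂ) • (mulR h * mulR h)‖ ≤ N := by
  have hN0 : 0 ≤ N := (abs_nonneg _).trans (hN 0)
  refine ContinuousLinearMap.opNorm_le_bound _ hN0 fun u => ?_
  have h1 := ((hasMul_mulB ha u).add_symbol ((hasMul_mulB hb u).smul_symbol (-1))).add_symbol
    (((hasMul_mulB hh u).comp (hasMul_mulB hh _)).smul_symbol (-z : ℂ))
  have h2 : (mulR a - mulR b - (z : ℂ) • (mulR h * mulR h)) u =
      mulR a u + (-1 : ℂ) • mulR b u + (-z : ℂ) • mulR h (mulR h u) := by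
    simp only [sub_apply, smul_apply, mul_apply_eq_comp, neg_smul, one_smul]
    abel
  rw [h2]
  refine h1.norm_le (hasMul_one u) (ae_of_all _ fun x => ?_)
  rw [norm_mul, one_mul]
  refine mul_le_mul_of_nonneg_right ?_ (norm_nonneg _)
  refine le_trans (le_of_eq ?_) (hN x)
  rw [← Real.norm_eq_abs, ← Complex.norm_real]
  congr 1
  push_cast
  ring

theorem continuous_mulR {h : ℝ → Space d → ℝ} (hh : ∀ r, MemLp (fun x => (h r x : ℂ)) ⊤ volume) {N : ℝ}
    (hN : ∀ r r' x, |h r x - h r' x| ≤ N * |r - r'|) : Continuous fun r => mulR (h r) := by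
  have h0 : MemLp (fun _ : Space d => ((0 : ℝ) : ℂ)) ⊤ volume := by simp
  have hN0 : 0 ≤ N := by simpa using (abs_nonneg _).trans (hN 1 0 0)
  refine (LipschitzWith.of_dist_le_mul (K := N.toNNReal) fun r r' => ?_).continuous
  rw [dist_eq_norm, Real.dist_eq, Real.coe_toNNReal _ hN0]
  simpa using norm_mulR_sub_sub_le (hh r) (hh r') h0 (z := 0) (N := N * |r - r'|)
    (by simpa using hN r r')

end MaxSpeed

/-! ### Moving observables and the bound with an intermediate time -/

namespace MaxSpeed

open scoped ComplexConjugate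

variable {d : ℕ}

/-- The observables used for the propagation in the time interval `[t₀, t]`, where `s = t⁻¹`. -/
theorem exists_isOutgoing {δ c : ℝ} (hδ : 0 < δ) (hc : 0 ≤ c) : ∃ (η : ℝ → ℝ) (M m : ℝ), 0 < m ∧
    0 ≤ M ∧ (∀ y ≤ δ, η y = 0) ∧ (∀ y, 3 * δ ≤ y → η y = m) ∧ (∀ y, 0 ≤ η y) ∧ (∀ y, η y ≤ m) ∧
    ∀ s e : ℝ, 0 ≤ s → s ≤ 1 →
      ∃ (h : ℝ → Space d → ℝ) (f₁ f₂ h₁ h₂ ρ : ℝ → Fin d → Space d → ℝ),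
        (∀ r, IsOutgoing s (M * s) (fun x => η (s * (jap x - (e + c * r)))) (h r) (f₁ r) (f₂ r) (h₁ r)
          (h₂ r) (ρ r)) ∧ c * s ≤ M * s ∧
        (∀ r, HasDerivAt (fun r => (mulR fun x => η (s * (jap x - (e + c * r))) : L2 d →L[ℂ] L2 d))
          ((-(c * s) : ℂ) • (mulR (h r) * mulR (h r))) r) ∧
        Continuous fun r => (mulR (h r) : L2 d →L[ℂ] L2 d) := by
  obtain ⟨η, η', η'', h, h', h'', M, m, t0, t1, t2, k0, k1, k2, d0, d1, e0, e1, hsq, hle, hm, hge,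
    hηm, b1, b2, b3, b4, z0, z1⟩ := exists_sq_step hδ
  have hM : 0 ≤ M := (abs_nonneg _).trans (b1 0)
  -- The constant must dominate the derivative bounds `2 M s` as well as the time derivative `c s`.
  refine ⟨η, max (2 * M) c, m, hm, le_max_of_le_right hc, z0, z1, hge, hηm, ?_⟩
  intro s e hs hs1
  have hκ : 2 * M * s ≤ max (2 * M) c * s := mul_le_mul_of_nonneg_right (le_max_left _ _) hs
  have S := fun r => smoothMul_comp_jap (d := d) t0 t1 t2 d0 d1 (M₀ := m)
    (fun y => by rw [abs_of_nonneg (hge y)]; exact hηm y) b1 b2 hs hs1 (e + c * r)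
  have S' := fun r => smoothMul_comp_jap (d := d) k0 k1 k2 e0 e1 hle b3 b4 hs hs1 (e + c * r)
  refine ⟨fun r x => h (s * (jap x - (e + c * r))), _, _, _, _, fun _ => jap₁,
    fun r => ⟨(S r).1, (S' r).1, ?_, fun j => (jap₁_temperate j).1.continuous, sum_jap₁_sq_le, hs,
      mul_nonneg (le_max_of_le_right hc) hs, fun x => hle _, fun j x => ((S r).2.1 j x).trans hκ,
      fun j x => ((S r).2.2 j x).trans hκ, fun j x => ((S' r).2.1 j x).trans hκ,
      fun j x => ((S' r).2.2 j x).trans hκ⟩, mul_le_mul_of_nonneg_right (le_max_right _ _) hs, ?_, ?_⟩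
  · intro j x
    rw [hsq, mul_assoc]
  · intro r
    -- Between the times `r` and `r'` the argument of the step moves by `-c s (r' - r)`.
    refine hasDerivAt_of_norm_le (M := M * (c * s) ^ 2) fun r' => ?_
    have h1 := norm_mulR_sub_sub_le (S r').1.memLp (S r).1.memLp (S' r).1.memLp
      (z := -(c * s) * (r' - r)) (N := M * (c * s) ^ 2 * (r' - r) ^ 2) fun x => by
        have := norm_taylor_le d0 d1 b2 (s * (jap x - (e + c * r))) (-(c * s) * (r' - r))
        rw [hsq, show s * (jap x - (e + c * r)) + -(c * s) * (r' - r) =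
          s * (jap x - (e + c * r')) by ring, show M * (-(c * s) * (r' - r)) ^ 2 =
          M * (c * s) ^ 2 * (r' - r) ^ 2 by ring] at this
        exact this
    rw [RCLike.real_smul_eq_coe_smul (K := ℂ), smul_smul]
    rw [show ((-(c * s) * (r' - r) : ℝ) : ℂ) = ((r' - r : ℝ) : ℂ) * (-(c * s) : ℂ) by
      push_cast; ring] at h1
    exact h1
  · refine continuous_mulR (fun r => (S' r).1.memLp) (N := M * (c * s)) fun r r' x => ?_
    have := Convex.norm_image_sub_le_of_norm_hasDerivWithin_le (f := h) (f' := h') (s := univ)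
      (x := s * (jap x - (e + c * r'))) (y := s * (jap x - (e + c * r))) (C := M)
      (fun x _ => (e0 x).hasDerivWithinAt) (fun x _ => b3 x) convex_univ (mem_univ _) (mem_univ _)
    refine this.trans (le_of_eq ?_)
    rw [mul_assoc, Real.norm_eq_abs,
      show s * (jap x - (e + c * r)) - s * (jap x - (e + c * r')) = -(c * s * (r - r')) by ring,
      abs_neg, abs_mul, abs_of_nonneg (mul_nonneg hc hs)]

variable {V : Space d → ℝ} {μ C : ℝ} {Q : L2 d →L[ℂ] L2 d}
  {D : Fin d → L2 d →L[ℂ] L2 d} {B : ℝ → L2 d →L[ℂ] L2 d} {n : ℝ → ℝ}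
  {U : ℝ → unitary (L2 d →L[ℂ] L2 d)} {g G : L2 d →L[ℂ] L2 d} {σ : ℝ → ℝ} {A K : ℝ}

set_option maxHeartbeats 1000000 in
/-- The maximal speed bound in terms of an intermediate time `t₀`. -/
theorem IsScatter.exists_norm_cutoff_le (h : IsScatter V μ C Q D B n U g G σ A K)
    {gt Lt gc : L2 d →L[ℂ] L2 d} {k K' : ℝ} (hg : IsCutPair Q g gt Lt gc k K') {c : ℝ}
    (hc : k < c) (a b : ℝ) :
    ∃ C₀ T, 0 ≤ C₀ ∧ ∀ t t₀ : ℝ, T ≤ t → 1 ≤ t₀ → t₀ ≤ t → ∀ u : L2 d,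
      ‖cutoff {x : Space d | c * t + a ≤ ‖x‖} (measurableSet_le measurable_const measurable_norm)
        ((U t : L2 d →L[ℂ] L2 d) (G (cutoff {x : Space d | ‖x‖ ≤ b}
          (measurableSet_le measurable_norm measurable_const) u)))‖ ≤
        (C₀ * (σ t₀ + t₀ / t) + C₀ * Real.sqrt (1 / t)) * ‖u‖ := by
  -- The observable moves with a speed strictly between `k` and `c`. As `c = c' + 4δ`, the plateau
  -- of the step uses `3δ`, and one `δ` remains to absorb `e - a` for large times.
  set c' := (k + c) / 2 with hc'
  set δ := (c - c') / 4 with hδ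
  have hk := hg.cut.speed_nonneg
  have hδ0 : 0 < δ := by rw [hδ, hc']; linarith
  have hc'0 : 0 ≤ c' := by rw [hc']; linarith
  have hkc' : k ≤ c' := by rw [hc']; linarith
  -- This bounds `jap` on the initial ball, so `J` vanishes there.
  set e := Real.sqrt (1 + b ^ 2) with he
  obtain ⟨η, M, m, hm, hM, z0, z1, hge, hηm, hfam⟩ := exists_isOutgoing (d := d) hδ0 hc'0
  obtain ⟨j, j', j'', M', t0, t1, t2, d0, d1, hj1, b1, b2, hj0, hjδ⟩ := exists_step hδ0
  have hM' : 0 ≤ M' := (abs_nonneg _).trans (b1 0)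
  obtain ⟨A₁, hA₁, stage1⟩ := h.exists_norm_mulR_le
  obtain ⟨A₂, hA₂, stage2⟩ := h.exists_outgoing_le hg hkc'
  refine ⟨2 + 4 * M' * A₁ + Real.sqrt (2 * M * A₂ / m), (e - a) / δ, by positivity, ?_⟩
  intro t t₀ hT ht₀ htt u
  have ht0 : 0 < t := by linarith
  have ht1 : 1 ≤ t := ht₀.trans htt
  set s := 1 / t with hs
  have hs0 : 0 < s := by positivity
  have hs1 : s ≤ 1 := by rw [hs, div_le_one ht0]; exact ht1
  have hst : s * t = 1 := by rw [hs]; field_simp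
  set y := cutoff {x : Space d | ‖x‖ ≤ b} (measurableSet_le measurable_norm measurable_const) u with hy
  have hyn : ‖y‖ ≤ ‖u‖ := norm_cutoff_apply_le _ _
  obtain ⟨SJ, J1, J2⟩ := smoothMul_comp_jap (d := d) t0 t1 t2 d0 d1 hj1 b1 b2 hs0.le hs1 e
  set J : Space d → ℝ := fun x => j (s * (jap x - e)) with hJ
  have hJy : mulR J y = 0 := by
    refine cutoff_mulR_eq_zero _ SJ.memLp (fun x hx => hj0 _ ?_) u
    refine mul_nonpos_of_nonneg_of_nonpos hs0.le (sub_nonpos.2 (Real.sqrt_le_sqrt ?_))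
    have := pow_le_pow_left₀ (norm_nonneg x) hx 2
    linarith
  have r1 := stage1 J _ _ SJ (fun x => hj1 _) (2 * M' * s) (by positivity) J1 J2 t₀ (by linarith) y hJy
  obtain ⟨hh, f₁, f₂, h₁, h₂, ρ, fO, fc, fd, fcont⟩ := hfam s e hs0.le hs1
  have r2 := stage2 s (M * s) _ hh f₁ f₂ h₁ h₂ ρ fO fc fd fcont t₀ t ht₀ htt y
  set ψ := fun r => (U r : L2 d →L[ℂ] L2 d) (G y) with hψ
  set f : ℝ → Space d → ℝ := fun r x => η (s * (jap x - (e + c' * r))) with hf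
  have hfm : ∀ r, MemLp (fun x => (f r x : ℂ)) ⊤ volume := fun r => (fO r).smooth.memLp
  have hJJ : MemLp (fun x => ((J x * J x : ℝ) : ℂ)) ⊤ volume := by
    simp only [Complex.ofReal_mul]
    exact SJ.memLp.mul SJ.memLp
  -- Where `f t₀` does not vanish, `s (jap x - e) ≥ δ` because `c' t₀ ≥ 0`. There `J = 1`, hence `f
  -- t₀ ≤ m J²`.
  have k0 : (inner ℂ (ψ t₀) (mulR (f t₀) (ψ t₀))).re ≤ m * ‖mulR J (ψ t₀)‖ ^ 2 := by
    obtain ⟨q1, q2⟩ := re_inner_mulR_const_mul m hJJ (ψ t₀)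
    rw [← mulR_self_inner SJ.memLp, ← q2]
    refine re_inner_mulR_le (hfm t₀) q1 (fun x => ?_) _
    simp only [hf, hJ]
    rcases le_total (s * (jap x - (e + c' * t₀))) δ with hx | hx
    · rw [z0 _ hx]
      exact mul_nonneg hm.le (mul_self_nonneg _)
    · rw [hjδ, mul_one, mul_one]
      · exact hηm _
      · refine hx.trans (mul_le_mul_of_nonneg_left ?_ hs0.le)
        have : 0 ≤ c' * t₀ := mul_nonneg hc'0 (by linarith)
        linarith
  set S : Set (Space d) := {x | c * t + a ≤ ‖x‖} with hS
  have hSm : MeasurableSet S := measurableSet_le measurable_const measurable_norm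
  -- For `t ≥ (e - a) / δ` the outer region lies where the step has reached its plateau `m`.
  have k1 : m * ‖cutoff S hSm (ψ t)‖ ^ 2 ≤ (inner ℂ (ψ t) (mulR (f t) (ψ t))).re := by
    have i1 := memLp_indicator hSm
    have i2 : MemLp (fun x => ((S.indicator 1 x * S.indicator 1 x : ℝ) : ℂ)) ⊤ volume := by
      simp only [Complex.ofReal_mul]
      exact i1.mul i1
    obtain ⟨q1, q2⟩ := re_inner_mulR_const_mul m i2 (ψ t)
    rw [cutoff_apply, ← mulR_self_inner i1, ← q2]
    refine re_inner_mulR_le q1 (hfm t) (fun x => ?_) _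
    simp only [hf]
    by_cases hx : x ∈ S
    · rw [indicator_of_mem hx, Pi.one_apply, mul_one, mul_one, z1]
      have e1 : c * t + a ≤ jap x := le_trans hx (norm_le_jap x)
      have e2 : e - a ≤ t * δ := by rwa [div_le_iff₀ hδ0] at hT
      have e3 : t * (3 * δ) ≤ jap x - (e + c' * t) := by
        have e4 : c = c' + 4 * δ := by rw [hδ]; ring
        have e5 : c * t = c' * t + 4 * (t * δ) := by rw [e4]; ring
        linarith
      calc 3 * δ = s * (t * (3 * δ)) := by rw [← mul_assoc, hst, one_mul]
        _ ≤ _ := mul_le_mul_of_nonneg_left e3 hs0.le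
    · rw [indicator_of_notMem hx, mul_zero, mul_zero]
      exact hge _
  have hσ := h.rate_nonneg t₀
  set X := (2 * σ t₀ + 2 * M' * s * (A₁ * (1 + t₀))) with hX
  have hX0 : 0 ≤ X := by positivity
  set Z := M * s * (A₂ * 2) with hZ
  have hZ0 : 0 ≤ Z := by positivity
  -- The growth over `[t₀, t]` carries the factor `M s = M / t`, while `s (t - t₀) + 1 ≤ 2`. Its
  -- square root is the term of order `t^(-1/2)`.
  have k2 : m * ‖cutoff S hSm (ψ t)‖ ^ 2 ≤ m * (X * ‖y‖) ^ 2 + Z * ‖y‖ ^ 2 := by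
    rw [Complex.sub_re] at r2
    have e1 : m * ‖mulR J (ψ t₀)‖ ^ 2 ≤ m * (X * ‖y‖) ^ 2 :=
      mul_le_mul_of_nonneg_left (pow_le_pow_left₀ (norm_nonneg _) r1 2) hm.le
    have e2 : M * s * (A₂ * (s * (t - t₀) + 1)) * ‖y‖ ^ 2 ≤ Z * ‖y‖ ^ 2 := by
      refine mul_le_mul_of_nonneg_right ?_ (sq_nonneg _)
      rw [hZ]
      have e3 : s * (t - t₀) + 1 ≤ 2 := by
        have := mul_pos hs0 (zero_lt_one.trans_le ht₀)
        linarith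
      gcongr
    linarith
  have k3 : ‖cutoff S hSm (ψ t)‖ ≤ (X + Real.sqrt (Z / m)) * ‖y‖ := by
    refine abs_le_of_sq_le_sq' ?_ (by positivity) |>.2
    have e1 : ‖cutoff S hSm (ψ t)‖ ^ 2 ≤ (X * ‖y‖) ^ 2 + Z / m * ‖y‖ ^ 2 := by
      rw [← mul_le_mul_iff_right₀ hm]
      refine k2.trans (le_of_eq ?_)
      field_simp
    have e2 : Z / m = Real.sqrt (Z / m) ^ 2 := (Real.sq_sqrt (by positivity)).symm
    rw [e2] at e1
    have e3 : 0 ≤ X * Real.sqrt (Z / m) * ‖y‖ ^ 2 := by positivity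
    rw [show ((X + Real.sqrt (Z / m)) * ‖y‖) ^ 2 = (X * ‖y‖) ^ 2 + Real.sqrt (Z / m) ^ 2 * ‖y‖ ^ 2 +
      2 * (X * Real.sqrt (Z / m) * ‖y‖ ^ 2) by ring]
    linarith
  refine k3.trans (mul_le_mul ?_ hyn (norm_nonneg _) (by positivity))
  have e1 : Z / m = 2 * M * A₂ / m * (1 / t) := by rw [hZ, hs]; ring
  rw [e1, Real.sqrt_mul (by positivity)]
  have e2 : t₀ / t = t₀ * s := by rw [hs]; ring
  have e3 : s ≤ t₀ * s := le_mul_of_one_le_left hs0.le ht₀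
  have e4 : 2 * M' * s * (A₁ * (1 + t₀)) ≤ 4 * M' * A₁ * (t₀ * s) := by
    have : M' * A₁ * s ≤ M' * A₁ * (t₀ * s) := mul_le_mul_of_nonneg_left e3 (by positivity)
    linarith
  set R := Real.sqrt (2 * M * A₂ / m)
  set N := Real.sqrt (1 / t)
  have hR : 0 ≤ R := Real.sqrt_nonneg _
  have hN : 0 ≤ N := Real.sqrt_nonneg _
  have p1 : 0 ≤ M' * A₁ := by positivity
  have p2 : 0 ≤ t₀ * s := by positivity
  rw [e2]
  have q1 : 0 ≤ (4 * (M' * A₁) + R) * σ t₀ := by positivity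
  have q2 : 0 ≤ (2 + R) * (t₀ * s) := by positivity
  have q3 : 0 ≤ (2 + 4 * (M' * A₁)) * N := by positivity
  rw [hX]
  linarith

end MaxSpeed

namespace MaxSpeed

open scoped ComplexConjugate

/-! ### Energy cutoffs -/

theorem exists_contDiff_one_on {K : Set ℝ} (hK : IsClosed K) {p q : ℝ} (h : K ⊆ Ioo p q) :
    ∃ f : ℝ → ℝ, ContDiff ℝ ∞ f ∧ HasCompactSupport f ∧ tsupport f ⊆ Ioo p q ∧ (∀ x, |f x| ≤ 1) ∧
      ∀ x ∈ K, f x = 1 := by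
  rcases le_or_gt q p with hpq | hpq
  · have hK0 : K = ∅ := subset_empty_iff.1 (h.trans (Ioo_eq_empty (not_lt.2 hpq)).subset)
    have h0 : tsupport (fun _ : ℝ => (0 : ℝ)) = ∅ := tsupport_eq_empty_iff.2 rfl
    refine ⟨fun _ => 0, contDiff_const, HasCompactSupport.zero, by rw [h0]; exact empty_subset _,
      by simp, by simp [hK0]⟩
  · rw [Real.Ioo_eq_ball] at h
    obtain ⟨r, ⟨hr0, hr⟩, hKr⟩ := exists_pos_lt_subset_ball (by linarith) hK h
    set b : ContDiffBump ((p + q) / 2) := ⟨r, (r + (q - p) / 2) / 2, hr0, by linarith⟩ with hb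
    refine ⟨fun x => b x, b.contDiff, b.hasCompactSupport, ?_, fun x => ?_, fun x hx => ?_⟩
    · rw [Real.Ioo_eq_ball]
      refine b.tsupport_eq.subset.trans (Metric.closedBall_subset_ball ?_)
      change (r + (q - p) / 2) / 2 < _
      linarith
    · rw [abs_of_nonneg b.nonneg]
      exact b.le_one
    · exact b.one_of_mem_closedBall (Metric.ball_subset_closedBall (hKr hx))

variable {d : ℕ} {V : Space d → ℝ} {μ C : ℝ} {Q : L2 d →L[ℂ] L2 d}

theorem IsRes.exists_hasComm (h : IsRes V μ C Q) {g : ℝ → ℝ} (hg : ContDiff ℝ ∞ g)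
    (hgc : HasCompactSupport g) : ∃ K, HasComm Q (funcCalc (schrodinger V) g) K := by
  obtain ⟨u, hu⟩ := h.exists_isCayley
  obtain ⟨K, h1, h2⟩ := exists_commutator_cfc μ hg hgc hu
  exact ⟨K, h1, h2⟩

theorem funcCalc_symm (H : L2 d →ₗ.[ℂ] L2 d) (g : ℝ → ℝ) (x y : L2 d) :
    inner ℂ x (funcCalc H g y) = inner ℂ (funcCalc H g x) y :=
  (ContinuousLinearMap.isSelfAdjoint_iff_isSymmetric.1
    (isSelfAdjoint_cfc_cayleyFun g (resolventOp H (-Complex.I))) x y).symm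

/-- `g(H) = (H + μ)⁻¹ L` with a bounded operator `L`. -/
theorem IsRes.exists_eq_mul (h : IsRes V μ C Q) {g : ℝ → ℝ} (hg : Continuous g)
    (hgc : HasCompactSupport g) : ∃ L : L2 d →L[ℂ] L2 d,
      (∀ x, funcCalc (schrodinger V) g x = Q (L x)) ∧
      (∀ x, funcCalc (schrodinger V) g x = L (Q x)) ∧ ∀ x y, inner ℂ x (L y) = inner ℂ (L x) y := by
  obtain ⟨u, hu⟩ := h.exists_isCayley
  have h1 := hu.mul_cfc hg hgc
  have h2 := hu.commute_cfc fun w => cayleyFun (fun x => (x + μ) * g x) w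
  refine ⟨funcCalc (schrodinger V) fun x => (x + μ) * g x, fun x => ?_, fun x => ?_,
    funcCalc_symm _ _⟩
  · exact (congrArg (fun T : L2 d →L[ℂ] L2 d => T x) h1).symm
  · exact (congrArg (fun T : L2 d →L[ℂ] L2 d => T x) (h2.eq.symm.trans h1)).symm

theorem IsRes.funcCalc_funcCalc (h : IsRes V μ C Q) {f g : ℝ → ℝ} (hf : Continuous f)
    (hfc : HasCompactSupport f) (hg : Continuous g) (hgc : HasCompactSupport g)
    (hfg : ∀ x ∈ tsupport g, f x = 1) (x : L2 d) :
    funcCalc (schrodinger V) f (funcCalc (schrodinger V) g x) = funcCalc (schrodinger V) g x := by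
  obtain ⟨u, hu⟩ := h.exists_isCayley
  have h1 := hu.cfc_mul hf hfc hg hgc
  have h2 : (fun x => f x * g x) = g := by
    ext x
    by_cases hx : x ∈ tsupport g
    · rw [hfg x hx, one_mul]
    · rw [image_eq_zero_of_notMem_tsupport hx, mul_zero]
  rw [h2] at h1
  exact (congrArg (fun T : L2 d →L[ℂ] L2 d => T x) h1).symm

/-- Two nested cutoffs supported in `I`: `f₁` is one on the support of `g`, and `f₂` is one on the
support of `f₁`. The range of `f₂(H)` lies in the spectral subspace of `I`, so the speed bound holds
there. -/
theorem IsRes.exists_isCutPair (h : IsRes V μ C Q) {p q : ℝ}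
    (hfin : speedBound V (Ioo p q) ≠ ⊤) {g : ℝ → ℝ} (hg : Continuous g) (hgc : HasCompactSupport g)
    (hgs : tsupport g ⊆ Ioo p q) : ∃ (gt Lt gc : L2 d →L[ℂ] L2 d) (K : ℝ),
      IsCutPair Q (funcCalc (schrodinger V) g) gt Lt gc (speedBound V (Ioo p q)).toReal K := by
  obtain ⟨f₁, s₁, c₁, t₁, n₁, o₁⟩ := exists_contDiff_one_on (isClosed_tsupport g) hgs
  obtain ⟨f₂, s₂, c₂, t₂, n₂, o₂⟩ := exists_contDiff_one_on (isClosed_tsupport f₁) t₁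
  obtain ⟨L, l1, l2, -⟩ := h.exists_eq_mul s₁.continuous c₁
  obtain ⟨K, hK⟩ := h.exists_hasComm s₂ c₂
  exact ⟨funcCalc (schrodinger V) f₁, L, funcCalc (schrodinger V) f₂, K,
    ⟨hK, norm_cfc_cayleyFun_le n₂ _, ENNReal.toReal_nonneg, fun v =>
      norm_symGrad_le_speedBound hfin (funcCalc_mem_spectralSubspace s₂.continuous c₂ t₂ v)⟩,
    norm_cfc_cayleyFun_le n₁ _, l1, l2, h.funcCalc_funcCalc s₁.continuous c₁ hg hgc o₁,
    h.funcCalc_funcCalc s₂.continuous c₂ s₁.continuous c₁ o₂⟩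

end MaxSpeed

namespace MaxSpeed

open scoped ComplexConjugate

/-! ### The time-dependent potential -/

variable {d : ℕ} {V : Space d → ℝ} {μ C : ℝ} {Q : L2 d →L[ℂ] L2 d}
  {D : Fin d → L2 d →L[ℂ] L2 d} {W : ℝ → Space d → ℝ} {w : ℝ → ℝ≥0∞}

theorem tailNorm_antitone (hw : w = tailNorm W ∨ w = tailNorm' W) : Antitone w := by
  intro s t hst
  rcases hw with rfl | rfl
  · exact lintegral_mono_set (Ioi_subset_Ioi hst)
  · exact iSup₂_mono fun n _ => iSup_mono fun l => lintegral_mono_set (Ioi_subset_Ioi hst)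

/-- A decreasing function that is infinite at `t` is infinite on `(0, t]`. At `t = 0` this says
nothing, and the tail there may indeed be infinite. -/
theorem lt_top_of_lintegral_lt_top (hw : Antitone w) (hwi : ∫⁻ t in Ioi 0, w t < ⊤) {t : ℝ}
    (ht : 0 < t) : w t < ⊤ := by
  by_contra h
  rw [not_lt, top_le_iff] at h
  refine hwi.ne (top_le_iff.1 ?_)
  calc ⊤ = ∫⁻ _ in Ioc 0 t, (⊤ : ℝ≥0∞) := by
        rw [setLIntegral_const, Real.volume_Ioc, ENNReal.top_mul]
        simpa using ht
    _ ≤ ∫⁻ r in Ioc 0 t, w r := by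
        refine setLIntegral_mono' measurableSet_Ioc fun r hr => ?_
        rw [← h]
        exact hw hr.2
    _ ≤ ∫⁻ r in Ioi 0, w r := lintegral_mono_set Ioc_subset_Ioi_self

theorem norm_mulR_le_toReal (f : Space d → ℝ) :
    ‖(mulR f : L2 d →L[ℂ] L2 d)‖ ≤ (eLpNorm f ⊤ volume).toReal := by
  have hn : eLpNorm (fun x => (f x : ℂ)) ⊤ volume = eLpNorm f ⊤ volume :=
    eLpNorm_congr_norm_ae (ae_of_all _ fun x => by simp)
  by_cases h : eLpNorm f ⊤ volume = ⊤
  · have : ¬ MemLp (fun x => (f x : ℂ)) ⊤ volume := fun h2 => h2.2.ne (hn.trans h)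
    rw [mulR, mulB, dif_neg this, norm_zero]
    exact ENNReal.toReal_nonneg
  · have := norm_mulB_le_eLpNorm (m := fun x => (f x : ℂ))
    rw [hn] at this
    rw [← toReal_enorm]
    exact ENNReal.toReal_mono h this

/-- The perturbation `W_t - μ` of `H + μ`. -/
noncomputable def pert (W : ℝ → Space d → ℝ) (μ : ℝ) (r : ℝ) : L2 d →L[ℂ] L2 d :=
  mulR (W r) - (μ : ℂ) • 1

theorem pert_apply (W : ℝ → Space d → ℝ) (μ r : ℝ) (x : L2 d) :
    pert W μ r x = mulR (W r) x - (μ : ℂ) • x := rfl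

theorem isPert_pert (hW : Measurable (Function.uncurry W))
    (hWb : ∀ T : ℝ, ∫⁻ t in Set.Ioc 0 T, eLpNorm (W t) ⊤ volume < ⊤) (μ : ℝ) :
    IsPert (pert W μ) fun r => (eLpNorm (W r) ⊤ volume).toReal + |μ| where
  meas u v := by
    simp only [pert_apply, inner_sub_right]
    exact (measurable_inner_mulR hW u v).sub measurable_const
  symm r u v := by
    rw [pert_apply, pert_apply, inner_sub_right, inner_sub_left, mulB_inner_ofReal,
      inner_smul_left, inner_smul_right, Complex.conj_ofReal]
  bound r := by
    refine (norm_sub_le _ _).trans (add_le_add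
      (norm_mulR_le_toReal _) ?_)
    rw [norm_smul, Complex.norm_real, Real.norm_eq_abs]
    exact mul_le_of_le_one_right (abs_nonneg _) ContinuousLinearMap.norm_id_le
  int T := (integrable_toReal_of_lintegral_ne_top (measurable_eLpNorm_top hW).aemeasurable
    (hWb T).ne).add (integrable_const _)

theorem mulR_pert_comm (W : ℝ → Space d → ℝ) (μ : ℝ) {η : Space d → ℝ}
    (hη : MemLp (fun x => (η x : ℂ)) ⊤ volume) (r : ℝ) (x : L2 d) :
    mulR η (pert W μ r x) = pert W μ r (mulR η x) := by
  rw [pert_apply, pert_apply, map_sub, map_smul]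
  congr 1
  by_cases h : MemLp (fun x => (W r x : ℂ)) ⊤ volume
  · exact mulR_comm hη h x
  · have : (mulR (W r) : L2 d →L[ℂ] L2 d) = 0 := by rw [mulR, mulB, dif_neg h]
    rw [this, zero_apply, zero_apply, map_zero]

theorem parNorm_toReal_le {f : Space d → ℝ} (hf : lipNorm f ≠ ⊤) (j : Fin d) :
    parNorm j f ≠ ⊤ ∧ (parNorm j f).toReal ≤ (lipNorm f).toReal := by
  have h : parNorm j f ≤ lipNorm f :=
    Finset.single_le_sum (f := fun j => parNorm j f) (fun _ _ => zero_le) (Finset.mem_univ j)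
  exact ⟨ne_top_of_le_ne_top hf h, ENNReal.toReal_mono hf h⟩

theorem IsRes.sum_norm_grad_le (h : IsRes V μ C Q) (hD : IsGrad Q D) (x : L2 d) :
    ∑ j, ‖D j x‖ ≤ d * Real.sqrt C * Real.sqrt (inner ℂ (Q x) x).re := by
  have h1 : ∀ j, ‖D j x‖ ≤ Real.sqrt C * Real.sqrt (inner ℂ (Q x) x).re := fun j => by
    rw [← Real.sqrt_mul h.nonneg]
    refine Real.le_sqrt_of_sq_le ?_
    exact (Finset.single_le_sum (f := fun j => ‖D j x‖ ^ 2) (fun _ _ => sq_nonneg _)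
      (Finset.mem_univ j)).trans (h.sum_grad_sq_le hD x)
  refine (Finset.sum_le_sum fun j _ => h1 j).trans (le_of_eq ?_)
  simp [mul_assoc]

theorem IsRes.norm_inner_mulR_sub_le_lipNorm (h : IsRes V μ C Q) (hD : IsGrad Q D)
    {f : Space d → ℝ} (hf : MemLp f ⊤ volume) (hp : lipNorm f ≠ ⊤) (x y : L2 d) :
    ‖inner ℂ x (mulR f (Q y)) - inner ℂ (mulR f (Q x)) y‖ ≤
      (lipNorm f).toReal * ((∑ j, ‖D j x‖) * ‖Q y‖ + ‖Q x‖ * ∑ j, ‖D j y‖) := by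
  refine (h.norm_inner_mulR_sub_le hD hf (fun j => (parNorm_toReal_le hp j).1) x y).trans ?_
  have h1 : ∑ j, (parNorm j f).toReal * (‖D j x‖ * ‖Q y‖ + ‖Q x‖ * ‖D j y‖) ≤
      ∑ j, (lipNorm f).toReal * (‖D j x‖ * ‖Q y‖ + ‖Q x‖ * ‖D j y‖) :=
    Finset.sum_le_sum fun j _ => mul_le_mul_of_nonneg_right (parNorm_toReal_le hp j).2 (by positivity)
  rw [← Finset.mul_sum, Finset.sum_add_distrib, ← Finset.sum_mul, ← Finset.mul_sum] at h1
  have h2 : 0 ≤ ∑ j, (parNorm j f).toReal * (‖D j x‖ * ‖Q y‖ + ‖Q x‖ * ‖D j y‖) :=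
    Finset.sum_nonneg fun j _ => mul_nonneg ENNReal.toReal_nonneg (by positivity)
  linarith

theorem IsRes.inner_pert_sub (h : IsRes V μ C Q) (r : ℝ) (x y : L2 d) :
    inner ℂ x (pert W μ r (Q y)) - inner ℂ (pert W μ r (Q x)) y =
      inner ℂ x (mulR (W r) (Q y)) - inner ℂ (mulR (W r) (Q x)) y := by
  rw [pert_apply, pert_apply, inner_sub_left, inner_sub_right, inner_smul_left, inner_smul_right,
    Complex.conj_ofReal, h.inner_right]
  ring

/-- Testing the commutator applied to `y` against the result `z` reduces the operator norm to the
form estimate, in which one factor of `‖z‖` cancels. -/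
theorem IsRes.norm_pert_commutator_le (h : IsRes V μ C Q) (hD : IsGrad Q D) {r : ℝ}
    (hf : MemLp (W r) ⊤ volume) (hp : lipNorm (W r) ≠ ⊤) :
    ‖pert W μ r * Q - Q * pert W μ r‖ ≤ (lipNorm (W r)).toReal * (2 * (∑ j, ‖D j‖) * ‖Q‖) := by
  have hl : 0 ≤ (lipNorm (W r)).toReal := ENNReal.toReal_nonneg
  refine ContinuousLinearMap.opNorm_le_bound _ (by positivity) fun y => ?_
  set z := (pert W μ r * Q - Q * pert W μ r) y with hz
  have h1 : inner ℂ z z = inner ℂ z (pert W μ r (Q y)) - inner ℂ (pert W μ r (Q z)) y := by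
    conv_lhs => enter [3]; rw [hz]
    rw [sub_apply, mul_apply_eq_comp, mul_apply_eq_comp, inner_sub_right, h.inner_right]
    congr 1
    rw [pert_apply, pert_apply, inner_sub_left, inner_sub_right, inner_smul_left, inner_smul_right,
      Complex.conj_ofReal, mulB_inner_ofReal]
  have h2 := h.norm_inner_mulR_sub_le_lipNorm hD hf hp z y
  rw [← h.inner_pert_sub, ← h1, inner_self_eq_norm_sq_to_K] at h2
  have h3 : ‖z‖ ^ 2 ≤ (lipNorm (W r)).toReal * (2 * (∑ j, ‖D j‖) * ‖Q‖) * ‖y‖ * ‖z‖ := by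
    have h4 : ∀ v, ∑ j, ‖D j v‖ ≤ (∑ j, ‖D j‖) * ‖v‖ := fun v => by
      rw [Finset.sum_mul]
      exact Finset.sum_le_sum fun j _ => (D j).le_opNorm v
    have h5 : (∑ j, ‖D j z‖) * ‖Q y‖ ≤ (∑ j, ‖D j‖) * ‖z‖ * (‖Q‖ * ‖y‖) :=
      mul_le_mul (h4 z) (Q.le_opNorm y) (norm_nonneg _) (by positivity)
    have h6 : ‖Q z‖ * ∑ j, ‖D j y‖ ≤ ‖Q‖ * ‖z‖ * ((∑ j, ‖D j‖) * ‖y‖) :=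
      mul_le_mul (Q.le_opNorm z) (h4 y) (by positivity) (by positivity)
    calc ‖z‖ ^ 2 = ‖((‖z‖ : ℂ)) ^ 2‖ := by simp
      _ ≤ _ := h2
      _ ≤ (lipNorm (W r)).toReal * ((∑ j, ‖D j‖) * ‖z‖ * (‖Q‖ * ‖y‖) +
          ‖Q‖ * ‖z‖ * ((∑ j, ‖D j‖) * ‖y‖)) := by gcongr
      _ = _ := by ring
  rcases (norm_nonneg z).eq_or_lt with h0 | h0
  · rw [← h0]; positivity
  · rw [pow_two] at h3
    exact le_of_mul_le_mul_right h3 h0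

/-- Only one gradient occurs, so the energy enters through its square root. This makes the resulting
energy inequality linear in the square root of the energy. -/
theorem IsRes.norm_pert_form_le (h : IsRes V μ C Q) (hD : IsGrad Q D) {r : ℝ}
    (hf : MemLp (W r) ⊤ volume) (hp : lipNorm (W r) ≠ ⊤) (y : L2 d) :
    ‖inner ℂ y (pert W μ r (Q y)) - inner ℂ (pert W μ r (Q y)) y‖ ≤
      (lipNorm (W r)).toReal * (2 * (d * Real.sqrt C)) * Real.sqrt (inner ℂ (Q y) y).re * ‖Q y‖ := by
  rw [h.inner_pert_sub]
  refine (h.norm_inner_mulR_sub_le_lipNorm hD hf hp y y).trans ?_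
  have h1 := h.sum_norm_grad_le hD y
  calc _ = (lipNorm (W r)).toReal * (2 * (∑ j, ‖D j y‖) * ‖Q y‖) := by ring
    _ ≤ (lipNorm (W r)).toReal * (2 * (d * Real.sqrt C * Real.sqrt (inner ℂ (Q y) y).re) * ‖Q y‖) := by
        have : 0 ≤ (lipNorm (W r)).toReal := ENNReal.toReal_nonneg
        gcongr
    _ = _ := by ring

/-- The evolution solves the equation in the weak form with respect to `(H + μ)⁻¹`. -/
theorem IsEvolution.isSol {W' : ℝ → Space d → ℝ} {U : ℝ → unitary (L2 d →L[ℂ] L2 d)}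
    (hU : IsEvolution (schrodinger V) W U) (hQ : IsRes V μ C Q)
    (hW' : Measurable (Function.uncurry W')) (hWW' : ∀ᵐ r : ℝ, W r =ᵐ[volume] W' r)
    (hWb' : ∀ T : ℝ, ∫⁻ t in Set.Ioc 0 T, eLpNorm (W' t) ⊤ volume < ⊤) (u : L2 d) :
    IsSol Q (pert W' μ) fun r => (U (max r 0) : L2 d →L[ℂ] L2 d) u := by
  have hB := isPert_pert hW' hWb' μ
  -- Replacing `r` by `max r 0` freezes the evolution at negative times, so that orbits are
  -- continuous on the whole line.
  have hc : Continuous fun r => (U (max r 0) : L2 d →L[ℂ] L2 d) u :=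
    (hU.cont u).comp_continuous (by fun_prop) fun r => le_max_right r 0
  refine ⟨hc, fun x s t hs hst => ?_⟩
  obtain ⟨hdom, hH⟩ := hasSch_iff.1 (hQ.sch x)
  set F : ℝ → ℂ := fun r => inner ℂ x ((U (max r 0) : L2 d →L[ℂ] L2 d) u) +
    inner ℂ (Q x) (pert W' μ r ((U (max r 0) : L2 d →L[ℂ] L2 d) u)) with hF
  have hFi : ∀ {a b : ℝ}, 0 ≤ a → a ≤ b → IntervalIntegrable F volume a b := fun ha hab =>
    ((continuous_const.inner hc).intervalIntegrable _ _).add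
      (hB.intervalIntegrable continuous_const hc ha hab)
  have hfin := ae_eLpNorm_lt_top hW' hWb'
  have key : ∀ T, 0 ≤ T → inner ℂ (Q x) ((U (max T 0) : L2 d →L[ℂ] L2 d) u) =
      inner ℂ (Q x) u - Complex.I * ∫ r in (0 : ℝ)..T, F r := by
    intro T hT
    have h1 := hU.weak_eq u ⟨Q x, hdom⟩ T hT
    rw [max_eq_left hT, h1]
    congr 2
    rw [intervalIntegral.integral_of_le hT, intervalIntegral.integral_of_le hT]
    refine setIntegral_congr_ae measurableSet_Ioc ?_
    filter_upwards [hWW', (ae_restrict_iff' measurableSet_Ioi).1 hfin] with r h2 h3 hr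
    have h4 := h3 hr.1
    have h5 : MemLp (fun x => (W' r x : ℂ)) ⊤ volume :=
      MemLp.ofReal ⟨(hW'.comp measurable_prodMk_left).aestronglyMeasurable, h4⟩
    simp only [hF]
    rw [hH, pert_apply, inner_sub_left, inner_sub_right, inner_smul_left, inner_smul_right,
      Complex.conj_ofReal, max_eq_left hr.1.le]
    have h6 : inner ℂ (Q x) (mulR (W' r) ((U r : L2 d →L[ℂ] L2 d) u)) =
        ∫ y, (W r y : ℂ) * inner ℂ ((Q x) y) (((U r : L2 d →L[ℂ] L2 d) u : L2 d) y) := by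
      rw [L2.inner_def]
      refine integral_congr_ae ?_
      filter_upwards [h2, hasMul_mulB h5 ((U r : L2 d →L[ℂ] L2 d) u)] with y k1 k2
      rw [k2, k1, ← smul_eq_mul, inner_smul_right]
    rw [h6]
    ring
  rw [key t (hs.trans hst), key s hs,
    ← intervalIntegral.integral_add_adjacent_intervals (hFi le_rfl hs) (hFi hs hst)]
  ring

end MaxSpeed

/-! ### Existence and rate of the asymptotic energy cutoff -/

namespace MaxSpeed

open scoped ComplexConjugate

variable {d : ℕ} {V : Space d → ℝ} {μ C : ℝ} {Q : L2 d →L[ℂ] L2 d} {W : ℝ → Space d → ℝ}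
  {w : ℝ → ℝ≥0∞}

/-- A monotone function is measurable, and the comparison with `w` gives integrability. -/
theorem integrableOn_tail {m : ℝ → ℝ} (hm : ∀ a > 0, IntegrableOn m (Ioi a)) (hm0 : ∀ r, 0 ≤ m r)
    {N : ℝ≥0∞} (hN : N ≠ ⊤) (hmw : ∀ a > 0, ENNReal.ofReal (∫ r in Ioi a, m r) ≤ N * w a)
    (hw : ∫⁻ t in Ioi 0, w t < ⊤) :
    AntitoneOn (fun a => ∫ r in Ioi a, m r) (Ioi 0) ∧
      IntegrableOn (fun a => ∫ r in Ioi a, m r) (Ioi 0) := by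
  have hanti : AntitoneOn (fun a => ∫ r in Ioi a, m r) (Ioi 0) := fun a ha b _ hab =>
    setIntegral_mono_set (hm a ha) (ae_of_all _ hm0) (Eventually.of_forall (Ioi_subset_Ioi hab))
  refine ⟨hanti, (aemeasurable_restrict_of_antitoneOn measurableSet_Ioi
    hanti).aestronglyMeasurable, ?_⟩
  rw [hasFiniteIntegral_iff_ofReal (ae_of_all _ fun a => integral_nonneg hm0)]
  refine lt_of_le_of_lt (setLIntegral_mono' measurableSet_Ioi fun a ha => hmw a ha) ?_
  rw [lintegral_const_mul' _ _ hN]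
  exact ENNReal.mul_lt_top (lt_top_iff_ne_top.2 hN) hw

/-- The asymptotic energy cutoff exists, with the required estimates. -/
theorem IsEvolution.exists_isScatter {U : ℝ → unitary (L2 d →L[ℂ] L2 d)}
    (hU : IsEvolution (schrodinger V) W U) (hQ : IsRes V μ C Q)
    (hW : AEStronglyMeasurable (Function.uncurry W) volume)
    (hWb : ∀ T : ℝ, ∫⁻ t in Set.Ioc 0 T, eLpNorm (W t) ⊤ volume < ⊤)
    (hw : w = tailNorm W ∨ w = tailNorm' W) (hw_int : ∫⁻ t in Set.Ioi 0, w t < ⊤)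
    {g : ℝ → ℝ} (hg : ContDiff ℝ ∞ g) (hgc : HasCompactSupport g) :
    ∃ (D : Fin d → L2 d →L[ℂ] L2 d) (B : ℝ → L2 d →L[ℂ] L2 d) (n : ℝ → ℝ)
      (G : L2 d →L[ℂ] L2 d) (σ : ℝ → ℝ) (A K : ℝ) (N : ℝ≥0),
      IsScatter V μ C Q D B n (fun r => U (max r 0)) (funcCalc (schrodinger V) g) G σ A K ∧
      Tendsto (fun r => heis (U r) (funcCalc (schrodinger V) g)) atTop (𝓝 G) ∧
      ∀ r > 0, ENNReal.ofReal (σ r) ≤ N * w r := by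
  obtain ⟨W', hW', hWW'⟩ := exists_measurable_version hW
  have hWb' : ∀ T : ℝ, ∫⁻ t in Set.Ioc 0 T, eLpNorm (W' t) ⊤ volume < ⊤ := fun T => by
    refine lt_of_eq_of_lt (lintegral_congr_ae ?_) (hWb T)
    filter_upwards [ae_restrict_of_ae hWW'] with r hr
    exact eLpNorm_congr_ae hr.symm
  have hwanti := tailNorm_antitone hw
  have hwfin : ∀ a > 0, w a < ⊤ := fun a ha => lt_top_of_lintegral_lt_top hwanti hw_int ha
  have hlip : ∀ a ≥ 0, ∫⁻ r in Ioi a, lipNorm (W' r) ≤ d * w a := fun a ha =>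
    lintegral_lipNorm_le hW' hWW' hWb hw ha
  have hlipm : Measurable fun r => lipNorm (W' r) :=
    Finset.measurable_fun_sum _ fun j _ => measurable_parNorm hW' j
  have hlipfin : ∀ a > 0, ∫⁻ r in Ioi a, lipNorm (W' r) < ⊤ := fun a ha =>
    (hlip a ha.le).trans_lt (ENNReal.mul_lt_top (ENNReal.natCast_lt_top d) (hwfin a ha))
  have hlipae : ∀ᵐ r ∂(volume.restrict (Ioi (0 : ℝ))), lipNorm (W' r) < ⊤ := by
    -- The tail integral may be infinite at zero, so finiteness almost everywhere is obtained on
    -- half-lines away from zero.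
    have h : Ioi (0 : ℝ) = ⋃ k : ℕ, Ioi (1 / ((k : ℝ) + 1)) := by
      ext r
      simp only [mem_Ioi, mem_iUnion]
      exact ⟨fun h => exists_nat_one_div_lt h, fun ⟨k, h⟩ => lt_trans (by positivity) h⟩
    rw [h, ae_restrict_iUnion_iff]
    exact fun k => ae_lt_top hlipm (hlipfin _ (by positivity)).ne
  have hmem : ∀ᵐ r ∂(volume.restrict (Ioi (0 : ℝ))), MemLp (W' r) ⊤ volume := by
    filter_upwards [ae_eLpNorm_lt_top hW' hWb'] with r hr
    exact ⟨(hW'.comp measurable_prodMk_left).aestronglyMeasurable, hr⟩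
  obtain ⟨D, hD⟩ := hQ.exists_isGrad
  obtain ⟨Kc, hKc⟩ := hQ.exists_hasComm hg hgc
  obtain ⟨L, hL, -, hLs⟩ := hQ.exists_eq_mul hg.continuous hgc
  set K := funcCalc (schrodinger V) g with hK
  have hKs : ∀ x y, inner ℂ x (K y) = inner ℂ (K x) y := funcCalc_symm _ _
  have hB := isPert_pert hW' hWb' μ
  set U' : ℝ → unitary (L2 d →L[ℂ] L2 d) := fun r => U (max r 0) with hU'
  have hsol : ∀ u, IsSol Q (pert W' μ) fun r => (U' r : L2 d →L[ℂ] L2 d) u :=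
    hU.isSol hQ hW' hWW' hWb'
  set κ₁ := Kc * (2 * (∑ j, ‖D j‖) * ‖Q‖) with hκ₁
  set κ₂ := 2 * (d * Real.sqrt C) with hκ₂
  have hκ₁0 : 0 ≤ κ₁ := mul_nonneg hKc.1 (by positivity)
  have hκ₂0 : 0 ≤ κ₂ := by positivity
  -- A single density serves both the convergence of the Heisenberg observable, through `κ₁`, and
  -- the energy estimate, through `κ₂`.
  set m : ℝ → ℝ := fun r => (lipNorm (W' r)).toReal * (κ₁ + κ₂) with hmdef
  have hm0 : ∀ r, 0 ≤ m r := fun r => mul_nonneg ENNReal.toReal_nonneg (by positivity)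
  have hm : ∀ a > 0, IntegrableOn m (Ioi a) := fun a ha =>
    (integrable_toReal_of_lintegral_ne_top hlipm.aemeasurable (hlipfin a ha).ne).mul_const _
  have hBK : ∀ᵐ r ∂(volume.restrict (Ioi 0)), ‖pert W' μ r * K - K * pert W' μ r‖ ≤ m r := by
    filter_upwards [hlipae, hmem] with r h1 h2
    -- The left factor is taken to be one here: only the norm of the commutator with `W` is needed.
    obtain ⟨Y', e1, e2⟩ := hKc.2 (pert W' μ r) 1 _ (Commute.one_left Q) (one_mul _).symm
    rw [e1, one_mul]
    refine e2.trans ?_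
    have h3 := mul_le_mul_of_nonneg_left (hQ.norm_pert_commutator_le hD h2 h1.ne) hKc.1
    have h4 : 0 ≤ (lipNorm (W' r)).toReal * κ₂ := mul_nonneg ENNReal.toReal_nonneg hκ₂0
    simp only [hmdef]
    linarith
  have hBQ : ∀ᵐ r ∂(volume.restrict (Ioi 0)), ∀ y,
      ‖inner ℂ y (pert W' μ r (Q y)) - inner ℂ (pert W' μ r (Q y)) y‖ ≤
        m r * Real.sqrt (inner ℂ (Q y) y).re * ‖Q y‖ := by
    filter_upwards [hlipae, hmem] with r h1 h2 y
    refine (hQ.norm_pert_form_le hD h2 h1.ne y).trans ?_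
    have h4 : (lipNorm (W' r)).toReal * κ₂ ≤ m r :=
      mul_le_mul_of_nonneg_left (le_add_of_nonneg_left hκ₁0) ENNReal.toReal_nonneg
    gcongr
  obtain ⟨G, hG, hGσ⟩ := exists_tendsto_heis hB hsol hL hKs hLs hm hm0 hBK
  set σ : ℝ → ℝ := fun a => ∫ r in Ioi a, m r with hσ
  have hσ0 : ∀ r, 0 ≤ σ r := fun r => integral_nonneg hm0
  set N : ℝ≥0 := d * (κ₁ + κ₂).toNNReal with hN
  have hσw : ∀ a > 0, ENNReal.ofReal (σ a) ≤ N * w a := by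
    intro a ha
    simp only [hσ, hmdef]
    rw [integral_mul_const, integral_toReal hlipm.aemeasurable
      (ae_lt_top hlipm (hlipfin a ha).ne), ENNReal.ofReal_mul ENNReal.toReal_nonneg,
      ENNReal.ofReal_toReal (hlipfin a ha).ne, hN]
    push_cast
    rw [mul_right_comm]
    exact mul_le_mul' (hlip a ha.le) le_rfl
  obtain ⟨hσa, hσi⟩ := integrableOn_tail hm hm0 ENNReal.coe_ne_top hσw hw_int
  refine ⟨D, pert W' μ, _, G, σ, d * Real.sqrt C * (Real.sqrt ‖Q‖ * ‖L‖ + ‖K‖), Kc, N,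
    ⟨hQ, hD, hB, hsol, ?_, fun η hη r x => mulR_pert_comm W' μ hη r x, tendsto_heis_symm hKs hG,
      fun r hr x => ?_, fun ε P hP r hr u => ?_, by positivity, hσ0, hσa, hσi, hKc⟩, ?_, hσw⟩
  · simp only [hU', max_self]
    exact hU.zero
  · have h1 := (heis (U' r) K - G).le_of_opNorm_le (hGσ r hr) x
    rw [sub_apply] at h1
    rw [← apply_heis, ← map_sub, Unitary.norm_map, norm_sub_rev]
    exact h1
  · set ψ := (U' r : L2 d →L[ℂ] L2 d) (G u) with hψ
    have h1 := sqrt_energy_le_of_tendsto_heis hB hsol hQ.isPos hL hm hm0 hBQ hG hP hr u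
    have h2 := hQ.sum_norm_grad_le hD (P ψ)
    have h3 := Real.sqrt_le_sqrt (hP.le_inner_re ψ)
    have h4 := hσ0 r
    refine h2.trans ?_
    rw [mul_assoc (d * Real.sqrt C), mul_assoc (d * Real.sqrt C)]
    refine mul_le_mul_of_nonneg_left ((h3.trans h1).trans ?_) (by positivity)
    refine mul_le_mul_of_nonneg_right ?_ (norm_nonneg _)
    have h5 : 0 ≤ Real.sqrt ‖Q‖ * ‖L‖ * σ r := by positivity
    have h6 := norm_nonneg K
    have h7 : ∫ r in Ioi r, m r = σ r := rfl
    rw [h7]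
    linarith
  · refine hG.congr' ?_
    filter_upwards [eventually_ge_atTop 0] with r hr
    simp only [hU', max_eq_left hr]

end MaxSpeed

/-! ### The maximal speed bound -/

theorem theorem4p1 (d : ℕ)
    -- the potential `V`, `Δ`-bounded with relative bound less than one
    (V : Space d → ℝ) (hV : AEStronglyMeasurable V volume)
    (a₁ a₂ : ℝ) (ha₁ : 0 ≤ a₁) (ha₁' : a₁ < 1) (ha₂ : 0 < a₂) (hVΔ : LaplacianBounded V a₁ a₂)
    -- the potential `W_t`, bounded
    (W : ℝ → Space d → ℝ) (hW : AEStronglyMeasurable (Function.uncurry W) volume)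
    (hWb : ∀ T : ℝ, ∫⁻ t in Set.Ioc 0 T, eLpNorm (W t) ⊤ volume < ⊤)
    -- `w♯` is `w` or `w'`, and it is integrable
    (w : ℝ → ℝ≥0∞) (hw : w = tailNorm W ∨ w = tailNorm' W)
    (hw_int : ∫⁻ t in Set.Ioi 0, w t < ⊤)
    -- the interval `I = (p, q)` and the energy cutoff `g ∈ C_0^∞(I; ℝ)`
    (p q : ℝ) (g : ℝ → ℝ) (hg : ContDiff ℝ ∞ g) (hg_comp : HasCompactSupport g)
    (hg_supp : tsupport g ⊆ Set.Ioo p q)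
    -- the evolution generated by `H_t = -½Δ + V + W_t`
    (U : ℝ → unitary (L2 d →L[ℂ] L2 d)) (hU : IsEvolution (schrodinger V) W U) :
    -- the operator norm limit `G = g_+(H)` exists
    ∃ G : L2 d →L[ℂ] L2 d,
      Tendsto (fun τ : ℝ => (((U τ)⁻¹ : unitary (L2 d →L[ℂ] L2 d)) : L2 d →L[ℂ] L2 d) *
        funcCalc (schrodinger V) g * (U τ : L2 d →L[ℂ] L2 d)) atTop (𝓝 G) ∧
      ∀ c a b β : ℝ, speedBound V (Set.Ioo p q) < ENNReal.ofReal c → b < a → 0 < β → β < 1 →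
        ∃ C : ℝ≥0, ∀ t : ℝ, 1 ≤ t →
          ‖cutoff {x : Space d | c * t + a ≤ ‖x‖}
                (measurableSet_le measurable_const measurable_norm) *
              (U t : L2 d →L[ℂ] L2 d) * G *
              cutoff {x : Space d | ‖x‖ ≤ b} (measurableSet_le measurable_norm measurable_const)‖ₑ
            ≤ C * (ENNReal.ofReal (t ^ (-min (1 / 2) (1 - β))) + w (t ^ β)) := by
  obtain ⟨μ, C, Q, hQ⟩ := exists_isRes hV ha₁ ha₁' ha₂ hVΔ
  obtain ⟨D, B, n, G, σ, A, K, N, hS, hG, hσ⟩ :=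
    hU.exists_isScatter hQ hW hWb hw hw_int hg hg_comp
  refine ⟨G, hG, fun c a b β hc _ hβ0 hβ1 => ?_⟩
  obtain ⟨gt, Lt, gc, K', hcut⟩ := hQ.exists_isCutPair hc.ne_top hg.continuous hg_comp hg_supp
  obtain ⟨C₀, T, hC₀, hmain⟩ := hS.exists_norm_cutoff_le hcut
    (ENNReal.toReal_lt_of_lt_ofReal hc) a b
  -- The first summand bounds the `σ` term, the second the two powers of `t`, and the third all
  -- times below the threshold `T`.
  refine ⟨C₀.toNNReal * N + 2 * C₀.toNNReal + ‖G‖₊ * T.toNNReal, fun t ht => ?_⟩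
  have ht0 : 0 < t := zero_lt_one.trans_le ht
  set χ₁ := cutoff {x : Space d | c * t + a ≤ ‖x‖}
    (measurableSet_le measurable_const measurable_norm)
  set χ₂ := cutoff {x : Space d | ‖x‖ ≤ b} (measurableSet_le measurable_norm measurable_const)
  set e := t ^ (-min (1 / 2) (1 - β)) with he
  have he0 : 0 ≤ e := Real.rpow_nonneg ht0.le _
  have hle : ∀ γ, min (1 / 2) (1 - β) ≤ γ → t ^ (-γ) ≤ e := fun γ hγ =>
    Real.rpow_le_rpow_of_exponent_le ht (neg_le_neg hγ)
  have hC₀' : ENNReal.ofReal C₀ = (C₀.toNNReal : ℝ≥0∞) := rfl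
  rw [← ofReal_norm]
  rcases le_total T t with hT | hT
  · have ht1 : 1 ≤ t ^ β := Real.one_le_rpow ht hβ0.le
    have ht2 : t ^ β ≤ t := by
      simpa using Real.rpow_le_rpow_of_exponent_le ht hβ1.le
    have hX := hS.rate_nonneg (t ^ β)
    have h1 : ‖χ₁ * (U t : L2 d →L[ℂ] L2 d) * G * χ₂‖ ≤ C₀ * σ (t ^ β) + 2 * C₀ * e := by
      refine ContinuousLinearMap.opNorm_le_bound _ (by positivity) fun u => ?_
      -- The intermediate time is `t^β`: the errors are then `σ(t^β)`, `t^(β-1)` and `t^(-1/2)`.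
      have h2 := hmain t (t ^ β) hT ht1 ht2 u
      simp only [max_eq_left ht0.le] at h2
      refine h2.trans (mul_le_mul_of_nonneg_right ?_ (norm_nonneg _))
      have h3 : t ^ β / t ≤ e := by
        have := hle (1 - β) (min_le_right _ _)
        rwa [neg_sub, Real.rpow_sub ht0, Real.rpow_one] at this
      have h4 : Real.sqrt (1 / t) ≤ e := by
        have := hle (1 / 2) (min_le_left _ _)
        rwa [Real.rpow_neg ht0.le, ← Real.sqrt_eq_rpow, ← Real.sqrt_inv, ← one_div] at this
      have h5 := mul_le_mul_of_nonneg_left h3 hC₀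
      have h6 := mul_le_mul_of_nonneg_left h4 hC₀
      linarith
    calc ENNReal.ofReal ‖χ₁ * (U t : L2 d →L[ℂ] L2 d) * G * χ₂‖
        ≤ ENNReal.ofReal (C₀ * σ (t ^ β) + 2 * C₀ * e) := ENNReal.ofReal_le_ofReal h1
      _ = C₀.toNNReal * ENNReal.ofReal (σ (t ^ β)) + 2 * C₀.toNNReal * ENNReal.ofReal e := by
          rw [ENNReal.ofReal_add (by positivity) (by positivity), ENNReal.ofReal_mul hC₀,
            ENNReal.ofReal_mul (by positivity), ENNReal.ofReal_mul zero_le_two, hC₀',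
            ENNReal.ofReal_ofNat]
      _ ≤ C₀.toNNReal * (N * w (t ^ β)) + 2 * C₀.toNNReal * ENNReal.ofReal e := by
          gcongr
          exact hσ _ (zero_lt_one.trans_le ht1)
      _ = (C₀.toNNReal * N) * w (t ^ β) + (2 * C₀.toNNReal) * ENNReal.ofReal e := by
          ring
      _ ≤ (C₀.toNNReal * N + 2 * C₀.toNNReal + ‖G‖₊ * T.toNNReal) * w (t ^ β) +
          (C₀.toNNReal * N + 2 * C₀.toNNReal + ‖G‖₊ * T.toNNReal) * ENNReal.ofReal e := by
          gcongr
          · rw [add_assoc]; exact le_self_add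
          · rw [add_right_comm]; exact le_add_self
      _ = _ := by push_cast; ring
  · have h1 : ‖χ₁ * (U t : L2 d →L[ℂ] L2 d) * G * χ₂‖ ≤ ‖G‖ := by
      refine ContinuousLinearMap.opNorm_le_bound _ (norm_nonneg _) fun u => ?_
      have h2 : ‖χ₁ ((U t : L2 d →L[ℂ] L2 d) (G (χ₂ u)))‖ ≤ ‖(U t : L2 d →L[ℂ] L2 d) (G (χ₂ u))‖ :=
        norm_cutoff_apply_le _ _
      refine h2.trans ?_
      rw [Unitary.norm_map]
      exact G.le_opNorm_of_le (norm_cutoff_apply_le _ _)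
    -- The decay is no faster than `t⁻¹`, so on `t ≤ T` the trivial bound `‖G‖` is at most `‖G‖ T
    -- e`.
    have h2 : 1 ≤ T * e := by
      have h3 := hle 1 ((min_le_left _ _).trans (by norm_num))
      rw [Real.rpow_neg_one] at h3
      calc 1 = t * t⁻¹ := (mul_inv_cancel₀ ht0.ne').symm
        _ ≤ T * e := mul_le_mul hT h3 (inv_nonneg.2 ht0.le) (ht0.le.trans hT)
    calc ENNReal.ofReal ‖χ₁ * (U t : L2 d →L[ℂ] L2 d) * G * χ₂‖
        ≤ ENNReal.ofReal (‖G‖ * (T * e)) :=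
          ENNReal.ofReal_le_ofReal (h1.trans (le_mul_of_one_le_right (norm_nonneg _) h2))
      _ = (‖G‖₊ * T.toNNReal) * ENNReal.ofReal e := by
          rw [ENNReal.ofReal_mul (norm_nonneg _), ENNReal.ofReal_mul (ht0.le.trans hT),
            ofReal_norm, mul_assoc]
          rfl
      _ ≤ (C₀.toNNReal * N + 2 * C₀.toNNReal + ‖G‖₊ * T.toNNReal) *
          (ENNReal.ofReal e + w (t ^ β)) := by
          gcongr
          · exact le_add_self
          · exact le_self_add
      _ = _ := by push_cast; ring
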